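/- **Conventions.** Let $\mathcal C$ be a monoidal category with unit object $\underline 1$; tensor products are written by juxtaposition, an object also denotes its identity morphism, and associativity and unit constraints are suppressed. $\mathcal C$ is assumed to have coequalizers and every object $Z$ of $\mathcal C$ is assumed to be left coflat ($-\otimes Z$ preserves coequalizers). Let $A$ be an algebra in $\mathcal C$ with multiplication $m$ and unit $\eta$, such that every left $A$-module $N$ is robust: for all $M\in\mathcal C$ and all right $A$-modules $P$, the functor $M\otimes-$ preserves the coequalizer $PAN\rightrightarrows PN\to P\otimes_A N$. Then the category ${}_A\mathcal C_A$ of $A$-bimodules is monoidal under $\otimes_A$. $\mathcal T_A^\#$ is the monoidal category whose objects are pairs $(X,\psi)$ with $\psi:XA\to AX$ such that $\psi\circ Xm=mX\circ A\psi\circ\psi A$ and $\psi\circ X\eta=\eta X$. A morphism $(X,\psi)\to(X',\psi')$ is a morphism $f:X\to AX'$ in $\mathcal C$ with $mX'\circ Af\circ\psi=mX'\circ A\psi'\circ fA$; the composite of $f:X\to AX'$ and $g:X'\to AX''$ is $mX''\circ Ag\circ f$; the tensor product of objects is $(XX',\ \psi X'\circ X\psi')$; and for morphisms $f:X\to AX'$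 and $g:Z\to AZ'$, $f\otimes Z=fZ:XZ\to AX'Z$ and $X\otimes g=\psi Z'\circ Xg:XZ\to AXZ'$. The monoidal category ${}_A^\#\mathcal T$ is the mirror image, with objects $(Y,\varphi)$, $\varphi:AY\to YA$, and morphisms $Y\to Y'A$. A cowreath $(A,X,\psi)$ is an algebra $A$ together with a coalgebra $(X,\psi)$ in $\mathcal T_A^\#$, with comultiplication $\delta:X\to AXX$ and counit $\epsilon:X\to A$. In a monoidal category, a coalgebra $(C,\Delta,\varepsilon)$ is Frobenius if there are $t:\underline 1\to C$ and a Casimir morphism $B:CC\to\underline 1$, i.e. $CB\circ\Delta C=BC\circ C\Delta$, such that $B\circ tC=\varepsilon=B\circ Ct$; Frobenius algebras are defined dually. An algebra morphism $A\to S$ is a Frobenius extension if $S$, with the induced $A$-ring structure, is a Frobenius algebra in ${}_A\mathcal C_A$. An entwined module over $(A,X,\psi)$ is a right $A$-module $(M,\mu)$ with $\rho:M\to MX$ such that $\rho\circ\mu=\mu X\circ M\psi\circ\rho A$, $\rho X\circ\rho=\mu XX\circ M\delta\circ\rho$ and $\mu\circ M\epsilon\circ\rho=M$. Morphisms of entwined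 modules are right $A$-linear morphisms $f$ with $fX\circ\rho=\rho\circ f$. The category of entwined modules is $\mathcal C(\psi)_A^X$, and $F:\mathcal C(\psi)_A^X\to\mathcal C_A$ is the functor forgetting $\rho$. **Duality.** Let $(A,X,\psi)$ be a cowreath and let $X\dashv Y$ in $\mathcal C$, with $b:\underline 1\to YX$ and $d:XY\to\underline 1$ satisfying $dX\circ Xb=X$ and $Yd\circ bY=Y$. Put $d_2=d\circ XdY:XXYY\to\underline 1$. * $\varphi=YAd\circ Y\psi Y\circ bAY:AY\to YA$. Then $(Y,\varphi)$ is an algebra in ${}_A^\#\mathcal T$ with multiplication $m_Y=YAd_2\circ Y\delta YY\circ bYY:YY\to YA$ and unit $\eta_\#=Y\epsilon\circ b:\underline 1\to YA$. The wreath product $YA$ is an algebra in $\mathcal C$ with multiplication $m_\#=Ym\circ m_Ym\circ Y\varphi A$ and unit $\eta_\#$. * $AX$ is an $A$-bimodule with left action $mX$ and right action $mX\circ A\psi$, and an $A$-coring (coalgebra in ${}_A\mathcal C_A$) with comultiplication $mXX\circ A\delta:AX\to AXX\cong AX\otimes_A AX$ and counit $m\circ A\epsilon$. $YA$ is an $A$-bimodule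 with left action $Ym\circ\varphi A$ and right action $Ym$. $AX\dashv YA$ in ${}_A\mathcal C_A$, with unit $Y\psi\circ bA:A\to YAX\cong YA\otimes_A AX$ and counit induced by $m\circ AdA:AXYA\to A$, so $YA$ is an $A$-ring (algebra in ${}_A\mathcal C_A$), the dual of the coring $AX$. * Every entwined module $M$ is a right module over the algebra $YA$ via $\mu\circ MdA\circ\rho YA:MYA\to M$. Conversely, a right $YA$-module $(N,\bar\mu)$ is an entwined module, with right $A$-action obtained by restriction along $Ym\circ\eta_\#A:A\to YA$ and coaction $\bar\mu X\circ NY\eta X\circ Nb$. $AX$ is an entwined module via its right $A$-action and $\rho=mXX\circ A\delta$, hence a right $YA$-module; $YA$ is the regular right $YA$-module, hence an entwined module. **Theorem.** Under these assumptions, let $(A,X,\psi)$ be a cowreath and let $X\dashv Y$ in $\mathcal C$. The following assertions are equivalent: 1. $(X,\psi)$ is a Frobenius coalgebra in $\mathcal T_A^\#$; 2. $YA$ is a Frobenius $A$-ring, i.e. a Frobenius algebra in ${}_A\mathcal C_A$; 3. $(Y,\varphi)$ is a Frobenius algebra in ${}_A^\#\mathcal T$; 4. the algebra extension $Ym\circ\eta_\#A:A\to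 YA$ is Frobenius; 5. $AX$ and $YA$ are isomorphic as left $A$-, right $YA$-modules in $\mathcal C$ (by one isomorphism that is linear on both sides); 6. $AX$ and $YA$ are isomorphic as left $A$-modules and as entwined modules (by one isomorphism); 7. there is a morphism $t:\underline 1\to X$ in $\mathcal T_A^\#$ such that $$\Phi=m^2X\circ AA\psi\circ AAXdA\circ A\delta YA\circ tYA:\ YA\to AX$$ is an isomorphism in $\mathcal C$, where $m^2=m\circ Am$; 8. there is a Casimir morphism $B:X\otimes X\to\underline 1$ for $(X,\psi)$ in $\mathcal T_A^\#$ such that $$\Psi=Ym\circ YAB\circ Y\psi X\circ bAX:\ AX\to YA$$ is an isomorphism in $\mathcal C$. If, moreover, $\underline 1$ is a left $\otimes$-generator of $\mathcal C$ (morphisms $f,g:UZ\to W$ are equal whenever $f\circ hZ=g\circ hZ$ for all $h:\underline 1\to U$), then these assertions are also equivalent to 9. $F:\mathcal C(\psi)_A^X\to\mathcal C_A$ is a Frobenius functor, i.e. it has a right adjoint that is also a left adjoint. -/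

import Mathlib

open CategoryTheory MonoidalCategory Limits
open scoped MonObj ComonObj

universe v u

namespace Cowreath

variable {C : Type u} [Category.{v} C] [MonoidalCategory C]

/-- A monoidal structure from the axioms for whiskering. -/
abbrev ofWhiskering {D : Type*} [Category D] [MonoidalCategoryStruct D]
    (tensorHom_def : ∀ {X Y X' Y' : D} (f : X ⟶ Y) (g : X' ⟶ Y'), f ⊗ₘ g = f ▷ X' ≫ Y ◁ g)
    (whiskerLeft_id : ∀ X Y : D, X ◁ 𝟙 Y = 𝟙 (X ⊗ Y))
    (id_whiskerRight : ∀ X Y : D, 𝟙 X ▷ Y = 𝟙 (X ⊗ Y))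
    (whiskerLeft_comp : ∀ (X : D) {Y Z W : D} (f : Y ⟶ Z) (g : Z ⟶ W),
      X ◁ (f ≫ g) = X ◁ f ≫ X ◁ g)
    (comp_whiskerRight : ∀ {X Y Z : D} (f : X ⟶ Y) (g : Y ⟶ Z) (W : D),
      (f ≫ g) ▷ W = f ▷ W ≫ g ▷ W)
    (whisker_exchange : ∀ {X X' Y Y' : D} (f : X ⟶ X') (g : Y ⟶ Y'),
      X ◁ g ≫ f ▷ Y' = f ▷ Y ≫ X' ◁ g)
    (assoc_left : ∀ {X X' : D} (f : X ⟶ X') (Y Z : D),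
      f ▷ Y ▷ Z ≫ (α_ X' Y Z).hom = (α_ X Y Z).hom ≫ f ▷ (Y ⊗ Z))
    (assoc_middle : ∀ (X : D) {Y Y' : D} (f : Y ⟶ Y') (Z : D),
      (X ◁ f) ▷ Z ≫ (α_ X Y' Z).hom = (α_ X Y Z).hom ≫ X ◁ f ▷ Z)
    (assoc_right : ∀ (X Y : D) {Z Z' : D} (f : Z ⟶ Z'),
      (X ⊗ Y) ◁ f ≫ (α_ X Y Z').hom = (α_ X Y Z).hom ≫ X ◁ Y ◁ f)
    (leftUnitor_naturality : ∀ {X Y : D} (f : X ⟶ Y),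
      𝟙_ D ◁ f ≫ (λ_ Y).hom = (λ_ X).hom ≫ f)
    (rightUnitor_naturality : ∀ {X Y : D} (f : X ⟶ Y),
      f ▷ 𝟙_ D ≫ (ρ_ Y).hom = (ρ_ X).hom ≫ f)
    (pentagon : ∀ W X Y Z : D,
      (α_ W X Y).hom ▷ Z ≫ (α_ W (X ⊗ Y) Z).hom ≫ W ◁ (α_ X Y Z).hom =
        (α_ (W ⊗ X) Y Z).hom ≫ (α_ W X (Y ⊗ Z)).hom)
    (triangle : ∀ X Y : D, (α_ X (𝟙_ D) Y).hom ≫ X ◁ (λ_ Y).hom = (ρ_ X).hom ▷ Y) :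
    MonoidalCategory D where
  tensorHom_def := tensorHom_def
  id_tensorHom_id X Y := by rw [tensorHom_def, whiskerLeft_id, id_whiskerRight, Category.comp_id]
  tensorHom_comp_tensorHom f₁ f₂ g₁ g₂ := by
    simp only [tensorHom_def, whiskerLeft_comp, comp_whiskerRight, Category.assoc]
    rw [reassoc_of% (whisker_exchange g₁ f₂)]
  whiskerLeft_id := whiskerLeft_id
  id_whiskerRight := id_whiskerRight
  associator_naturality f₁ f₂ f₃ := by
    simp only [tensorHom_def, whiskerLeft_comp, comp_whiskerRight, Category.assoc, assoc_right]
    rw [reassoc_of% assoc_middle, reassoc_of% assoc_left]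
  leftUnitor_naturality := leftUnitor_naturality
  rightUnitor_naturality := rightUnitor_naturality
  pentagon := pentagon
  triangle := triangle

/-- `f : X ⟶ A ⊗ Y` extended to the left `A`-linear `A ⊗ X ⟶ A ⊗ Y`. -/
def lext (A : Mon C) {X Y : C} (f : X ⟶ A.X ⊗ Y) : A.X ⊗ X ⟶ A.X ⊗ Y :=
  A.X ◁ f ≫ (α_ A.X A.X Y).inv ≫ μ[A.X] ▷ Y

/-- `X ⟶ A ⊗ X` -/
def lunit (A : Mon C) (X : C) : X ⟶ A.X ⊗ X := (λ_ X).inv ≫ η[A.X] ▷ X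

section
variable (A : Mon C) {X Y Z W : C}

@[simp]
lemma lunit_lext (f : X ⟶ A.X ⊗ Y) : lunit A X ≫ lext A f = f := by
  calc _ = 𝟙 _ ⊗≫ (η[A.X] ▷ X ≫ A.X ◁ f) ⊗≫ μ[A.X] ▷ Y := by
        simp only [lext, lunit]; monoidal
    _ = 𝟙 _ ⊗≫ f ⊗≫ (η[A.X] ▷ A.X ≫ μ[A.X]) ▷ Y := by
        rw [← whisker_exchange]; monoidal
    _ = _ := by rw [MonObj.one_mul]; monoidal

lemma lunit_natural (f : X ⟶ Y) : lunit A X ≫ A.X ◁ f = f ≫ lunit A Y := by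
  simp only [lunit, Category.assoc, ← whisker_exchange]
  monoidal

@[simp]
lemma lext_lunit : lext A (lunit A X) = 𝟙 _ := by
  calc _ = 𝟙 _ ⊗≫ (A.X ◁ η[A.X] ≫ μ[A.X]) ▷ X := by simp only [lext, lunit]; monoidal
    _ = _ := by rw [MonObj.mul_one]; monoidal

lemma mul_lext (f : X ⟶ A.X ⊗ Y) :
    (α_ A.X A.X X).inv ≫ μ[A.X] ▷ X ≫ lext A f =
      A.X ◁ lext A f ≫ (α_ A.X A.X Y).inv ≫ μ[A.X] ▷ Y := by
  calc _ = 𝟙 _ ⊗≫ ((μ[A.X] ▷ X) ≫ A.X ◁ f) ⊗≫ μ[A.X] ▷ Y := by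
        simp only [lext]; monoidal
    _ = 𝟙 _ ⊗≫ (A.X ⊗ A.X) ◁ f ⊗≫ ((μ[A.X] ▷ A.X ≫ μ[A.X]) ▷ Y) ⊗≫ 𝟙 _ := by
        rw [← whisker_exchange]; monoidal
    _ = _ := by rw [MonObj.mul_assoc]; simp only [lext]; monoidal

lemma lext_comp (f : X ⟶ A.X ⊗ Y) (g : Y ⟶ A.X ⊗ Z) :
    lext A (f ≫ lext A g) = lext A f ≫ lext A g := by
  conv_rhs => rw [lext]
  simp only [Category.assoc, mul_lext]
  simp [lext]

lemma lext_precomp (f : X ⟶ Y) (g : Y ⟶ A.X ⊗ Z) :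
    lext A (f ≫ g) = A.X ◁ f ≫ lext A g := by
  simp [lext]

lemma lext_postcomp (f : X ⟶ A.X ⊗ Y) (g : Y ⟶ Z) :
    lext A (f ≫ A.X ◁ g) = lext A f ≫ A.X ◁ g := by
  simp only [lext, MonoidalCategory.whiskerLeft_comp, Category.assoc, ← whisker_exchange]
  monoidal

/-- `f : X ⟶ A ⊗ Y` tensored with `Z` on the right -/
def rten {A : Mon C} {X Y : C} (f : X ⟶ A.X ⊗ Y) (Z : C) : X ⊗ Z ⟶ A.X ⊗ (Y ⊗ Z) :=
  f ▷ Z ≫ (α_ A.X Y Z).hom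

@[simp]
lemma rten_lunit : rten (lunit A X) Z = lunit A (X ⊗ Z) := by
  simp only [rten, lunit]; monoidal

lemma rten_precomp (f : X ⟶ Y) (g : Y ⟶ A.X ⊗ Z) : rten (f ≫ g) W = f ▷ W ≫ rten g W := by
  simp [rten]

lemma rten_postcomp (f : X ⟶ A.X ⊗ Y) (g : Y ⟶ Z) :
    rten (f ≫ A.X ◁ g) W = rten f W ≫ A.X ◁ (g ▷ W) := by
  simp [rten]

lemma rten_lext (f : X ⟶ A.X ⊗ Y) (Z : C) :
    lext A (rten f Z) = (α_ A.X X Z).inv ≫ rten (lext A f) Z := by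
  simp only [rten, lext]; monoidal

lemma rten_comp (f : X ⟶ A.X ⊗ Y) (g : Y ⟶ A.X ⊗ Z) :
    rten (f ≫ lext A g) W = rten f W ≫ lext A (rten g W) := by
  simp only [rten, lext]; monoidal

lemma rten_tensor (f : X ⟶ A.X ⊗ Y) :
    rten f (Z ⊗ W) = (α_ X Z W).inv ≫ rten (rten f Z) W ≫ A.X ◁ (α_ Y Z W).hom := by
  simp only [rten]; monoidal

end

/-- Right transfer morphisms through the algebra `A`: an object `X` with `ψ : X A ⟶ A X` compatible
with the multiplication and the unit of `A`. They are the objects of the Eilenberg-Moore category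
(the monoidal category of right transfer morphisms); a coalgebra in it is a cowreath. -/
structure RightTransfer (A : Mon C) where
  /-- the underlying object -/
  X : C
  /-- the transfer morphism `X A ⟶ A X` -/
  ψ : X ⊗ A.X ⟶ A.X ⊗ X
  mul_ψ : X ◁ μ[A.X] ≫ ψ = (α_ X A.X A.X).inv ≫ ψ ▷ A.X ≫ (α_ A.X X A.X).hom ≫
    A.X ◁ ψ ≫ (α_ A.X A.X X).inv ≫ μ[A.X] ▷ X
  one_ψ : (ρ_ X).inv ≫ X ◁ η[A.X] ≫ ψ = (λ_ X).inv ≫ η[A.X] ▷ X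

namespace RightTransfer

variable {A : Mon C}

/-- `g : Y ⟶ A ⊗ Z` tensored with the transfer morphism `X` on the left -/
def lten (X : RightTransfer A) {Y Z : C} (g : Y ⟶ A.X ⊗ Z) : X.X ⊗ Y ⟶ A.X ⊗ (X.X ⊗ Z) :=
  X.X ◁ g ≫ (α_ X.X A.X Z).inv ≫ X.ψ ▷ Z ≫ (α_ A.X X.X Z).hom

section
variable (X : RightTransfer A) {Y Z W V : C}

@[simp]
lemma lten_lunit : X.lten (lunit A Y) = lunit A (X.X ⊗ Y) := by
  calc _ = 𝟙 _ ⊗≫ ((ρ_ X.X).inv ≫ X.X ◁ η[A.X] ≫ X.ψ) ▷ Y ⊗≫ 𝟙 _ := by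
        simp only [lten, lunit]; monoidal
    _ = _ := by rw [one_ψ]; simp only [lunit]; monoidal

lemma lten_precomp (f : Y ⟶ Z) (g : Z ⟶ A.X ⊗ W) : X.lten (f ≫ g) = X.X ◁ f ≫ X.lten g := by
  simp [lten]

lemma lten_postcomp (f : Y ⟶ A.X ⊗ Z) (g : Z ⟶ W) :
    X.lten (f ≫ A.X ◁ g) = X.lten f ≫ A.X ◁ (X.X ◁ g) := by
  calc _ = X.X ◁ f ⊗≫ ((X.X ⊗ A.X) ◁ g ≫ X.ψ ▷ W) ⊗≫ 𝟙 _ := by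
        simp only [lten]; monoidal
    _ = _ := by rw [whisker_exchange]; simp only [lten]; monoidal

lemma lten_comp (f : Y ⟶ A.X ⊗ Z) (g : Z ⟶ A.X ⊗ W) :
    X.lten (f ≫ lext A g) = X.lten f ≫ lext A (X.lten g) := by
  calc _ = X.X ◁ f ⊗≫ X.X ◁ A.X ◁ g ⊗≫ (X.X ◁ μ[A.X] ≫ X.ψ) ▷ W ⊗≫ 𝟙 _ := by
        simp only [lten, lext]; monoidal
    _ = X.X ◁ f ⊗≫ ((X.X ⊗ A.X) ◁ g ≫ X.ψ ▷ (A.X ⊗ W)) ⊗≫ A.X ◁ X.ψ ▷ W ⊗≫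
        μ[A.X] ▷ (X.X ⊗ W) := by
        rw [mul_ψ]; monoidal
    _ = _ := by rw [whisker_exchange]; simp only [lten, lext]; monoidal

lemma lten_rten (f : Y ⟶ A.X ⊗ Z) :
    X.lten (rten f W) = (α_ X.X Y W).inv ≫ rten (X.lten f) W ≫ A.X ◁ (α_ X.X Z W).hom := by
  simp only [rten, lten]; monoidal

end

/-- The tensor product of transfer morphisms. -/
def tensor (X Y : RightTransfer A) : RightTransfer A where
  X := X.X ⊗ Y.X
  ψ := (α_ X.X Y.X A.X).hom ≫ X.X ◁ Y.ψ ≫ (α_ X.X A.X Y.X).inv ≫ X.ψ ▷ Y.X ≫ (α_ A.X X.X Y.X).hom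
  mul_ψ := by
    have h : Y.X ◁ μ[A.X] ≫ Y.ψ = (α_ Y.X A.X A.X).inv ≫ rten Y.ψ A.X ≫ lext A Y.ψ := by
      rw [mul_ψ]; simp [rten, lext]
    calc _ = (α_ X.X Y.X _).hom ≫ X.lten (Y.X ◁ μ[A.X] ≫ Y.ψ) := by simp [lten]
      _ = (α_ X.X Y.X _).hom ≫ X.lten ((α_ Y.X A.X A.X).inv ≫ (rten Y.ψ A.X ≫ lext A Y.ψ)) := by
          rw [h]
      _ = _ := by
          rw [lten_precomp, lten_comp, lten_rten]
          simp only [lten, rten, lext]; monoidal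
  one_ψ := by
    have h : (ρ_ Y.X).inv ≫ Y.X ◁ η[A.X] ≫ Y.ψ = lunit A Y.X := Y.one_ψ
    calc _ = X.lten ((ρ_ Y.X).inv ≫ Y.X ◁ η[A.X] ≫ Y.ψ) := by simp [lten]
      _ = _ := by rw [h, lten_lunit]; simp [lunit]

/-- The unit transfer morphism. -/
def unit (A : Mon C) : RightTransfer A where
  X := 𝟙_ C
  ψ := (λ_ A.X).hom ≫ (ρ_ A.X).inv
  mul_ψ := by monoidal
  one_ψ := by monoidal

/-- Morphisms `(X, ψ) ⟶ (Y, ψ')` in the Eilenberg-Moore category: morphisms `X ⟶ A Y` compatible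
with `ψ` and `ψ'`. The composite of `f` and `g` is `f ≫ A g ≫ m Z`. -/
@[ext]
structure Hom (X Y : RightTransfer A) where
  /-- the underlying morphism -/
  hom : X.X ⟶ A.X ⊗ Y.X
  comm : X.ψ ≫ A.X ◁ hom ≫ (α_ A.X A.X Y.X).inv ≫ μ[A.X] ▷ Y.X =
    hom ▷ A.X ≫ (α_ A.X Y.X A.X).hom ≫ A.X ◁ Y.ψ ≫ (α_ A.X A.X Y.X).inv ≫ μ[A.X] ▷ Y.X

lemma Hom.comm' {X Y : RightTransfer A} (f : Hom X Y) :
    X.ψ ≫ lext A f.hom = rten f.hom A.X ≫ lext A Y.ψ := by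
  simpa [lext, rten] using f.comm

/-- constructor -/
def Hom.mk' {X Y : RightTransfer A} (f : X.X ⟶ A.X ⊗ Y.X)
    (h : X.ψ ≫ lext A f = rten f A.X ≫ lext A Y.ψ) : Hom X Y :=
  ⟨f, by simpa [lext, rten] using h⟩

instance : Category (RightTransfer A) where
  Hom X Y := Hom X Y
  id X := Hom.mk' ((λ_ X.X).inv ≫ η[A.X] ▷ X.X) (by
    change X.ψ ≫ lext A (lunit A _) = rten (lunit A _) _ ≫ _
    simp)
  comp {X Y Z} f g := Hom.mk' (f.hom ≫ A.X ◁ g.hom ≫ (α_ A.X A.X Z.X).inv ≫ μ[A.X] ▷ Z.X) (by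
    change X.ψ ≫ lext A (f.hom ≫ lext A g.hom) = rten (f.hom ≫ lext A g.hom) _ ≫ _
    rw [lext_comp, reassoc_of% f.comm', rten_comp, Category.assoc, ← lext_comp, ← lext_comp, g.comm'])
  id_comp f := Hom.ext (lunit_lext A f.hom)
  comp_id f := Hom.ext (by
    change f.hom ≫ lext A (lunit A _) = _
    simp)
  assoc f g h := Hom.ext (by
    change (f.hom ≫ lext A g.hom) ≫ lext A h.hom = f.hom ≫ lext A (g.hom ≫ lext A h.hom)
    rw [lext_comp, Category.assoc])

@[ext]
lemma hom_ext {X Y : RightTransfer A} (f g : X ⟶ Y) (h : f.hom = g.hom) : f = g := Hom.ext h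

lemma comp_hom {X Y Z : RightTransfer A} (f : X ⟶ Y) (g : Y ⟶ Z) :
    (f ≫ g).hom = f.hom ≫ lext A g.hom := rfl

lemma id_hom (X : RightTransfer A) : (𝟙 X : X ⟶ X).hom = lunit A X.X := rfl

lemma exchange {X X' : RightTransfer A} (f : X ⟶ X') {Y Y' : C} (g : Y ⟶ A.X ⊗ Y') :
    X.lten g ≫ lext A (rten f.hom Y') = rten f.hom Y ≫ lext A (X'.lten g) := by
  calc _ = X.X ◁ g ⊗≫ (X.ψ ≫ lext A f.hom) ▷ Y' ⊗≫ 𝟙 _ := by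
        simp only [lten, lext, rten]; monoidal
    _ = (X.X ◁ g ≫ f.hom ▷ (A.X ⊗ Y')) ⊗≫ lext A X'.ψ ▷ Y' ⊗≫ 𝟙 _ := by
        rw [f.comm']; simp only [rten]; monoidal
    _ = _ := by
        rw [whisker_exchange]; simp only [lten, lext, rten]; monoidal

/-- morphisms of `C` compatible with the transfer morphisms are morphisms here -/
def homOf {X Y : RightTransfer A} (f : X.X ⟶ Y.X) (h : X.ψ ≫ A.X ◁ f = f ▷ A.X ≫ Y.ψ) : X ⟶ Y :=
  Hom.mk' (f ≫ lunit A Y.X) (by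
    rw [← lunit_natural, lext_postcomp, lext_lunit, Category.id_comp, h, rten_postcomp, rten_lunit,
      Category.assoc, ← lext_precomp, lunit_lext])

/-- isomorphisms -/
def isoOf {X Y : RightTransfer A} (f : X.X ≅ Y.X) (h : X.ψ ≫ A.X ◁ f.hom = f.hom ▷ A.X ≫ Y.ψ) :
    X ≅ Y where
  hom := homOf f.hom h
  inv := homOf f.inv (by
    rw [← cancel_epi (f.hom ▷ A.X), ← reassoc_of% h]
    simp [← MonoidalCategory.whiskerLeft_comp, hom_inv_whiskerRight_assoc])
  hom_inv_id := hom_ext _ _ (by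
    change (f.hom ≫ lunit A _) ≫ lext A (f.inv ≫ lunit A _) = lunit A _
    simp)
  inv_hom_id := hom_ext _ _ (by
    change (f.inv ≫ lunit A _) ≫ lext A (f.hom ≫ lunit A _) = lunit A _
    simp)

instance : MonoidalCategoryStruct (RightTransfer A) where
  tensorObj := tensor
  tensorUnit := unit A
  whiskerLeft X Y Y' g := Hom.mk'
    (X.X ◁ g.hom ≫ (α_ X.X A.X Y'.X).inv ≫ X.ψ ▷ Y'.X ≫ (α_ A.X X.X Y'.X).hom) (by
      change ((α_ X.X Y.X _).hom ≫ X.lten Y.ψ) ≫ lext A (X.lten g.hom) =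
        rten (X.lten g.hom) _ ≫ lext A ((α_ X.X Y'.X _).hom ≫ X.lten Y'.ψ)
      rw [Category.assoc, ← lten_comp, g.comm', lten_comp, lext_precomp, lten_rten]
      simp)
  whiskerRight {X X'} f Y := Hom.mk' (f.hom ▷ Y.X ≫ (α_ A.X X'.X Y.X).hom) (by
      change ((α_ X.X Y.X _).hom ≫ X.lten Y.ψ) ≫ lext A (rten f.hom Y.X) =
        rten (rten f.hom Y.X) _ ≫ lext A ((α_ X'.X Y.X _).hom ≫ X'.lten Y.ψ)
      rw [Category.assoc, exchange, lext_precomp, rten_tensor]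
      simp)
  associator X Y Z := isoOf (α_ X.X Y.X Z.X) (by
    dsimp [tensor]; monoidal)
  leftUnitor X := isoOf (λ_ X.X) (by dsimp [tensor, unit]; monoidal)
  rightUnitor X := isoOf (ρ_ X.X) (by dsimp [tensor, unit]; monoidal)

lemma whiskerLeft_hom (X : RightTransfer A) {Y Y' : RightTransfer A} (g : Y ⟶ Y') :
    (X ◁ g).hom = X.lten g.hom := rfl
lemma whiskerRight_hom {X X' : RightTransfer A} (f : X ⟶ X') (Y : RightTransfer A) :
    (f ▷ Y).hom = rten f.hom Y.X := rfl
lemma associator_hom_hom (X Y Z : RightTransfer A) :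
    (α_ X Y Z).hom.hom = (α_ X.X Y.X Z.X).hom ≫ lunit A _ := rfl
lemma leftUnitor_hom_hom (X : RightTransfer A) :
    (λ_ X).hom.hom = (λ_ X.X).hom ≫ lunit A _ := rfl
lemma rightUnitor_hom_hom (X : RightTransfer A) :
    (ρ_ X).hom.hom = (ρ_ X.X).hom ≫ lunit A _ := rfl
lemma tensorObj_X (X Y : RightTransfer A) : (X ⊗ Y).X = X.X ⊗ Y.X := rfl

lemma tensor_lten (X Y : RightTransfer A) {Z W : C} (f : Z ⟶ A.X ⊗ W) :
    (tensor X Y).lten f ≫ A.X ◁ (α_ X.X Y.X W).hom = (α_ X.X Y.X Z).hom ≫ X.lten (Y.lten f) := by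
  dsimp only [lten, tensor]; monoidal

lemma comp_pure {X Y Z : C} (f : X ⟶ A.X ⊗ Y) (g : Y ⟶ Z) :
    f ≫ lext A (g ≫ lunit A Z) = f ≫ A.X ◁ g := by
  rw [lext_precomp, lext_lunit, Category.comp_id]

instance : MonoidalCategory (RightTransfer A) :=
  ofWhiskering (fun _ _ => rfl)
    (fun X Y => hom_ext _ _ (lten_lunit X))
    (fun X Y => hom_ext _ _ (rten_lunit A))
    (fun X _ _ _ f g => hom_ext _ _ (lten_comp X f.hom g.hom))
    (fun f g Y => hom_ext _ _ (rten_comp A f.hom g.hom))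
    (fun f g => hom_ext _ _ (exchange f g.hom))
    (fun {X X'} f Y Z => hom_ext _ _ (by
      change rten (rten f.hom Y.X) Z.X ≫ lext A ((α_ X'.X Y.X Z.X).hom ≫ lunit A _) =
        ((α_ X.X Y.X Z.X).hom ≫ lunit A _) ≫ lext A (rten f.hom (Y.X ⊗ Z.X))
      rw [comp_pure, Category.assoc, lunit_lext, rten_tensor, Iso.hom_inv_id_assoc]))
    (fun X {Y Y'} f Z => hom_ext _ _ (by
      change rten (X.lten f.hom) Z.X ≫ lext A ((α_ X.X Y'.X Z.X).hom ≫ lunit A _) =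
        ((α_ X.X Y.X Z.X).hom ≫ lunit A _) ≫ lext A (X.lten (rten f.hom Z.X))
      rw [comp_pure, Category.assoc, lunit_lext, lten_rten, Iso.hom_inv_id_assoc]))
    (fun X Y {Z Z'} f => hom_ext _ _ (by
      change (X ⊗ Y).lten f.hom ≫ lext A ((α_ X.X Y.X Z'.X).hom ≫ lunit A _) =
        ((α_ X.X Y.X Z.X).hom ≫ lunit A _) ≫ lext A (X.lten (Y.lten f.hom))
      refine (comp_pure _ _).trans ?_
      rw [Category.assoc, lunit_lext]
      exact tensor_lten X Y f.hom))
    (fun {X Y} f => hom_ext _ _ (by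
      change (unit A).lten f.hom ≫ lext A ((λ_ Y.X).hom ≫ lunit A _) =
        ((λ_ X.X).hom ≫ lunit A _) ≫ lext A f.hom
      refine (comp_pure _ _).trans ?_
      rw [Category.assoc, lunit_lext]
      simp only [lten, unit]; monoidal))
    (fun {X Y} f => hom_ext _ _ (by
      change rten f.hom (𝟙_ C) ≫ lext A ((ρ_ Y.X).hom ≫ lunit A _) =
        ((ρ_ X.X).hom ≫ lunit A _) ≫ lext A f.hom
      rw [comp_pure, Category.assoc, lunit_lext]
      simp only [rten]; monoidal))
    (fun W X Y Z => hom_ext _ _ (by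
      change rten ((α_ W.X X.X Y.X).hom ≫ lunit A _) Z.X ≫
        lext A (((α_ W.X (X.X ⊗ Y.X) Z.X).hom ≫ lunit A _) ≫
          lext A (W.lten ((α_ X.X Y.X Z.X).hom ≫ lunit A _))) =
        ((α_ (W.X ⊗ X.X) Y.X Z.X).hom ≫ lunit A _) ≫
          lext A ((α_ W.X X.X (Y.X ⊗ Z.X)).hom ≫ lunit A _)
      simp [lten_precomp, rten_precomp]))
    (fun X Y => hom_ext _ _ (by
      change ((α_ X.X (𝟙_ C) Y.X).hom ≫ lunit A _) ≫ lext A (X.lten ((λ_ Y.X).hom ≫ lunit A _)) =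
        rten ((ρ_ X.X).hom ≫ lunit A _) Y.X
      simp [lten_precomp, rten_precomp]))

end RightTransfer
end Cowreath

namespace Cowreath

variable {C : Type u} [Category.{v} C] [MonoidalCategory C]

/-- Left modules over `A`. -/
structure LeftModule (A : Mon C) where
  /-- the underlying object -/
  X : C
  /-- the action -/
  act : A.X ⊗ X ⟶ X
  one_act : η[A.X] ▷ X ≫ act = (λ_ X).hom
  mul_act : μ[A.X] ▷ X ≫ act = (α_ A.X A.X X).hom ≫ A.X ◁ act ≫ act

/-- Right modules over `A`. -/
structure RightModule (A : Mon C) where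
  /-- the underlying object -/
  X : C
  /-- the action -/
  act : X ⊗ A.X ⟶ X
  act_one : X ◁ η[A.X] ≫ act = (ρ_ X).hom
  act_mul : X ◁ μ[A.X] ≫ act = (α_ X A.X A.X).inv ≫ act ▷ A.X ≫ act

/-- `X` is left coflat: `- ⊗ X` preserves coequalizers. -/
class LeftCoflat (X : C) : Prop where
  preserves : PreservesColimitsOfShape WalkingParallelPair (tensorRight X)

/-- A left `A`-module `Y` is robust if `M ⊗ -` preserves the coequalizer defining `X ⊗_A Y`, for
all objects `M` and all right `A`-modules `X`. -/
class IsRobust [HasCoequalizers C] {A : Mon C} (Y : LeftModule A) : Prop where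
  isColimit : ∀ (M : C) (X : RightModule A), Nonempty (IsColimit (Cofork.ofπ
    (f := M ◁ (X.act ▷ Y.X)) (g := M ◁ ((α_ X.X A.X Y.X).hom ≫ X.X ◁ Y.act))
    (M ◁ coequalizer.π (X.act ▷ Y.X) ((α_ X.X A.X Y.X).hom ≫ X.X ◁ Y.act))
    (by simp only [← MonoidalCategory.whiskerLeft_comp, coequalizer.condition])))

namespace BimodTensor

variable [HasCoequalizers C] {A : Mon C} (P Q R S : Bimod A A)

/-- `P ⊗_A Q` -/
noncomputable def tobj : C := coequalizer (P.actRight ▷ Q.X) ((α_ P.X A.X Q.X).hom ≫ P.X ◁ Q.actLeft)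

/-- the projection `P ⊗ Q ⟶ P ⊗_A Q` -/
noncomputable def tπ : P.X ⊗ Q.X ⟶ tobj P Q := coequalizer.π _ _

instance : Epi (tπ P Q) := inferInstanceAs (Epi (coequalizer.π _ _))

lemma tcond : P.actRight ▷ Q.X ≫ tπ P Q = (α_ P.X A.X Q.X).hom ≫ P.X ◁ Q.actLeft ≫ tπ P Q := by
  exact (coequalizer.condition _ _).trans (Category.assoc _ _ _)

section desc
variable {P Q} {Z W : C}

/-- universal property -/
noncomputable def tdesc (f : P.X ⊗ Q.X ⟶ Z)
    (h : P.actRight ▷ Q.X ≫ f = ((α_ P.X A.X Q.X).hom ≫ P.X ◁ Q.actLeft) ≫ f) : tobj P Q ⟶ Z :=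
  coequalizer.desc f h

lemma tπ_tdesc (f : P.X ⊗ Q.X ⟶ Z) (h) : tπ P Q ≫ tdesc f h = f := coequalizer.π_desc f h

variable [∀ X : C, LeftCoflat X] [∀ Y : LeftModule A, IsRobust Y]

variable (P Q) in
lemma exR (Z : C) : Nonempty (IsColimit (Cofork.ofπ
    (f := P.actRight ▷ Q.X ▷ Z) (g := ((α_ P.X A.X Q.X).hom ≫ P.X ◁ Q.actLeft) ▷ Z)
    (tπ P Q ▷ Z) (by simp only [← comp_whiskerRight, tcond, Category.assoc]))) := by
  have := (LeftCoflat.preserves (X := Z))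
  exact ⟨isColimitCoforkMapOfIsColimit (tensorRight Z)
    (coequalizer.condition _ _) (coequalizerIsCoequalizer _ _)⟩

/-- the left module underlying a bimodule -/
def leftMod (P : Bimod A A) : LeftModule A := ⟨P.X, P.actLeft, P.one_actLeft, P.left_assoc⟩
/-- the right module underlying a bimodule -/
def rightMod (P : Bimod A A) : RightModule A := ⟨P.X, P.actRight, P.actRight_one, P.right_assoc⟩

variable (P Q) in
lemma exL (Z : C) : Nonempty (IsColimit (Cofork.ofπ
    (f := Z ◁ (P.actRight ▷ Q.X)) (g := Z ◁ ((α_ P.X A.X Q.X).hom ≫ P.X ◁ Q.actLeft))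
    (Z ◁ tπ P Q) (by simp only [← MonoidalCategory.whiskerLeft_comp, tcond, Category.assoc]))) :=
  IsRobust.isColimit (Y := leftMod Q) Z (rightMod P)

instance : Epi (tπ P Q ▷ Z) := ⟨fun _ _ h => Cofork.IsColimit.hom_ext (exR P Q Z).some h⟩
instance : Epi (Z ◁ tπ P Q) := ⟨fun _ _ h => Cofork.IsColimit.hom_ext (exL P Q Z).some h⟩
instance : Epi ((Z ◁ tπ P Q) ▷ W) := by
  have := (LeftCoflat.preserves (X := W))
  exact ⟨fun _ _ h => Cofork.IsColimit.hom_ext (isColimitCoforkMapOfIsColimit (tensorRight W) _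
    (exL P Q Z).some) h⟩
instance : Epi (Z ◁ tπ P Q ▷ W) := by
  have : Z ◁ tπ P Q ▷ W = (α_ _ _ _).inv ≫ (Z ◁ tπ P Q) ▷ W ≫ (α_ _ _ _).hom := by simp
  rw [this]; infer_instance
instance : Epi (tπ P Q ▷ Z ▷ W) := by
  have : tπ P Q ▷ Z ▷ W = (α_ _ _ _).hom ≫ tπ P Q ▷ (Z ⊗ W) ≫ (α_ _ _ _).inv := by simp
  rw [this]; infer_instance
instance : Epi (Z ◁ W ◁ tπ P Q) := by
  have : Z ◁ W ◁ tπ P Q = (α_ _ _ _).inv ≫ (Z ⊗ W) ◁ tπ P Q ≫ (α_ _ _ _).hom := by simp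
  rw [this]; infer_instance

/-- universal property of `tπ ▷ Z` -/
noncomputable def tdescR (f : (P.X ⊗ Q.X) ⊗ Z ⟶ W)
    (h : P.actRight ▷ Q.X ▷ Z ≫ f = ((α_ P.X A.X Q.X).hom ≫ P.X ◁ Q.actLeft) ▷ Z ≫ f) :
    tobj P Q ⊗ Z ⟶ W :=
  Cofork.IsColimit.desc (exR P Q Z).some f h

lemma tπ_tdescR (f : (P.X ⊗ Q.X) ⊗ Z ⟶ W) (h) : tπ P Q ▷ Z ≫ tdescR f h = f :=
  Cofork.IsColimit.π_desc' (exR P Q Z).some f h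

/-- universal property of `Z ◁ tπ` -/
noncomputable def tdescL (f : Z ⊗ (P.X ⊗ Q.X) ⟶ W)
    (h : Z ◁ (P.actRight ▷ Q.X) ≫ f = Z ◁ ((α_ P.X A.X Q.X).hom ≫ P.X ◁ Q.actLeft) ≫ f) :
    Z ⊗ tobj P Q ⟶ W :=
  Cofork.IsColimit.desc (exL P Q Z).some f h

lemma tπ_tdescL (f : Z ⊗ (P.X ⊗ Q.X) ⟶ W) (h) : Z ◁ tπ P Q ≫ tdescL f h = f :=
  Cofork.IsColimit.π_desc' (exL P Q Z).some f h

end desc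

variable [∀ X : C, LeftCoflat X] [∀ Y : LeftModule A, IsRobust Y]

/-- left action -/
noncomputable def tactL : A.X ⊗ tobj P Q ⟶ tobj P Q :=
  tdescL ((α_ _ _ _).inv ≫ P.actLeft ▷ Q.X ≫ tπ P Q) (by
    calc _ = 𝟙 _ ⊗≫ ((α_ _ _ _).hom ≫ A.X ◁ P.actRight ≫ P.actLeft) ▷ Q.X ≫ tπ P Q := by monoidal
      _ = 𝟙 _ ⊗≫ (P.actLeft ▷ A.X) ▷ Q.X ≫ P.actRight ▷ Q.X ≫ tπ P Q := by
        rw [← P.middle_assoc]; monoidal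
      _ = 𝟙 _ ⊗≫ (P.actLeft ▷ (A.X ⊗ Q.X) ≫ P.X ◁ Q.actLeft) ≫ tπ P Q := by
        rw [tcond]; monoidal
      _ = _ := by rw [← whisker_exchange]; monoidal)

lemma tπ_tactL : A.X ◁ tπ P Q ≫ tactL P Q = (α_ _ _ _).inv ≫ P.actLeft ▷ Q.X ≫ tπ P Q :=
  tπ_tdescL _ _

/-- right action -/
noncomputable def tactR : tobj P Q ⊗ A.X ⟶ tobj P Q :=
  tdescR ((α_ _ _ _).hom ≫ P.X ◁ Q.actRight ≫ tπ P Q) (by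
    calc _ = 𝟙 _ ⊗≫ (P.actRight ▷ (Q.X ⊗ A.X) ≫ P.X ◁ Q.actRight) ≫ tπ P Q := by monoidal
      _ = 𝟙 _ ⊗≫ (P.X ⊗ A.X) ◁ Q.actRight ≫ P.actRight ▷ Q.X ≫ tπ P Q := by
        rw [← whisker_exchange]; monoidal
      _ = 𝟙 _ ⊗≫ P.X ◁ ((α_ _ _ _).hom ≫ A.X ◁ Q.actRight ≫ Q.actLeft) ≫ tπ P Q := by
        rw [tcond]; monoidal
      _ = _ := by rw [← Q.middle_assoc]; monoidal)

lemma tπ_tactR : tπ P Q ▷ A.X ≫ tactR P Q = (α_ _ _ _).hom ≫ P.X ◁ Q.actRight ≫ tπ P Q :=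
  tπ_tdescR _ _

/-- The tensor product over `A` of bimodules -/
noncomputable def tensor : Bimod A A where
  X := tobj P Q
  actLeft := tactL P Q
  actRight := tactR P Q
  one_actLeft := by
    rw [← cancel_epi (𝟙_ C ◁ tπ P Q), whisker_exchange_assoc, tπ_tactL,
      associator_inv_naturality_left_assoc, ← comp_whiskerRight_assoc, P.one_actLeft]
    monoidal
  left_assoc := by
    rw [← cancel_epi ((A.X ⊗ A.X) ◁ tπ P Q), whisker_exchange_assoc, tπ_tactL,
      associator_inv_naturality_left_assoc, ← comp_whiskerRight_assoc, P.left_assoc]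
    calc _ = 𝟙 _ ⊗≫ A.X ◁ ((α_ _ _ _).inv ≫ P.actLeft ▷ Q.X) ≫ ((α_ _ _ _).inv ≫
          P.actLeft ▷ Q.X ≫ tπ P Q) := by monoidal
      _ = 𝟙 _ ⊗≫ A.X ◁ ((α_ _ _ _).inv ≫ P.actLeft ▷ Q.X) ≫ A.X ◁ tπ P Q ≫ tactL P Q := by
        rw [← tπ_tactL]
      _ = 𝟙 _ ⊗≫ A.X ◁ ((α_ _ _ _).inv ≫ P.actLeft ▷ Q.X ≫ tπ P Q) ≫ tactL P Q := by
        monoidal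
      _ = 𝟙 _ ⊗≫ A.X ◁ (A.X ◁ tπ P Q ≫ tactL P Q) ≫ tactL P Q := by rw [tπ_tactL]
      _ = _ := by monoidal
  actRight_one := by
    rw [← cancel_epi (tπ P Q ▷ 𝟙_ C), ← whisker_exchange_assoc, tπ_tactR,
      associator_naturality_right_assoc, ← whiskerLeft_comp_assoc, Q.actRight_one]
    monoidal
  right_assoc := by
    rw [← cancel_epi (tπ P Q ▷ (A.X ⊗ A.X)), ← whisker_exchange_assoc, tπ_tactR,
      associator_naturality_right_assoc, ← whiskerLeft_comp_assoc, Q.right_assoc]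
    calc _ = 𝟙 _ ⊗≫ ((α_ _ _ _).hom ≫ P.X ◁ Q.actRight) ▷ A.X ≫ ((α_ _ _ _).hom ≫
          P.X ◁ Q.actRight ≫ tπ P Q) := by monoidal
      _ = 𝟙 _ ⊗≫ ((α_ _ _ _).hom ≫ P.X ◁ Q.actRight) ▷ A.X ≫ tπ P Q ▷ A.X ≫ tactR P Q := by
        rw [← tπ_tactR]
      _ = 𝟙 _ ⊗≫ ((α_ _ _ _).hom ≫ P.X ◁ Q.actRight ≫ tπ P Q) ▷ A.X ≫ tactR P Q := by
        monoidal
      _ = 𝟙 _ ⊗≫ (tπ P Q ▷ A.X ≫ tactR P Q) ▷ A.X ≫ tactR P Q := by rw [tπ_tactR]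
      _ = _ := by monoidal
  middle_assoc := by
    rw [← cancel_epi ((A.X ◁ tπ P Q) ▷ A.X), ← comp_whiskerRight_assoc, tπ_tactL]
    calc _ = 𝟙 _ ⊗≫ (P.actLeft ▷ Q.X) ▷ A.X ≫ tπ P Q ▷ A.X ≫ tactR P Q := by monoidal
      _ = 𝟙 _ ⊗≫ (P.actLeft ▷ (Q.X ⊗ A.X) ≫ P.X ◁ Q.actRight) ≫ tπ P Q := by
        rw [tπ_tactR]; monoidal
      _ = 𝟙 _ ⊗≫ A.X ◁ (P.X ◁ Q.actRight) ≫ (α_ _ _ _).inv ≫ P.actLeft ▷ Q.X ≫ tπ P Q := by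
        rw [← whisker_exchange]; monoidal
      _ = 𝟙 _ ⊗≫ A.X ◁ ((α_ _ _ _).hom ≫ P.X ◁ Q.actRight ≫ tπ P Q) ≫ tactL P Q := by
        rw [← tπ_tactL]; monoidal
      _ = _ := by rw [← tπ_tactR]; monoidal

/-- the projection `P ⊗ Q ⟶ P ⊗_A Q` -/
noncomputable def π : P.X ⊗ Q.X ⟶ (tensor P Q).X := tπ P Q

lemma cond : P.actRight ▷ Q.X ≫ π P Q = (α_ P.X A.X Q.X).hom ≫ P.X ◁ Q.actLeft ≫ π P Q := tcond P Q

lemma π_actL : A.X ◁ π P Q ≫ (tensor P Q).actLeft = (α_ _ _ _).inv ≫ P.actLeft ▷ Q.X ≫ π P Q :=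
  tπ_tactL P Q

lemma π_actR : π P Q ▷ A.X ≫ (tensor P Q).actRight = (α_ _ _ _).hom ≫ P.X ◁ Q.actRight ≫ π P Q :=
  tπ_tactR P Q

section
variable {P Q} {Z W V : C}

/-- universal property of `π` -/
noncomputable def desc (f : P.X ⊗ Q.X ⟶ Z)
    (h : P.actRight ▷ Q.X ≫ f = ((α_ P.X A.X Q.X).hom ≫ P.X ◁ Q.actLeft) ≫ f) :
    (tensor P Q).X ⟶ Z := tdesc f h

lemma π_desc (f : P.X ⊗ Q.X ⟶ Z) (h) : π P Q ≫ desc f h = f := tπ_tdesc f h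

/-- universal property of `π ▷ Z` -/
noncomputable def descR (f : (P.X ⊗ Q.X) ⊗ Z ⟶ W)
    (h : P.actRight ▷ Q.X ▷ Z ≫ f = ((α_ P.X A.X Q.X).hom ≫ P.X ◁ Q.actLeft) ▷ Z ≫ f) :
    (tensor P Q).X ⊗ Z ⟶ W := tdescR f h

lemma π_descR (f : (P.X ⊗ Q.X) ⊗ Z ⟶ W) (h) : π P Q ▷ Z ≫ descR f h = f := tπ_tdescR f h

/-- universal property of `Z ◁ π` -/
noncomputable def descL (f : Z ⊗ (P.X ⊗ Q.X) ⟶ W)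
    (h : Z ◁ (P.actRight ▷ Q.X) ≫ f = Z ◁ ((α_ P.X A.X Q.X).hom ≫ P.X ◁ Q.actLeft) ≫ f) :
    Z ⊗ (tensor P Q).X ⟶ W := tdescL f h

lemma π_descL (f : Z ⊗ (P.X ⊗ Q.X) ⟶ W) (h) : Z ◁ π P Q ≫ descL f h = f := tπ_tdescL f h

instance : Epi (π P Q) := inferInstanceAs (Epi (tπ P Q))
instance : Epi (π P Q ▷ Z) := inferInstanceAs (Epi (tπ P Q ▷ Z))
instance : Epi (Z ◁ π P Q) := inferInstanceAs (Epi (Z ◁ tπ P Q))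
instance : Epi (Z ◁ π P Q ▷ W) := inferInstanceAs (Epi (Z ◁ tπ P Q ▷ W))
instance : Epi ((Z ◁ π P Q) ▷ W) := inferInstanceAs (Epi ((Z ◁ tπ P Q) ▷ W))
instance : Epi (π P Q ▷ Z ▷ W) := inferInstanceAs (Epi (tπ P Q ▷ Z ▷ W))
instance : Epi (Z ◁ W ◁ π P Q) := inferInstanceAs (Epi (Z ◁ W ◁ tπ P Q))

end

variable {P Q R S}

/-- a morphism of bimodules out of `P ⊗_A Q` -/
noncomputable def homMk {T : Bimod A A} (f : (tensor P Q).X ⟶ T.X)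
    (hl : P.actLeft ▷ Q.X ≫ π P Q ≫ f = (α_ _ _ _).hom ≫ A.X ◁ (π P Q ≫ f) ≫ T.actLeft)
    (hr : (α_ _ _ _).hom ≫ P.X ◁ Q.actRight ≫ π P Q ≫ f = (π P Q ≫ f) ▷ A.X ≫ T.actRight) :
    tensor P Q ⟶ T where
  hom := f
  left_act_hom := by
    rw [← cancel_epi (A.X ◁ π P Q), ← Category.assoc, π_actL, Category.assoc, Category.assoc, hl]
    simp
  right_act_hom := by
    rw [← cancel_epi (π P Q ▷ A.X), ← Category.assoc, π_actR, Category.assoc, Category.assoc, hr]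
    simp

/-- left whiskering -/
noncomputable def wL (P : Bimod A A) {Q R : Bimod A A} (f : Q ⟶ R) : tensor P Q ⟶ tensor P R :=
  homMk (desc (P.X ◁ f.hom ≫ π P R) (by
    calc _ = (P.actRight ▷ Q.X ≫ P.X ◁ f.hom) ≫ π P R := (Category.assoc _ _ _).symm
      _ = (P.X ⊗ A.X) ◁ f.hom ≫ P.actRight ▷ R.X ≫ π P R := by
        rw [← whisker_exchange, Category.assoc]
      _ = 𝟙 _ ⊗≫ P.X ◁ (A.X ◁ f.hom ≫ R.actLeft) ≫ π P R := by rw [cond]; monoidal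
      _ = _ := by rw [← f.left_act_hom]; monoidal))
  (by
    rw [π_desc, MonoidalCategory.whiskerLeft_comp_assoc, π_actL, ← whisker_exchange_assoc]
    monoidal)
  (by
    rw [π_desc, comp_whiskerRight_assoc, π_actR, ← whiskerLeft_comp_assoc, f.right_act_hom]
    monoidal)

lemma π_wL (f : Q ⟶ R) : π P Q ≫ (wL P f).hom = P.X ◁ f.hom ≫ π P R := π_desc _ _

/-- right whiskering -/
noncomputable def wR {P Q : Bimod A A} (f : P ⟶ Q) (R : Bimod A A) : tensor P R ⟶ tensor Q R :=
  homMk (desc (f.hom ▷ R.X ≫ π Q R) (by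
    calc _ = (P.actRight ≫ f.hom) ▷ R.X ≫ π Q R := by rw [comp_whiskerRight, Category.assoc]
      _ = f.hom ▷ A.X ▷ R.X ≫ Q.actRight ▷ R.X ≫ π Q R := by
        rw [f.right_act_hom]; monoidal
      _ = 𝟙 _ ⊗≫ (f.hom ▷ (A.X ⊗ R.X) ≫ Q.X ◁ R.actLeft) ≫ π Q R := by rw [cond]; monoidal
      _ = _ := by rw [← whisker_exchange]; monoidal))
  (by
    rw [π_desc, MonoidalCategory.whiskerLeft_comp_assoc, π_actL, ← comp_whiskerRight_assoc,
      f.left_act_hom]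
    monoidal)
  (by
    rw [π_desc, comp_whiskerRight_assoc, π_actR, whisker_exchange_assoc]
    monoidal)

lemma π_wR (f : P ⟶ Q) : π P R ≫ (wR f R).hom = f.hom ▷ R.X ≫ π Q R := π_desc _ _

variable (P Q R) in
/-- the morphism `(P ⊗_A Q) ⊗ R ⟶ P ⊗_A (Q ⊗_A R)` -/
noncomputable def assocAux : (tensor P Q).X ⊗ R.X ⟶ (tensor P (tensor Q R)).X :=
  descR ((α_ P.X Q.X R.X).hom ≫ P.X ◁ π Q R ≫ π P (tensor Q R)) (by
      calc _ = 𝟙 _ ⊗≫ (P.actRight ▷ (Q.X ⊗ R.X) ≫ P.X ◁ π Q R) ≫ π P (tensor Q R) := by monoidal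
        _ = 𝟙 _ ⊗≫ (P.X ⊗ A.X) ◁ π Q R ≫ P.actRight ▷ _ ≫ π P (tensor Q R) := by
          rw [← whisker_exchange]; monoidal
        _ = 𝟙 _ ⊗≫ P.X ◁ (A.X ◁ π Q R ≫ (tensor Q R).actLeft) ≫ π P (tensor Q R) := by
          rw [cond]; monoidal
        _ = _ := by rw [π_actL]; monoidal)

lemma π_assocAux : π P Q ▷ R.X ≫ assocAux P Q R =
    (α_ P.X Q.X R.X).hom ≫ P.X ◁ π Q R ≫ π P (tensor Q R) := π_descR _ _

variable (P Q R) in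
/-- associator -/
noncomputable def assocHom' : (tensor (tensor P Q) R).X ⟶ (tensor P (tensor Q R)).X :=
  desc (assocAux P Q R) (by
    rw [← cancel_epi (π P Q ▷ A.X ▷ R.X), ← comp_whiskerRight_assoc, π_actR]
    calc _ = ((α_ P.X Q.X A.X).hom ≫ P.X ◁ Q.actRight) ▷ R.X ≫ π P Q ▷ R.X ≫ assocAux P Q R := by
          monoidal
      _ = 𝟙 _ ⊗≫ P.X ◁ (Q.actRight ▷ R.X ≫ π Q R) ≫ π P (tensor Q R) := by
          rw [π_assocAux]; monoidal
      _ = 𝟙 _ ⊗≫ (P.X ⊗ Q.X) ◁ R.actLeft ≫ ((α_ P.X Q.X R.X).hom ≫ P.X ◁ π Q R ≫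
          π P (tensor Q R)) := by rw [cond]; monoidal
      _ = 𝟙 _ ⊗≫ ((P.X ⊗ Q.X) ◁ R.actLeft ≫ π P Q ▷ R.X) ≫ assocAux P Q R := by
          rw [← π_assocAux]; monoidal
      _ = _ := by rw [whisker_exchange]; monoidal)

lemma π_assocHom' : π (tensor P Q) R ≫ assocHom' P Q R = assocAux P Q R := π_desc _ _

lemma ππ_assocHom' : π P Q ▷ R.X ≫ π (tensor P Q) R ≫ assocHom' P Q R =
    (α_ P.X Q.X R.X).hom ≫ P.X ◁ π Q R ≫ π P (tensor Q R) := by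
  rw [π_assocHom', π_assocAux]

variable (P Q R) in
/-- the morphism `P ⊗ (Q ⊗_A R) ⟶ (P ⊗_A Q) ⊗_A R` -/
noncomputable def assocInvAux : P.X ⊗ (tensor Q R).X ⟶ (tensor (tensor P Q) R).X :=
  descL ((α_ P.X Q.X R.X).inv ≫ π P Q ▷ R.X ≫ π (tensor P Q) R) (by
      calc _ = 𝟙 _ ⊗≫ ((α_ _ _ _).hom ≫ P.X ◁ Q.actRight ≫ π P Q) ▷ R.X ≫ π (tensor P Q) R := by
            monoidal
        _ = 𝟙 _ ⊗≫ π P Q ▷ A.X ▷ R.X ≫ (tensor P Q).actRight ▷ R.X ≫ π (tensor P Q) R := by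
          rw [← π_actR]; monoidal
        _ = 𝟙 _ ⊗≫ (π P Q ▷ (A.X ⊗ R.X) ≫ (tensor P Q).X ◁ R.actLeft) ≫ π (tensor P Q) R := by
          rw [cond]; monoidal
        _ = _ := by rw [← whisker_exchange]; monoidal)

lemma π_assocInvAux : P.X ◁ π Q R ≫ assocInvAux P Q R =
    (α_ P.X Q.X R.X).inv ≫ π P Q ▷ R.X ≫ π (tensor P Q) R := π_descL _ _

variable (P Q R) in
/-- inverse associator -/
noncomputable def assocInv' : (tensor P (tensor Q R)).X ⟶ (tensor (tensor P Q) R).X :=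
  desc (assocInvAux P Q R) (by
    rw [← cancel_epi ((P.X ⊗ A.X) ◁ π Q R), whisker_exchange_assoc, π_assocInvAux]
    calc _ = 𝟙 _ ⊗≫ (P.actRight ▷ Q.X ≫ π P Q) ▷ R.X ≫ π (tensor P Q) R := by monoidal
      _ = 𝟙 _ ⊗≫ P.X ◁ ((α_ _ _ _).inv ≫ Q.actLeft ▷ R.X) ≫ ((α_ P.X Q.X R.X).inv ≫ π P Q ▷ R.X ≫
          π (tensor P Q) R) := by rw [cond]; monoidal
      _ = 𝟙 _ ⊗≫ P.X ◁ ((α_ _ _ _).inv ≫ Q.actLeft ▷ R.X ≫ π Q R) ≫ assocInvAux P Q R := by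
          rw [← π_assocInvAux]; monoidal
      _ = _ := by rw [← π_actL]; monoidal)

lemma ππ_assocInv' : P.X ◁ π Q R ≫ π P (tensor Q R) ≫ assocInv' P Q R =
    (α_ P.X Q.X R.X).inv ≫ π P Q ▷ R.X ≫ π (tensor P Q) R := by
  rw [assocInv', π_desc, π_assocInvAux]

variable (P Q R) in
/-- associator -/
noncomputable def assocHom : tensor (tensor P Q) R ⟶ tensor P (tensor Q R) :=
  homMk (assocHom' P Q R)
    (by
      rw [π_assocHom', ← cancel_epi ((A.X ◁ π P Q) ▷ R.X), ← comp_whiskerRight_assoc, π_actL]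
      calc _ = ((α_ _ _ _).inv ≫ P.actLeft ▷ Q.X) ▷ R.X ≫ π P Q ▷ R.X ≫ assocAux P Q R := by
            monoidal
        _ = 𝟙 _ ⊗≫ (P.actLeft ▷ (Q.X ⊗ R.X) ≫ P.X ◁ π Q R) ≫ π P (tensor Q R) := by
            rw [π_assocAux]; monoidal
        _ = 𝟙 _ ⊗≫ (A.X ⊗ P.X) ◁ π Q R ⊗≫ ((α_ _ _ _).inv ≫ P.actLeft ▷ _ ≫ π P (tensor Q R)) := by
            rw [← whisker_exchange]; monoidal
        _ = 𝟙 _ ⊗≫ A.X ◁ ((α_ _ _ _).hom ≫ P.X ◁ π Q R ≫ π P (tensor Q R)) ≫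
              (tensor P (tensor Q R)).actLeft := by rw [← π_actL]; monoidal
        _ = _ := by rw [← π_assocAux]; monoidal)
    (by
      rw [π_assocHom', ← cancel_epi (π P Q ▷ R.X ▷ A.X)]
      calc _ = 𝟙 _ ⊗≫ (π P Q ▷ (R.X ⊗ A.X) ≫ _ ◁ R.actRight) ≫ assocAux P Q R := by monoidal
        _ = 𝟙 _ ⊗≫ (P.X ⊗ Q.X) ◁ R.actRight ≫ π P Q ▷ R.X ≫ assocAux P Q R := by
            rw [← whisker_exchange]; monoidal
        _ = 𝟙 _ ⊗≫ P.X ◁ ((α_ _ _ _).hom ≫ Q.X ◁ R.actRight ≫ π Q R) ≫ π P (tensor Q R) := by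
            rw [π_assocAux]; monoidal
        _ = 𝟙 _ ⊗≫ (P.X ◁ π Q R) ▷ A.X ≫ ((α_ _ _ _).hom ≫ P.X ◁ (tensor Q R).actRight ≫
              π P (tensor Q R)) := by rw [← π_actR]; monoidal
        _ = 𝟙 _ ⊗≫ ((α_ _ _ _).hom ≫ P.X ◁ π Q R ≫ π P (tensor Q R)) ▷ A.X ≫
              (tensor P (tensor Q R)).actRight := by rw [← π_actR]; monoidal
        _ = _ := by rw [← π_assocAux]; monoidal)

variable (P Q R) in
/-- associator -/
noncomputable def assoc : tensor (tensor P Q) R ≅ tensor P (tensor Q R) :=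
  Bimod.isoOfIso
    { hom := assocHom' P Q R
      inv := assocInv' P Q R
      hom_inv_id := by
        rw [← cancel_epi (π (tensor P Q) R), ← cancel_epi (π P Q ▷ R.X),
          reassoc_of% (ππ_assocHom' (P := P) (Q := Q) (R := R)), ππ_assocInv']
        simp
      inv_hom_id := by
        rw [← cancel_epi (π P (tensor Q R)), ← cancel_epi (P.X ◁ π Q R),
          reassoc_of% (ππ_assocInv' (P := P) (Q := Q) (R := R)), ππ_assocHom']
        simp }
    (assocHom P Q R).left_act_hom (assocHom P Q R).right_act_hom

lemma ππ_assoc : π P Q ▷ R.X ≫ π (tensor P Q) R ≫ (assoc P Q R).hom.hom =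
    (α_ P.X Q.X R.X).hom ≫ P.X ◁ π Q R ≫ π P (tensor Q R) := ππ_assocHom'

/-- `A` as a bimodule over itself -/
abbrev reg (A : Mon C) : Bimod A A where
  X := A.X
  actLeft := μ[A.X]
  actRight := μ[A.X]
  left_assoc := by simp
  right_assoc := by simp
  middle_assoc := by simp

/-- left unitor -/
noncomputable def lUnitor' (P : Bimod A A) : (tensor (reg A) P).X ⟶ P.X :=
  desc (P := reg A) (Q := P) P.actLeft (by simp [P.left_assoc])

lemma π_lUnitor' (P : Bimod A A) : π (reg A) P ≫ lUnitor' P = P.actLeft :=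
  π_desc (P := reg A) _ _

/-- left unitor -/
noncomputable def lUnitor (P : Bimod A A) : tensor (reg A) P ≅ P :=
  Bimod.isoOfIso (P := tensor (reg A) P)
    { hom := lUnitor' P
      inv := (λ_ P.X).inv ≫ η[A.X] ▷ P.X ≫ π (reg A) P
      hom_inv_id := by
        rw [← cancel_epi (π (reg A) P), reassoc_of% π_lUnitor']
        calc P.actLeft ≫ (λ_ P.X).inv ≫ η[A.X] ▷ P.X ≫ π (reg A) P
            = 𝟙 _ ⊗≫ (𝟙_ C ◁ P.actLeft ≫ η[A.X] ▷ P.X) ≫ π (reg A) P := by monoidal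
          _ = 𝟙 _ ⊗≫ η[A.X] ▷ (A.X ⊗ P.X) ⊗≫ ((α_ _ _ _).hom ≫ A.X ◁ P.actLeft ≫
                π (reg A) P) := by rw [whisker_exchange]; monoidal
          _ = 𝟙 _ ⊗≫ (η[A.X] ▷ A.X ≫ μ[A.X]) ▷ P.X ≫ π (reg A) P := by
              rw [← cond (reg A) P]; monoidal
          _ = _ := by rw [MonObj.one_mul]; monoidal
      inv_hom_id := by
        rw [Category.assoc, Category.assoc, π_lUnitor', P.one_actLeft]; simp }
    (homMk (P := reg A) (lUnitor' P) (by rw [π_lUnitor', P.left_assoc])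
      (by rw [π_lUnitor', P.middle_assoc])).left_act_hom
    (homMk (P := reg A) (lUnitor' P) (by rw [π_lUnitor', P.left_assoc])
      (by rw [π_lUnitor', P.middle_assoc])).right_act_hom

lemma π_lUnitor (P : Bimod A A) : π (reg A) P ≫ (lUnitor P).hom.hom = P.actLeft := π_lUnitor' P

/-- right unitor -/
noncomputable def rUnitor' (P : Bimod A A) : (tensor P (reg A)).X ⟶ P.X :=
  desc (P := P) (Q := reg A) P.actRight (by
    rw [Category.assoc, P.right_assoc, Iso.hom_inv_id_assoc])

lemma π_rUnitor' (P : Bimod A A) : π P (reg A) ≫ rUnitor' P = P.actRight :=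
  π_desc (Q := reg A) _ _

/-- right unitor -/
noncomputable def rUnitor (P : Bimod A A) : tensor P (reg A) ≅ P :=
  Bimod.isoOfIso (P := tensor P (reg A))
    { hom := rUnitor' P
      inv := (ρ_ P.X).inv ≫ P.X ◁ η[A.X] ≫ π P (reg A)
      hom_inv_id := by
        rw [← cancel_epi (π P (reg A)), reassoc_of% π_rUnitor']
        calc P.actRight ≫ (ρ_ P.X).inv ≫ P.X ◁ η[A.X] ≫ π P (reg A)
            = 𝟙 _ ⊗≫ (P.actRight ▷ 𝟙_ C ≫ P.X ◁ η[A.X]) ≫ π P (reg A) := by monoidal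
          _ = 𝟙 _ ⊗≫ (P.X ⊗ A.X) ◁ η[A.X] ≫ (P.actRight ▷ A.X ≫
                π P (reg A)) := by rw [← whisker_exchange]; monoidal
          _ = 𝟙 _ ⊗≫ P.X ◁ (A.X ◁ η[A.X] ≫ μ[A.X]) ≫ π P (reg A) := by
              rw [cond P (reg A)]; monoidal
          _ = _ := by rw [MonObj.mul_one]; monoidal
      inv_hom_id := by
        rw [Category.assoc, Category.assoc, π_rUnitor', P.actRight_one]; simp }
    (homMk (Q := reg A) (rUnitor' P) (by rw [π_rUnitor', P.middle_assoc])
      (by rw [π_rUnitor', P.right_assoc]; simp)).left_act_hom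
    (homMk (Q := reg A) (rUnitor' P) (by rw [π_rUnitor', P.middle_assoc])
      (by rw [π_rUnitor', P.right_assoc]; simp)).right_act_hom

lemma π_rUnitor (P : Bimod A A) : π P (reg A) ≫ (rUnitor P).hom.hom = P.actRight := π_rUnitor' P

lemma hom_ext' {T : Bimod A A} {f g : tensor P Q ⟶ T} (h : π P Q ≫ f.hom = π P Q ≫ g.hom) :
    f = g := Bimod.hom_ext _ _ ((cancel_epi (π P Q)).1 h)

lemma hom_ext₃ {T : Bimod A A} {f g : tensor (tensor P Q) R ⟶ T}
    (h : π P Q ▷ R.X ≫ π _ R ≫ f.hom = π P Q ▷ R.X ≫ π _ R ≫ g.hom) : f = g :=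
  hom_ext' ((cancel_epi (π P Q ▷ R.X)).1 h)

lemma hom_ext₄ {T : Bimod A A} {f g : tensor (tensor (tensor P Q) R) S ⟶ T}
    (h : π P Q ▷ R.X ▷ S.X ≫ π _ R ▷ S.X ≫ π _ S ≫ f.hom =
      π P Q ▷ R.X ▷ S.X ≫ π _ R ▷ S.X ≫ π _ S ≫ g.hom) : f = g :=
  hom_ext₃ ((cancel_epi (π P Q ▷ R.X ▷ S.X)).1 h)

noncomputable instance : MonoidalCategoryStruct (Bimod A A) where
  tensorObj P Q := tensor P Q
  tensorUnit := reg A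
  whiskerLeft P _ _ f := wL P f
  whiskerRight f R := wR f R
  associator P Q R := assoc P Q R
  leftUnitor P := lUnitor P
  rightUnitor P := rUnitor P

lemma wL_id (X Y : Bimod A A) : wL X (𝟙 Y) = 𝟙 (tensor X Y) := hom_ext' (by
  rw [π_wL]; simp)
lemma wR_id (X Y : Bimod A A) : wR (𝟙 X) Y = 𝟙 (tensor X Y) := hom_ext' (by
  rw [π_wR]; simp)
lemma wL_comp (X : Bimod A A) {Y Z W : Bimod A A} (f : Y ⟶ Z) (g : Z ⟶ W) :
    wL X (f ≫ g) = wL X f ≫ wL X g := hom_ext' (by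
  rw [π_wL, Bimod.comp_hom', Bimod.comp_hom', reassoc_of% π_wL, π_wL]; simp)
lemma wR_comp {X Y Z : Bimod A A} (f : X ⟶ Y) (g : Y ⟶ Z) (W : Bimod A A) :
    wR (f ≫ g) W = wR f W ≫ wR g W := hom_ext' (by
  rw [π_wR, Bimod.comp_hom', Bimod.comp_hom', reassoc_of% π_wR, π_wR]; simp)
lemma w_exchange {X X' Y Y' : Bimod A A} (f : X ⟶ X') (g : Y ⟶ Y') :
    wL X g ≫ wR f Y' = wR f Y ≫ wL X' g := hom_ext' (by
  rw [Bimod.comp_hom', Bimod.comp_hom', reassoc_of% π_wR, π_wL, reassoc_of% π_wL, π_wR,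
    whisker_exchange_assoc])
lemma assoc_left {X X' : Bimod A A} (f : X ⟶ X') (Y Z : Bimod A A) :
    wR (wR f Y) Z ≫ (assoc X' Y Z).hom = (assoc X Y Z).hom ≫ wR f (tensor Y Z) := hom_ext₃ (by
  rw [Bimod.comp_hom', Bimod.comp_hom', reassoc_of% ππ_assoc, π_wR, reassoc_of% π_wR,
    ← comp_whiskerRight_assoc, π_wR, comp_whiskerRight_assoc, ππ_assoc,
    whisker_exchange_assoc]
  simp)
lemma assoc_middle (X : Bimod A A) {Y Y' : Bimod A A} (f : Y ⟶ Y') (Z : Bimod A A) :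
    wR (wL X f) Z ≫ (assoc X Y' Z).hom = (assoc X Y Z).hom ≫ wL X (wR f Z) := hom_ext₃ (by
  rw [Bimod.comp_hom', Bimod.comp_hom', reassoc_of% ππ_assoc, π_wL, reassoc_of% π_wR,
    ← comp_whiskerRight_assoc, π_wL, comp_whiskerRight_assoc, ππ_assoc,
    ← whiskerLeft_comp_assoc, π_wR]
  simp)
lemma assoc_right (X Y : Bimod A A) {Z Z' : Bimod A A} (f : Z ⟶ Z') :
    wL (tensor X Y) f ≫ (assoc X Y Z').hom = (assoc X Y Z).hom ≫ wL X (wL Y f) := hom_ext₃ (by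
  rw [Bimod.comp_hom', Bimod.comp_hom', reassoc_of% ππ_assoc, π_wL, reassoc_of% π_wL,
    ← whisker_exchange_assoc, ππ_assoc, ← whiskerLeft_comp_assoc, π_wL]
  simp)
lemma lUnitor_natural {X Y : Bimod A A} (f : X ⟶ Y) :
    wL (reg A) f ≫ (lUnitor Y).hom = (lUnitor X).hom ≫ f := hom_ext' (by
  rw [Bimod.comp_hom', Bimod.comp_hom', reassoc_of% π_lUnitor, reassoc_of% π_wL, π_lUnitor]
  exact f.left_act_hom.symm)
lemma rUnitor_natural {X Y : Bimod A A} (f : X ⟶ Y) :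
    wR f (reg A) ≫ (rUnitor Y).hom = (rUnitor X).hom ≫ f := hom_ext' (by
  rw [Bimod.comp_hom', Bimod.comp_hom', reassoc_of% π_rUnitor, reassoc_of% π_wR, π_rUnitor]
  exact f.right_act_hom.symm)
lemma pentagon' (W X Y Z : Bimod A A) :
    wR (assoc W X Y).hom Z ≫ (assoc W (tensor X Y) Z).hom ≫ wL W (assoc X Y Z).hom =
      (assoc (tensor W X) Y Z).hom ≫ (assoc W X (tensor Y Z)).hom := hom_ext₄ (by
  simp only [Bimod.comp_hom']
  rw [reassoc_of% π_wR, reassoc_of% (ππ_assoc (P := tensor W X))]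
  calc _ = (π W X ▷ Y.X ≫ π (tensor W X) Y ≫ (assoc W X Y).hom.hom) ▷ Z.X ≫
          π (tensor W (tensor X Y)) Z ≫ (assoc W (tensor X Y) Z).hom.hom ≫
          (wL W (assoc X Y Z).hom).hom := by
        simp only [comp_whiskerRight, Category.assoc]
    _ = 𝟙 _ ⊗≫ (W.X ◁ π X Y) ▷ Z.X ≫ (π W (tensor X Y) ▷ Z.X ≫
          π (tensor W (tensor X Y)) Z ≫ (assoc W (tensor X Y) Z).hom.hom) ≫
          (wL W (assoc X Y Z).hom).hom := by
        rw [ππ_assoc]; monoidal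
    _ = 𝟙 _ ⊗≫ W.X ◁ π X Y ▷ Z.X ≫ W.X ◁ π (tensor X Y) Z ≫ (π W (tensor (tensor X Y) Z) ≫
          (wL W (assoc X Y Z).hom).hom) := by
        rw [ππ_assoc]; monoidal
    _ = 𝟙 _ ⊗≫ W.X ◁ (π X Y ▷ Z.X ≫ π (tensor X Y) Z ≫ (assoc X Y Z).hom.hom) ≫
          π W (tensor X (tensor Y Z)) := by
        rw [π_wL]; monoidal
    _ = 𝟙 _ ⊗≫ (W.X ⊗ X.X) ◁ π Y Z ≫ ((α_ _ _ _).hom ≫ W.X ◁ π X (tensor Y Z) ≫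
          π W (tensor X (tensor Y Z))) := by
        rw [ππ_assoc]; monoidal
    _ = 𝟙 _ ⊗≫ ((W.X ⊗ X.X) ◁ π Y Z ≫ π W X ▷ _) ≫ π (tensor W X) (tensor Y Z) ≫
          (assoc W X (tensor Y Z)).hom.hom := by
        rw [← ππ_assoc]; monoidal
    _ = _ := by rw [whisker_exchange]; monoidal)
lemma triangle' (X Y : Bimod A A) :
    (assoc X (reg A) Y).hom ≫ wL X (lUnitor Y).hom = wR (rUnitor X).hom Y := hom_ext₃ (by
  rw [Bimod.comp_hom', reassoc_of% ππ_assoc, π_wL, π_wR, ← comp_whiskerRight_assoc, π_rUnitor,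
    ← whiskerLeft_comp_assoc, π_lUnitor, cond])

noncomputable instance : MonoidalCategory (Bimod A A) :=
  ofWhiskering (fun _ _ => rfl) wL_id wR_id wL_comp wR_comp w_exchange assoc_left assoc_middle
    assoc_right lUnitor_natural rUnitor_natural pentagon' triangle'

end BimodTensor
end Cowreath

namespace Cowreath

variable {C : Type u} [Category.{v} C] [MonoidalCategory C]

/-- `f : X ⟶ Y ⊗ A` extended to the right `A`-linear `X ⊗ A ⟶ Y ⊗ A`. -/
def rext (A : Mon C) {X Y : C} (f : X ⟶ Y ⊗ A.X) : X ⊗ A.X ⟶ Y ⊗ A.X :=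
  f ▷ A.X ≫ (α_ Y A.X A.X).hom ≫ Y ◁ μ[A.X]

/-- `X ⟶ X ⊗ A` -/
def runit (A : Mon C) (X : C) : X ⟶ X ⊗ A.X := (ρ_ X).inv ≫ X ◁ η[A.X]

section
variable (A : Mon C) {X Y Z W : C}

@[simp]
lemma runit_rext (f : X ⟶ Y ⊗ A.X) : runit A X ≫ rext A f = f := by
  calc _ = 𝟙 _ ⊗≫ (X ◁ η[A.X] ≫ f ▷ A.X) ⊗≫ Y ◁ μ[A.X] := by
        simp only [rext, runit]; monoidal
    _ = 𝟙 _ ⊗≫ f ⊗≫ Y ◁ (A.X ◁ η[A.X] ≫ μ[A.X]) := by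
        rw [whisker_exchange]; monoidal
    _ = _ := by rw [MonObj.mul_one]; monoidal

lemma runit_natural (f : X ⟶ Y) : runit A X ≫ f ▷ A.X = f ≫ runit A Y := by
  simp only [runit, Category.assoc, whisker_exchange]
  monoidal

@[simp]
lemma rext_runit : rext A (runit A X) = 𝟙 _ := by
  calc _ = 𝟙 _ ⊗≫ X ◁ (η[A.X] ▷ A.X ≫ μ[A.X]) := by simp only [rext, runit]; monoidal
    _ = _ := by rw [MonObj.one_mul]; monoidal

lemma mul_rext (f : X ⟶ Y ⊗ A.X) :
    (α_ X A.X A.X).hom ≫ X ◁ μ[A.X] ≫ rext A f =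
      rext A f ▷ A.X ≫ (α_ Y A.X A.X).hom ≫ Y ◁ μ[A.X] := by
  calc _ = 𝟙 _ ⊗≫ (X ◁ μ[A.X] ≫ f ▷ A.X) ⊗≫ Y ◁ μ[A.X] := by
        simp only [rext]; monoidal
    _ = 𝟙 _ ⊗≫ f ▷ (A.X ⊗ A.X) ⊗≫ Y ◁ ((α_ A.X A.X A.X).hom ≫ A.X ◁ μ[A.X] ≫ μ[A.X]) := by
        rw [whisker_exchange]; monoidal
    _ = _ := by rw [← MonObj.mul_assoc]; simp only [rext]; monoidal

lemma rext_comp (f : X ⟶ Y ⊗ A.X) (g : Y ⟶ Z ⊗ A.X) :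
    rext A (f ≫ rext A g) = rext A f ≫ rext A g := by
  conv_rhs => rw [rext]
  simp only [Category.assoc, mul_rext]
  simp [rext]

lemma rext_precomp (f : X ⟶ Y) (g : Y ⟶ Z ⊗ A.X) :
    rext A (f ≫ g) = f ▷ A.X ≫ rext A g := by
  simp [rext]

lemma rext_postcomp (f : X ⟶ Y ⊗ A.X) (g : Y ⟶ Z) :
    rext A (f ≫ g ▷ A.X) = rext A f ≫ g ▷ A.X := by
  simp only [rext, comp_whiskerRight, Category.assoc, whisker_exchange]
  monoidal

/-- `f : X ⟶ Y ⊗ A` tensored with `Z` on the left -/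
def wten {A : Mon C} {X Y : C} (Z : C) (f : X ⟶ Y ⊗ A.X) : Z ⊗ X ⟶ (Z ⊗ Y) ⊗ A.X :=
  Z ◁ f ≫ (α_ Z Y A.X).inv

@[simp]
lemma wten_runit : wten Z (runit A X) = runit A (Z ⊗ X) := by
  simp only [wten, runit]; monoidal

lemma wten_precomp (f : X ⟶ Y) (g : Y ⟶ Z ⊗ A.X) : wten W (f ≫ g) = W ◁ f ≫ wten W g := by
  simp [wten]

lemma wten_postcomp (f : X ⟶ Y ⊗ A.X) (g : Y ⟶ Z) :
    wten W (f ≫ g ▷ A.X) = wten W f ≫ (W ◁ g) ▷ A.X := by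
  simp [wten]

lemma wten_comp (f : X ⟶ Y ⊗ A.X) (g : Y ⟶ Z ⊗ A.X) :
    wten W (f ≫ rext A g) = wten W f ≫ rext A (wten W g) := by
  simp only [wten, rext]; monoidal

lemma wten_tensor (f : X ⟶ Y ⊗ A.X) :
    wten (Z ⊗ W) f = (α_ Z W X).hom ≫ wten Z (wten W f) ≫ (α_ Z W Y).inv ▷ A.X := by
  simp only [wten]; monoidal

end

/-- Left transfer morphisms through `A`: an object `X` with `φ : A X ⟶ X A` compatible with the
multiplication and the unit of `A`. An algebra in the category of left transfer morphisms is a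
wreath. -/
structure LeftTransfer (A : Mon C) where
  /-- the underlying object -/
  X : C
  /-- the transfer morphism `A X ⟶ X A` -/
  φ : A.X ⊗ X ⟶ X ⊗ A.X
  mul_φ : μ[A.X] ▷ X ≫ φ = (α_ A.X A.X X).hom ≫ A.X ◁ φ ≫ (α_ A.X X A.X).inv ≫
    φ ▷ A.X ≫ (α_ X A.X A.X).hom ≫ X ◁ μ[A.X]
  one_φ : (λ_ X).inv ≫ η[A.X] ▷ X ≫ φ = (ρ_ X).inv ≫ X ◁ η[A.X]

namespace LeftTransfer

variable {A : Mon C}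

/-- `f : Y ⟶ Z ⊗ A` tensored with the transfer morphism `X` on the right -/
def tenr (X : LeftTransfer A) {Y Z : C} (f : Y ⟶ Z ⊗ A.X) : Y ⊗ X.X ⟶ (Z ⊗ X.X) ⊗ A.X :=
  f ▷ X.X ≫ (α_ Z A.X X.X).hom ≫ Z ◁ X.φ ≫ (α_ Z X.X A.X).inv

section
variable (X : LeftTransfer A) {Y Z W V : C}

@[simp]
lemma tenr_runit : X.tenr (runit A Y) = runit A (Y ⊗ X.X) := by
  calc _ = 𝟙 _ ⊗≫ Y ◁ ((λ_ X.X).inv ≫ η[A.X] ▷ X.X ≫ X.φ) ⊗≫ 𝟙 _ := by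
        simp only [tenr, runit]; monoidal
    _ = _ := by rw [one_φ]; simp only [runit]; monoidal

lemma tenr_precomp (f : Y ⟶ Z) (g : Z ⟶ W ⊗ A.X) : X.tenr (f ≫ g) = f ▷ X.X ≫ X.tenr g := by
  simp [tenr]

lemma tenr_postcomp (f : Y ⟶ Z ⊗ A.X) (g : Z ⟶ W) :
    X.tenr (f ≫ g ▷ A.X) = X.tenr f ≫ (g ▷ X.X) ▷ A.X := by
  calc _ = f ▷ X.X ⊗≫ (g ▷ (A.X ⊗ X.X) ≫ W ◁ X.φ) ⊗≫ 𝟙 _ := by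
        simp only [tenr]; monoidal
    _ = _ := by rw [← whisker_exchange]; simp only [tenr]; monoidal

lemma tenr_comp (f : Y ⟶ Z ⊗ A.X) (g : Z ⟶ W ⊗ A.X) :
    X.tenr (f ≫ rext A g) = X.tenr f ≫ rext A (X.tenr g) := by
  calc _ = f ▷ X.X ⊗≫ g ▷ A.X ▷ X.X ⊗≫ W ◁ (μ[A.X] ▷ X.X ≫ X.φ) ⊗≫ 𝟙 _ := by
        simp only [tenr, rext]; monoidal
    _ = f ▷ X.X ⊗≫ (g ▷ (A.X ⊗ X.X) ≫ (W ⊗ A.X) ◁ X.φ) ⊗≫ W ◁ X.φ ▷ A.X ⊗≫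
        (W ⊗ X.X) ◁ μ[A.X] := by
        rw [mul_φ]; monoidal
    _ = _ := by rw [← whisker_exchange]; simp only [tenr, rext]; monoidal

lemma tenr_wten (f : Y ⟶ Z ⊗ A.X) :
    X.tenr (wten W f) = (α_ W Y X.X).hom ≫ wten W (X.tenr f) ≫ (α_ W Z X.X).inv ▷ A.X := by
  simp only [wten, tenr]; monoidal

end

/-- The tensor product of transfer morphisms. -/
def tensor (X Y : LeftTransfer A) : LeftTransfer A where
  X := X.X ⊗ Y.X
  φ := (α_ A.X X.X Y.X).inv ≫ X.φ ▷ Y.X ≫ (α_ X.X A.X Y.X).hom ≫ X.X ◁ Y.φ ≫ (α_ X.X Y.X A.X).inv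
  mul_φ := by
    have h : μ[A.X] ▷ X.X ≫ X.φ = (α_ A.X A.X X.X).hom ≫ wten A.X X.φ ≫ rext A X.φ := by
      rw [mul_φ]; simp [wten, rext]
    calc _ = (α_ _ X.X Y.X).inv ≫ Y.tenr (μ[A.X] ▷ X.X ≫ X.φ) := by simp [tenr]
      _ = (α_ _ X.X Y.X).inv ≫ Y.tenr ((α_ A.X A.X X.X).hom ≫ (wten A.X X.φ ≫ rext A X.φ)) := by
          rw [h]
      _ = _ := by
          rw [tenr_precomp, tenr_comp, tenr_wten]
          simp only [tenr, wten, rext]; monoidal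
  one_φ := by
    have h : (λ_ X.X).inv ≫ η[A.X] ▷ X.X ≫ X.φ = runit A X.X := X.one_φ
    calc _ = Y.tenr ((λ_ X.X).inv ≫ η[A.X] ▷ X.X ≫ X.φ) := by simp [tenr]
      _ = _ := by rw [h, tenr_runit]; simp [runit]

/-- The unit transfer morphism. -/
def unit (A : Mon C) : LeftTransfer A where
  X := 𝟙_ C
  φ := (ρ_ A.X).hom ≫ (λ_ A.X).inv
  mul_φ := by monoidal
  one_φ := by monoidal

/-- Morphisms `(X, φ) ⟶ (Y, φ')` of left transfer morphisms: morphisms `X ⟶ Y A` compatible with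
`φ` and `φ'`. -/
@[ext]
structure Hom (X Y : LeftTransfer A) where
  /-- the underlying morphism -/
  hom : X.X ⟶ Y.X ⊗ A.X
  comm : X.φ ≫ hom ▷ A.X ≫ (α_ Y.X A.X A.X).hom ≫ Y.X ◁ μ[A.X] =
    A.X ◁ hom ≫ (α_ A.X Y.X A.X).inv ≫ Y.φ ▷ A.X ≫ (α_ Y.X A.X A.X).hom ≫ Y.X ◁ μ[A.X]

lemma Hom.comm' {X Y : LeftTransfer A} (f : Hom X Y) :
    X.φ ≫ rext A f.hom = wten A.X f.hom ≫ rext A Y.φ := by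
  simpa [rext, wten] using f.comm

/-- constructor -/
def Hom.mk' {X Y : LeftTransfer A} (f : X.X ⟶ Y.X ⊗ A.X)
    (h : X.φ ≫ rext A f = wten A.X f ≫ rext A Y.φ) : Hom X Y :=
  ⟨f, by simpa [rext, wten] using h⟩

instance : Category (LeftTransfer A) where
  Hom X Y := Hom X Y
  id X := Hom.mk' ((ρ_ X.X).inv ≫ X.X ◁ η[A.X]) (by
    change X.φ ≫ rext A (runit A _) = wten _ (runit A _) ≫ _
    simp)
  comp {X Y Z} f g := Hom.mk' (f.hom ≫ g.hom ▷ A.X ≫ (α_ Z.X A.X A.X).hom ≫ Z.X ◁ μ[A.X]) (by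
    change X.φ ≫ rext A (f.hom ≫ rext A g.hom) = wten _ (f.hom ≫ rext A g.hom) ≫ _
    rw [rext_comp, reassoc_of% f.comm', wten_comp, Category.assoc, ← rext_comp, ← rext_comp, g.comm'])
  id_comp f := Hom.ext (runit_rext A f.hom)
  comp_id f := Hom.ext (by
    change f.hom ≫ rext A (runit A _) = _
    simp)
  assoc f g h := Hom.ext (by
    change (f.hom ≫ rext A g.hom) ≫ rext A h.hom = f.hom ≫ rext A (g.hom ≫ rext A h.hom)
    rw [rext_comp, Category.assoc])

@[ext]
lemma hom_ext {X Y : LeftTransfer A} (f g : X ⟶ Y) (h : f.hom = g.hom) : f = g := Hom.ext h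

lemma comp_hom {X Y Z : LeftTransfer A} (f : X ⟶ Y) (g : Y ⟶ Z) :
    (f ≫ g).hom = f.hom ≫ rext A g.hom := rfl

lemma id_hom (X : LeftTransfer A) : (𝟙 X : X ⟶ X).hom = runit A X.X := rfl

lemma exchange {X X' : LeftTransfer A} (f : X ⟶ X') {Y Y' : C} (g : Y ⟶ Y' ⊗ A.X) :
    X.tenr g ≫ rext A (wten Y' f.hom) = wten Y f.hom ≫ rext A (X'.tenr g) := by
  calc _ = g ▷ X.X ⊗≫ Y' ◁ (X.φ ≫ rext A f.hom) ⊗≫ 𝟙 _ := by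
        simp only [tenr, rext, wten]; monoidal
    _ = (g ▷ X.X ≫ (Y' ⊗ A.X) ◁ f.hom) ⊗≫ Y' ◁ rext A X'.φ ⊗≫ 𝟙 _ := by
        rw [f.comm']; simp only [wten]; monoidal
    _ = _ := by
        rw [← whisker_exchange]; simp only [tenr, rext, wten]; monoidal

/-- morphisms of `C` compatible with the transfer morphisms are morphisms here -/
def homOf {X Y : LeftTransfer A} (f : X.X ⟶ Y.X) (h : X.φ ≫ f ▷ A.X = A.X ◁ f ≫ Y.φ) : X ⟶ Y :=
  Hom.mk' (f ≫ runit A Y.X) (by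
    rw [← runit_natural, rext_postcomp, rext_runit, Category.id_comp, h, wten_postcomp, wten_runit,
      Category.assoc, ← rext_precomp, runit_rext])

/-- isomorphisms -/
def isoOf {X Y : LeftTransfer A} (f : X.X ≅ Y.X) (h : X.φ ≫ f.hom ▷ A.X = A.X ◁ f.hom ≫ Y.φ) :
    X ≅ Y where
  hom := homOf f.hom h
  inv := homOf f.inv (by
    rw [← cancel_epi (A.X ◁ f.hom), ← reassoc_of% h]
    simp [← comp_whiskerRight, whiskerLeft_hom_inv_assoc])
  hom_inv_id := hom_ext _ _ (by
    change (f.hom ≫ runit A _) ≫ rext A (f.inv ≫ runit A _) = runit A _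
    simp)
  inv_hom_id := hom_ext _ _ (by
    change (f.inv ≫ runit A _) ≫ rext A (f.hom ≫ runit A _) = runit A _
    simp)

instance : MonoidalCategoryStruct (LeftTransfer A) where
  tensorObj := tensor
  tensorUnit := unit A
  whiskerLeft X Y Y' g := Hom.mk' (X.X ◁ g.hom ≫ (α_ X.X Y'.X A.X).inv) (by
      change ((α_ _ X.X Y.X).inv ≫ Y.tenr X.φ) ≫ rext A (wten X.X g.hom) =
        wten _ (wten X.X g.hom) ≫ rext A ((α_ _ X.X Y'.X).inv ≫ Y'.tenr X.φ)
      rw [Category.assoc, exchange, rext_precomp, wten_tensor]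
      simp)
  whiskerRight {X X'} f Y := Hom.mk'
    (f.hom ▷ Y.X ≫ (α_ X'.X A.X Y.X).hom ≫ X'.X ◁ Y.φ ≫ (α_ X'.X Y.X A.X).inv) (by
      change ((α_ _ X.X Y.X).inv ≫ Y.tenr X.φ) ≫ rext A (Y.tenr f.hom) =
        wten _ (Y.tenr f.hom) ≫ rext A ((α_ _ X'.X Y.X).inv ≫ Y.tenr X'.φ)
      rw [Category.assoc, ← tenr_comp, f.comm', tenr_comp, rext_precomp, tenr_wten]
      simp)
  associator X Y Z := isoOf (α_ X.X Y.X Z.X) (by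
    dsimp [tensor]; monoidal)
  leftUnitor X := isoOf (λ_ X.X) (by dsimp [tensor, unit]; monoidal)
  rightUnitor X := isoOf (ρ_ X.X) (by dsimp [tensor, unit]; monoidal)

lemma whiskerLeft_hom (X : LeftTransfer A) {Y Y' : LeftTransfer A} (g : Y ⟶ Y') :
    (X ◁ g).hom = wten X.X g.hom := rfl
lemma whiskerRight_hom {X X' : LeftTransfer A} (f : X ⟶ X') (Y : LeftTransfer A) :
    (f ▷ Y).hom = Y.tenr f.hom := rfl
lemma associator_hom_hom (X Y Z : LeftTransfer A) :
    (α_ X Y Z).hom.hom = (α_ X.X Y.X Z.X).hom ≫ runit A _ := rfl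
lemma leftUnitor_hom_hom (X : LeftTransfer A) :
    (λ_ X).hom.hom = (λ_ X.X).hom ≫ runit A _ := rfl
lemma rightUnitor_hom_hom (X : LeftTransfer A) :
    (ρ_ X).hom.hom = (ρ_ X.X).hom ≫ runit A _ := rfl
lemma tensorObj_X (X Y : LeftTransfer A) : (X ⊗ Y).X = X.X ⊗ Y.X := rfl

lemma tensor_tenr (X Y : LeftTransfer A) {Z W : C} (f : Z ⟶ W ⊗ A.X) :
    (tensor X Y).tenr f = (α_ Z X.X Y.X).inv ≫ Y.tenr (X.tenr f) ≫ (α_ W X.X Y.X).hom ▷ A.X := by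
  dsimp only [tenr, tensor]; monoidal

lemma comp_pure {X Y Z : C} (f : X ⟶ Y ⊗ A.X) (g : Y ⟶ Z) :
    f ≫ rext A (g ≫ runit A Z) = f ≫ g ▷ A.X := by
  rw [rext_precomp, rext_runit, Category.comp_id]

instance : MonoidalCategory (LeftTransfer A) :=
  ofWhiskering (fun _ _ => rfl)
    (fun X Y => hom_ext _ _ (wten_runit A))
    (fun X Y => hom_ext _ _ (tenr_runit Y))
    (fun X _ _ _ f g => hom_ext _ _ (wten_comp A f.hom g.hom))
    (fun f g Y => hom_ext _ _ (tenr_comp Y f.hom g.hom))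
    (fun f g => hom_ext _ _ (exchange g f.hom).symm)
    (fun {X X'} f Y Z => hom_ext _ _ (by
      change Z.tenr (Y.tenr f.hom) ≫ rext A ((α_ X'.X Y.X Z.X).hom ≫ runit A _) =
        ((α_ X.X Y.X Z.X).hom ≫ runit A _) ≫ rext A ((tensor Y Z).tenr f.hom)
      rw [comp_pure, Category.assoc]
      refine Eq.trans ?_ (congrArg _ (runit_rext A ((tensor Y Z).tenr f.hom)).symm)
      rw [tensor_tenr]
      exact (Iso.hom_inv_id_assoc _ _).symm))
    (fun X {Y Y'} f Z => hom_ext _ _ (by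
      change Z.tenr (wten X.X f.hom) ≫ rext A ((α_ X.X Y'.X Z.X).hom ≫ runit A _) =
        ((α_ X.X Y.X Z.X).hom ≫ runit A _) ≫ rext A (wten X.X (Z.tenr f.hom))
      rw [comp_pure, Category.assoc, runit_rext, tenr_wten]
      simp))
    (fun X Y {Z Z'} f => hom_ext _ _ (by
      change wten (X.X ⊗ Y.X) f.hom ≫ rext A ((α_ X.X Y.X Z'.X).hom ≫ runit A _) =
        ((α_ X.X Y.X Z.X).hom ≫ runit A _) ≫ rext A (wten X.X (wten Y.X f.hom))
      rw [comp_pure, Category.assoc, runit_rext, wten_tensor]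
      simp))
    (fun {X Y} f => hom_ext _ _ (by
      change wten (𝟙_ C) f.hom ≫ rext A ((λ_ Y.X).hom ≫ runit A _) =
        ((λ_ X.X).hom ≫ runit A _) ≫ rext A f.hom
      rw [comp_pure, Category.assoc, runit_rext]
      simp only [wten]; monoidal))
    (fun {X Y} f => hom_ext _ _ (by
      change (unit A).tenr f.hom ≫ rext A ((ρ_ Y.X).hom ≫ runit A _) =
        ((ρ_ X.X).hom ≫ runit A _) ≫ rext A f.hom
      refine (comp_pure _ _).trans ?_
      rw [Category.assoc, runit_rext]
      simp only [tenr, unit]; monoidal))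
    (fun W X Y Z => hom_ext _ _ (by
      change Z.tenr ((α_ W.X X.X Y.X).hom ≫ runit A _) ≫
        rext A (((α_ W.X (X.X ⊗ Y.X) Z.X).hom ≫ runit A _) ≫
          rext A (wten W.X ((α_ X.X Y.X Z.X).hom ≫ runit A _))) =
        ((α_ (W.X ⊗ X.X) Y.X Z.X).hom ≫ runit A _) ≫
          rext A ((α_ W.X X.X (Y.X ⊗ Z.X)).hom ≫ runit A _)
      simp [wten_precomp, tenr_precomp]))
    (fun X Y => hom_ext _ _ (by
      change ((α_ X.X (𝟙_ C) Y.X).hom ≫ runit A _) ≫ rext A (wten X.X ((λ_ Y.X).hom ≫ runit A _)) =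
        Y.tenr ((ρ_ X.X).hom ≫ runit A _)
      simp [wten_precomp, tenr_precomp]))

end LeftTransfer
end Cowreath

namespace Cowreath

/-- Casimir morphisms `B : X X ⟶ 1` of a coalgebra `X` in a monoidal category:
`(X B) ∘ (Δ X) = (B X) ∘ (X Δ)`. -/
def IsCasimir {D : Type u} [Category.{v} D] [MonoidalCategory D] {X : D} [ComonObj X]
    (B : X ⊗ X ⟶ 𝟙_ D) : Prop :=
  Δ[X] ▷ X ≫ (α_ X X X).hom ≫ X ◁ B ≫ (ρ_ X).hom =
    X ◁ Δ[X] ≫ (α_ X X X).inv ≫ B ▷ X ≫ (λ_ X).hom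

/-- Frobenius coalgebras in a monoidal category: there are a morphism `t : 1 ⟶ X` and a Casimir
morphism `B` with `B ∘ (t X) = ε = B ∘ (X t)`. -/
def IsFrobeniusCoalgebra {D : Type u} [Category.{v} D] [MonoidalCategory D] (X : D) [ComonObj X] :
    Prop :=
  ∃ (t : 𝟙_ D ⟶ X) (B : X ⊗ X ⟶ 𝟙_ D), IsCasimir B ∧
    (λ_ X).inv ≫ t ▷ X ≫ B = ε[X] ∧ (ρ_ X).inv ≫ X ◁ t ≫ B = ε[X]

/-- Frobenius algebras in a monoidal category: there are `θ : S ⟶ 1` and a Casimir element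
`e : 1 ⟶ S S` with `(θ S) ∘ e = η = (S θ) ∘ e`. -/
def IsFrobeniusAlgebra {D : Type u} [Category.{v} D] [MonoidalCategory D] (S : D) [MonObj S] :
    Prop :=
  ∃ (θ : S ⟶ 𝟙_ D) (e : 𝟙_ D ⟶ S ⊗ S),
    (ρ_ S).inv ≫ S ◁ e ≫ (α_ S S S).inv ≫ μ[S] ▷ S =
      (λ_ S).inv ≫ e ▷ S ≫ (α_ S S S).hom ≫ S ◁ μ[S] ∧
    e ≫ θ ▷ S ≫ (λ_ S).hom = η[S] ∧ e ≫ S ◁ θ ≫ (ρ_ S).hom = η[S]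

section hat
variable {C : Type u} [Category.{v} C] [MonoidalCategory C]

/-- transposition `Hom(Z, Y ⊗ W) ⟶ Hom(X ⊗ Z, W)` -/
def hat (X : C) {Y Z W : C} [ExactPairing Y X] (f : Z ⟶ Y ⊗ W) : X ⊗ Z ⟶ W :=
  X ◁ f ≫ (α_ X Y W).inv ≫ ε_ Y X ▷ W ≫ (λ_ W).hom

/-- transposition `Hom(X ⊗ Z, W) ⟶ Hom(Z, Y ⊗ W)` -/
def unhat (Y : C) {X Z W : C} [ExactPairing Y X] (f : X ⊗ Z ⟶ W) : Z ⟶ Y ⊗ W :=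
  (λ_ Z).inv ≫ η_ Y X ▷ Z ≫ (α_ Y X Z).hom ≫ Y ◁ f

variable {X Y Z W : C} [ExactPairing Y X]

@[simp]
lemma hat_unhat (f : X ⊗ Z ⟶ W) : hat X (unhat Y f) = f := by
  calc _ = 𝟙 _ ⊗≫ X ◁ η_ Y X ▷ Z ⊗≫ ((X ⊗ Y) ◁ f ≫ ε_ Y X ▷ W) ⊗≫ 𝟙 _ := by
        simp only [hat, unhat]; monoidal
    _ = 𝟙 _ ⊗≫ (X ◁ η_ Y X ≫ (α_ _ _ _).inv ≫ ε_ Y X ▷ X) ▷ Z ⊗≫ f := by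
        rw [whisker_exchange]; monoidal
    _ = _ := by rw [ExactPairing.coevaluation_evaluation]; monoidal

@[simp]
lemma unhat_hat (f : Z ⟶ Y ⊗ W) : unhat Y (hat X f) = f := by
  calc _ = 𝟙 _ ⊗≫ (η_ Y X ▷ Z ≫ (Y ⊗ X) ◁ f) ⊗≫ Y ◁ ε_ Y X ▷ W ⊗≫ 𝟙 _ := by
        simp only [hat, unhat]; monoidal
    _ = 𝟙 _ ⊗≫ f ⊗≫ (η_ Y X ▷ Y ≫ (α_ _ _ _).hom ≫ Y ◁ ε_ Y X) ▷ W ⊗≫ 𝟙 _ := by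
        rw [← whisker_exchange]; monoidal
    _ = _ := by rw [ExactPairing.evaluation_coevaluation]; monoidal

lemma hat_injective {f g : Z ⟶ Y ⊗ W} (h : hat X f = hat X g) : f = g := by
  rw [← unhat_hat (X := X) f, h, unhat_hat]

lemma whisker_hat (f : Z ⟶ Y ⊗ W) : X ◁ f ≫ (α_ X Y W).inv ≫ ε_ Y X ▷ W = hat X f ≫ (λ_ W).inv := by
  simp [hat]

end hat

section dual
variable {D : Type u} [Category.{v} D] [MonoidalCategory D] (X Y : D) [ExactPairing Y X]

/-- `X ⊗ X ⊗ Y ⊗ Y ⟶ 1` -/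
def ev₂ : (X ⊗ X) ⊗ (Y ⊗ Y) ⟶ 𝟙_ D :=
  (α_ X X (Y ⊗ Y)).hom ≫ X ◁ (α_ X Y Y).inv ≫ X ◁ ε_ Y X ▷ Y ≫ X ◁ (λ_ Y).hom ≫ ε_ Y X

variable {X Y} in
lemma dual_ext {Z : D} {f g : Z ⟶ Y} (h : X ◁ f ≫ ε_ Y X = X ◁ g ≫ ε_ Y X) : f = g := by
  rw [← cancel_mono (ρ_ Y).inv]
  apply hat_injective (X := X)
  calc _ = 𝟙 _ ⊗≫ (X ◁ f ≫ ε_ Y X) ⊗≫ 𝟙 _ := by simp only [hat]; monoidal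
    _ = _ := by rw [h]; simp only [hat]; monoidal

/-- The multiplication of the right dual `Y` of a coalgebra `X`. In strict notation it is
`(Y d₂) ∘ (Y Δ Y Y) ∘ (b Y Y)` with `d₂ = d ∘ (X d Y)`. -/
def dualMul [ComonObj X] : Y ⊗ Y ⟶ Y :=
  (λ_ (Y ⊗ Y)).inv ≫ η_ Y X ▷ (Y ⊗ Y) ≫ (α_ Y X (Y ⊗ Y)).hom ≫ Y ◁ (Δ[X] ▷ (Y ⊗ Y) ≫ ev₂ X Y) ≫
    (ρ_ Y).hom

/-- The unit of the right dual of a coalgebra. -/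
def dualOne [ComonObj X] : 𝟙_ D ⟶ Y := η_ Y X ≫ Y ◁ ε[X] ≫ (ρ_ Y).hom

lemma dualMul_ev [ComonObj X] : X ◁ dualMul X Y ≫ ε_ Y X = Δ[X] ▷ (Y ⊗ Y) ≫ ev₂ X Y := by
  calc _ = hat X (unhat Y (Δ[X] ▷ (Y ⊗ Y) ≫ ev₂ X Y)) := by
        simp only [hat, unhat, dualMul]; monoidal
    _ = _ := hat_unhat _

lemma dualOne_ev [ComonObj X] : X ◁ dualOne X Y ≫ ε_ Y X = (ρ_ X).hom ≫ ε[X] := by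
  calc _ = hat X (unhat Y ((ρ_ X).hom ≫ ε[X])) := by
        simp only [hat, unhat, dualOne]; monoidal
    _ = _ := hat_unhat _

/-- The algebra structure on the right dual of a coalgebra. -/
@[reducible]
def dualMonObj [ComonObj X] : MonObj Y where
  mul := dualMul X Y
  one := dualOne X Y
  one_mul := dual_ext (X := X) (by
    calc _ = X ◁ dualOne X Y ▷ Y ≫ (X ◁ dualMul X Y ≫ ε_ Y X) := by simp
      _ = 𝟙 _ ⊗≫ (X ◁ (dualOne X Y ▷ Y) ≫ Δ[X] ▷ (Y ⊗ Y)) ≫ ev₂ X Y := by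
          rw [dualMul_ev]; monoidal
      _ = 𝟙 _ ⊗≫ Δ[X] ▷ (𝟙_ D ⊗ Y) ⊗≫ X ◁ (X ◁ dualOne X Y ≫ ε_ Y X) ▷ Y ⊗≫ ε_ Y X := by
          rw [whisker_exchange]; simp only [ev₂]; monoidal
      _ = 𝟙 _ ⊗≫ (Δ[X] ≫ X ◁ ε[X]) ▷ Y ⊗≫ ε_ Y X := by
          rw [dualOne_ev]; monoidal
      _ = _ := by rw [ComonObj.comul_counit]; monoidal)
  mul_one := dual_ext (X := X) (by
    calc _ = X ◁ Y ◁ dualOne X Y ≫ (X ◁ dualMul X Y ≫ ε_ Y X) := by simp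
      _ = 𝟙 _ ⊗≫ (X ◁ (Y ◁ dualOne X Y) ≫ Δ[X] ▷ (Y ⊗ Y)) ≫ ev₂ X Y := by
          rw [dualMul_ev]; monoidal
      _ = 𝟙 _ ⊗≫ Δ[X] ▷ (Y ⊗ 𝟙_ D) ⊗≫ X ◁ ((X ⊗ Y) ◁ dualOne X Y ≫ ε_ Y X ▷ Y) ⊗≫ ε_ Y X := by
          rw [whisker_exchange]; simp only [ev₂]; monoidal
      _ = 𝟙 _ ⊗≫ Δ[X] ▷ (Y ⊗ 𝟙_ D) ⊗≫ X ◁ ε_ Y X ⊗≫ (X ◁ dualOne X Y ≫ ε_ Y X) := by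
          rw [whisker_exchange]; monoidal
      _ = 𝟙 _ ⊗≫ Δ[X] ▷ Y ⊗≫ (X ◁ ε_ Y X ≫ ε[X] ▷ 𝟙_ D) ⊗≫ 𝟙 _ := by
          rw [dualOne_ev]; monoidal
      _ = 𝟙 _ ⊗≫ (Δ[X] ≫ ε[X] ▷ X) ▷ Y ⊗≫ ε_ Y X := by
          rw [whisker_exchange]; monoidal
      _ = _ := by rw [ComonObj.counit_comul]; monoidal)
  mul_assoc := dual_ext (X := X) (by
    calc _ = X ◁ dualMul X Y ▷ Y ≫ (X ◁ dualMul X Y ≫ ε_ Y X) := by simp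
      _ = 𝟙 _ ⊗≫ (X ◁ (dualMul X Y ▷ Y) ≫ Δ[X] ▷ (Y ⊗ Y)) ≫ ev₂ X Y := by
          rw [dualMul_ev]; monoidal
      _ = 𝟙 _ ⊗≫ Δ[X] ▷ ((Y ⊗ Y) ⊗ Y) ⊗≫ X ◁ (X ◁ dualMul X Y ≫ ε_ Y X) ▷ Y ⊗≫ ε_ Y X := by
          rw [whisker_exchange]; simp only [ev₂]; monoidal
      _ = 𝟙 _ ⊗≫ (Δ[X] ≫ X ◁ Δ[X]) ▷ (Y ⊗ Y ⊗ Y) ⊗≫ X ◁ ev₂ X Y ▷ Y ⊗≫ ε_ Y X := by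
          rw [dualMul_ev]; monoidal
      _ = 𝟙 _ ⊗≫ Δ[X] ▷ (Y ⊗ Y ⊗ Y) ⊗≫ (Δ[X] ▷ ((X ⊗ Y) ⊗ Y ⊗ Y) ≫
            (X ⊗ X) ◁ (ε_ Y X ▷ (Y ⊗ Y))) ⊗≫ ev₂ X Y := by
          rw [ComonObj.comul_assoc]; simp only [ev₂]; monoidal
      _ = 𝟙 _ ⊗≫ Δ[X] ▷ (Y ⊗ Y ⊗ Y) ⊗≫ X ◁ ε_ Y X ▷ (Y ⊗ Y) ⊗≫ (Δ[X] ▷ (Y ⊗ Y) ≫ ev₂ X Y) := by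
          rw [← whisker_exchange]; monoidal
      _ = 𝟙 _ ⊗≫ Δ[X] ▷ (Y ⊗ Y ⊗ Y) ⊗≫ X ◁ (ε_ Y X ▷ (Y ⊗ Y) ≫ 𝟙_ D ◁ dualMul X Y) ⊗≫ ε_ Y X := by
          rw [← dualMul_ev]; monoidal
      _ = 𝟙 _ ⊗≫ (Δ[X] ▷ (Y ⊗ Y ⊗ Y) ≫ (X ⊗ X) ◁ (Y ◁ dualMul X Y)) ≫ ev₂ X Y := by
          rw [← whisker_exchange]; simp only [ev₂]; monoidal
      _ = 𝟙 _ ⊗≫ X ◁ (Y ◁ dualMul X Y) ≫ (Δ[X] ▷ (Y ⊗ Y) ≫ ev₂ X Y) := by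
          rw [← whisker_exchange]; monoidal
      _ = _ := by rw [← dualMul_ev]; monoidal)
end dual

section
variable {C : Type u} [Category.{v} C] [MonoidalCategory C] {A : Mon C}
variable (X : RightTransfer A) (Y : C) [ExactPairing Y X.X]

/-- The left transfer morphism `φ = (Y A d) ∘ (Y ψ Y) ∘ (b A Y) : A Y ⟶ Y A`. -/
def dualφ : A.X ⊗ Y ⟶ Y ⊗ A.X :=
  unhat Y ((α_ X.X A.X Y).inv ≫ X.ψ ▷ Y ≫ (α_ A.X X.X Y).hom ≫ A.X ◁ ε_ Y X.X ≫ (ρ_ A.X).hom)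

lemma hat_dualφ : X.X ◁ dualφ X Y ≫ (α_ X.X Y A.X).inv ≫ ε_ Y X.X ▷ A.X =
    (α_ X.X A.X Y).inv ≫ X.ψ ▷ Y ≫ (α_ A.X X.X Y).hom ≫ A.X ◁ ε_ Y X.X ≫ (ρ_ A.X).hom ≫
      (λ_ A.X).inv := by
  rw [whisker_hat, dualφ, hat_unhat]; simp

/-- The left transfer morphism `(Y, φ)` dual to `(X, ψ)`. -/
def dualTransfer : LeftTransfer A where
  X := Y
  φ := dualφ X Y
  mul_φ := hat_injective (X := X.X) (by
    calc _ = X.X ◁ μ[A.X] ▷ Y ≫ (X.X ◁ dualφ X Y ≫ (α_ X.X Y A.X).inv ≫ ε_ Y X.X ▷ A.X) ≫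
          (λ_ _).hom := by
          simp [hat]
      _ = 𝟙 _ ⊗≫ (X.X ◁ μ[A.X] ≫ X.ψ) ▷ Y ⊗≫ A.X ◁ ε_ Y X.X ⊗≫ 𝟙 _ := by
          rw [hat_dualφ]; monoidal
      _ = 𝟙 _ ⊗≫ X.ψ ▷ A.X ▷ Y ⊗≫ A.X ◁ X.ψ ▷ Y ⊗≫ (μ[A.X] ▷ (X.X ⊗ Y) ≫
            A.X ◁ ε_ Y X.X) ⊗≫ 𝟙 _ := by
          rw [X.mul_ψ]; monoidal
      _ = 𝟙 _ ⊗≫ X.ψ ▷ A.X ▷ Y ⊗≫ A.X ◁ ((α_ X.X A.X Y).inv ≫ X.ψ ▷ Y ≫ (α_ A.X X.X Y).hom ≫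
            A.X ◁ ε_ Y X.X ≫ (ρ_ A.X).hom ≫ (λ_ A.X).inv) ⊗≫ μ[A.X] := by
          rw [← whisker_exchange]; monoidal
      _ = 𝟙 _ ⊗≫ (X.ψ ▷ (A.X ⊗ Y) ≫ (A.X ⊗ X.X) ◁ dualφ X Y) ⊗≫ A.X ◁ ε_ Y X.X ▷ A.X ⊗≫ μ[A.X] := by
          rw [← hat_dualφ]; monoidal
      _ = 𝟙 _ ⊗≫ X.X ◁ A.X ◁ dualφ X Y ⊗≫ ((α_ X.X A.X Y).inv ≫ X.ψ ▷ Y ≫ (α_ A.X X.X Y).hom ≫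
            A.X ◁ ε_ Y X.X ≫ (ρ_ A.X).hom ≫ (λ_ A.X).inv) ▷ A.X ⊗≫ μ[A.X] := by
          rw [← whisker_exchange]; monoidal
      _ = 𝟙 _ ⊗≫ X.X ◁ A.X ◁ dualφ X Y ⊗≫ X.X ◁ dualφ X Y ▷ A.X ⊗≫ (ε_ Y X.X ▷ (A.X ⊗ A.X) ≫
            𝟙_ C ◁ μ[A.X]) ⊗≫ 𝟙 _ := by
          rw [← hat_dualφ]; monoidal
      _ = _ := by
          rw [← whisker_exchange]; simp only [hat]; monoidal)
  one_φ := hat_injective (X := X.X) (by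
    calc _ = 𝟙 _ ⊗≫ X.X ◁ η[A.X] ▷ Y ≫ (X.X ◁ dualφ X Y ≫ (α_ X.X Y A.X).inv ≫ ε_ Y X.X ▷ A.X) ≫
          (λ_ _).hom := by
          simp only [hat]; monoidal
      _ = 𝟙 _ ⊗≫ ((ρ_ X.X).inv ≫ X.X ◁ η[A.X] ≫ X.ψ) ▷ Y ⊗≫ A.X ◁ ε_ Y X.X ⊗≫ 𝟙 _ := by
          rw [hat_dualφ]; monoidal
      _ = 𝟙 _ ⊗≫ (η[A.X] ▷ (X.X ⊗ Y) ≫ A.X ◁ ε_ Y X.X) ⊗≫ 𝟙 _ := by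
          rw [X.one_ψ]; monoidal
      _ = 𝟙 _ ⊗≫ (ε_ Y X.X ▷ 𝟙_ C ≫ 𝟙_ C ◁ η[A.X]) ⊗≫ 𝟙 _ := by
          rw [← whisker_exchange]; monoidal
      _ = _ := by
          rw [← whisker_exchange]; simp only [hat]; monoidal)

end
end Cowreath

namespace Cowreath
variable {C : Type u} [Category.{v} C] [MonoidalCategory C] {A : Mon C}

section
variable (X : RightTransfer A) [ComonObj X]

/-- The comultiplication `X ⟶ A X X` -/
def cδ : X.X ⟶ A.X ⊗ (X.X ⊗ X.X) := (Δ[X]).hom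

/-- The counit `X ⟶ A` -/
def cε₀ : X.X ⟶ A.X ⊗ 𝟙_ C := (ε[X]).hom

/-- The counit `X ⟶ A` -/
def cε : X.X ⟶ A.X := cε₀ X ≫ (ρ_ A.X).hom

lemma cε' : cε X ≫ (ρ_ A.X).inv = cε₀ X := by simp [cε]

/-- `X X A ⟶ A X X` -/
def ψ₂ (X : RightTransfer A) : (X.X ⊗ X.X) ⊗ A.X ⟶ A.X ⊗ (X.X ⊗ X.X) :=
  (α_ X.X X.X A.X).hom ≫ X.X ◁ X.ψ ≫ (α_ X.X A.X X.X).inv ≫ X.ψ ▷ X.X ≫ (α_ A.X X.X X.X).hom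

lemma ψ_cδ : X.ψ ≫ lext A (cδ X) = rten (cδ X) A.X ≫ lext A (ψ₂ X) :=
  (RightTransfer.Hom.comm' (Δ[X]))

lemma ψ_cε : X.ψ ≫ A.X ◁ cε X ≫ μ[A.X] = cε X ▷ A.X ≫ μ[A.X] := by
  have h : X.ψ ≫ lext A (cε₀ X) = rten (cε₀ X) A.X ≫ lext A ((λ_ A.X).hom ≫ (ρ_ A.X).inv) :=
    RightTransfer.Hom.comm' (ε[X])
  rw [← cε'] at h
  calc _ = (X.ψ ≫ lext A (cε X ≫ (ρ_ A.X).inv)) ≫ (ρ_ A.X).hom := by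
        simp only [lext]; monoidal
    _ = (rten (cε X ≫ (ρ_ A.X).inv) A.X ≫ lext A ((λ_ A.X).hom ≫ (ρ_ A.X).inv)) ≫ (ρ_ A.X).hom := by
        rw [h]
    _ = _ := by simp only [rten, lext]; monoidal

lemma cδ_cε_left : cδ X ≫ lext A (rten (cε X ≫ (ρ_ A.X).inv) X.X) =
    (λ_ X.X).inv ≫ lunit A (𝟙_ C ⊗ X.X) := by
  rw [cε']
  exact congrArg RightTransfer.Hom.hom (ComonObj.counit_comul X)

lemma cδ_cε_right : cδ X ≫ lext A (X.lten (cε X ≫ (ρ_ A.X).inv)) =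
    (ρ_ X.X).inv ≫ lunit A (X.X ⊗ 𝟙_ C) := by
  rw [cε']
  exact congrArg RightTransfer.Hom.hom (ComonObj.comul_counit X)

lemma cδ_assoc : cδ X ≫ lext A (X.lten (cδ X)) =
    cδ X ≫ lext A (rten (cδ X) X.X) ≫ A.X ◁ (α_ X.X X.X X.X).hom := by
  have h : cδ X ≫ lext A (X.lten (cδ X)) =
      cδ X ≫ lext A (rten (cδ X) X.X ≫ lext A ((α_ X.X X.X X.X).hom ≫ lunit A _)) :=
    congrArg RightTransfer.Hom.hom (ComonObj.comul_assoc X)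
  rw [h, RightTransfer.comp_pure, lext_postcomp]

end

variable (X : RightTransfer A) (Y : C) [ExactPairing Y X.X]

lemma hat_rext {X Y Z W : C} [ExactPairing Y X] (f : Z ⟶ W ⊗ A.X) (g : W ⟶ Y ⊗ A.X) :
    hat X (f ≫ rext A g) = X ◁ f ⊗≫ (X ◁ g ≫ (α_ X Y A.X).inv ≫ ε_ Y X ▷ A.X) ▷ A.X ⊗≫ μ[A.X] := by
  calc _ = 𝟙 _ ⊗≫ X ◁ f ⊗≫ X ◁ g ▷ A.X ⊗≫ ((X ⊗ Y) ◁ μ[A.X] ≫ ε_ Y X ▷ A.X) ⊗≫ 𝟙 _ := by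
        simp only [hat, rext]; monoidal
    _ = _ := by rw [whisker_exchange]; monoidal

/-- `f : Z ⟶ W ⊗ A` tensored with `(Y, φ)` on the right -/
def dtenr {Z W : C} (f : Z ⟶ W ⊗ A.X) : Z ⊗ Y ⟶ (W ⊗ Y) ⊗ A.X :=
  f ▷ Y ≫ (α_ W A.X Y).hom ≫ W ◁ dualφ X Y ≫ (α_ W Y A.X).inv

/-- `A Y Y ⟶ Y Y A` -/
def dualφ₂ : A.X ⊗ (Y ⊗ Y) ⟶ (Y ⊗ Y) ⊗ A.X :=
  (α_ A.X Y Y).inv ≫ dualφ X Y ▷ Y ≫ (α_ Y A.X Y).hom ≫ Y ◁ dualφ X Y ≫ (α_ Y Y A.X).inv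

variable [ComonObj X]

/-- The multiplication `(Y A d₂) ∘ (Y δ Y Y) ∘ (b Y Y) : Y Y ⟶ Y A` -/
def wMul : Y ⊗ Y ⟶ Y ⊗ A.X :=
  unhat Y (cδ X ▷ (Y ⊗ Y) ≫ (α_ A.X (X.X ⊗ X.X) (Y ⊗ Y)).hom ≫ A.X ◁ ev₂ X.X Y ≫ (ρ_ A.X).hom)

/-- The unit `(Y ε) ∘ b : 1 ⟶ Y A` -/
def wOne : 𝟙_ C ⟶ Y ⊗ A.X := η_ Y X.X ≫ Y ◁ cε X

lemma hat_wMul : X.X ◁ wMul X Y ≫ (α_ X.X Y A.X).inv ≫ ε_ Y X.X ▷ A.X =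
    cδ X ▷ (Y ⊗ Y) ≫ (α_ A.X (X.X ⊗ X.X) (Y ⊗ Y)).hom ≫ A.X ◁ ev₂ X.X Y ≫ (ρ_ A.X).hom ≫
      (λ_ A.X).inv := by
  rw [whisker_hat, wMul, hat_unhat]; simp

lemma hat_wOne : X.X ◁ wOne X Y ≫ (α_ X.X Y A.X).inv ≫ ε_ Y X.X ▷ A.X =
    (ρ_ X.X).hom ≫ cε X ≫ (λ_ A.X).inv := by
  have : wOne X Y = unhat Y ((ρ_ X.X).hom ≫ cε X) := by simp only [wOne, unhat]; monoidal
  rw [whisker_hat, this, hat_unhat]; simp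

lemma w_assoc : dtenr X Y (wMul X Y) ≫ rext A (wMul X Y) =
    (α_ Y Y Y).hom ≫ wten Y (wMul X Y) ≫ rext A (wMul X Y) := hat_injective (X := X.X) (by
  calc _ = X.X ◁ (wMul X Y) ▷ Y ⊗≫ X.X ◁ Y ◁ dualφ X Y ⊗≫
        (X.X ◁ wMul X Y ≫ (α_ X.X Y A.X).inv ≫ ε_ Y X.X ▷ A.X) ▷ A.X ⊗≫ μ[A.X] := by
        rw [hat_rext]; simp only [dtenr]; monoidal
    _ = 𝟙 _ ⊗≫ (X.X ◁ ((wMul X Y) ▷ Y ⊗≫ Y ◁ dualφ X Y ⊗≫ 𝟙 (Y ⊗ (Y ⊗ A.X))) ≫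
          cδ X ▷ (Y ⊗ (Y ⊗ A.X))) ⊗≫ A.X ◁ ev₂ X.X Y ▷ A.X ⊗≫ μ[A.X] := by
        rw [hat_wMul]; monoidal
    _ = 𝟙 _ ⊗≫ cδ X ▷ ((Y ⊗ Y) ⊗ Y) ⊗≫ A.X ◁ X.X ◁ X.X ◁ (wMul X Y) ▷ Y ⊗≫
          A.X ◁ X.X ◁ ((X.X ⊗ Y) ◁ dualφ X Y ≫ ε_ Y X.X ▷ (Y ⊗ A.X)) ⊗≫
          A.X ◁ ε_ Y X.X ▷ A.X ⊗≫ μ[A.X] := by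
        rw [whisker_exchange]; simp only [ev₂]; monoidal
    _ = 𝟙 _ ⊗≫ cδ X ▷ ((Y ⊗ Y) ⊗ Y) ⊗≫ A.X ◁ X.X ◁ (X.X ◁ wMul X Y ≫ (α_ X.X Y A.X).inv ≫
            ε_ Y X.X ▷ A.X) ▷ Y ⊗≫
          A.X ◁ (X.X ◁ dualφ X Y ≫ (α_ X.X Y A.X).inv ≫ ε_ Y X.X ▷ A.X) ⊗≫ μ[A.X] := by
        rw [whisker_exchange]; monoidal
    _ = 𝟙 _ ⊗≫ cδ X ▷ ((Y ⊗ Y) ⊗ Y) ⊗≫ A.X ◁ X.X ◁ cδ X ▷ (Y ⊗ Y) ▷ Y ⊗≫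
          A.X ◁ ((X.X ⊗ A.X) ◁ ev₂ X.X Y ≫ X.ψ ▷ 𝟙_ C) ▷ Y ⊗≫ (A.X ⊗ A.X) ◁ ε_ Y X.X ⊗≫ μ[A.X] := by
        rw [hat_wMul, hat_dualφ]; monoidal
    _ = 𝟙 _ ⊗≫ cδ X ▷ ((Y ⊗ Y) ⊗ Y) ⊗≫ A.X ◁ X.lten (cδ X) ▷ ((Y ⊗ Y) ⊗ Y) ⊗≫
          ((A.X ⊗ A.X) ◁ (X.X ◁ ev₂ X.X Y ▷ Y ⊗≫ ε_ Y X.X) ≫ μ[A.X] ▷ 𝟙_ C) ⊗≫ 𝟙 _ := by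
        rw [whisker_exchange]; simp only [RightTransfer.lten]; monoidal
    _ = 𝟙 _ ⊗≫ (cδ X ≫ lext A (X.lten (cδ X))) ▷ (Y ⊗ Y ⊗ Y) ⊗≫
          A.X ◁ (X.X ◁ ev₂ X.X Y ▷ Y ⊗≫ ε_ Y X.X) ⊗≫ 𝟙 _ := by
        rw [whisker_exchange]; simp only [lext]; monoidal
    _ = 𝟙 _ ⊗≫ cδ X ▷ (Y ⊗ Y ⊗ Y) ⊗≫ A.X ◁ cδ X ▷ (X.X ⊗ Y ⊗ Y ⊗ Y) ⊗≫ 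
          (μ[A.X] ▷ (X.X ⊗ (X.X ⊗ ((X.X ⊗ Y) ⊗ (Y ⊗ Y)))) ≫
          A.X ◁ (X.X ◁ X.X ◁ ε_ Y X.X ▷ (Y ⊗ Y) ⊗≫ ev₂ X.X Y)) ⊗≫ 𝟙 _ := by
        rw [cδ_assoc]; simp only [lext, rten, ev₂]; monoidal
    _ = 𝟙 _ ⊗≫ cδ X ▷ (Y ⊗ Y ⊗ Y) ⊗≫ A.X ◁ (cδ X ▷ ((X.X ⊗ Y) ⊗ Y ⊗ Y) ≫ 
          (A.X ⊗ X.X ⊗ X.X) ◁ ε_ Y X.X ▷ (Y ⊗ Y)) ⊗≫ A.X ◁ A.X ◁ ev₂ X.X Y ⊗≫ μ[A.X] := by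
        rw [← whisker_exchange]; monoidal
    _ = 𝟙 _ ⊗≫ cδ X ▷ (Y ⊗ Y ⊗ Y) ⊗≫ A.X ◁ X.X ◁ ε_ Y X.X ▷ (Y ⊗ Y) ⊗≫
          A.X ◁ (cδ X ▷ (Y ⊗ Y) ≫ (α_ A.X (X.X ⊗ X.X) (Y ⊗ Y)).hom ≫ A.X ◁ ev₂ X.X Y ≫
            (ρ_ A.X).hom ≫ (λ_ A.X).inv) ⊗≫ μ[A.X] := by
        rw [← whisker_exchange]; monoidal
    _ = 𝟙 _ ⊗≫ cδ X ▷ (Y ⊗ Y ⊗ Y) ⊗≫ A.X ◁ X.X ◁ (ε_ Y X.X ▷ (Y ⊗ Y) ≫ 𝟙_ C ◁ wMul X Y) ⊗≫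
          A.X ◁ ε_ Y X.X ▷ A.X ⊗≫ μ[A.X] := by
        rw [← hat_wMul]; monoidal
    _ = 𝟙 _ ⊗≫ (cδ X ▷ (Y ⊗ (Y ⊗ Y)) ≫ (A.X ⊗ X.X ⊗ X.X) ◁ (Y ◁ wMul X Y)) ⊗≫
          A.X ◁ ev₂ X.X Y ▷ A.X ⊗≫ μ[A.X] := by
        rw [← whisker_exchange]; simp only [ev₂]; monoidal
    _ = 𝟙 _ ⊗≫ X.X ◁ (Y ◁ wMul X Y) ⊗≫ (cδ X ▷ (Y ⊗ Y) ≫ (α_ A.X (X.X ⊗ X.X) (Y ⊗ Y)).hom ≫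
            A.X ◁ ev₂ X.X Y ≫ (ρ_ A.X).hom ≫ (λ_ A.X).inv) ▷ A.X ⊗≫ μ[A.X] := by
        rw [← whisker_exchange]; monoidal
    _ = _ := by
        rw [← hat_wMul, ← Category.assoc (α_ Y Y Y).hom, hat_rext]; simp only [wten]; monoidal)

lemma w_one_mul : dtenr X Y (wOne X Y) ≫ rext A (wMul X Y) =
    (λ_ Y).hom ≫ runit A Y := hat_injective (X := X.X) (by
  calc _ = X.X ◁ (wOne X Y) ▷ Y ⊗≫ X.X ◁ Y ◁ dualφ X Y ⊗≫
        (X.X ◁ wMul X Y ≫ (α_ X.X Y A.X).inv ≫ ε_ Y X.X ▷ A.X) ▷ A.X ⊗≫ μ[A.X] := by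
        rw [hat_rext]; simp only [dtenr]; monoidal
    _ = 𝟙 _ ⊗≫ (X.X ◁ ((wOne X Y) ▷ Y ⊗≫ Y ◁ dualφ X Y ⊗≫ 𝟙 (Y ⊗ (Y ⊗ A.X))) ≫
          cδ X ▷ (Y ⊗ (Y ⊗ A.X))) ⊗≫ A.X ◁ ev₂ X.X Y ▷ A.X ⊗≫ μ[A.X] := by
        rw [hat_wMul]; monoidal
    _ = 𝟙 _ ⊗≫ cδ X ▷ (𝟙_ C ⊗ Y) ⊗≫ A.X ◁ X.X ◁ X.X ◁ (wOne X Y) ▷ Y ⊗≫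
          A.X ◁ X.X ◁ ((X.X ⊗ Y) ◁ dualφ X Y ≫ ε_ Y X.X ▷ (Y ⊗ A.X)) ⊗≫
          A.X ◁ ε_ Y X.X ▷ A.X ⊗≫ μ[A.X] := by
        rw [whisker_exchange]; simp only [ev₂]; monoidal
    _ = 𝟙 _ ⊗≫ cδ X ▷ (𝟙_ C ⊗ Y) ⊗≫ A.X ◁ X.X ◁ (X.X ◁ wOne X Y ≫ (α_ X.X Y A.X).inv ≫
            ε_ Y X.X ▷ A.X) ▷ Y ⊗≫
          A.X ◁ (X.X ◁ dualφ X Y ≫ (α_ X.X Y A.X).inv ≫ ε_ Y X.X ▷ A.X) ⊗≫ μ[A.X] := by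
        rw [whisker_exchange]; monoidal
    _ = 𝟙 _ ⊗≫ cδ X ▷ Y ⊗≫ A.X ◁ X.lten (cε X ≫ (ρ_ A.X).inv) ▷ Y ⊗≫
          ((A.X ⊗ A.X) ◁ ε_ Y X.X ≫ μ[A.X] ▷ 𝟙_ C) ⊗≫ 𝟙 _ := by
        rw [hat_wOne, hat_dualφ]; simp only [RightTransfer.lten]; monoidal
    _ = 𝟙 _ ⊗≫ (cδ X ≫ lext A (X.lten (cε X ≫ (ρ_ A.X).inv))) ▷ Y ⊗≫ A.X ◁ ε_ Y X.X ⊗≫ 𝟙 _ := by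
        rw [whisker_exchange]; simp only [lext]; monoidal
    _ = 𝟙 _ ⊗≫ (η[A.X] ▷ (X.X ⊗ Y) ≫ A.X ◁ ε_ Y X.X) ⊗≫ 𝟙 _ := by
        rw [cδ_cε_right]; simp only [lunit]; monoidal
    _ = 𝟙 _ ⊗≫ (ε_ Y X.X ▷ 𝟙_ C ≫ 𝟙_ C ◁ η[A.X]) ⊗≫ 𝟙 _ := by
        rw [← whisker_exchange]; monoidal
    _ = _ := by
        rw [← whisker_exchange]; simp only [hat, runit]; monoidal)

lemma w_mul_one : wten Y (wOne X Y) ≫ rext A (wMul X Y) =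
    (ρ_ Y).hom ≫ runit A Y := hat_injective (X := X.X) (by
  calc _ = 𝟙 _ ⊗≫ X.X ◁ (Y ◁ wOne X Y) ⊗≫ (cδ X ▷ (Y ⊗ Y) ≫ (α_ A.X (X.X ⊗ X.X) (Y ⊗ Y)).hom ≫
            A.X ◁ ev₂ X.X Y ≫ (ρ_ A.X).hom ≫ (λ_ A.X).inv) ▷ A.X ⊗≫ μ[A.X] := by
        rw [← hat_wMul, hat_rext]; simp only [wten]; monoidal
    _ = 𝟙 _ ⊗≫ (X.X ◁ (Y ◁ wOne X Y) ≫ cδ X ▷ (Y ⊗ (Y ⊗ A.X))) ⊗≫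
          A.X ◁ ev₂ X.X Y ▷ A.X ⊗≫ μ[A.X] := by monoidal
    _ = 𝟙 _ ⊗≫ cδ X ▷ Y ⊗≫ A.X ◁ X.X ◁ ((X.X ⊗ Y) ◁ wOne X Y ≫ ε_ Y X.X ▷ (Y ⊗ A.X)) ⊗≫
          A.X ◁ ε_ Y X.X ▷ A.X ⊗≫ μ[A.X] := by
        rw [whisker_exchange]; simp only [ev₂]; monoidal
    _ = 𝟙 _ ⊗≫ cδ X ▷ Y ⊗≫ A.X ◁ X.X ◁ ε_ Y X.X ⊗≫
          A.X ◁ (X.X ◁ wOne X Y ≫ (α_ X.X Y A.X).inv ≫ ε_ Y X.X ▷ A.X) ⊗≫ μ[A.X] := by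
        rw [whisker_exchange]; monoidal
    _ = 𝟙 _ ⊗≫ cδ X ▷ Y ⊗≫ A.X ◁ (X.X ◁ ε_ Y X.X ≫ cε X ▷ 𝟙_ C) ⊗≫ μ[A.X] := by
        rw [hat_wOne]; monoidal
    _ = 𝟙 _ ⊗≫ cδ X ▷ Y ⊗≫ A.X ◁ cε X ▷ (X.X ⊗ Y) ⊗≫ ((A.X ⊗ A.X) ◁ ε_ Y X.X ≫
          μ[A.X] ▷ 𝟙_ C) ⊗≫ 𝟙 _ := by
        rw [whisker_exchange]; monoidal
    _ = 𝟙 _ ⊗≫ (cδ X ≫ lext A (rten (cε X ≫ (ρ_ A.X).inv) X.X)) ▷ Y ⊗≫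
          A.X ◁ ε_ Y X.X ⊗≫ 𝟙 _ := by
        rw [whisker_exchange]; simp only [lext, rten]; monoidal
    _ = 𝟙 _ ⊗≫ (η[A.X] ▷ (X.X ⊗ Y) ≫ A.X ◁ ε_ Y X.X) ⊗≫ 𝟙 _ := by
        rw [cδ_cε_left]; simp only [lunit]; monoidal
    _ = 𝟙 _ ⊗≫ (ε_ Y X.X ▷ 𝟙_ C ≫ 𝟙_ C ◁ η[A.X]) ⊗≫ 𝟙 _ := by
        rw [← whisker_exchange]; monoidal
    _ = _ := by
        rw [← whisker_exchange]; simp only [hat, runit]; monoidal)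

lemma w_mul_comm : dualφ₂ X Y ≫
      rext A (wMul X Y) = wten A.X (wMul X Y) ≫ rext A (dualφ X Y) := hat_injective (X := X.X) (by
  calc _ = 𝟙 _ ⊗≫ X.X ◁ (dualφ X Y ▷ Y ⊗≫ Y ◁ dualφ X Y) ⊗≫
        (X.X ◁ wMul X Y ≫ (α_ X.X Y A.X).inv ≫ ε_ Y X.X ▷ A.X) ▷ A.X ⊗≫ μ[A.X] := by
        rw [hat_rext]; simp only [dualφ₂]; monoidal
    _ = 𝟙 _ ⊗≫ (X.X ◁ (dualφ X Y ▷ Y ⊗≫ Y ◁ dualφ X Y ⊗≫ 𝟙 (Y ⊗ (Y ⊗ A.X))) ≫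
          cδ X ▷ (Y ⊗ (Y ⊗ A.X))) ⊗≫ A.X ◁ ev₂ X.X Y ▷ A.X ⊗≫ μ[A.X] := by
        rw [hat_wMul]; monoidal
    _ = 𝟙 _ ⊗≫ cδ X ▷ ((A.X ⊗ Y) ⊗ Y) ⊗≫ A.X ◁ X.X ◁ X.X ◁ (dualφ X Y) ▷ Y ⊗≫
          A.X ◁ X.X ◁ ((X.X ⊗ Y) ◁ dualφ X Y ≫ ε_ Y X.X ▷ (Y ⊗ A.X)) ⊗≫
          A.X ◁ ε_ Y X.X ▷ A.X ⊗≫ μ[A.X] := by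
        rw [whisker_exchange]; simp only [ev₂]; monoidal
    _ = 𝟙 _ ⊗≫ cδ X ▷ ((A.X ⊗ Y) ⊗ Y) ⊗≫ A.X ◁ X.X ◁ (X.X ◁ dualφ X Y ≫ (α_ X.X Y A.X).inv ≫
            ε_ Y X.X ▷ A.X) ▷ Y ⊗≫
          A.X ◁ (X.X ◁ dualφ X Y ≫ (α_ X.X Y A.X).inv ≫ ε_ Y X.X ▷ A.X) ⊗≫ μ[A.X] := by
        rw [whisker_exchange]; monoidal
    _ = 𝟙 _ ⊗≫ cδ X ▷ ((A.X ⊗ Y) ⊗ Y) ⊗≫ A.X ◁ X.X ◁ X.ψ ▷ Y ▷ Y ⊗≫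
          A.X ◁ ((X.X ⊗ A.X) ◁ ε_ Y X.X ≫ X.ψ ▷ 𝟙_ C) ▷ Y ⊗≫ (A.X ⊗ A.X) ◁ ε_ Y X.X ⊗≫ μ[A.X] := by
        rw [hat_dualφ]; monoidal
    _ = 𝟙 _ ⊗≫ cδ X ▷ ((A.X ⊗ Y) ⊗ Y) ⊗≫ A.X ◁ ψ₂ X ▷ (Y ⊗ Y) ⊗≫
          ((A.X ⊗ A.X) ◁ ev₂ X.X Y ≫ μ[A.X] ▷ 𝟙_ C) ⊗≫ 𝟙 _ := by
        rw [whisker_exchange]; simp only [ψ₂, ev₂]; monoidal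
    _ = 𝟙 _ ⊗≫ (rten (cδ X) A.X ≫ lext A (ψ₂ X)) ▷ (Y ⊗ Y) ⊗≫
          A.X ◁ ev₂ X.X Y ⊗≫ 𝟙 _ := by
        rw [whisker_exchange]; simp only [lext, rten, ψ₂]; monoidal
    _ = 𝟙 _ ⊗≫ X.ψ ▷ (Y ⊗ Y) ⊗≫ A.X ◁ cδ X ▷ (Y ⊗ Y) ⊗≫ (μ[A.X] ▷ ((X.X ⊗ X.X) ⊗ (Y ⊗ Y)) ≫
          A.X ◁ ev₂ X.X Y) ⊗≫ 𝟙 _ := by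
        rw [← ψ_cδ]; simp only [lext]; monoidal
    _ = 𝟙 _ ⊗≫ X.ψ ▷ (Y ⊗ Y) ⊗≫ A.X ◁ (cδ X ▷ (Y ⊗ Y) ≫ (α_ A.X (X.X ⊗ X.X) (Y ⊗ Y)).hom ≫
            A.X ◁ ev₂ X.X Y ≫ (ρ_ A.X).hom ≫ (λ_ A.X).inv) ⊗≫ μ[A.X] := by
        rw [← whisker_exchange]; monoidal
    _ = 𝟙 _ ⊗≫ (X.ψ ▷ (Y ⊗ Y) ≫ (A.X ⊗ X.X) ◁ wMul X Y) ⊗≫ A.X ◁ ε_ Y X.X ▷ A.X ⊗≫ μ[A.X] := by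
        rw [← hat_wMul]; monoidal
    _ = 𝟙 _ ⊗≫ X.X ◁ (A.X ◁ wMul X Y) ⊗≫ ((α_ X.X A.X Y).inv ≫ X.ψ ▷ Y ≫ (α_ A.X X.X Y).hom ≫
          A.X ◁ ε_ Y X.X ≫ (ρ_ A.X).hom ≫ (λ_ A.X).inv) ▷ A.X ⊗≫ μ[A.X] := by
        rw [← whisker_exchange]; monoidal
    _ = _ := by
        rw [hat_rext, ← hat_dualφ]; simp only [wten]; monoidal)

lemma w_one_comm : ((ρ_ A.X).hom ≫ (λ_ A.X).inv) ≫
      rext A (wOne X Y) = wten A.X (wOne X Y) ≫ rext A (dualφ X Y) := hat_injective (X := X.X) (by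
  calc _ = 𝟙 _ ⊗≫ (X.X ◁ wOne X Y ≫ (α_ X.X Y A.X).inv ≫ ε_ Y X.X ▷ A.X) ▷ A.X ⊗≫ μ[A.X] := by
        rw [hat_rext]; monoidal
    _ = 𝟙 _ ⊗≫ (cε X ▷ A.X ≫ μ[A.X]) := by
        rw [hat_wOne]; monoidal
    _ = 𝟙 _ ⊗≫ X.ψ ⊗≫ A.X ◁ ((ρ_ X.X).hom ≫ cε X ≫ (λ_ A.X).inv) ⊗≫ μ[A.X] := by
        rw [← ψ_cε]; monoidal
    _ = 𝟙 _ ⊗≫ (X.ψ ▷ 𝟙_ C ≫ (A.X ⊗ X.X) ◁ wOne X Y) ⊗≫ A.X ◁ ε_ Y X.X ▷ A.X ⊗≫ μ[A.X] := by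
        rw [← hat_wOne X Y]; monoidal
    _ = 𝟙 _ ⊗≫ X.X ◁ (A.X ◁ wOne X Y) ⊗≫ ((α_ X.X A.X Y).inv ≫ X.ψ ▷ Y ≫ (α_ A.X X.X Y).hom ≫
          A.X ◁ ε_ Y X.X ≫ (ρ_ A.X).hom ≫ (λ_ A.X).inv) ▷ A.X ⊗≫ μ[A.X] := by
        rw [← whisker_exchange]; monoidal
    _ = _ := by
        rw [hat_rext, ← hat_dualφ]; simp only [wten]; monoidal)

/-- The algebra `(Y, φ)` in the category of left transfer morphisms, dual to the coalgebra `(X, ψ)`. -/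
@[reducible]
def dualTransferMonObj : MonObj (dualTransfer X Y) where
  mul := LeftTransfer.Hom.mk' (wMul X Y) (w_mul_comm X Y)
  one := LeftTransfer.Hom.mk' (wOne X Y) (w_one_comm X Y)
  one_mul := LeftTransfer.hom_ext _ _ (w_one_mul X Y)
  mul_one := LeftTransfer.hom_ext _ _ (w_mul_one X Y)
  mul_assoc := LeftTransfer.hom_ext _ _ (by
    change dtenr X Y (wMul X Y) ≫ rext A (wMul X Y) =
      ((α_ Y Y Y).hom ≫ runit A _) ≫ rext A (wten Y (wMul X Y) ≫ rext A (wMul X Y))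
    rw [Category.assoc, runit_rext, w_assoc])


end Cowreath

namespace Cowreath
variable {C : Type u} [Category.{v} C] [MonoidalCategory C] {A : Mon C}

namespace Wreath
variable (S : LeftTransfer A)

/-- The left action of `A` on `Y A` -/
def ν : A.X ⊗ (S.X ⊗ A.X) ⟶ S.X ⊗ A.X := (α_ A.X S.X A.X).inv ≫ rext A S.φ

lemma one_ν : η[A.X] ▷ (S.X ⊗ A.X) ≫ ν S = (λ_ _).hom := by
  calc _ = 𝟙 _ ⊗≫ ((λ_ S.X).inv ≫ η[A.X] ▷ S.X ≫ S.φ) ▷ A.X ⊗≫ S.X ◁ μ[A.X] := by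
        simp only [ν, rext]; monoidal
    _ = 𝟙 _ ⊗≫ rext A (runit A S.X) := by rw [S.one_φ]; simp only [rext, runit]; monoidal
    _ = _ := by rw [rext_runit]; monoidal

lemma mul_ν : μ[A.X] ▷ (S.X ⊗ A.X) ≫ ν S = (α_ A.X A.X _).hom ≫ A.X ◁ ν S ≫ ν S := by
  calc _ = 𝟙 _ ⊗≫ (μ[A.X] ▷ S.X ≫ S.φ) ▷ A.X ⊗≫ S.X ◁ μ[A.X] := by
        simp only [ν, rext]; monoidal
    _ = 𝟙 _ ⊗≫ A.X ◁ S.φ ▷ A.X ⊗≫ S.φ ▷ A.X ▷ A.X ⊗≫ S.X ◁ (μ[A.X] ▷ A.X ≫ μ[A.X]) := by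
        rw [S.mul_φ]; monoidal
    _ = 𝟙 _ ⊗≫ A.X ◁ S.φ ▷ A.X ⊗≫ (S.φ ▷ (A.X ⊗ A.X) ≫ (S.X ⊗ A.X) ◁ μ[A.X]) ⊗≫
          S.X ◁ μ[A.X] := by
        rw [MonObj.mul_assoc]; monoidal
    _ = _ := by rw [← whisker_exchange]; simp only [ν, rext]; monoidal

/-- The right action of `A` on `Y A` -/
def rAct : (S.X ⊗ A.X) ⊗ A.X ⟶ S.X ⊗ A.X := (α_ _ _ _).hom ≫ S.X ◁ μ[A.X]

/-- The bimodule `Y A` -/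
abbrev bimod : Bimod A A where
  X := S.X ⊗ A.X
  actLeft := (α_ A.X S.X A.X).inv ≫ S.φ ▷ A.X ≫ (α_ S.X A.X A.X).hom ≫ S.X ◁ μ[A.X]
  actRight := (α_ _ _ _).hom ≫ S.X ◁ μ[A.X]
  one_actLeft := one_ν S
  left_assoc := mul_ν S
  actRight_one := by
    simp [← MonoidalCategory.whiskerLeft_comp]
  right_assoc := by
    calc _ = 𝟙 _ ⊗≫ S.X ◁ ((α_ _ _ _).hom ≫ A.X ◁ μ[A.X] ≫ μ[A.X]) := by monoidal
      _ = _ := by rw [← MonObj.mul_assoc]; monoidal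
  middle_assoc := by
    calc _ = 𝟙 _ ⊗≫ S.φ ▷ A.X ▷ A.X ⊗≫ S.X ◁ (μ[A.X] ▷ A.X ≫ μ[A.X]) := by monoidal
      _ = 𝟙 _ ⊗≫ (S.φ ▷ (A.X ⊗ A.X) ≫ (S.X ⊗ A.X) ◁ μ[A.X]) ⊗≫ S.X ◁ μ[A.X] := by
          rw [MonObj.mul_assoc]; monoidal
      _ = _ := by rw [← whisker_exchange]; monoidal

variable [MonObj S]

/-- The multiplication `Y Y ⟶ Y A` of a right wreath -/
def m : S.X ⊗ S.X ⟶ S.X ⊗ A.X := (μ[S]).hom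

/-- The unit `1 ⟶ Y A` of a right wreath -/
def e : 𝟙_ C ⟶ S.X ⊗ A.X := (η[S]).hom

/-- The transfer morphism of `Y Y` -/
def φ₂ : A.X ⊗ (S.X ⊗ S.X) ⟶ (S.X ⊗ S.X) ⊗ A.X :=
  (α_ A.X S.X S.X).inv ≫ S.φ ▷ S.X ≫ (α_ S.X A.X S.X).hom ≫ S.X ◁ S.φ ≫ (α_ S.X S.X A.X).inv

lemma m_comm : φ₂ S ≫ rext A (m S) = wten A.X (m S) ≫ rext A S.φ := LeftTransfer.Hom.comm' μ[S]

lemma e_comm : ((ρ_ A.X).hom ≫ (λ_ A.X).inv) ≫ rext A (e S) = wten A.X (e S) ≫ rext A S.φ :=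
  LeftTransfer.Hom.comm' η[S]

lemma m_assoc : S.tenr (m S) ≫ rext A (m S) =
    (α_ S.X S.X S.X).hom ≫ wten S.X (m S) ≫ rext A (m S) := by
  have h : S.tenr (m S) ≫ rext A (m S) =
    ((α_ S.X S.X S.X).hom ≫ runit A _) ≫ rext A (wten S.X (m S) ≫ rext A (m S)) :=
    congrArg LeftTransfer.Hom.hom (MonObj.mul_assoc S)
  rw [h, Category.assoc, runit_rext]

lemma m_one : wten S.X (e S) ≫ rext A (m S) = (ρ_ S.X).hom ≫ runit A S.X :=
  congrArg LeftTransfer.Hom.hom (MonObj.mul_one S)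

lemma one_m : S.tenr (e S) ≫ rext A (m S) = (λ_ S.X).hom ≫ runit A S.X :=
  congrArg LeftTransfer.Hom.hom (MonObj.one_mul S)

/-- The multiplication `Y A Y A ⟶ Y A` of the wreath product -/
def mul : (S.X ⊗ A.X) ⊗ (S.X ⊗ A.X) ⟶ S.X ⊗ A.X :=
  (α_ S.X A.X (S.X ⊗ A.X)).hom ≫ S.X ◁ (α_ A.X S.X A.X).inv ≫ S.X ◁ S.φ ▷ A.X ≫
    S.X ◁ (α_ S.X A.X A.X).hom ≫ (α_ S.X S.X (A.X ⊗ A.X)).inv ≫ (m S ⊗ₘ μ[A.X]) ≫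
    (α_ S.X A.X A.X).hom ≫ S.X ◁ μ[A.X]

lemma mul_eq : mul S = 𝟙 _ ⊗≫ S.X ◁ S.φ ▷ A.X ⊗≫ rext A (m S) ▷ A.X ⊗≫ S.X ◁ μ[A.X] := by
  calc _ = 𝟙 _ ⊗≫ S.X ◁ S.φ ▷ A.X ⊗≫ m S ▷ A.X ▷ A.X ⊗≫
        S.X ◁ ((α_ _ _ _).hom ≫ A.X ◁ μ[A.X] ≫ μ[A.X]) := by
        rw [mul, MonoidalCategory.tensorHom_def]; monoidal
    _ = _ := by rw [← MonObj.mul_assoc]; simp only [rext]; monoidal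

lemma mul_eq' : mul S = 𝟙 _ ⊗≫ S.X ◁ S.φ ▷ A.X ⊗≫ (S.X ⊗ S.X) ◁ μ[A.X] ⊗≫ rext A (m S) := by
  rw [mul, MonoidalCategory.tensorHom_def', rext]; monoidal

/-- The algebra map `A ⟶ Y A` -/
def i : A.X ⟶ S.X ⊗ A.X := (λ_ A.X).inv ≫ e S ▷ A.X ≫ (α_ S.X A.X A.X).hom ≫ S.X ◁ μ[A.X]

lemma e_mul : e S ▷ (S.X ⊗ A.X) ≫ mul S = (λ_ _).hom := by
  calc _ = 𝟙 _ ⊗≫ (S.tenr (e S) ≫ rext A (m S)) ▷ A.X ⊗≫ S.X ◁ μ[A.X] := by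
        rw [mul_eq]; simp only [LeftTransfer.tenr]; monoidal
    _ = 𝟙 _ ⊗≫ rext A (runit A S.X) := by rw [one_m]; simp only [rext]; monoidal
    _ = _ := by rw [rext_runit]; monoidal

lemma mul_e : (S.X ⊗ A.X) ◁ e S ≫ mul S = (ρ_ _).hom := by
  calc _ = 𝟙 _ ⊗≫ S.X ◁ (A.X ◁ e S ⊗≫ S.φ ▷ A.X ⊗≫ S.X ◁ μ[A.X]) ⊗≫ rext A (m S) := by
        rw [mul_eq']; monoidal
    _ = 𝟙 _ ⊗≫ S.X ◁ (wten A.X (e S) ≫ rext A S.φ) ⊗≫ rext A (m S) := by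
        simp only [wten, rext]; monoidal
    _ = 𝟙 _ ⊗≫ S.X ◁ (e S ▷ A.X) ⊗≫ ((S.X ⊗ S.X) ◁ μ[A.X] ≫ m S ▷ A.X) ⊗≫ S.X ◁ μ[A.X] := by
        rw [← e_comm]; simp only [rext]; monoidal
    _ = 𝟙 _ ⊗≫ S.X ◁ (e S ▷ A.X) ⊗≫ m S ▷ A.X ▷ A.X ⊗≫
          S.X ◁ ((α_ _ _ _).hom ≫ A.X ◁ μ[A.X] ≫ μ[A.X]) := by
        rw [whisker_exchange]; monoidal
    _ = 𝟙 _ ⊗≫ (wten S.X (e S) ≫ rext A (m S)) ▷ A.X ⊗≫ S.X ◁ μ[A.X] := by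
        rw [← MonObj.mul_assoc]; simp only [wten, rext]; monoidal
    _ = 𝟙 _ ⊗≫ rext A (runit A S.X) := by rw [m_one]; simp only [rext]; monoidal
    _ = _ := by rw [rext_runit]; monoidal

/-- auxiliary -/
def g : (S.X ⊗ A.X) ⊗ S.X ⟶ S.X ⊗ A.X :=
  (α_ _ _ _).hom ≫ S.X ◁ S.φ ≫ (α_ _ _ _).inv ≫ rext A (m S)

lemma mul_g : mul S = (α_ _ _ _).inv ≫ rext A (g S) := by
  rw [mul_eq]; simp only [g, rext]; monoidal

lemma mul_rlin : mul S ▷ A.X ≫ (α_ _ _ _).hom ≫ S.X ◁ μ[A.X] =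
    (α_ _ _ _).hom ≫ (S.X ⊗ A.X) ◁ ((α_ _ _ _).hom ≫ S.X ◁ μ[A.X]) ≫ mul S := by
  rw [mul_g, comp_whiskerRight, Category.assoc, ← mul_rext]
  monoidal

lemma rext_rext {X Y Z : C} (f : X ⟶ Y ⊗ A.X) (h : Y ⟶ Z ⊗ A.X) :
    rext A f ▷ A.X ≫ (α_ _ _ _).hom ≫ Y ◁ μ[A.X] ≫ rext A h =
      (α_ _ _ _).hom ≫ X ◁ μ[A.X] ≫ rext A (f ≫ rext A h) := by
  rw [rext_comp]
  calc _ = (rext A f ▷ A.X ≫ (α_ _ _ _).hom ≫ Y ◁ μ[A.X]) ≫ rext A h := by monoidal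
    _ = _ := by rw [← mul_rext]; monoidal

lemma sub : mul S ▷ S.X ≫ g S = (α_ _ _ _).hom ≫ (S.X ⊗ A.X) ◁ g S ≫ mul S := by
  calc _ = 𝟙 _ ⊗≫ S.X ◁ S.φ ▷ (A.X ⊗ S.X) ⊗≫ S.X ◁ S.X ◁ μ[A.X] ▷ S.X ⊗≫ m S ▷ A.X ▷ S.X ⊗≫
          S.X ◁ (μ[A.X] ▷ S.X ≫ S.φ) ⊗≫ rext A (m S) := by
        rw [mul_eq', g, rext]; monoidal
    _ = 𝟙 _ ⊗≫ S.X ◁ S.φ ▷ (A.X ⊗ S.X) ⊗≫ S.X ◁ S.X ◁ μ[A.X] ▷ S.X ⊗≫ (m S ▷ (A.X ⊗ S.X) ≫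
          (S.X ⊗ A.X) ◁ S.φ) ⊗≫ S.X ◁ S.φ ▷ A.X ⊗≫ S.X ◁ S.X ◁ μ[A.X] ⊗≫ rext A (m S) := by
        rw [S.mul_φ]; monoidal
    _ = 𝟙 _ ⊗≫ S.X ◁ S.φ ▷ (A.X ⊗ S.X) ⊗≫ S.X ◁ S.X ◁ (μ[A.X] ▷ S.X ≫ S.φ) ⊗≫ 
          S.tenr (m S) ▷ A.X ⊗≫ ((S.X ⊗ S.X) ◁ μ[A.X] ≫ rext A (m S)) := by
        rw [← whisker_exchange]; simp only [LeftTransfer.tenr]; monoidal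
    _ = 𝟙 _ ⊗≫ (S.X ◁ S.φ ▷ (A.X ⊗ S.X) ⊗≫ ((S.X ⊗ S.X) ⊗ A.X) ◁ S.φ) ⊗≫
          S.X ◁ S.X ◁ S.φ ▷ A.X ⊗≫ S.X ◁ S.X ◁ S.X ◁ μ[A.X] ⊗≫
          S.tenr (m S) ▷ A.X ⊗≫ ((α_ _ _ _).hom ≫ (S.X ⊗ S.X) ◁ μ[A.X] ≫ rext A (m S)) := by
        rw [S.mul_φ]; monoidal
    _ = 𝟙 _ ⊗≫ S.X ◁ (S.φ ▷ (A.X ⊗ S.X) ≫ (S.X ⊗ A.X) ◁ S.φ) ⊗≫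
          S.X ◁ S.X ◁ S.φ ▷ A.X ⊗≫ S.X ◁ S.X ◁ S.X ◁ μ[A.X] ⊗≫
          rext A (S.tenr (m S) ≫ rext A (m S)) := by
        rw [mul_rext]; simp only [rext]; monoidal
    _ = 𝟙 _ ⊗≫ S.X ◁ A.X ◁ S.X ◁ S.φ ⊗≫ S.X ◁ φ₂ S ▷ A.X ⊗≫ 
          ((S.X ⊗ (S.X ⊗ S.X)) ◁ μ[A.X] ≫ rext A (wten S.X (m S) ≫ rext A (m S))) := by
        rw [m_assoc, ← whisker_exchange, rext_precomp]; simp only [φ₂]; monoidal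
    _ = 𝟙 _ ⊗≫ S.X ◁ A.X ◁ S.X ◁ S.φ ⊗≫ S.X ◁ (φ₂ S ≫ rext A (m S)) ▷ A.X ⊗≫ 
          (S.X ⊗ S.X) ◁ μ[A.X] ≫ rext A (m S) := by
        calc _ = 𝟙 _ ⊗≫ S.X ◁ A.X ◁ S.X ◁ S.φ ⊗≫ S.X ◁ φ₂ S ▷ A.X ⊗≫ 
              ((α_ _ _ _).hom ≫ (S.X ⊗ (S.X ⊗ S.X)) ◁ μ[A.X] ≫
                rext A (wten S.X (m S) ≫ rext A (m S))) := by
              monoidal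
          _ = _ := by rw [← rext_rext]; simp only [rext, wten]; monoidal
    _ = 𝟙 _ ⊗≫ S.X ◁ A.X ◁ S.X ◁ S.φ ⊗≫ S.X ◁ A.X ◁ m S ▷ A.X ⊗≫
          S.X ◁ (S.φ ▷ (A.X ⊗ A.X)) ⊗≫ S.X ◁ S.X ◁ (μ[A.X] ▷ A.X ≫ μ[A.X]) ⊗≫ rext A (m S) := by
        rw [m_comm]; simp only [wten, rext]; monoidal
    _ = 𝟙 _ ⊗≫ S.X ◁ A.X ◁ S.X ◁ S.φ ⊗≫ S.X ◁ A.X ◁ m S ▷ A.X ⊗≫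
          S.X ◁ (S.φ ▷ (A.X ⊗ A.X) ≫ (S.X ⊗ A.X) ◁ μ[A.X]) ⊗≫ S.X ◁ S.X ◁ μ[A.X] ⊗≫
          rext A (m S) := by
        rw [MonObj.mul_assoc]; monoidal
    _ = _ := by
        rw [← whisker_exchange, mul_eq', g]; simp only [rext]; monoidal

lemma mul_assoc : mul S ▷ (S.X ⊗ A.X) ≫ mul S = (α_ _ _ _).hom ≫ (S.X ⊗ A.X) ◁ mul S ≫ mul S := by
  calc _ = 𝟙 _ ⊗≫ (mul S ▷ S.X ≫ g S) ▷ A.X ⊗≫ S.X ◁ μ[A.X] := by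
        calc _ = mul S ▷ (S.X ⊗ A.X) ≫ ((α_ _ _ _).inv ≫ rext A (g S)) := by rw [← mul_g]
          _ = _ := by simp only [rext]; monoidal
    _ = 𝟙 _ ⊗≫ (S.X ⊗ A.X) ◁ g S ▷ A.X ⊗≫ (mul S ▷ A.X ≫ (α_ _ _ _).hom ≫ S.X ◁ μ[A.X]) := by
        rw [sub]; monoidal
    _ = 𝟙 _ ⊗≫ (S.X ⊗ A.X) ◁ g S ▷ A.X ⊗≫ (S.X ⊗ A.X) ◁ S.X ◁ μ[A.X] ≫ mul S := by
        rw [mul_rlin]; monoidal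
    _ = 𝟙 _ ⊗≫ (S.X ⊗ A.X) ◁ ((α_ _ _ _).inv ≫ rext A (g S)) ≫ mul S := by
        simp only [rext]; monoidal
    _ = _ := by rw [← mul_g]; monoidal

/-- The wreath product algebra `Y # A`. -/
@[reducible]
def monObj : MonObj (S.X ⊗ A.X) where
  mul := mul S
  one := e S
  one_mul := e_mul S
  mul_one := mul_e S
  mul_assoc := mul_assoc S

/-- The wreath product algebra `Y # A`. -/
@[reducible]
def mon : Mon C := { X := S.X ⊗ A.X, mon := monObj S }

lemma mul_i : (S.X ⊗ A.X) ◁ i S ≫ mul S = rAct S := by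
  calc _ = 𝟙 _ ⊗≫ (S.X ⊗ A.X) ◁ e S ▷ A.X ⊗≫ ((α_ _ _ _).hom ≫ (S.X ⊗ A.X) ◁
          ((α_ _ _ _).hom ≫ S.X ◁ μ[A.X]) ≫ mul S) := by
        simp only [i]; monoidal
    _ = 𝟙 _ ⊗≫ ((S.X ⊗ A.X) ◁ e S ≫ mul S) ▷ A.X ⊗≫ S.X ◁ μ[A.X] := by
        rw [← mul_rlin]; monoidal
    _ = _ := by rw [mul_e, rAct]; monoidal

lemma i_mul : i S ▷ (S.X ⊗ A.X) ≫ mul S = ν S := by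
  calc _ = 𝟙 _ ⊗≫ e S ▷ A.X ▷ S.X ▷ A.X ⊗≫ S.X ◁ (μ[A.X] ▷ S.X ≫ S.φ) ▷ A.X ⊗≫
          rext A (m S) ▷ A.X ⊗≫ S.X ◁ μ[A.X] := by
        rw [mul_eq, i]; monoidal
    _ = 𝟙 _ ⊗≫ (e S ▷ (A.X ⊗ S.X) ≫ (S.X ⊗ A.X) ◁ S.φ) ▷ A.X ⊗≫ S.X ◁ S.φ ▷ A.X ▷ A.X ⊗≫ 
          ((α_ _ _ _).hom ≫ (S.X ⊗ S.X) ◁ μ[A.X] ≫ rext A (m S)) ▷ A.X ⊗≫ S.X ◁ μ[A.X] := by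
        rw [S.mul_φ]; monoidal
    _ = 𝟙 _ ⊗≫ S.φ ▷ A.X ⊗≫ ((S.tenr (e S) ≫ rext A (m S)) ▷ A.X ⊗≫ S.X ◁ μ[A.X]) ▷ A.X ⊗≫
          S.X ◁ μ[A.X] := by
        rw [← whisker_exchange, mul_rext]; simp only [LeftTransfer.tenr]; monoidal
    _ = 𝟙 _ ⊗≫ S.φ ▷ A.X ⊗≫ (rext A (runit A S.X)) ▷ A.X ⊗≫ S.X ◁ μ[A.X] := by
        rw [one_m]; simp only [rext]; monoidal
    _ = _ := by rw [rext_runit]; simp only [ν, rext]; monoidal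

lemma one_i : η[A.X] ≫ i S = e S := by
  calc _ = 𝟙 _ ⊗≫ (𝟙_ C ◁ η[A.X] ≫ e S ▷ A.X) ⊗≫ S.X ◁ μ[A.X] := by simp only [i]; monoidal
    _ = 𝟙 _ ⊗≫ e S ⊗≫ S.X ◁ (A.X ◁ η[A.X] ≫ μ[A.X]) := by rw [whisker_exchange]; monoidal
    _ = _ := by rw [MonObj.mul_one]; monoidal

lemma i_i : (i S ⊗ₘ i S) ≫ mul S = μ[A.X] ≫ i S := by
  calc _ = i S ▷ A.X ≫ ((S.X ⊗ A.X) ◁ i S ≫ mul S) := by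
        rw [MonoidalCategory.tensorHom_def, Category.assoc]
    _ = 𝟙 _ ⊗≫ (rext A (e S) ▷ A.X ≫ (α_ _ _ _).hom ≫ S.X ◁ μ[A.X]) := by
        rw [mul_i]; simp only [rAct, i, rext]; monoidal
    _ = 𝟙 _ ⊗≫ 𝟙_ C ◁ μ[A.X] ≫ rext A (e S) := by rw [← mul_rext]; monoidal
    _ = _ := by simp only [i, rext]; monoidal

end Wreath
end Cowreath

namespace Cowreath
variable {C : Type u} [Category.{v} C] [MonoidalCategory C]

namespace Extension
variable {A S : Mon C} (i : A ⟶ S)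

lemma one_i : η[A.X] ≫ i.hom = η[S.X] := IsMonHom.one_hom i.hom
lemma mul_i : μ[A.X] ≫ i.hom = i.hom ▷ A.X ≫ S.X ◁ i.hom ≫ μ[S.X] := by
  rw [IsMonHom.mul_hom i.hom, MonoidalCategory.tensorHom_def, Category.assoc]

/-- `S` as an `A`-bimodule by restriction of scalars along `i : A ⟶ S` -/
abbrev bimod : Bimod A A where
  X := S.X
  actLeft := i.hom ▷ S.X ≫ μ[S.X]
  actRight := S.X ◁ i.hom ≫ μ[S.X]
  one_actLeft := by
    rw [← comp_whiskerRight_assoc, one_i, MonObj.one_mul]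
  left_assoc := by
    calc _ = 𝟙 _ ⊗≫ i.hom ▷ A.X ▷ S.X ≫ (S.X ◁ i.hom) ▷ S.X ≫ (μ[S.X] ▷ S.X ≫ μ[S.X]) := by
          rw [← comp_whiskerRight_assoc, mul_i]; monoidal
      _ = 𝟙 _ ⊗≫ (i.hom ▷ (A.X ⊗ S.X) ≫ S.X ◁ (i.hom ▷ S.X ≫ μ[S.X])) ≫ μ[S.X] := by
          rw [MonObj.mul_assoc]; monoidal
      _ = _ := by rw [← whisker_exchange]; monoidal
  actRight_one := by
    rw [← whiskerLeft_comp_assoc, one_i, MonObj.mul_one]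
  right_assoc := by
    calc _ = 𝟙 _ ⊗≫ S.X ◁ i.hom ▷ A.X ⊗≫ S.X ◁ S.X ◁ i.hom ⊗≫
          ((α_ _ _ _).hom ≫ S.X ◁ μ[S.X] ≫ μ[S.X]) := by
          rw [← whiskerLeft_comp_assoc, mul_i]; monoidal
      _ = 𝟙 _ ⊗≫ S.X ◁ i.hom ▷ A.X ⊗≫ ((S.X ⊗ S.X) ◁ i.hom ≫ μ[S.X] ▷ S.X) ≫ μ[S.X] := by
          rw [← MonObj.mul_assoc]; monoidal
      _ = _ := by rw [whisker_exchange]; monoidal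
  middle_assoc := by
    calc _ = i.hom ▷ S.X ▷ A.X ≫ (μ[S.X] ▷ A.X ≫ S.X ◁ i.hom) ≫ μ[S.X] := by monoidal
      _ = 𝟙 _ ⊗≫ (i.hom ▷ (S.X ⊗ A.X) ≫ S.X ◁ S.X ◁ i.hom) ⊗≫ (μ[S.X] ▷ S.X ≫ μ[S.X]) := by
          rw [← whisker_exchange]; monoidal
      _ = 𝟙 _ ⊗≫ A.X ◁ (S.X ◁ i.hom) ⊗≫ (i.hom ▷ (S.X ⊗ S.X) ≫ S.X ◁ μ[S.X]) ⊗≫ μ[S.X] := by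
          rw [MonObj.mul_assoc, ← whisker_exchange]; monoidal
      _ = _ := by rw [← whisker_exchange]; monoidal

variable [HasCoequalizers C] [∀ X : C, LeftCoflat X] [∀ Y : LeftModule A, IsRobust Y]

open BimodTensor

/-- The multiplication `S ⊗_A S ⟶ S` induced by the multiplication of `S`. -/
noncomputable def mul₀ : (tensor (bimod i) (bimod i)).X ⟶ S.X :=
  desc (P := bimod i) (Q := bimod i) (μ[S.X] : S.X ⊗ S.X ⟶ S.X) (by
    change (S.X ◁ i.hom ≫ μ[S.X]) ▷ S.X ≫ μ[S.X] =
      ((α_ S.X A.X S.X).hom ≫ S.X ◁ (i.hom ▷ S.X ≫ μ[S.X])) ≫ μ[S.X]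
    calc _ = (S.X ◁ i.hom) ▷ S.X ≫ (μ[S.X] ▷ S.X ≫ μ[S.X]) := by monoidal
      _ = _ := by rw [MonObj.mul_assoc]; monoidal)

/-- The projection `S ⊗ S ⟶ S ⊗_A S` -/
noncomputable def pS : S.X ⊗ S.X ⟶ (tensor (bimod i) (bimod i)).X := π (bimod i) (bimod i)

lemma π_mul₀ : pS i ≫ mul₀ i = μ[S.X] := π_desc (P := bimod i) (Q := bimod i) _ _

/-- The multiplication `S ⊗_A S ⟶ S` induced by the multiplication of `S`. -/
noncomputable def mul : bimod i ⊗ bimod i ⟶ bimod i :=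
  homMk (mul₀ i) (by
      change (i.hom ▷ S.X ≫ μ[S.X]) ▷ S.X ≫ (pS i ≫ mul₀ i) =
        (α_ A.X S.X S.X).hom ≫ A.X ◁ (pS i ≫ mul₀ i) ≫ (i.hom ▷ S.X ≫ μ[S.X])
      rw [π_mul₀]
      calc _ = i.hom ▷ S.X ▷ S.X ≫ (μ[S.X] ▷ S.X ≫ μ[S.X]) := by monoidal
        _ = 𝟙 _ ⊗≫ (i.hom ▷ (S.X ⊗ S.X) ≫ S.X ◁ μ[S.X]) ≫ μ[S.X] := by
            rw [MonObj.mul_assoc]; monoidal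
        _ = _ := by rw [← whisker_exchange]; monoidal)
    (by
      change (α_ S.X S.X A.X).hom ≫ S.X ◁ (S.X ◁ i.hom ≫ μ[S.X]) ≫
        (pS i ≫ mul₀ i) =
        (pS i ≫ mul₀ i) ▷ A.X ≫ (S.X ◁ i.hom ≫ μ[S.X])
      rw [π_mul₀]
      calc _ = 𝟙 _ ⊗≫ S.X ◁ S.X ◁ i.hom ⊗≫ ((α_ _ _ _).hom ≫ S.X ◁ μ[S.X] ≫ μ[S.X]) := by monoidal
        _ = 𝟙 _ ⊗≫ ((S.X ⊗ S.X) ◁ i.hom ≫ μ[S.X] ▷ S.X) ≫ μ[S.X] := by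
            rw [← MonObj.mul_assoc]; monoidal
        _ = _ := by rw [whisker_exchange]; monoidal)

/-- The unit `A ⟶ S`. -/
noncomputable def one : 𝟙_ (Bimod A A) ⟶ bimod i where
  hom := (i.hom : A.X ⟶ S.X)
  left_act_hom := by
    change μ[A.X] ≫ i.hom = A.X ◁ i.hom ≫ (i.hom ▷ S.X ≫ μ[S.X])
    rw [mul_i, whisker_exchange_assoc]
  right_act_hom := by
    change μ[A.X] ≫ i.hom = i.hom ▷ A.X ≫ (S.X ◁ i.hom ≫ μ[S.X])
    rw [mul_i]

lemma assocAux {S T U V : C} [MonObj S] (p : S ⊗ S ⟶ T) (m : T ⟶ S) (pl : T ⊗ S ⟶ U)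
    (pr : S ⊗ T ⟶ V) (a : U ⟶ V) (w₁ : U ⟶ T) (w₂ : V ⟶ T) (hm : p ≫ m = μ[S])
    (h₁ : pl ≫ w₁ = m ▷ S ≫ p) (h₂ : pr ≫ w₂ = S ◁ m ≫ p)
    (h₃ : p ▷ S ≫ pl ≫ a = (α_ S S S).hom ≫ S ◁ p ≫ pr) :
    p ▷ S ≫ pl ≫ w₁ ≫ m = p ▷ S ≫ pl ≫ a ≫ w₂ ≫ m := by
  rw [reassoc_of% h₁, reassoc_of% h₃, reassoc_of% h₂, hm, ← comp_whiskerRight_assoc,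
    ← whiskerLeft_comp_assoc, hm, MonObj.mul_assoc]

/-- The `A`-ring of an algebra extension. -/
@[reducible]
noncomputable def monObj : MonObj (bimod i) where
  mul := mul i
  one := one i
  one_mul := hom_ext' (P := reg A) (by
    have h1 : π (reg A) (bimod i) ≫ (wR (one i) (bimod i)).hom =
      i.hom ▷ S.X ≫ pS i := π_wR (P := reg A) (R := bimod i) (one i)
    change π (reg A) (bimod i) ≫ (wR (one i) (bimod i)).hom ≫ mul₀ i =
      π (reg A) (bimod i) ≫ (lUnitor (bimod i)).hom.hom
    rw [π_lUnitor, reassoc_of% h1]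
    exact congrArg (i.hom ▷ S.X ≫ ·) (π_mul₀ i))
  mul_one := hom_ext' (Q := reg A) (by
    have h1 : π (bimod i) (reg A) ≫ (wL (bimod i) (one i)).hom =
      S.X ◁ i.hom ≫ pS i := π_wL (Q := reg A) (P := bimod i) (one i)
    change π (bimod i) (reg A) ≫ (wL (bimod i) (one i)).hom ≫ mul₀ i =
      π (bimod i) (reg A) ≫ (rUnitor (bimod i)).hom.hom
    rw [π_rUnitor, reassoc_of% h1]
    exact congrArg (S.X ◁ i.hom ≫ ·) (π_mul₀ i))
  mul_assoc := hom_ext₃ (by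
    have h1 : π (tensor (bimod i) (bimod i)) (bimod i) ≫ (wR (mul i) (bimod i)).hom =
      mul₀ i ▷ S.X ≫ pS i := π_wR (R := bimod i) (mul i)
    have h2 : π (bimod i) (tensor (bimod i) (bimod i)) ≫ (wL (bimod i) (mul i)).hom =
      S.X ◁ mul₀ i ≫ pS i := π_wL (P := bimod i) (mul i)
    have h3 : pS i ▷ S.X ≫ π (tensor (bimod i) (bimod i)) (bimod i) ≫
          (assoc (bimod i) (bimod i) (bimod i)).hom.hom =
        (α_ S.X S.X S.X).hom ≫ S.X ◁ pS i ≫ π (bimod i) (tensor (bimod i) (bimod i)) :=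
      ππ_assoc (P := bimod i) (Q := bimod i) (R := bimod i)
    exact assocAux (S := S.X) _ _ _ _ _ _ _ (π_mul₀ i) h1 h2 h3)

/-- `A ⟶ S` is a Frobenius extension: `S` is a Frobenius algebra in the category of `A`-bimodules. -/
def _root_.Cowreath.IsFrobeniusExtension : Prop :=
  letI := monObj i
  IsFrobeniusAlgebra (bimod i)

end Extension
end Cowreath

namespace Cowreath
variable {C : Type u} [Category.{v} C] [MonoidalCategory C]  {A : Mon C}

namespace Coring
open RightTransfer

/-- The bimodule `A X`. -/
abbrev obj (X : RightTransfer A) : Bimod A A where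
  X := A.X ⊗ X.X
  actLeft := (α_ A.X A.X X.X).inv ≫ μ[A.X] ▷ X.X
  actRight := (α_ A.X X.X A.X).hom ≫ A.X ◁ X.ψ ≫ (α_ A.X A.X X.X).inv ≫ μ[A.X] ▷ X.X
  one_actLeft := by
    calc _ = 𝟙 _ ⊗≫ (η[A.X] ▷ A.X ≫ μ[A.X]) ▷ X.X := by monoidal
      _ = _ := by rw [MonObj.one_mul]; monoidal
  left_assoc := by
    calc _ = 𝟙 _ ⊗≫ (μ[A.X] ▷ A.X ≫ μ[A.X]) ▷ X.X := by monoidal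
      _ = _ := by rw [MonObj.mul_assoc]; monoidal
  actRight_one := by
    calc _ = 𝟙 _ ⊗≫ A.X ◁ ((ρ_ X.X).inv ≫ X.X ◁ η[A.X] ≫ X.ψ) ⊗≫ μ[A.X] ▷ X.X := by monoidal
      _ = 𝟙 _ ⊗≫ (A.X ◁ η[A.X] ≫ μ[A.X]) ▷ X.X := by rw [X.one_ψ]; monoidal
      _ = _ := by rw [MonObj.mul_one]; monoidal
  right_assoc := by
    calc _ = 𝟙 _ ⊗≫ A.X ◁ (X.X ◁ μ[A.X] ≫ X.ψ) ⊗≫ μ[A.X] ▷ X.X := by monoidal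
      _ = 𝟙 _ ⊗≫ A.X ◁ X.ψ ▷ A.X ⊗≫ A.X ◁ A.X ◁ X.ψ ⊗≫
          ((α_ _ _ _).hom ≫ A.X ◁ μ[A.X] ≫ μ[A.X]) ▷ X.X := by rw [X.mul_ψ]; monoidal
      _ = 𝟙 _ ⊗≫ A.X ◁ X.ψ ▷ A.X ⊗≫ ((A.X ⊗ A.X) ◁ X.ψ ≫ μ[A.X] ▷ (A.X ⊗ X.X)) ⊗≫
          μ[A.X] ▷ X.X := by rw [← MonObj.mul_assoc]; monoidal
      _ = _ := by rw [whisker_exchange]; monoidal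
  middle_assoc := by
    calc _ = 𝟙 _ ⊗≫ (μ[A.X] ▷ (X.X ⊗ A.X) ≫ A.X ◁ X.ψ) ⊗≫ μ[A.X] ▷ X.X := by monoidal
      _ = 𝟙 _ ⊗≫ A.X ◁ A.X ◁ X.ψ ⊗≫ (μ[A.X] ▷ A.X ≫ μ[A.X]) ▷ X.X := by
          rw [← whisker_exchange]; monoidal
      _ = _ := by rw [MonObj.mul_assoc]; monoidal

lemma actRight_eq (X : RightTransfer A) : (obj X).actRight = (α_ A.X X.X A.X).hom ≫ lext A X.ψ := rfl

/-- The bimodule morphism `A X ⟶ A Y` induced by `f : X ⟶ A Y`. -/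
abbrev map {X Y : RightTransfer A} (f : X ⟶ Y) : obj X ⟶ obj Y where
  hom := A.X ◁ f.hom ≫ (α_ A.X A.X Y.X).inv ≫ μ[A.X] ▷ Y.X
  left_act_hom := by
    simpa [lext] using mul_lext A f.hom
  right_act_hom := by
    change ((α_ A.X X.X A.X).hom ≫ lext A X.ψ) ≫ lext A f.hom =
      lext A f.hom ▷ A.X ≫ (α_ A.X Y.X A.X).hom ≫ lext A Y.ψ
    have := rten_lext A f.hom A.X
    rw [Category.assoc, ← lext_comp, f.comm', lext_comp, rten_lext, rten]
    simp

lemma map_hom {X Y : RightTransfer A} (f : X ⟶ Y) : (map f).hom = lext A f.hom := rfl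

variable (A) in
/-- The functor `X ↦ A X` -/
def functor : RightTransfer A ⥤ Bimod A A where
  obj := obj
  map := map
  map_id X := by
    ext
    exact lext_lunit A
  map_comp f g := by
    ext
    exact lext_comp A f.hom g.hom

variable [HasCoequalizers C] [∀ X : C, LeftCoflat X] [∀ Y : LeftModule A, IsRobust Y]
open BimodTensor

variable (X Y Z : RightTransfer A)

/-- `A X Y ⟶ A X A Y` -/
def ins (X Y : C) : A.X ⊗ (X ⊗ Y) ⟶ (A.X ⊗ X) ⊗ (A.X ⊗ Y) :=
  A.X ◁ X ◁ ((λ_ Y).inv ≫ η[A.X] ▷ Y) ≫ (α_ A.X X (A.X ⊗ Y)).inv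

lemma ins_eq (X Y : C) : ins (A := A) X Y = (α_ _ _ _).inv ≫ (A.X ⊗ X) ◁ lunit A Y := by
  simp only [ins, lunit]; monoidal

lemma insertion : π (obj X) (obj Y) = (α_ _ _ _).inv ≫ (obj X).actRight ▷ Y.X ≫
    (A.X ⊗ X.X) ◁ lunit A Y.X ≫ π (obj X) (obj Y) := by
  calc _ = (A.X ⊗ X.X) ◁ lext A (lunit A Y.X) ≫ π (obj X) (obj Y) := by rw [lext_lunit]; simp
    _ = 𝟙 _ ⊗≫ ((A.X ⊗ X.X) ⊗ A.X) ◁ lunit A Y.X ≫ ((α_ (obj X).X A.X (obj Y).X).hom ≫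
          (obj X).X ◁ (obj Y).actLeft ≫ π (obj X) (obj Y)) := by
        simp only [lext]; monoidal
    _ = (α_ _ _ _).inv ≫ (((A.X ⊗ X.X) ⊗ A.X) ◁ lunit A Y.X ≫ (obj X).actRight ▷ (A.X ⊗ Y.X)) ≫
          π (obj X) (obj Y) := by
        rw [← BimodTensor.cond]; monoidal
    _ = _ := by rw [whisker_exchange, Category.assoc]

/-- `A X Y ⟶ A X ⊗_A A Y` -/
noncomputable def δ₀ : A.X ⊗ (X.X ⊗ Y.X) ⟶ (tensor (obj X) (obj Y)).X :=
  ins X.X Y.X ≫ π (obj X) (obj Y)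

lemma π_eq : π (obj X) (obj Y) = (α_ _ _ _).inv ≫ (obj X).actRight ▷ Y.X ≫ (α_ _ _ _).hom ≫
    δ₀ X Y := by
  rw [insertion, δ₀, ins_eq]; simp

/-- `A X Y ⟶ A X ⊗_A A Y` -/
noncomputable def δ : obj (X ⊗ Y) ⟶ obj X ⊗ obj Y where
  hom := δ₀ X Y
  left_act_hom := by
    change ((α_ A.X A.X (X.X ⊗ Y.X)).inv ≫ μ[A.X] ▷ (X.X ⊗ Y.X)) ≫ δ₀ X Y =
      A.X ◁ δ₀ X Y ≫ (tensor (obj X) (obj Y)).actLeft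
    calc _ = 𝟙 _ ⊗≫ (μ[A.X] ▷ (X.X ⊗ Y.X) ≫ A.X ◁ (X.X ◁ lunit A Y.X)) ⊗≫ π (obj X) (obj Y) := by
          rw [δ₀, ins_eq]; monoidal
      _ = 𝟙 _ ⊗≫ (A.X ⊗ A.X) ◁ (X.X ◁ lunit A Y.X) ⊗≫ ((α_ _ _ _).inv ≫ (obj X).actLeft ▷ (obj Y).X ≫
            π (obj X) (obj Y)) := by
          rw [← whisker_exchange]; monoidal
      _ = _ := by rw [← π_actL, δ₀, ins_eq]; monoidal
  right_act_hom := by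
    change ((α_ A.X (X.X ⊗ Y.X) A.X).hom ≫ lext A ((α_ X.X Y.X A.X).hom ≫ X.lten Y.ψ)) ≫ δ₀ X Y =
      δ₀ X Y ▷ A.X ≫ (tensor (obj X) (obj Y)).actRight
    symm
    calc _ = ins X.X Y.X ▷ A.X ≫ (π (obj X) (obj Y) ▷ A.X ≫ (tensor (obj X) (obj Y)).actRight) := by
          rw [δ₀, comp_whiskerRight, Category.assoc]
      _ = 𝟙 _ ⊗≫ A.X ◁ X.X ◁ (rten (lunit A Y.X) A.X ≫ lext A Y.ψ) ⊗≫ π (obj X) (obj Y) := by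
          rw [π_actR, actRight_eq, ins_eq]; simp only [rten]; monoidal
      _ = 𝟙 _ ⊗≫ A.X ◁ X.X ◁ Y.ψ ⊗≫ (obj X).actRight ▷ Y.X ⊗≫ δ₀ X Y := by
          rw [rten_lunit, lunit_lext, π_eq]; monoidal
      _ = _ := by rw [actRight_eq]; simp only [lext, lten]; monoidal

lemma ψ_δ {X Y Y' : RightTransfer A} (g : Y ⟶ Y') : (A.X ⊗ X.X) ◁ g.hom ≫ (α_ _ _ _).inv ≫
      (obj X).actRight ▷ Y'.X ≫ (α_ _ _ _).hom = (α_ _ _ _).hom ≫ lext A (X.lten g.hom) := by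
  rw [actRight_eq]; simp only [lext, lten]; monoidal

lemma ins_natural {X X' : C} (f : A.X ⊗ X ⟶ A.X ⊗ X') (Y : C) :
    ins X Y ≫ f ▷ (A.X ⊗ Y) = (α_ _ _ _).inv ≫ f ▷ Y ≫ (α_ _ _ _).hom ≫ ins X' Y := by
  simp only [ins_eq, Category.assoc, whisker_exchange]
  simp

lemma δ_natural_left {X X' : RightTransfer A} (f : X ⟶ X') (Y : RightTransfer A) :
    δ X Y ≫ map f ▷ obj Y = map (f ▷ Y) ≫ δ X' Y := by
  apply Bimod.hom_ext
  change (ins X.X Y.X ≫ π (obj X) (obj Y)) ≫ (wR (map f) (obj Y)).hom =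
    lext A (rten f.hom Y.X) ≫ (ins X'.X Y.X ≫ π (obj X') (obj Y))
  rw [Category.assoc, π_wR, rten_lext, map_hom]
  rw [← Category.assoc, ins_natural, rten]
  simp

lemma δ_natural_right (X : RightTransfer A) {Y Y' : RightTransfer A} (g : Y ⟶ Y') :
    δ X Y ≫ obj X ◁ map g = map (X ◁ g) ≫ δ X Y' := by
  apply Bimod.hom_ext
  change (ins X.X Y.X ≫ π (obj X) (obj Y)) ≫ (wL (obj X) (map g)).hom =
    lext A (X.lten g.hom) ≫ δ₀ X Y'
  calc _ = (α_ _ _ _).inv ≫ (A.X ⊗ X.X) ◁ (lunit A Y.X ≫ lext A g.hom) ≫ π (obj X) (obj Y') := by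
        rw [Category.assoc, π_wL, ins_eq, map_hom]; monoidal
    _ = (α_ _ _ _).inv ≫ ((A.X ⊗ X.X) ◁ g.hom ≫ (α_ _ _ _).inv ≫
          (obj X).actRight ▷ Y'.X ≫ (α_ _ _ _).hom) ≫ δ₀ X Y' := by
        rw [lunit_lext, π_eq]; simp
    _ = _ := by rw [ψ_δ]; simp

lemma comp_aux {P Q R S T : C} {a : P ⟶ Q} {p : Q ⟶ R} {w : R ⟶ S} (e : S ⟶ T) {q : Q ⟶ S}
    (h : p ≫ w = q) : (a ≫ p) ≫ w ≫ e = a ≫ q ≫ e := by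
  rw [← h]; simp

lemma comp_aux' {P Q R S : C} {a : P ⟶ Q} {p : Q ⟶ R} {w : R ⟶ S} {q : Q ⟶ S}
    (h : p ≫ w = q) : (a ≫ p) ≫ w = a ≫ q := by
  rw [← h]; simp

lemma δ_assoc (X Y Z : RightTransfer A) :
    δ (X ⊗ Y) Z ≫ δ X Y ▷ obj Z ≫ (α_ (obj X) (obj Y) (obj Z)).hom =
      map (α_ X Y Z).hom ≫ δ X (Y ⊗ Z) ≫ obj X ◁ δ Y Z := by
  apply Bimod.hom_ext
  change (ins (X.X ⊗ Y.X) Z.X ≫ π (obj (X ⊗ Y)) (obj Z)) ≫ (wR (δ X Y) (obj Z)).hom ≫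
      (assoc (obj X) (obj Y) (obj Z)).hom.hom =
    lext A ((α_ X.X Y.X Z.X).hom ≫ lunit A _) ≫
      (ins X.X (Y.X ⊗ Z.X) ≫ π (obj X) (obj (Y ⊗ Z))) ≫ (wL (obj X) (δ Y Z)).hom
  have hL : π (obj (X ⊗ Y)) (obj Z) ≫ (wR (δ X Y) (obj Z)).hom =
      (ins X.X Y.X ≫ π (obj X) (obj Y)) ▷ (A.X ⊗ Z.X) ≫ π _ (obj Z) := π_wR _
  have hR : π (obj X) (obj (Y ⊗ Z)) ≫ (wL (obj X) (δ Y Z)).hom =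
      (A.X ⊗ X.X) ◁ (ins Y.X Z.X ≫ π (obj Y) (obj Z)) ≫ π (obj X) _ := π_wL _
  have hA : lext A ((α_ X.X Y.X Z.X).hom ≫ lunit A _) = A.X ◁ (α_ X.X Y.X Z.X).hom := by
    rw [lext_precomp, lext_lunit, Category.comp_id]
  have hα := ππ_assoc (P := obj X) (Q := obj Y) (R := obj Z)
  refine (comp_aux _ hL).trans ?_
  rw [hA]
  refine Eq.trans ?_ (congrArg (A.X ◁ (α_ X.X Y.X Z.X).hom ≫ ·) (comp_aux' hR).symm)
  calc _ = ins (X.X ⊗ Y.X) Z.X ≫ ins X.X Y.X ▷ (A.X ⊗ Z.X) ≫ (π (obj X) (obj Y) ▷ (A.X ⊗ Z.X) ≫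
        π _ (obj Z) ≫ (assoc (obj X) (obj Y) (obj Z)).hom.hom) := by
        rw [comp_whiskerRight]
        exact congrArg (ins (X.X ⊗ Y.X) Z.X ≫ ·)
          ((Category.assoc _ _ _).trans (Category.assoc _ _ _))
    _ = 𝟙 _ ⊗≫ ((A.X ⊗ (X.X ⊗ Y.X)) ◁ lunit A Z.X ≫ ins X.X Y.X ▷ (A.X ⊗ Z.X)) ⊗≫
        (A.X ⊗ X.X) ◁ π (obj Y) (obj Z) ≫ π (obj X) (tensor (obj Y) (obj Z)) := by
        rw [hα, ins_eq (X.X ⊗ Y.X)]; monoidal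
    _ = 𝟙 _ ⊗≫ (A.X ⊗ X.X) ◁ (lunit A Y.X ▷ Z.X ≫ (A.X ⊗ Y.X) ◁ lunit A Z.X) ⊗≫
        (A.X ⊗ X.X) ◁ π (obj Y) (obj Z) ≫ π (obj X) (tensor (obj Y) (obj Z)) := by
        rw [whisker_exchange, ins_eq]; monoidal
    _ = _ := by
        rw [ins_eq, ins_eq, ← rten_lunit, rten]; monoidal

variable (A) in
/-- `A 1 ⟶ A` -/
noncomputable def η₀ : obj (𝟙_ (RightTransfer A)) ⟶ 𝟙_ (Bimod A A) where
  hom := (ρ_ A.X).hom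
  left_act_hom := by
    change ((α_ A.X A.X (𝟙_ C)).inv ≫ μ[A.X] ▷ 𝟙_ C) ≫ (ρ_ A.X).hom = A.X ◁ (ρ_ A.X).hom ≫ μ[A.X]
    monoidal
  right_act_hom := by
    change ((α_ A.X (𝟙_ C) A.X).hom ≫ A.X ◁ ((λ_ A.X).hom ≫ (ρ_ A.X).inv) ≫ (α_ A.X A.X (𝟙_ C)).inv ≫
      μ[A.X] ▷ 𝟙_ C) ≫ (ρ_ A.X).hom = (ρ_ A.X).hom ▷ A.X ≫ μ[A.X]
    monoidal

lemma δ_left (X : RightTransfer A) :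
    map (λ_ X).inv ≫ δ (𝟙_ _) X ≫ η₀ A ▷ obj X ≫ (λ_ (obj X)).hom = 𝟙 _ := by
  apply Bimod.hom_ext
  change lext A ((λ_ X.X).inv ≫ lunit A _) ≫ (ins (𝟙_ C) X.X ≫ π (obj (𝟙_ _)) (obj X)) ≫
    (wR (η₀ A) (obj X)).hom ≫ (lUnitor (obj X)).hom.hom = 𝟙 _
  have hL : π (obj (𝟙_ _)) (obj X) ≫ (wR (η₀ A) (obj X)).hom ≫ (lUnitor (obj X)).hom.hom =
      (ρ_ A.X).hom ▷ (A.X ⊗ X.X) ≫ (obj X).actLeft := by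
    rw [← π_lUnitor]
    exact (Category.assoc _ _ _).symm.trans
      ((congrArg (· ≫ (lUnitor (obj X)).hom.hom) (π_wR (η₀ A))).trans (Category.assoc _ _ _))
  rw [lext_precomp, lext_lunit, Category.comp_id]
  refine (congrArg (A.X ◁ (λ_ X.X).inv ≫ ·) (comp_aux' hL)).trans ?_
  rw [ins]
  calc _ = 𝟙 _ ⊗≫ (A.X ◁ η[A.X] ≫ μ[A.X]) ▷ X.X := by monoidal
    _ = _ := by rw [MonObj.mul_one]; monoidal

lemma δ_right (X : RightTransfer A) :
    map (ρ_ X).inv ≫ δ X (𝟙_ _) ≫ obj X ◁ η₀ A ≫ (ρ_ (obj X)).hom = 𝟙 _ := by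
  apply Bimod.hom_ext
  change lext A ((ρ_ X.X).inv ≫ lunit A _) ≫ (ins X.X (𝟙_ C) ≫ π (obj X) (obj (𝟙_ _))) ≫
    (wL (obj X) (η₀ A)).hom ≫ (rUnitor (obj X)).hom.hom = 𝟙 _
  have hL : π (obj X) (obj (𝟙_ _)) ≫ (wL (obj X) (η₀ A)).hom ≫ (rUnitor (obj X)).hom.hom =
      (A.X ⊗ X.X) ◁ (ρ_ A.X).hom ≫ (obj X).actRight := by
    rw [← π_rUnitor]
    exact (Category.assoc _ _ _).symm.trans
      ((congrArg (· ≫ (rUnitor (obj X)).hom.hom) (π_wL (η₀ A))).trans (Category.assoc _ _ _))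
  rw [lext_precomp, lext_lunit, Category.comp_id]
  refine (congrArg (A.X ◁ (ρ_ X.X).inv ≫ ·) (comp_aux' hL)).trans ?_
  rw [ins]
  calc _ = 𝟙 _ ⊗≫ (A.X ⊗ X.X) ◁ η[A.X] ≫ (obj X).actRight := by monoidal
    _ = _ := by rw [show (A.X ⊗ X.X) ◁ η[A.X] ≫ (obj X).actRight = _ from (obj X).actRight_one]; monoidal

open Functor in
noncomputable instance : (functor A).OplaxMonoidal :=
  Functor.OplaxMonoidal.mk (η₀ A) (fun X Y => δ X Y) (fun f Y => δ_natural_left f Y)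
    (fun X g => δ_natural_right X g) (fun X Y Z => δ_assoc X Y Z)
    (fun X => by
      have h := δ_left X
      rw [← Category.assoc, ← Category.assoc, ← Iso.eq_comp_inv, Category.id_comp,
        Category.assoc] at h
      exact h.symm)
    (fun X => by
      have h := δ_right X
      rw [← Category.assoc, ← Category.assoc, ← Iso.eq_comp_inv, Category.id_comp,
        Category.assoc] at h
      exact h.symm)


/-- The `A`-coring `A X`: its comultiplication is `(m X X) ∘ (A δ)`, followed by the canonical
isomorphism `A X X ⟶ A X ⊗_A A X`, and its counit is `m ∘ (A ε)`. -/
@[reducible]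
noncomputable def comonObj (X : RightTransfer A) [ComonObj X] : ComonObj (obj X) :=
  Functor.obj.instComonObj (F := functor A) (A := X)

end Coring
end Cowreath

namespace Cowreath
variable {C : Type u} [Category.{v} C] [MonoidalCategory C] {A : Mon C}

namespace Duality
variable (X : RightTransfer A) (Y : C) [ExactPairing Y X.X]

/-- The bimodule `Y A` -/
abbrev bimod : Bimod A A where
  X := Y ⊗ A.X
  actLeft := (α_ A.X Y A.X).inv ≫ dualφ X Y ▷ A.X ≫ (α_ Y A.X A.X).hom ≫ Y ◁ μ[A.X]
  actRight := (α_ _ _ _).hom ≫ Y ◁ μ[A.X]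
  one_actLeft := (Wreath.bimod (dualTransfer X Y)).one_actLeft
  left_assoc := (Wreath.bimod (dualTransfer X Y)).left_assoc
  actRight_one := (Wreath.bimod (dualTransfer X Y)).actRight_one
  right_assoc := (Wreath.bimod (dualTransfer X Y)).right_assoc
  middle_assoc := (Wreath.bimod (dualTransfer X Y)).middle_assoc

/-- `A ⟶ Y A X` -/
def b₁ : A.X ⟶ Y ⊗ (A.X ⊗ X.X) :=
  (λ_ A.X).inv ≫ η_ Y X.X ▷ A.X ≫ (α_ Y X.X A.X).hom ≫ Y ◁ X.ψ

/-- `A X Y A ⟶ A` -/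
def d₁ : (A.X ⊗ X.X) ⊗ (Y ⊗ A.X) ⟶ A.X :=
  (α_ A.X X.X (Y ⊗ A.X)).hom ≫ A.X ◁ (α_ X.X Y A.X).inv ≫ A.X ◁ ε_ Y X.X ▷ A.X ≫
    A.X ◁ (λ_ A.X).hom ≫ μ[A.X]

lemma b₁_eq : b₁ X Y = (ρ_ A.X).inv ≫ A.X ◁ η_ Y X.X ≫ (α_ A.X Y X.X).inv ≫ dualφ X Y ▷ X.X ≫
    (α_ Y A.X X.X).hom := by
  symm
  calc _ = 𝟙 _ ⊗≫ (𝟙_ C ◁ (A.X ◁ η_ Y X.X) ≫ η_ Y X.X ▷ (A.X ⊗ (Y ⊗ X.X))) ⊗≫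
        Y ◁ X.ψ ▷ Y ▷ X.X ⊗≫ Y ◁ A.X ◁ ε_ Y X.X ▷ X.X ⊗≫ 𝟙 _ := by
        simp only [dualφ, unhat]; monoidal
    _ = 𝟙 _ ⊗≫ η_ Y X.X ▷ A.X ⊗≫ Y ◁ ((X.X ⊗ A.X) ◁ η_ Y X.X ≫ X.ψ ▷ (Y ⊗ X.X)) ⊗≫
        Y ◁ A.X ◁ ε_ Y X.X ▷ X.X ⊗≫ 𝟙 _ := by
        rw [whisker_exchange]; monoidal
    _ = 𝟙 _ ⊗≫ η_ Y X.X ▷ A.X ⊗≫ Y ◁ X.ψ ⊗≫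
        Y ◁ A.X ◁ (X.X ◁ η_ Y X.X ≫ (α_ _ _ _).inv ≫ ε_ Y X.X ▷ X.X) ⊗≫ 𝟙 _ := by
        rw [whisker_exchange]; monoidal
    _ = _ := by rw [ExactPairing.coevaluation_evaluation, b₁]; monoidal

lemma b₁_left : μ[A.X] ≫ b₁ X Y = A.X ◁ b₁ X Y ≫ (α_ _ _ _).inv ≫ dualφ X Y ▷ (A.X ⊗ X.X) ≫
    (α_ _ _ _).hom ≫ Y ◁ ((α_ _ _ _).inv ≫ μ[A.X] ▷ X.X) := by
  symm
  calc _ = 𝟙 _ ⊗≫ A.X ◁ η_ Y X.X ▷ A.X ⊗≫ ((A.X ⊗ Y) ◁ X.ψ ≫ dualφ X Y ▷ (A.X ⊗ X.X)) ⊗≫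
        Y ◁ μ[A.X] ▷ X.X := by simp only [b₁]; monoidal
    _ = 𝟙 _ ⊗≫ ((ρ_ A.X).inv ≫ A.X ◁ η_ Y X.X ≫ (α_ A.X Y X.X).inv ≫ dualφ X Y ▷ X.X ≫
        (α_ Y A.X X.X).hom) ▷ A.X ⊗≫ Y ◁ A.X ◁ X.ψ ⊗≫ Y ◁ μ[A.X] ▷ X.X := by
        rw [whisker_exchange]; monoidal
    _ = 𝟙 _ ⊗≫ η_ Y X.X ▷ (A.X ⊗ A.X) ⊗≫ Y ◁ ((α_ X.X A.X A.X).inv ≫ X.ψ ▷ A.X ≫ (α_ A.X X.X A.X).hom ≫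
          A.X ◁ X.ψ ≫ (α_ A.X A.X X.X).inv ≫ μ[A.X] ▷ X.X) := by
        rw [← b₁_eq]; simp only [b₁]; monoidal
    _ = 𝟙 _ ⊗≫ (η_ Y X.X ▷ (A.X ⊗ A.X) ≫ (Y ⊗ X.X) ◁ μ[A.X]) ⊗≫ Y ◁ X.ψ := by
        rw [← X.mul_ψ]; monoidal
    _ = _ := by rw [← whisker_exchange]; simp only [b₁]; monoidal

lemma b₁_right : μ[A.X] ≫ b₁ X Y = b₁ X Y ▷ A.X ≫ (α_ _ _ _).hom ≫ Y ◁ (Coring.obj X).actRight := by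
  symm
  calc _ = 𝟙 _ ⊗≫ η_ Y X.X ▷ (A.X ⊗ A.X) ⊗≫ Y ◁ ((α_ X.X A.X A.X).inv ≫ X.ψ ▷ A.X ≫ (α_ A.X X.X A.X).hom ≫
          A.X ◁ X.ψ ≫ (α_ A.X A.X X.X).inv ≫ μ[A.X] ▷ X.X) := by
        simp only [b₁]; monoidal
    _ = 𝟙 _ ⊗≫ (η_ Y X.X ▷ (A.X ⊗ A.X) ≫ (Y ⊗ X.X) ◁ μ[A.X]) ⊗≫ Y ◁ X.ψ := by
        rw [← X.mul_ψ]; monoidal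
    _ = _ := by rw [← whisker_exchange]; simp only [b₁]; monoidal

lemma d₁_cond : (Coring.obj X).actRight ▷ (Y ⊗ A.X) ≫ d₁ X Y =
    ((α_ (A.X ⊗ X.X) A.X (Y ⊗ A.X)).hom ≫ (A.X ⊗ X.X) ◁ (bimod X Y).actLeft) ≫ d₁ X Y := by
  symm
  calc _ = 𝟙 _ ⊗≫ A.X ◁ X.X ◁ dualφ X Y ▷ A.X ⊗≫ A.X ◁ ((X.X ⊗ Y) ◁ μ[A.X] ≫
        ε_ Y X.X ▷ A.X) ⊗≫ μ[A.X] := by simp only [d₁]; monoidal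
    _ = 𝟙 _ ⊗≫ A.X ◁ (X.X ◁ dualφ X Y ≫ (α_ X.X Y A.X).inv ≫ ε_ Y X.X ▷ A.X) ▷ A.X ⊗≫
        ((α_ _ _ _).hom ≫ A.X ◁ μ[A.X] ≫ μ[A.X]) := by
        rw [whisker_exchange]; monoidal
    _ = 𝟙 _ ⊗≫ A.X ◁ X.ψ ▷ (Y ⊗ A.X) ⊗≫ ((A.X ⊗ A.X) ◁ (ε_ Y X.X ▷ A.X) ≫ 
        μ[A.X] ▷ (𝟙_ C ⊗ A.X)) ⊗≫ μ[A.X] := by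
        rw [hat_dualφ, ← MonObj.mul_assoc]; monoidal
    _ = _ := by rw [whisker_exchange]; simp only [d₁]; monoidal

lemma d₁_left : (Coring.obj X).actLeft ▷ (Y ⊗ A.X) ≫ d₁ X Y =
    (α_ _ _ _).hom ≫ A.X ◁ d₁ X Y ≫ μ[A.X] := by
  calc _ = 𝟙 _ ⊗≫ (μ[A.X] ▷ ((X.X ⊗ Y) ⊗ A.X) ≫ A.X ◁ (ε_ Y X.X ▷ A.X)) ⊗≫ μ[A.X] := by
        simp only [d₁]; monoidal
    _ = 𝟙 _ ⊗≫ A.X ◁ A.X ◁ (ε_ Y X.X ▷ A.X) ⊗≫ (μ[A.X] ▷ A.X ≫ μ[A.X]) := by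
        rw [← whisker_exchange]; monoidal
    _ = _ := by rw [MonObj.mul_assoc]; simp only [d₁]; monoidal

lemma d₁_right : (α_ _ _ _).hom ≫ (A.X ⊗ X.X) ◁ (bimod X Y).actRight ≫ d₁ X Y =
    d₁ X Y ▷ A.X ≫ μ[A.X] := by
  calc _ = 𝟙 _ ⊗≫ A.X ◁ ((X.X ⊗ Y) ◁ μ[A.X] ≫ ε_ Y X.X ▷ A.X) ⊗≫ μ[A.X] := by
        simp only [d₁]; monoidal
    _ = 𝟙 _ ⊗≫ A.X ◁ (ε_ Y X.X ▷ (A.X ⊗ A.X)) ⊗≫ ((α_ _ _ _).hom ≫ A.X ◁ μ[A.X] ≫ μ[A.X]) := by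
        rw [whisker_exchange]; monoidal
    _ = _ := by rw [← MonObj.mul_assoc]; simp only [d₁]; monoidal

lemma zig : (A.X ⊗ X.X) ◁ (b₁ X Y ≫ (α_ _ _ _).inv ≫ (Y ⊗ A.X) ◁ lunit A X.X) ≫
    (α_ _ _ _).inv ≫ d₁ X Y ▷ (A.X ⊗ X.X) ≫ (Coring.obj X).actLeft = (Coring.obj X).actRight := by
  calc _ = 𝟙 _ ⊗≫ (A.X ⊗ X.X) ◁ b₁ X Y ⊗≫ (((A.X ⊗ X.X) ⊗ (Y ⊗ A.X)) ◁ lunit A X.X ≫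
        d₁ X Y ▷ (A.X ⊗ X.X)) ⊗≫ μ[A.X] ▷ X.X := by monoidal
    _ = 𝟙 _ ⊗≫ (A.X ⊗ X.X) ◁ b₁ X Y ⊗≫ d₁ X Y ▷ X.X ⊗≫ lext A (lunit A X.X) := by
        rw [whisker_exchange]; simp only [lext]; monoidal
    _ = 𝟙 _ ⊗≫ A.X ◁ X.X ◁ η_ Y X.X ▷ A.X ⊗≫ A.X ◁ ((X.X ⊗ Y) ◁ X.ψ ≫ ε_ Y X.X ▷ (A.X ⊗ X.X)) ⊗≫
        μ[A.X] ▷ X.X := by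
        rw [lext_lunit]; simp only [b₁, d₁]; monoidal
    _ = 𝟙 _ ⊗≫ A.X ◁ (X.X ◁ η_ Y X.X ≫ (α_ _ _ _).inv ≫ ε_ Y X.X ▷ X.X) ▷ A.X ⊗≫ A.X ◁ X.ψ ⊗≫
        μ[A.X] ▷ X.X := by
        rw [whisker_exchange]; monoidal
    _ = _ := by rw [ExactPairing.coevaluation_evaluation]; monoidal

lemma lunit_d₁ : lunit A X.X ▷ (Y ⊗ A.X) ≫ d₁ X Y = (α_ _ _ _).inv ≫ ε_ Y X.X ▷ A.X ≫ (λ_ _).hom := by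
  calc _ = 𝟙 _ ⊗≫ (η[A.X] ▷ ((X.X ⊗ Y) ⊗ A.X) ≫ A.X ◁ (ε_ Y X.X ▷ A.X)) ⊗≫ μ[A.X] := by
        simp only [lunit, d₁]; monoidal
    _ = 𝟙 _ ⊗≫ ε_ Y X.X ▷ A.X ⊗≫ (η[A.X] ▷ A.X ≫ μ[A.X]) := by
        rw [← whisker_exchange]; monoidal
    _ = _ := by rw [MonObj.one_mul]; monoidal

lemma zag : b₁ X Y ▷ (Y ⊗ A.X) ≫ (α_ _ _ _).inv ▷ (Y ⊗ A.X) ≫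
    ((Y ⊗ A.X) ◁ lunit A X.X) ▷ (Y ⊗ A.X) ≫ (α_ _ _ _).hom ≫ (Y ⊗ A.X) ◁ d₁ X Y ≫
      (bimod X Y).actRight = (bimod X Y).actLeft := by
  calc _ = 𝟙 _ ⊗≫ b₁ X Y ▷ (Y ⊗ A.X) ⊗≫ Y ◁ A.X ◁ (lunit A X.X ▷ (Y ⊗ A.X) ≫ d₁ X Y) ⊗≫
        Y ◁ μ[A.X] := by monoidal
    _ = 𝟙 _ ⊗≫ η_ Y X.X ▷ (A.X ⊗ Y ⊗ A.X) ⊗≫ Y ◁ ((α_ X.X A.X Y).inv ≫ X.ψ ▷ Y ≫ (α_ A.X X.X Y).hom ≫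
        A.X ◁ ε_ Y X.X ≫ (ρ_ A.X).hom ≫ (λ_ A.X).inv) ▷ A.X ⊗≫ Y ◁ μ[A.X] := by
        rw [lunit_d₁]; simp only [b₁]; monoidal
    _ = 𝟙 _ ⊗≫ (η_ Y X.X ▷ (A.X ⊗ Y) ≫ (Y ⊗ X.X) ◁ dualφ X Y) ▷ A.X ⊗≫ Y ◁ ε_ Y X.X ▷ A.X ▷ A.X ⊗≫
        Y ◁ μ[A.X] := by
        rw [← hat_dualφ]; monoidal
    _ = 𝟙 _ ⊗≫ dualφ X Y ▷ A.X ⊗≫ (η_ Y X.X ▷ Y ≫ (α_ _ _ _).hom ≫ Y ◁ ε_ Y X.X) ▷ A.X ▷ A.X ⊗≫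
        Y ◁ μ[A.X] := by
        rw [← whisker_exchange]; monoidal
    _ = _ := by rw [ExactPairing.evaluation_coevaluation]; monoidal

variable [HasCoequalizers C] [∀ X : C, LeftCoflat X] [∀ Y : LeftModule A, IsRobust Y]
open BimodTensor

/-- `Y A X ⟶ Y A ⊗_A A X` -/
noncomputable def j : Y ⊗ (A.X ⊗ X.X) ⟶ (tensor (bimod X Y) (Coring.obj X)).X :=
  (α_ _ _ _).inv ≫ (Y ⊗ A.X) ◁ lunit A X.X ≫ π (bimod X Y) (Coring.obj X)

lemma π_eq : π (bimod X Y) (Coring.obj X) = (α_ _ _ _).hom ≫ Y ◁ ((α_ _ _ _).inv ≫ μ[A.X] ▷ X.X) ≫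
    j X Y := by
  calc _ = (Y ⊗ A.X) ◁ lext A (lunit A X.X) ≫ π (bimod X Y) (Coring.obj X) := by
        rw [lext_lunit]; simp
    _ = 𝟙 _ ⊗≫ ((Y ⊗ A.X) ⊗ A.X) ◁ lunit A X.X ≫ ((α_ (bimod X Y).X A.X (Coring.obj X).X).hom ≫
          (bimod X Y).X ◁ (Coring.obj X).actLeft ≫ π (bimod X Y) (Coring.obj X)) := by
        simp only [lext]; monoidal
    _ = (α_ _ _ _).inv ≫ (((Y ⊗ A.X) ⊗ A.X) ◁ lunit A X.X ≫ (bimod X Y).actRight ▷ (A.X ⊗ X.X)) ≫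
          π (bimod X Y) (Coring.obj X) := by
        rw [← BimodTensor.cond]; monoidal
    _ = _ := by rw [whisker_exchange, Category.assoc]; simp only [j]; monoidal

/-- The coevaluation `A ⟶ Y A X ⟶ Y A ⊗_A A X` -/
noncomputable def coev : 𝟙_ (Bimod A A) ⟶ bimod X Y ⊗ Coring.obj X where
  hom := b₁ X Y ≫ j X Y
  left_act_hom := by
    change μ[A.X] ≫ b₁ X Y ≫ j X Y =
      A.X ◁ (b₁ X Y ≫ j X Y) ≫ (tensor (bimod X Y) (Coring.obj X)).actLeft
    rw [← Category.assoc, b₁_left]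
    symm
    calc _ = 𝟙 _ ⊗≫ A.X ◁ b₁ X Y ⊗≫ A.X ◁ (Y ⊗ A.X) ◁ lunit A X.X ≫ (A.X ◁ π (bimod X Y) (Coring.obj X) ≫
            (tensor (bimod X Y) (Coring.obj X)).actLeft) := by simp only [j]; monoidal
      _ = 𝟙 _ ⊗≫ A.X ◁ b₁ X Y ⊗≫ ((A.X ⊗ (Y ⊗ A.X)) ◁ lunit A X.X ≫ (bimod X Y).actLeft ▷ (A.X ⊗ X.X)) ≫
            π (bimod X Y) (Coring.obj X) := by
          rw [π_actL]; monoidal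
      _ = _ := by rw [whisker_exchange]; simp only [j]; monoidal
  right_act_hom := by
    change μ[A.X] ≫ b₁ X Y ≫ j X Y =
      (b₁ X Y ≫ j X Y) ▷ A.X ≫ (tensor (bimod X Y) (Coring.obj X)).actRight
    rw [← Category.assoc, b₁_right]
    symm
    calc _ = 𝟙 _ ⊗≫ b₁ X Y ▷ A.X ⊗≫ ((Y ⊗ A.X) ◁ lunit A X.X) ▷ A.X ≫ (π (bimod X Y) (Coring.obj X) ▷ A.X ≫
            (tensor (bimod X Y) (Coring.obj X)).actRight) := by simp only [j]; monoidal
      _ = 𝟙 _ ⊗≫ b₁ X Y ▷ A.X ⊗≫ (Y ⊗ A.X) ◁ (rten (lunit A X.X) A.X ≫ lext A X.ψ) ≫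
            π (bimod X Y) (Coring.obj X) := by
          rw [π_actR, Coring.actRight_eq]; simp only [rten]; monoidal
      _ = 𝟙 _ ⊗≫ b₁ X Y ▷ A.X ⊗≫ Y ◁ A.X ◁ X.ψ ⊗≫ Y ◁ μ[A.X] ▷ X.X ≫ j X Y := by
          rw [rten_lunit, lunit_lext, π_eq]; monoidal
      _ = _ := by monoidal

/-- The evaluation `A X ⊗_A Y A ⟶ A`, induced by `m ∘ (A d A)` -/
noncomputable def ev : Coring.obj X ⊗ bimod X Y ⟶ 𝟙_ (Bimod A A) :=
  homMk (P := Coring.obj X) (Q := bimod X Y) (T := reg A)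
    (desc (P := Coring.obj X) (Q := bimod X Y) (d₁ X Y) (d₁_cond X Y))
    (by rw [π_desc]; exact d₁_left X Y) (by rw [π_desc]; exact d₁_right X Y)

lemma π_ev : π (Coring.obj X) (bimod X Y) ≫ (ev X Y).hom = d₁ X Y := π_desc _ _


lemma glue_zig {P Q R S T U V W M : C} {p : P ⟶ Q} {w : Q ⟶ R} {f : P ⟶ S} {q : S ⟶ R} {i : R ⟶ T}
    {r : S ⟶ U} {s : U ⟶ T} {v : T ⟶ V} {g : U ⟶ W} {k : W ⟶ V} {l : V ⟶ M}
    {n : W ⟶ M} {x : P ⟶ M} (h₁ : p ≫ w = f ≫ q) (h₂ : q ≫ i = r ≫ s) (h₃ : s ≫ v = g ≫ k)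
    (h₄ : k ≫ l = n) (h₅ : f ≫ r ≫ g ≫ n = x) : p ≫ w ≫ i ≫ v ≫ l = x := by
  rw [reassoc_of% h₁, reassoc_of% h₂, reassoc_of% h₃, h₄, h₅]

lemma exact_zig : Coring.obj X ◁ coev X Y ≫ (α_ _ _ _).inv ≫ ev X Y ▷ Coring.obj X ≫
    (λ_ (Coring.obj X)).hom = (ρ_ (Coring.obj X)).hom := by
  apply hom_ext' (P := Coring.obj X) (Q := reg A)
  have h₁ : π (Coring.obj X) (reg A) ≫ (wL (Coring.obj X) (coev X Y)).hom =
      ((A.X ⊗ X.X) ◁ (b₁ X Y ≫ (α_ _ _ _).inv ≫ (Y ⊗ A.X) ◁ lunit A X.X)) ≫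
        (A.X ⊗ X.X) ◁ π (bimod X Y) (Coring.obj X) ≫
          π (Coring.obj X) (tensor (bimod X Y) (Coring.obj X)) := by
    refine (π_wL (P := Coring.obj X) (Q := reg A) (coev X Y)).trans ?_
    change (A.X ⊗ X.X) ◁ (b₁ X Y ≫ j X Y) ≫ _ = _
    simp only [j, MonoidalCategory.whiskerLeft_comp, Category.assoc]
    rfl
  have h₂ := ππ_assocInv' (P := Coring.obj X) (Q := bimod X Y) (R := Coring.obj X)
  have h₃ : π (tensor (Coring.obj X) (bimod X Y)) (Coring.obj X) ≫ (wR (ev X Y) (Coring.obj X)).hom =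
      (ev X Y).hom ▷ (A.X ⊗ X.X) ≫ π (reg A) (Coring.obj X) := π_wR (R := Coring.obj X) (ev X Y)
  have h₃' : (π (Coring.obj X) (bimod X Y) ▷ (A.X ⊗ X.X) ≫
      π (tensor (Coring.obj X) (bimod X Y)) (Coring.obj X)) ≫ (wR (ev X Y) (Coring.obj X)).hom =
      d₁ X Y ▷ (A.X ⊗ X.X) ≫ π (reg A) (Coring.obj X) := by
    rw [Category.assoc, h₃, ← Category.assoc]
    exact congrArg (· ≫ π (reg A) (Coring.obj X)) ((comp_whiskerRight _ _ _).symm.trans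
      (congrArg (· ▷ (A.X ⊗ X.X)) (π_ev X Y)))
  have h₄ := glue_zig h₁ ((Category.assoc _ _ _).trans h₂) h₃' (π_lUnitor (Coring.obj X)) (zig X Y)
  exact h₄.trans (π_rUnitor (Coring.obj X)).symm

lemma exact_zag : coev X Y ▷ bimod X Y ≫ (α_ _ _ _).hom ≫ bimod X Y ◁ ev X Y ≫
    (ρ_ (bimod X Y)).hom = (λ_ (bimod X Y)).hom := by
  apply hom_ext' (P := reg A) (Q := bimod X Y)
  have h₁ : π (reg A) (bimod X Y) ≫ (wR (coev X Y) (bimod X Y)).hom =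
      (b₁ X Y ≫ (α_ _ _ _).inv ≫ (Y ⊗ A.X) ◁ lunit A X.X) ▷ (Y ⊗ A.X) ≫
        π (bimod X Y) (Coring.obj X) ▷ (Y ⊗ A.X) ≫
          π (tensor (bimod X Y) (Coring.obj X)) (bimod X Y) := by
    refine (π_wR (P := reg A) (R := bimod X Y) (coev X Y)).trans ?_
    change (b₁ X Y ≫ j X Y) ▷ (Y ⊗ A.X) ≫ _ = _
    simp only [j, comp_whiskerRight, Category.assoc]
    rfl
  have h₂ := ππ_assoc (P := bimod X Y) (Q := Coring.obj X) (R := bimod X Y)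
  have h₃ : π (bimod X Y) (tensor (Coring.obj X) (bimod X Y)) ≫ (wL (bimod X Y) (ev X Y)).hom =
      (Y ⊗ A.X) ◁ (ev X Y).hom ≫ π (bimod X Y) (reg A) := π_wL (P := bimod X Y) (ev X Y)
  have h₃' : ((Y ⊗ A.X) ◁ π (Coring.obj X) (bimod X Y) ≫
      π (bimod X Y) (tensor (Coring.obj X) (bimod X Y))) ≫ (wL (bimod X Y) (ev X Y)).hom =
      (Y ⊗ A.X) ◁ d₁ X Y ≫ π (bimod X Y) (reg A) := by
    rw [Category.assoc, h₃, ← Category.assoc]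
    exact congrArg (· ≫ π (bimod X Y) (reg A)) ((MonoidalCategory.whiskerLeft_comp _ _ _).symm.trans
      (congrArg ((Y ⊗ A.X) ◁ ·) (π_ev X Y)))
  have h₅ := zag X Y
  have h₄ := glue_zig h₁ ((Category.assoc _ _ _).trans h₂) h₃' (π_rUnitor (bimod X Y)) (by
    rw [comp_whiskerRight, comp_whiskerRight, Category.assoc, Category.assoc])
  exact (h₄.trans h₅).trans (π_lUnitor (bimod X Y)).symm

/-- The bimodules `A X` and `Y A` are dual to each other. -/
noncomputable instance : ExactPairing (bimod X Y) (Coring.obj X) where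
  coevaluation' := coev X Y
  evaluation' := ev X Y
  coevaluation_evaluation' := by
    have := exact_zig X Y
    rw [← Category.assoc, ← Category.assoc, ← Iso.eq_comp_inv, Category.assoc] at this
    exact this
  evaluation_coevaluation' := by
    have := exact_zag X Y
    rw [← Category.assoc, ← Category.assoc, ← Iso.eq_comp_inv, Category.assoc] at this
    exact this

variable [ComonObj X]

/-- The `A`-ring `Y A`, dual to the `A`-coring `A X`. -/
@[reducible]
noncomputable def monObj : MonObj (bimod X Y) :=
  letI := Coring.comonObj X
  dualMonObj (Coring.obj X) (bimod X Y)

end Duality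
end Cowreath

namespace Cowreath
variable {C : Type u} [Category.{v} C] [MonoidalCategory C] {A : Mon C}

namespace RightModule

/-- Right linear morphisms. -/
@[ext]
structure Hom (M N : RightModule A) where
  /-- the underlying morphism -/
  hom : M.X ⟶ N.X
  act_hom : M.act ≫ hom = hom ▷ A.X ≫ N.act

instance : Category (RightModule A) where
  Hom := Hom
  id M := ⟨𝟙 _, by simp⟩
  comp f g := ⟨f.hom ≫ g.hom, by
    rw [reassoc_of% f.act_hom, g.act_hom, comp_whiskerRight, Category.assoc]⟩

/-- The regular right module. -/
def regular (A : Mon C) : RightModule A where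
  X := A.X
  act := μ[A.X]
  act_one := MonObj.mul_one A.X
  act_mul := by simp

end RightModule

/-- Entwined modules over the cowreath `(A, Z, ψ)`. -/
structure EntwinedModule (Z : RightTransfer A) [ComonObj Z] extends RightModule A where
  /-- the coaction -/
  coact : X ⟶ X ⊗ Z.X
  act_coact : act ≫ coact = coact ▷ A.X ≫ (α_ X Z.X A.X).hom ≫ X ◁ Z.ψ ≫
    (α_ X A.X Z.X).inv ≫ act ▷ Z.X
  coassoc : coact ≫ coact ▷ Z.X ≫ (α_ X Z.X Z.X).hom =
    coact ≫ X ◁ cδ Z ≫ (α_ X A.X (Z.X ⊗ Z.X)).inv ≫ act ▷ (Z.X ⊗ Z.X)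
  counit : coact ≫ X ◁ cε Z ≫ act = 𝟙 X

namespace EntwinedModule
variable {X : RightTransfer A} [ComonObj X]

/-- Right linear and right colinear morphisms. -/
@[ext]
structure Hom (M N : EntwinedModule X) extends RightModule.Hom M.toRightModule N.toRightModule where
  coact_hom : hom ≫ N.coact = M.coact ≫ hom ▷ X.X

instance : Category (EntwinedModule X) where
  Hom := Hom
  id M := { hom := 𝟙 _, act_hom := by simp, coact_hom := by simp }
  comp f g :=
    { hom := f.hom ≫ g.hom
      act_hom := by rw [reassoc_of% f.act_hom, g.act_hom, comp_whiskerRight, Category.assoc]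
      coact_hom := by
        rw [Category.assoc, g.coact_hom, reassoc_of% f.coact_hom, comp_whiskerRight] }

variable (X) in
/-- The forgetful functor from entwined modules to right `A`-modules. -/
def forget : EntwinedModule X ⥤ RightModule A where
  obj M := M.toRightModule
  map f := f.toHom

end EntwinedModule

/-- A functor is Frobenius if it has a right adjoint that is also a left adjoint. -/
def IsFrobeniusFunctor {D E : Type*} [Category* D] [Category* E] (F : D ⥤ E) : Prop :=
  ∃ G : E ⥤ D, Nonempty (F ⊣ G) ∧ Nonempty (G ⊣ F)

/-- Left `⊗`-generators: morphisms `f, g : Y Z ⟶ W` are equal as soon as `f ∘ (h Z) = g ∘ (h Z)`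
for all `h : P ⟶ Y`. -/
def IsLeftTensorGenerator (P : C) : Prop :=
  ∀ ⦃Y Z W : C⦄ (f g : Y ⊗ Z ⟶ W), (∀ h : P ⟶ Y, h ▷ Z ≫ f = h ▷ Z ≫ g) → f = g

namespace Coring
variable (X : RightTransfer A) [ComonObj X]

lemma ψ₂_eq (W : C) (f : W ⟶ A.X ⊗ (X.X ⊗ X.X)) : f ▷ A.X ≫ (α_ _ _ _).hom ≫ lext A (ψ₂ X) =
    𝟙 _ ⊗≫ (f ≫ (α_ _ _ _).inv) ▷ A.X ⊗≫ (A.X ⊗ X.X) ◁ X.ψ ⊗≫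
      lext A X.ψ ▷ X.X ⊗≫ 𝟙 _ := by
  simp only [lext, ψ₂]; monoidal

/-- The entwined module `A X`, with coaction `(m X X) ∘ (A δ)`. -/
def entwined : EntwinedModule X where
  X := A.X ⊗ X.X
  act := (obj X).actRight
  act_one := (obj X).actRight_one
  act_mul := (obj X).right_assoc
  coact := A.X ◁ cδ X ≫ (α_ A.X A.X (X.X ⊗ X.X)).inv ≫ μ[A.X] ▷ (X.X ⊗ X.X) ≫
    (α_ A.X X.X X.X).inv
  act_coact := by
    calc _ = ((α_ A.X X.X A.X).hom ≫ lext A X.ψ) ≫ (lext A (cδ X) ≫ (α_ _ _ _).inv) := by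
          simp [lext]
      _ = (α_ _ _ _).hom ≫ lext A (X.ψ ≫ lext A (cδ X)) ≫ (α_ _ _ _).inv := by
          rw [lext_comp]; simp
      _ = lext A (cδ X) ▷ A.X ≫ (α_ _ _ _).hom ≫ lext A (ψ₂ X) ≫ (α_ _ _ _).inv := by
          rw [ψ_cδ, lext_comp, rten_lext, rten]; simp
      _ = 𝟙 _ ⊗≫ (lext A (cδ X) ▷ A.X ≫ (α_ _ _ _).hom ≫ lext A (ψ₂ X)) ⊗≫ 𝟙 _ := by monoidal
      _ = _ := by rw [ψ₂_eq]; simp only [lext]; monoidal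
  coassoc := by
    calc _ = 𝟙 _ ⊗≫ lext A ((cδ X ≫ lext A (rten (cδ X) X.X)) ≫ A.X ◁ (α_ X.X X.X X.X).hom) ⊗≫ 𝟙 _ := by
          rw [lext_postcomp, lext_comp]; simp only [lext, rten]; monoidal
      _ = 𝟙 _ ⊗≫ lext A (cδ X) ⊗≫ lext A (X.lten (cδ X)) ⊗≫ 𝟙 _ := by
          rw [Category.assoc, ← cδ_assoc, lext_comp]; monoidal
      _ = _ := by simp only [lext, RightTransfer.lten]; monoidal
  counit := by
    calc _ = 𝟙 _ ⊗≫ lext A (cδ X ≫ lext A (X.lten (cε X ≫ (ρ_ A.X).inv))) ⊗≫ 𝟙 _ := by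
          rw [lext_comp]; simp only [lext, RightTransfer.lten]; monoidal
      _ = 𝟙 _ ⊗≫ lext A (lunit A X.X) ⊗≫ 𝟙 _ := by
          rw [cδ_cε_right, lext_precomp]; simp only [lext, lunit]; monoidal
      _ = _ := by rw [lext_lunit]; monoidal

end Coring

namespace Duality
variable (X : RightTransfer A) (Y : C) [ExactPairing Y X.X] [ComonObj X]

/-- The wreath product algebra `Y A`. -/
abbrev mon : Mon C :=
  letI := dualTransferMonObj X Y
  { X := Y ⊗ A.X, mon := Wreath.monObj (dualTransfer X Y) }

/-- The algebra extension `(Y m) ∘ (η A) : A ⟶ Y A`, where `η : 1 ⟶ Y A` is the unit. -/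
def incl : A ⟶ mon X Y where
  hom := (λ_ A.X).inv ≫ wOne X Y ▷ A.X ≫ (α_ Y A.X A.X).hom ≫ Y ◁ μ[A.X]
  isMonHom_hom :=
    letI := dualTransferMonObj X Y
    letI : MonObj (Y ⊗ A.X) := (mon X Y).mon
    { one_hom := Wreath.one_i (dualTransfer X Y)
      mul_hom := (Wreath.i_i (dualTransfer X Y)).symm }

lemma mul_eq : (mon X Y).mon.mul = 𝟙 _ ⊗≫ Y ◁ dualφ X Y ▷ A.X ⊗≫ (Y ⊗ Y) ◁ μ[A.X] ⊗≫
    rext A (wMul X Y) :=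
  letI := dualTransferMonObj X Y
  Wreath.mul_eq' (dualTransfer X Y)

variable {X Y}

/-- A right `Y A`-module from actions `μ : N A ⟶ N` and `κ : N Y ⟶ N`. -/
def moduleOf (N : RightModule A) (κ : N.X ⊗ Y ⟶ N.X)
    (h₁ : N.act ▷ Y ≫ κ = (α_ N.X A.X Y).hom ≫ N.X ◁ dualφ X Y ≫ (α_ N.X Y A.X).inv ≫
      κ ▷ A.X ≫ N.act)
    (h₂ : κ ▷ Y ≫ κ = (α_ N.X Y Y).hom ≫ N.X ◁ wMul X Y ≫ (α_ N.X Y A.X).inv ≫ κ ▷ A.X ≫ N.act)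
    (h₃ : (ρ_ N.X).inv ≫ N.X ◁ wOne X Y ≫ (α_ N.X Y A.X).inv ≫ κ ▷ A.X ≫ N.act = 𝟙 _) :
    RightModule (mon X Y) where
  X := N.X
  act := (α_ N.X Y A.X).inv ≫ κ ▷ A.X ≫ N.act
  act_one := by
    rw [Iso.inv_comp_eq, Category.comp_id] at h₃
    exact h₃
  act_mul := by
    calc _ = 𝟙 _ ⊗≫ N.X ◁ Y ◁ dualφ X Y ▷ A.X ⊗≫ N.X ◁ (Y ⊗ Y) ◁ μ[A.X] ⊗≫
            N.X ◁ wMul X Y ▷ A.X ⊗≫ ((N.X ⊗ Y) ◁ μ[A.X] ≫ κ ▷ A.X) ⊗≫ N.act := by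
          rw [mul_eq]; simp only [rext]; monoidal
      _ = 𝟙 _ ⊗≫ N.X ◁ Y ◁ dualφ X Y ▷ A.X ⊗≫ N.X ◁ (Y ⊗ Y) ◁ μ[A.X] ⊗≫
            N.X ◁ wMul X Y ▷ A.X ⊗≫ κ ▷ (A.X ⊗ A.X) ⊗≫
            ((α_ N.X A.X A.X).inv ≫ N.act ▷ A.X ≫ N.act) := by
          rw [whisker_exchange, ← N.act_mul]; monoidal
      _ = 𝟙 _ ⊗≫ N.X ◁ Y ◁ dualφ X Y ▷ A.X ⊗≫ N.X ◁ (Y ⊗ Y) ◁ μ[A.X] ⊗≫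
            ((α_ N.X Y Y).hom ≫ N.X ◁ wMul X Y ≫ (α_ N.X Y A.X).inv ≫ κ ▷ A.X ≫ N.act) ▷ A.X ≫
              N.act := by
          monoidal
      _ = 𝟙 _ ⊗≫ N.X ◁ Y ◁ dualφ X Y ▷ A.X ⊗≫ ((N.X ⊗ Y) ◁ (Y ◁ μ[A.X]) ≫
            κ ▷ (Y ⊗ A.X)) ⊗≫ κ ▷ A.X ⊗≫ N.act := by
          rw [← h₂]; monoidal
      _ = 𝟙 _ ⊗≫ ((N.X ⊗ Y) ◁ dualφ X Y ≫ κ ▷ (Y ⊗ A.X)) ▷ A.X ⊗≫ ((N.X ⊗ Y) ◁ μ[A.X] ≫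
            κ ▷ A.X) ⊗≫ N.act := by
          rw [whisker_exchange]; monoidal
      _ = 𝟙 _ ⊗≫ κ ▷ (A.X ⊗ Y) ▷ A.X ⊗≫ N.X ◁ dualφ X Y ▷ A.X ⊗≫ κ ▷ A.X ▷ A.X ⊗≫
            (N.X ◁ μ[A.X] ≫ N.act) := by
          rw [whisker_exchange, whisker_exchange]; monoidal
      _ = 𝟙 _ ⊗≫ κ ▷ (A.X ⊗ Y) ▷ A.X ⊗≫ ((α_ N.X A.X Y).hom ≫ N.X ◁ dualφ X Y ≫ (α_ N.X Y A.X).inv ≫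
      κ ▷ A.X ≫ N.act) ▷ A.X ⊗≫ N.act := by
          rw [N.act_mul]; monoidal
      _ = _ := by rw [← h₁]; monoidal


lemma hat_dualφ' {N : C} {W : C} (f : W ⟶ N ⊗ X.X) :
    f ▷ (A.X ⊗ Y) ⊗≫ N ◁ X.X ◁ dualφ X Y ⊗≫ N ◁ ε_ Y X.X ▷ A.X = f ▷ (A.X ⊗ Y) ⊗≫
      N ◁ X.ψ ▷ Y ⊗≫ N ◁ A.X ◁ ε_ Y X.X ⊗≫ 𝟙 (N ⊗ (𝟙_ C ⊗ A.X)) := by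
  calc _ = f ▷ (A.X ⊗ Y) ⊗≫ N ◁ (X.X ◁ dualφ X Y ≫ (α_ X.X Y A.X).inv ≫ ε_ Y X.X ▷ A.X) := by
        monoidal
    _ = _ := by rw [hat_dualφ]; monoidal

/-- Entwined modules are right `Y A`-modules, with action `N Y A ⟶ N X Y A ⟶ N A ⟶ N`. -/
def toModule (N : EntwinedModule X) : RightModule (mon X Y) :=
  moduleOf N.toRightModule (N.coact ▷ Y ≫ (α_ N.X X.X Y).hom ≫ N.X ◁ ε_ Y X.X ≫ (ρ_ N.X).hom)
    (by
      calc _ = 𝟙 _ ⊗≫ (N.act ≫ N.coact) ▷ Y ⊗≫ N.X ◁ ε_ Y X.X ⊗≫ 𝟙 _ := by monoidal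
        _ = 𝟙 _ ⊗≫ (N.coact ▷ A.X) ▷ Y ⊗≫ N.X ◁ X.ψ ▷ Y ⊗≫ (N.act ▷ (X.X ⊗ Y) ≫
              N.X ◁ ε_ Y X.X) ⊗≫ 𝟙 _ := by
            rw [N.act_coact]; monoidal
        _ = 𝟙 _ ⊗≫ (N.coact ▷ (A.X ⊗ Y) ⊗≫ N.X ◁ X.ψ ▷ Y ⊗≫ N.X ◁ A.X ◁ ε_ Y X.X ⊗≫
              𝟙 (N.X ⊗ (𝟙_ C ⊗ A.X))) ⊗≫ N.act := by
            rw [← whisker_exchange]; monoidal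
        _ = 𝟙 _ ⊗≫ (N.coact ▷ (A.X ⊗ Y) ≫ (N.X ⊗ X.X) ◁ dualφ X Y) ⊗≫ N.X ◁ ε_ Y X.X ▷ A.X ⊗≫
              N.act := by
            rw [← hat_dualφ']; monoidal
        _ = _ := by rw [← whisker_exchange]; monoidal)
    (by
      calc _ = 𝟙 _ ⊗≫ N.coact ▷ (Y ⊗ Y) ⊗≫ (N.X ◁ (ε_ Y X.X ▷ Y) ≫ N.coact ▷ (𝟙_ C ⊗ Y)) ⊗≫
            N.X ◁ ε_ Y X.X ⊗≫ 𝟙 _ := by monoidal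
        _ = 𝟙 _ ⊗≫ (N.coact ≫ N.coact ▷ X.X ≫ (α_ N.X X.X X.X).hom) ▷ (Y ⊗ Y) ⊗≫
            N.X ◁ ev₂ X.X Y ⊗≫ 𝟙 _ := by
          rw [whisker_exchange]; simp only [ev₂]; monoidal
        _ = 𝟙 _ ⊗≫ N.coact ▷ (Y ⊗ Y) ⊗≫ N.X ◁ cδ X ▷ (Y ⊗ Y) ⊗≫ (N.act ▷ ((X.X ⊗ X.X) ⊗ (Y ⊗ Y)) ≫
            N.X ◁ ev₂ X.X Y) ⊗≫ 𝟙 _ := by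
          rw [N.coassoc]; monoidal
        _ = 𝟙 _ ⊗≫ N.coact ▷ (Y ⊗ Y) ⊗≫ N.X ◁ (cδ X ▷ (Y ⊗ Y) ≫
            (α_ A.X (X.X ⊗ X.X) (Y ⊗ Y)).hom ≫ A.X ◁ ev₂ X.X Y ≫ (ρ_ A.X).hom ≫
              (λ_ A.X).inv) ⊗≫ N.act := by
          rw [← whisker_exchange]; monoidal
        _ = 𝟙 _ ⊗≫ (N.coact ▷ (Y ⊗ Y) ≫ (N.X ⊗ X.X) ◁ wMul X Y) ⊗≫ N.X ◁ ε_ Y X.X ▷ A.X ⊗≫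
              N.act := by
          rw [← hat_wMul]; monoidal
        _ = _ := by rw [← whisker_exchange]; monoidal)
    (by
      calc _ = 𝟙 _ ⊗≫ (N.X ◁ wOne X Y ≫ N.coact ▷ (Y ⊗ A.X)) ⊗≫ N.X ◁ ε_ Y X.X ▷ A.X ⊗≫
            N.act := by monoidal
        _ = 𝟙 _ ⊗≫ N.coact ⊗≫ N.X ◁ (X.X ◁ wOne X Y ≫ (α_ X.X Y A.X).inv ≫ ε_ Y X.X ▷ A.X) ⊗≫
            N.act := by
          rw [whisker_exchange]; monoidal
        _ = 𝟙 _ ⊗≫ (N.coact ≫ N.X ◁ cε X ≫ N.act) := by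
          rw [hat_wOne]; monoidal
        _ = _ := by rw [N.counit]; monoidal)

variable (X Y) in
lemma coev_wMul : (η_ Y X.X ≫ Y ◁ ((λ_ X.X).inv ≫ η_ Y X.X ▷ X.X ≫ (α_ _ _ _).hom)) ⊗≫
      wMul X Y ▷ (X.X ⊗ X.X) ⊗≫ 𝟙 (Y ⊗ (A.X ⊗ (X.X ⊗ X.X))) =
    η_ Y X.X ≫ Y ◁ cδ X := hat_injective (X := X.X) (by
  calc _ = 𝟙 _ ⊗≫ X.X ◁ η_ Y X.X ⊗≫ X.X ◁ Y ◁ η_ Y X.X ▷ X.X ⊗≫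
        (X.X ◁ wMul X Y ≫ (α_ X.X Y A.X).inv ≫ ε_ Y X.X ▷ A.X) ▷ (X.X ⊗ X.X) ⊗≫ 𝟙 _ := by
        simp only [hat]; monoidal
    _ = 𝟙 _ ⊗≫ (X.X ◁ (η_ Y X.X ⊗≫ Y ◁ η_ Y X.X ▷ X.X) ≫ cδ X ▷ (Y ⊗ ((Y ⊗ X.X) ⊗ X.X))) ⊗≫
        A.X ◁ ev₂ X.X Y ▷ (X.X ⊗ X.X) ⊗≫ 𝟙 _ := by
        rw [hat_wMul]; monoidal
    _ = 𝟙 _ ⊗≫ cδ X ⊗≫ A.X ◁ X.X ◁ X.X ◁ η_ Y X.X ⊗≫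
        A.X ◁ X.X ◁ ((X.X ⊗ Y) ◁ (η_ Y X.X ▷ X.X) ≫ ε_ Y X.X ▷ ((Y ⊗ X.X) ⊗ X.X)) ⊗≫
        A.X ◁ ε_ Y X.X ▷ (X.X ⊗ X.X) ⊗≫ 𝟙 _ := by
        rw [whisker_exchange]; simp only [ev₂]; monoidal
    _ = 𝟙 _ ⊗≫ cδ X ⊗≫
        A.X ◁ X.X ◁ (X.X ◁ η_ Y X.X ≫ (α_ _ _ _).inv ≫ ε_ Y X.X ▷ X.X) ⊗≫
        A.X ◁ (X.X ◁ η_ Y X.X ≫ (α_ _ _ _).inv ≫ ε_ Y X.X ▷ X.X) ▷ X.X ⊗≫ 𝟙 _ := by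
        rw [whisker_exchange]; monoidal
    _ = 𝟙 _ ⊗≫ cδ X ⊗≫ 𝟙 _ := by
        rw [ExactPairing.coevaluation_evaluation]; monoidal
    _ = 𝟙 _ ⊗≫ (X.X ◁ η_ Y X.X ≫ (α_ _ _ _).inv ≫ ε_ Y X.X ▷ X.X) ⊗≫ cδ X := by
        rw [ExactPairing.coevaluation_evaluation]; monoidal
    _ = 𝟙 _ ⊗≫ X.X ◁ η_ Y X.X ⊗≫ (ε_ Y X.X ▷ X.X ≫ 𝟙_ C ◁ cδ X) ⊗≫ 𝟙 _ := by
        monoidal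
    _ = _ := by rw [← whisker_exchange]; simp only [hat]; monoidal)

/-- An entwined module from actions `μ : N A ⟶ N` and `κ : N Y ⟶ N`; the coaction is
`N ⟶ N Y X ⟶ N X`. -/
def entwinedOf (N : RightModule A) (κ : N.X ⊗ Y ⟶ N.X)
    (h₁ : N.act ▷ Y ≫ κ = (α_ N.X A.X Y).hom ≫ N.X ◁ dualφ X Y ≫ (α_ N.X Y A.X).inv ≫
      κ ▷ A.X ≫ N.act)
    (h₂ : κ ▷ Y ≫ κ = (α_ N.X Y Y).hom ≫ N.X ◁ wMul X Y ≫ (α_ N.X Y A.X).inv ≫ κ ▷ A.X ≫ N.act)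
    (h₃ : (ρ_ N.X).inv ≫ N.X ◁ wOne X Y ≫ (α_ N.X Y A.X).inv ≫ κ ▷ A.X ≫ N.act = 𝟙 _) :
    EntwinedModule X where
  toRightModule := N
  coact := (ρ_ N.X).inv ≫ N.X ◁ η_ Y X.X ≫ (α_ N.X Y X.X).inv ≫ κ ▷ X.X
  act_coact := by
    calc _ = 𝟙 _ ⊗≫ (N.act ▷ 𝟙_ C ≫ N.X ◁ η_ Y X.X) ⊗≫ κ ▷ X.X := by monoidal
      _ = 𝟙 _ ⊗≫ (N.X ⊗ A.X) ◁ η_ Y X.X ⊗≫ (N.act ▷ Y ≫ κ) ▷ X.X := by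
        rw [← whisker_exchange]; monoidal
      _ = 𝟙 _ ⊗≫ N.X ◁ ((ρ_ A.X).inv ≫ A.X ◁ η_ Y X.X ≫ (α_ A.X Y X.X).inv ≫ dualφ X Y ▷ X.X ≫
            (α_ Y A.X X.X).hom) ⊗≫ κ ▷ A.X ▷ X.X ⊗≫ N.act ▷ X.X := by
        rw [h₁]; monoidal
      _ = 𝟙 _ ⊗≫ N.X ◁ η_ Y X.X ▷ A.X ⊗≫ ((N.X ⊗ Y) ◁ X.ψ ≫ κ ▷ (A.X ⊗ X.X)) ⊗≫ N.act ▷ X.X := by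
        rw [← b₁_eq]; simp only [b₁]; monoidal
      _ = _ := by rw [whisker_exchange]; monoidal
  coassoc := by
    calc _ = 𝟙 _ ⊗≫ N.X ◁ η_ Y X.X ⊗≫ (κ ▷ (𝟙_ C ⊗ X.X) ≫ N.X ◁ (η_ Y X.X ▷ X.X)) ⊗≫
          κ ▷ X.X ▷ X.X ⊗≫ 𝟙 _ := by monoidal
      _ = 𝟙 _ ⊗≫ N.X ◁ η_ Y X.X ⊗≫ (N.X ⊗ Y) ◁ (η_ Y X.X ▷ X.X) ⊗≫
          (κ ▷ Y ≫ κ) ▷ (X.X ⊗ X.X) ⊗≫ 𝟙 _ := by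
        rw [← whisker_exchange]; monoidal
      _ = 𝟙 _ ⊗≫ N.X ◁ ((η_ Y X.X ≫ Y ◁ ((λ_ X.X).inv ≫ η_ Y X.X ▷ X.X ≫ (α_ _ _ _).hom)) ⊗≫
          wMul X Y ▷ (X.X ⊗ X.X) ⊗≫ 𝟙 (Y ⊗ (A.X ⊗ (X.X ⊗ X.X)))) ⊗≫
          κ ▷ A.X ▷ (X.X ⊗ X.X) ⊗≫ N.act ▷ (X.X ⊗ X.X) := by
        rw [h₂]; monoidal
      _ = 𝟙 _ ⊗≫ N.X ◁ η_ Y X.X ⊗≫ ((N.X ⊗ Y) ◁ cδ X ≫ κ ▷ (A.X ⊗ (X.X ⊗ X.X))) ⊗≫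
          N.act ▷ (X.X ⊗ X.X) := by
        rw [coev_wMul]; monoidal
      _ = _ := by rw [whisker_exchange]; monoidal
  counit := by
    calc _ = 𝟙 _ ⊗≫ N.X ◁ η_ Y X.X ⊗≫ (κ ▷ X.X ≫ N.X ◁ cε X) ⊗≫ N.act := by monoidal
      _ = (ρ_ N.X).inv ≫ N.X ◁ wOne X Y ≫ (α_ N.X Y A.X).inv ≫ κ ▷ A.X ≫ N.act := by
        rw [← whisker_exchange]; simp only [wOne]; monoidal
      _ = _ := h₃

section restriction
variable (X Y)

/-- `wreathMul` : the multiplication of `Y A` -/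
def wreathMul : (Y ⊗ A.X) ⊗ (Y ⊗ A.X) ⟶ Y ⊗ A.X := (mon X Y).mon.mul

lemma mul_eq'' : wreathMul X Y = 𝟙 _ ⊗≫ Y ◁ dualφ X Y ▷ A.X ⊗≫ (Y ⊗ Y) ◁ μ[A.X] ⊗≫
    rext A (wMul X Y) := mul_eq X Y

lemma mul_incl : (Y ⊗ A.X) ◁ (incl X Y).hom ≫ wreathMul X Y = (α_ _ _ _).hom ≫ Y ◁ μ[A.X] :=
  letI := dualTransferMonObj X Y
  Wreath.mul_i (dualTransfer X Y)

lemma incl_mul : (incl X Y).hom ▷ (Y ⊗ A.X) ≫ wreathMul X Y = (bimod X Y).actLeft := by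
  letI := dualTransferMonObj X Y
  refine (Wreath.i_mul (dualTransfer X Y)).trans ?_
  rfl

end restriction

end Duality
end Cowreath

namespace Cowreath
variable {C : Type u} [Category.{v} C] [MonoidalCategory C] {A : Mon C}

/-- Restriction of scalars along an algebra morphism `i : A ⟶ S`. -/
abbrev RightModule.restrict {S : Mon C} (i : A ⟶ S) (N : RightModule S) : RightModule A where
  X := N.X
  act := N.X ◁ i.hom ≫ N.act
  act_one := by
    rw [← whiskerLeft_comp_assoc, Extension.one_i, N.act_one]
  act_mul := by
    calc _ = N.X ◁ i.hom ▷ A.X ≫ N.X ◁ S.X ◁ i.hom ≫ (N.X ◁ μ[S.X] ≫ N.act) := by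
          rw [← whiskerLeft_comp_assoc, Extension.mul_i]; monoidal
      _ = 𝟙 _ ⊗≫ (N.X ◁ i.hom) ▷ A.X ⊗≫ ((N.X ⊗ S.X) ◁ i.hom ≫ N.act ▷ S.X) ≫ N.act := by
          rw [N.act_mul]; monoidal
      _ = _ := by rw [whisker_exchange]; monoidal

namespace Duality
variable (X : RightTransfer A) (Y : C) [ExactPairing Y X.X] [ComonObj X]

lemma runit_mul_incl : (runit A Y ▷ A.X ≫ (Y ⊗ A.X) ◁ (incl X Y).hom) ≫ wreathMul X Y = 𝟙 _ := by
  rw [Category.assoc, mul_incl]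
  calc _ = 𝟙 _ ⊗≫ Y ◁ (η[A.X] ▷ A.X ≫ μ[A.X]) := by simp only [runit]; monoidal
    _ = _ := by rw [MonObj.one_mul]; monoidal

lemma incl_mul_runit : ((incl X Y).hom ▷ Y ≫ (Y ⊗ A.X) ◁ runit A Y) ≫ wreathMul X Y =
    dualφ X Y := by
  calc _ = A.X ◁ runit A Y ≫ ((incl X Y).hom ▷ (Y ⊗ A.X) ≫ wreathMul X Y) := by
        rw [← whisker_exchange, Category.assoc]
    _ = 𝟙 _ ⊗≫ ((A.X ⊗ Y) ◁ η[A.X] ≫ dualφ X Y ▷ A.X) ⊗≫ Y ◁ μ[A.X] := by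
        rw [incl_mul]; simp only [runit]; monoidal
    _ = 𝟙 _ ⊗≫ dualφ X Y ⊗≫ Y ◁ (A.X ◁ η[A.X] ≫ μ[A.X]) := by
        rw [whisker_exchange]; monoidal
    _ = _ := by rw [MonObj.mul_one]; monoidal

lemma one_dualφ : (λ_ Y).inv ≫ η[A.X] ▷ Y ≫ dualφ X Y = (ρ_ Y).inv ≫ Y ◁ η[A.X] :=
  (dualTransfer X Y).one_φ

lemma runit_mul_runit : (runit A Y ▷ Y ≫ (Y ⊗ A.X) ◁ runit A Y) ≫ wreathMul X Y = wMul X Y := by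
  calc _ = 𝟙 _ ⊗≫ Y ◁ η[A.X] ▷ Y ⊗≫ Y ◁ ((A.X ⊗ Y) ◁ η[A.X] ≫ dualφ X Y ▷ A.X) ⊗≫
        (Y ⊗ Y) ◁ μ[A.X] ⊗≫ rext A (wMul X Y) := by
        rw [mul_eq'']; simp only [runit]; monoidal
    _ = 𝟙 _ ⊗≫ Y ◁ ((λ_ Y).inv ≫ η[A.X] ▷ Y ≫ dualφ X Y) ⊗≫
        (Y ⊗ Y) ◁ (A.X ◁ η[A.X] ≫ μ[A.X]) ⊗≫ rext A (wMul X Y) := by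
        rw [whisker_exchange]; monoidal
    _ = 𝟙 _ ⊗≫ (runit A (Y ⊗ Y) ≫ rext A (wMul X Y)) := by
        rw [one_dualφ, MonObj.mul_one]; simp only [runit]; monoidal
    _ = _ := by rw [runit_rext]; monoidal

variable {X Y}

/-- the right `A`-action -/
abbrev actA (N : RightModule (mon X Y)) : RightModule A := N.restrict (incl X Y)

/-- the action of `Y` -/
def actY (N : RightModule (mon X Y)) : N.X ⊗ Y ⟶ N.X := N.X ◁ runit A Y ≫ N.act

lemma act_act (N : RightModule (mon X Y)) {P Q : C} (f : P ⟶ Y ⊗ A.X) (g : Q ⟶ Y ⊗ A.X)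
    {h : P ⊗ Q ⟶ Y ⊗ A.X} (hh : (f ▷ Q ≫ (Y ⊗ A.X) ◁ g) ≫ wreathMul X Y = h) :
    (N.X ◁ f ≫ (N.act : N.X ⊗ (Y ⊗ A.X) ⟶ N.X)) ▷ Q ≫ N.X ◁ g ≫ (N.act : N.X ⊗ (Y ⊗ A.X) ⟶ N.X) =
      (α_ _ _ _).hom ≫ N.X ◁ h ≫ (N.act : N.X ⊗ (Y ⊗ A.X) ⟶ N.X) := by
  subst hh
  have h := N.act_mul
  change N.X ◁ wreathMul X Y ≫ (N.act : N.X ⊗ (Y ⊗ A.X) ⟶ N.X) =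
    (α_ N.X (Y ⊗ A.X) (Y ⊗ A.X)).inv ≫ (N.act : N.X ⊗ (Y ⊗ A.X) ⟶ N.X) ▷ (Y ⊗ A.X) ≫
      (N.act : N.X ⊗ (Y ⊗ A.X) ⟶ N.X) at h
  generalize (N.act : N.X ⊗ (Y ⊗ A.X) ⟶ N.X) = a at h ⊢
  calc _ = (N.X ◁ f) ▷ Q ≫ (a ▷ Q ≫ N.X ◁ g) ≫ a := by monoidal
    _ = 𝟙 _ ⊗≫ N.X ◁ f ▷ Q ⊗≫ N.X ◁ (Y ⊗ A.X) ◁ g ⊗≫ ((α_ N.X (Y ⊗ A.X) (Y ⊗ A.X)).inv ≫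
          a ▷ (Y ⊗ A.X) ≫ a) := by
        rw [← whisker_exchange]; monoidal
    _ = _ := by rw [← h]; monoidal

lemma act_eq (N : RightModule (mon X Y)) : (α_ N.X Y A.X).inv ≫ actY N ▷ A.X ≫ (actA N).act =
    N.act :=
  (Iso.inv_comp_eq _).2 ((act_act N (runit A Y) (incl X Y).hom (runit_mul_incl X Y)).trans (by simp))

/-- Right `Y A`-modules are entwined modules. -/
def toEntwined (N : RightModule (mon X Y)) : EntwinedModule X :=
  entwinedOf (actA N) (actY N)
    ((act_act N (incl X Y).hom (runit A Y) (incl_mul_runit X Y)).trans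
      (congrArg (fun z => (α_ N.X A.X Y).hom ≫ N.X ◁ dualφ X Y ≫ z) (act_eq N).symm))
    ((act_act N (runit A Y) (runit A Y) (runit_mul_runit X Y)).trans
      (congrArg (fun z => (α_ N.X Y Y).hom ≫ N.X ◁ wMul X Y ≫ z) (act_eq N).symm))
    ((congrArg (fun z => (ρ_ N.X).inv ≫ N.X ◁ wOne X Y ≫ z) (act_eq N)).trans
      ((Iso.inv_comp_eq _).2 (N.act_one.trans (Category.comp_id _).symm)))

end Duality
end Cowreath

namespace Cowreath
variable {C : Type u} [Category.{v} C] [MonoidalCategory C] {A : Mon C}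

section
variable {X : RightTransfer A} [ComonObj X] {Y : C} [ExactPairing Y X.X]

variable (Y) in
/-- For `t : 1 ⟶ X` in the category of right transfer morphisms, the composite
`Y A ⟶ A X Y A ⟶ A A X X Y A ⟶ A A X A ⟶ A A A X ⟶ A X` of `t`, `δ`, `d`, `ψ` and the
multiplication of `A`. -/
def frobeniusMap (t : 𝟙_ (RightTransfer A) ⟶ X) : Y ⊗ A.X ⟶ A.X ⊗ X.X :=
  (λ_ (Y ⊗ A.X)).inv ≫ (t.hom : 𝟙_ C ⟶ A.X ⊗ X.X) ▷ (Y ⊗ A.X) ≫ (α_ A.X X.X (Y ⊗ A.X)).hom ≫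
    A.X ◁ (cδ X ▷ (Y ⊗ A.X) ≫ (α_ A.X (X.X ⊗ X.X) (Y ⊗ A.X)).hom ≫
      A.X ◁ ((α_ X.X X.X (Y ⊗ A.X)).hom ≫
        X.X ◁ ((α_ X.X Y A.X).inv ≫ ε_ Y X.X ▷ A.X ≫ (λ_ A.X).hom) ≫ X.ψ) ≫
      (α_ A.X A.X X.X).inv ≫ μ[A.X] ▷ X.X) ≫
    (α_ A.X A.X X.X).inv ≫ μ[A.X] ▷ X.X

variable (Y) in
/-- For `B : X X ⟶ 1` in the category of right transfer morphisms, the composite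
`A X ⟶ Y X A X ⟶ Y A X X ⟶ Y A A ⟶ Y A` of `b`, `ψ`, `B` and the multiplication of `A`. -/
def casimirMap (B : X ⊗ X ⟶ 𝟙_ (RightTransfer A)) : A.X ⊗ X.X ⟶ Y ⊗ A.X :=
  (λ_ (A.X ⊗ X.X)).inv ≫ η_ Y X.X ▷ (A.X ⊗ X.X) ≫ (α_ Y X.X (A.X ⊗ X.X)).hom ≫
    Y ◁ ((α_ X.X A.X X.X).inv ≫ X.ψ ▷ X.X ≫ (α_ A.X X.X X.X).hom ≫
      A.X ◁ ((B.hom : X.X ⊗ X.X ⟶ A.X ⊗ 𝟙_ C) ≫ (ρ_ A.X).hom) ≫ μ[A.X])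

variable (X Y) in
/-- `A X` and `Y A` are isomorphic as left `A`-modules and as right modules over the wreath product
algebra `Y A`. -/
def IsoAsModules : Prop :=
  ∃ e : Duality.toModule (Y := Y) (Coring.entwined X) ≅ RightModule.regular (Duality.mon X Y),
    (Coring.obj X).actLeft ≫ (e.hom.hom : A.X ⊗ X.X ⟶ Y ⊗ A.X) =
      A.X ◁ (e.hom.hom : A.X ⊗ X.X ⟶ Y ⊗ A.X) ≫ (Duality.bimod X Y).actLeft

variable (X Y) in
/-- `A X` and `Y A` are isomorphic as left `A`-modules and as entwined modules. -/
def IsoAsEntwinedModules : Prop :=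
  ∃ e : Coring.entwined X ≅ Duality.toEntwined (RightModule.regular (Duality.mon X Y)),
    (Coring.obj X).actLeft ≫ (e.hom.hom : A.X ⊗ X.X ⟶ Y ⊗ A.X) =
      A.X ◁ (e.hom.hom : A.X ⊗ X.X ⟶ Y ⊗ A.X) ≫ (Duality.bimod X Y).actLeft

end
end Cowreath

open Cowreath

/-!
All the conditions are compared with one statement about the algebra extension `A ⟶ S = Y A`.

The `A`-coring `P = A X` is an `A`-`S`-bimodule, the action of `S` being that of an entwined module.
Its counit `ev : P ⟶ A` and the coevaluation of `X ⊣ Y` make it the left dual of the right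
`A`-module `S` (`Duality.extensionDual`): the pairing `⟨p, s⟩ = ev (p s)` has a dual basis `Σ yᵢ ⊗
xᵢ : 1 ⟶ S ⊗ P`. A *Frobenius pair* (`ExtensionDual.IsFrobeniusPair`) consists of a central element
`t` of `P`, `a t = t a`, and a map `Ψ : P ⟶ S`, linear over `A` on the left and over `S` on the
right, such that `Ψ t = 1` and `⟨t, Ψ p⟩ = ev p`; equivalently `s ↦ t s` and `Ψ` are mutually
inverse. So a Frobenius pair is the same as a bilinear isomorphism `P ≅ S`, and the same as a
central `t` for which `s ↦ t s` is invertible.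

* A form `B : X X ⟶ A` extends to a left linear map `A X ⟶ Y A` (`Duality.ofForm`). This map is
  right `A`-linear if and only if `B` is a morphism of right transfer morphisms, and colinear if and
  only if `B` is Casimir; an `S`-linear map is the same as an entwined one
  (`Duality.linear_iff_entwined`). Central elements of `A X` are the morphisms `1 ⟶ X` of right
  transfer morphisms. This settles the conditions on `t`, on `B` and on isomorphisms of modules, and
  turns Frobenius structures `(t, B)` on the coalgebra `X` into Frobenius pairs
  (`Duality.isFrobeniusCoalgebra_iff`).
* A Frobenius system of `A ⟶ S` is a bilinear functional `θ : S ⟶ A` with a Casimir element `e ∈ S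
  ⊗_A S`. The functional is `⟨t, -⟩` for the central element `t = Σ θ(yᵢ) xᵢ`, and `e` corresponds
  to `Ψ p = ⟨p, e¹⟩ e²`, with inverse `e = Σ yᵢ ⊗ Ψ(xᵢ)` (`ExtensionDual.isFrobeniusExtension_iff`).
  Elements of `S ⊗_A S` can be lifted to `S ⊗ S`, because `S ⊗ S ⟶ S ⊗_A S ≅ Y ⊗ S` is split by `y ⊗
  s ↦ y 1 ⊗ s`.
* Under `S ⊗_A S ≅ Y Y A`, the Frobenius systems of `A ⟶ S` are the Frobenius structures on the
  algebra `(Y, φ)`: `θ` is determined by its restriction to `Y`, and being Casimir can be tested on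
  `A` and on `Y`, which generate `S` (`Duality.isWreathSystem_extendForm_iff`).
* The algebra structure that `Y A` has as the dual of the coring `A X` is the one it has as an
  extension of `A`, since both have the same pairing with `A X` (`Duality.dualMul_eq`).
* The forgetful functor has the right adjoint `M ↦ M X` (`forgetAdjCofree`). If `X` is Frobenius, `m
  ↦ m t` and `n ⊗ x ↦ n₀ B(n₁, x)` make this functor a left adjoint as well (`cofreeAdjForget`).
  Conversely the unit of such an adjunction at the module `A` is `a ↦ t a` for some `t : 1 ⟶ A X`,
  and an entwined map out of `A X` is determined by the image of `t`, which can be any element. If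
  `1` is a left `⊗`-generator, naturality at the left multiplications of `A` shows that `t` is
  central. The entwined map `Ψ : A X ⟶ Y A` with `Ψ t = 1` is then inverse to `s ↦ t s`, by the
  universal property.
-/

/-! ### Duals of algebra extensions and Frobenius pairs -/

namespace Cowreath

variable {C : Type u} [Category.{v} C] [MonoidalCategory C]

/-- A left dual of the right `A`-module `S`, for an algebra morphism `i : A ⟶ S`: an
`A`-`S`-bimodule `P` together with `ev : P ⟶ A` and a dual basis `coev = Σ yᵢ ⊗ xᵢ : 1 ⟶ S ⊗ P` for
the pairing `⟨p, s⟩ = ev (p s)` of `P` and `S`. -/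
structure ExtensionDual {A S : Mon C} (i : A ⟶ S) where
  /-- the right `S`-module -/
  P : RightModule S
  /-- the left action of `A` -/
  actL : A.X ⊗ P.X ⟶ P.X
  actL_act : actL ▷ S.X ≫ P.act = (α_ _ _ _).hom ≫ A.X ◁ P.act ≫ actL
  /-- the functional `p ↦ ⟨p, 1⟩` -/
  ev : P.X ⟶ A.X
  actL_ev : actL ≫ ev = A.X ◁ ev ≫ μ[A.X]
  act_ev : P.X ◁ i.hom ≫ P.act ≫ ev = ev ▷ A.X ≫ μ[A.X]
  /-- the dual basis -/
  coev : 𝟙_ C ⟶ S.X ⊗ P.X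
  basis_left : (λ_ S.X).inv ≫ coev ▷ S.X ≫ (α_ _ _ _).hom ≫ S.X ◁ (P.act ≫ ev) ≫
    S.X ◁ i.hom ≫ μ[S.X] = 𝟙 _
  basis_right : (ρ_ P.X).inv ≫ P.X ◁ coev ≫ (α_ _ _ _).inv ≫ (P.act ≫ ev) ▷ P.X ≫ actL = 𝟙 _

namespace RightModule
variable {S : Mon C}

/-- The right linear map `S ⟶ N`, `s ↦ t s`. -/
def ofElement (N : RightModule S) (t : 𝟙_ C ⟶ N.X) : S.X ⟶ N.X := (λ_ S.X).inv ≫ t ▷ S.X ≫ N.act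

variable (N : RightModule S)

lemma one_ofElement (t : 𝟙_ C ⟶ N.X) : η[S.X] ≫ N.ofElement t = t := by
  calc _ = 𝟙 _ ⊗≫ (𝟙_ C ◁ η[S.X] ≫ t ▷ S.X) ≫ N.act := by simp only [ofElement]; monoidal
    _ = _ := by rw [whisker_exchange, Category.assoc, N.act_one]; monoidal

lemma mul_ofElement (t : 𝟙_ C ⟶ N.X) : μ[S.X] ≫ N.ofElement t = N.ofElement t ▷ S.X ≫ N.act := by
  calc _ = 𝟙 _ ⊗≫ (𝟙_ C ◁ μ[S.X] ≫ t ▷ S.X) ≫ N.act := by simp only [ofElement]; monoidal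
    _ = 𝟙 _ ⊗≫ t ▷ (S.X ⊗ S.X) ≫ (N.X ◁ μ[S.X] ≫ N.act) := by rw [whisker_exchange]; monoidal
    _ = _ := by rw [N.act_mul]; simp only [ofElement]; monoidal

lemma eq_ofElement {f : S.X ⟶ N.X} (h : μ[S.X] ≫ f = f ▷ S.X ≫ N.act) :
    f = N.ofElement (η[S.X] ≫ f) := by
  simp only [ofElement, comp_whiskerRight, Category.assoc, ← h]
  simp

end RightModule

namespace ExtensionDual
variable {A S : Mon C} {i : A ⟶ S} (D : ExtensionDual i)

/-- The pairing `⟨p, s⟩ = ev (p s)` -/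
def pair : D.P.X ⊗ S.X ⟶ A.X := D.P.act ≫ D.ev

lemma act_pair : D.P.act ▷ S.X ≫ D.pair = (α_ _ _ _).hom ≫ D.P.X ◁ μ[S.X] ≫ D.pair := by
  rw [pair, reassoc_of% D.P.act_mul]; simp

lemma pair_left : D.actL ▷ S.X ≫ D.pair = (α_ _ _ _).hom ≫ A.X ◁ D.pair ≫ μ[A.X] := by
  rw [pair, reassoc_of% D.actL_act, D.actL_ev]; simp

lemma pair_one : D.P.X ◁ η[S.X] ≫ D.pair = (ρ_ _).hom ≫ D.ev := by
  rw [pair, reassoc_of% D.P.act_one]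

lemma pair_right : D.P.X ◁ (S.X ◁ i.hom ≫ μ[S.X]) ≫ D.pair =
    (α_ _ _ _).inv ≫ D.pair ▷ A.X ≫ μ[A.X] := by
  calc _ = 𝟙 _ ⊗≫ D.P.X ◁ S.X ◁ i.hom ⊗≫ ((α_ _ _ _).hom ≫ D.P.X ◁ μ[S.X] ≫ D.pair) := by monoidal
    _ = 𝟙 _ ⊗≫ ((D.P.X ⊗ S.X) ◁ i.hom ≫ D.P.act ▷ S.X) ≫ D.pair := by rw [← act_pair]; monoidal
    _ = 𝟙 _ ⊗≫ D.P.act ▷ A.X ≫ (D.P.X ◁ i.hom ≫ D.P.act ≫ D.ev) := by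
      rw [whisker_exchange, pair]; monoidal
    _ = _ := by rw [D.act_ev, pair]; monoidal

/-- `p = Σ ⟨p, yᵢ⟩ xᵢ`, for `p = f z` -/
lemma pair_basis {Z : C} (f : Z ⟶ D.P.X) :
    f = (ρ_ Z).inv ≫ Z ◁ D.coev ≫ (α_ _ _ _).inv ≫ (f ▷ S.X ≫ D.pair) ▷ D.P.X ≫ D.actL := by
  calc _ = f ≫ 𝟙 _ := by simp
    _ = 𝟙 _ ⊗≫ (f ▷ 𝟙_ C ≫ D.P.X ◁ D.coev) ⊗≫ D.pair ▷ D.P.X ≫ D.actL := by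
      rw [← D.basis_right, pair]; monoidal
    _ = _ := by rw [← whisker_exchange]; monoidal

/-- The pairing is nondegenerate in its first argument. -/
lemma ext_pair {Z : C} {f g : Z ⟶ D.P.X} (h : f ▷ S.X ≫ D.pair = g ▷ S.X ≫ D.pair) : f = g := by
  rw [D.pair_basis f, h, ← D.pair_basis g]

/-- An `S`-linear endomorphism of `P` is determined by its composite with `ev`. -/
lemma eq_id_of_ev {k : D.P.X ⟶ D.P.X} (h : D.P.act ≫ k = k ▷ S.X ≫ D.P.act)
    (hk : k ≫ D.ev = D.ev) : k = 𝟙 _ := D.ext_pair (by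
  rw [pair, ← reassoc_of% h, hk]; simp)

/-- `t : 1 ⟶ P` with `a t = t a` -/
def IsCentral (t : 𝟙_ C ⟶ D.P.X) : Prop :=
  (ρ_ A.X).inv ≫ A.X ◁ t ≫ D.actL = (λ_ A.X).inv ≫ t ▷ A.X ≫ D.P.X ◁ i.hom ≫ D.P.act

/-- `t` is central if and only if `s ↦ t s` is left `A`-linear. -/
lemma isCentral_iff (t : 𝟙_ C ⟶ D.P.X) : D.IsCentral t ↔
    i.hom ▷ S.X ≫ μ[S.X] ≫ D.P.ofElement t = A.X ◁ D.P.ofElement t ≫ D.actL := by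
  have h₁ : i.hom ▷ S.X ≫ μ[S.X] ≫ D.P.ofElement t =
      ((λ_ A.X).inv ≫ t ▷ A.X ≫ D.P.X ◁ i.hom ≫ D.P.act) ▷ S.X ≫ D.P.act := by
    calc _ = 𝟙 _ ⊗≫ (𝟙_ C ◁ i.hom ≫ t ▷ S.X) ▷ S.X ≫ D.P.act ▷ S.X ≫ D.P.act := by
          rw [RightModule.mul_ofElement]; simp only [RightModule.ofElement]; monoidal
      _ = _ := by rw [whisker_exchange]; monoidal
  have h₂ : A.X ◁ D.P.ofElement t ≫ D.actL =
      ((ρ_ A.X).inv ≫ A.X ◁ t ≫ D.actL) ▷ S.X ≫ D.P.act := by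
    calc _ = 𝟙 _ ⊗≫ (A.X ◁ t) ▷ S.X ⊗≫ ((α_ _ _ _).hom ≫ A.X ◁ D.P.act ≫ D.actL) := by
          simp only [RightModule.ofElement]; monoidal
      _ = _ := by rw [← D.actL_act]; monoidal
  rw [h₁, h₂]
  refine ⟨fun h => by rw [h], fun h => ?_⟩
  have key (f : A.X ⟶ D.P.X) : f = (ρ_ A.X).inv ≫ A.X ◁ η[S.X] ≫ f ▷ S.X ≫ D.P.act := by
    rw [whisker_exchange_assoc, D.P.act_one]; simp
  rw [IsCentral, key ((ρ_ A.X).inv ≫ _), ← h, ← key]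

/-- Left `A`-linear and right `S`-linear maps `P ⟶ S` -/
structure IsBilinear (Ψ : D.P.X ⟶ S.X) : Prop where
  left : D.actL ≫ Ψ = A.X ◁ Ψ ≫ i.hom ▷ S.X ≫ μ[S.X]
  right : D.P.act ≫ Ψ = Ψ ▷ S.X ≫ μ[S.X]

/-- A central element `t` of `P` and a bilinear map `Ψ : P ⟶ S` with `Ψ t = 1` and
`⟨t, Ψ p⟩ = ev p`, that is, such that `s ↦ t s` and `Ψ` are mutually inverse. -/
structure IsFrobeniusPair (t : 𝟙_ C ⟶ D.P.X) (Ψ : D.P.X ⟶ S.X) : Prop where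
  central : D.IsCentral t
  bilinear : D.IsBilinear Ψ
  apply_element : t ≫ Ψ = η[S.X]
  pair_apply : Ψ ≫ D.P.ofElement t ≫ D.ev = D.ev

variable {D}

lemma IsFrobeniusPair.ofElement_comp {t : 𝟙_ C ⟶ D.P.X} {Ψ : D.P.X ⟶ S.X}
    (h : D.IsFrobeniusPair t Ψ) : D.P.ofElement t ≫ Ψ = 𝟙 _ := by
  rw [RightModule.ofElement, Category.assoc, Category.assoc, h.bilinear.right,
    ← comp_whiskerRight_assoc, h.apply_element, MonObj.one_mul]
  simp

lemma IsFrobeniusPair.comp_ofElement {t : 𝟙_ C ⟶ D.P.X} {Ψ : D.P.X ⟶ S.X}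
    (h : D.IsFrobeniusPair t Ψ) : Ψ ≫ D.P.ofElement t = 𝟙 _ :=
  D.eq_id_of_ev (by
    rw [reassoc_of% h.bilinear.right, RightModule.mul_ofElement, comp_whiskerRight, Category.assoc])
    (by rw [Category.assoc, h.pair_apply])

lemma isFrobeniusPair_of_inverse {t : 𝟙_ C ⟶ D.P.X} {Ψ : D.P.X ⟶ S.X}
    (ht : D.IsCentral t) (h₁ : D.P.ofElement t ≫ Ψ = 𝟙 _) (h₂ : Ψ ≫ D.P.ofElement t = 𝟙 _) :
    D.IsFrobeniusPair t Ψ where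
  central := ht
  bilinear := by
    have : IsIso (D.P.ofElement t) := ⟨Ψ, h₁, h₂⟩
    constructor
    · rw [← cancel_mono (D.P.ofElement t), Category.assoc, h₂, Category.assoc, Category.assoc,
        (D.isCentral_iff t).1 ht, ← MonoidalCategory.whiskerLeft_comp_assoc, h₂]
      simp
    · rw [← cancel_mono (D.P.ofElement t), Category.assoc, h₂, Category.assoc,
        RightModule.mul_ofElement, ← comp_whiskerRight_assoc, h₂]
      simp
  apply_element := by rw [← D.P.one_ofElement t, Category.assoc, h₁, Category.comp_id]
  pair_apply := by rw [reassoc_of% h₂]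

variable (D)

lemma exists_isFrobeniusPair_iff_isIso_ofElement :
    (∃ t Ψ, D.IsFrobeniusPair t Ψ) ↔ ∃ t, D.IsCentral t ∧ IsIso (D.P.ofElement t) :=
  ⟨fun ⟨t, Ψ, h⟩ => ⟨t, h.central, Ψ, h.ofElement_comp, h.comp_ofElement⟩,
    fun ⟨t, ht, Ψ, h₁, h₂⟩ => ⟨t, Ψ, isFrobeniusPair_of_inverse ht h₁ h₂⟩⟩

lemma exists_isFrobeniusPair_iff_isIso :
    (∃ t Ψ, D.IsFrobeniusPair t Ψ) ↔ ∃ Ψ, D.IsBilinear Ψ ∧ IsIso Ψ := by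
  refine ⟨fun ⟨t, Ψ, h⟩ => ⟨Ψ, h.bilinear, D.P.ofElement t, h.comp_ofElement, h.ofElement_comp⟩,
    fun ⟨Ψ, h, _⟩ => ⟨η[S.X] ≫ inv Ψ, Ψ, ?_⟩⟩
  have hl : i.hom ▷ S.X ≫ μ[S.X] ≫ inv Ψ = A.X ◁ inv Ψ ≫ D.actL := by
    rw [← cancel_mono Ψ]
    simp only [Category.assoc, IsIso.inv_hom_id, Category.comp_id, h.left]
    rw [← MonoidalCategory.whiskerLeft_comp_assoc, IsIso.inv_hom_id]; simp
  have hr : μ[S.X] ≫ inv Ψ = inv Ψ ▷ S.X ≫ D.P.act := by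
    rw [← cancel_mono Ψ]
    simp only [Category.assoc, IsIso.inv_hom_id, Category.comp_id, h.right]
    rw [← comp_whiskerRight_assoc, IsIso.inv_hom_id]; simp
  have e := D.P.eq_ofElement hr
  exact isFrobeniusPair_of_inverse (by rw [isCentral_iff, ← e, hl]) (by rw [← e]; simp)
    (by rw [← e]; simp)

end ExtensionDual
end Cowreath

/-! ### Frobenius extensions -/

namespace Cowreath

variable {C : Type u} [Category.{v} C] [MonoidalCategory C]

namespace Extension
variable {A S : Mon C} (i : A ⟶ S)

/-- A Frobenius system of `i : A ⟶ S` relative to `p : S ⊗ S ⟶ T`: an `A`-bimodule map `θ : S ⟶ A`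
and `e : 1 ⟶ S ⊗ S` with `s e = e s` after applying `p`, and `θ(e¹) e² = 1 = e¹ θ(e²)`. For the
projection `p : S ⊗ S ⟶ S ⊗_A S` these are the Frobenius systems of the extension, with a lift of
the Casimir element to `S ⊗ S`. -/
structure IsFrobeniusSystem {T : C} (p : S.X ⊗ S.X ⟶ T) (θ : S.X ⟶ A.X) (e : 𝟙_ C ⟶ S.X ⊗ S.X) :
    Prop where
  left : i.hom ▷ S.X ≫ μ[S.X] ≫ θ = A.X ◁ θ ≫ μ[A.X]
  right : S.X ◁ i.hom ≫ μ[S.X] ≫ θ = θ ▷ A.X ≫ μ[A.X]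
  casimir : (ρ_ S.X).inv ≫ S.X ◁ e ≫ (α_ _ _ _).inv ≫ μ[S.X] ▷ S.X ≫ p =
    (λ_ S.X).inv ≫ e ▷ S.X ≫ (α_ _ _ _).hom ≫ S.X ◁ μ[S.X] ≫ p
  unit_left : e ≫ (θ ≫ i.hom) ▷ S.X ≫ μ[S.X] = η[S.X]
  unit_right : e ≫ S.X ◁ (θ ≫ i.hom) ≫ μ[S.X] = η[S.X]

variable [HasCoequalizers C] [∀ X : C, LeftCoflat X] [∀ Y : LeftModule A, IsRobust Y]
open BimodTensor

lemma pS_cond : (S.X ◁ i.hom ≫ μ[S.X]) ▷ S.X ≫ pS i =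
    (α_ _ _ _).hom ≫ S.X ◁ (i.hom ▷ S.X ≫ μ[S.X]) ≫ pS i := BimodTensor.cond (bimod i) (bimod i)

lemma pS_actL : A.X ◁ pS i ≫ (tensor (bimod i) (bimod i)).actLeft =
    (α_ _ _ _).inv ≫ (i.hom ▷ S.X ≫ μ[S.X]) ▷ S.X ≫ pS i := π_actL (bimod i) (bimod i)

lemma pS_actR : pS i ▷ A.X ≫ (tensor (bimod i) (bimod i)).actRight =
    (α_ _ _ _).hom ≫ S.X ◁ (S.X ◁ i.hom ≫ μ[S.X]) ≫ pS i := π_actR (bimod i) (bimod i)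

/-- `S ⟶ S ⊗_A S`, `s ↦ s e` -/
noncomputable def mulElement (e : 𝟙_ C ⟶ S.X ⊗ S.X) : S.X ⟶ (tensor (bimod i) (bimod i)).X :=
  (ρ_ S.X).inv ≫ S.X ◁ e ≫ (α_ _ _ _).inv ≫ μ[S.X] ▷ S.X ≫ pS i

/-- `S ⟶ S ⊗_A S`, `s ↦ e s` -/
noncomputable def elementMul (e : 𝟙_ C ⟶ S.X ⊗ S.X) : S.X ⟶ (tensor (bimod i) (bimod i)).X :=
  (λ_ S.X).inv ≫ e ▷ S.X ≫ (α_ _ _ _).hom ≫ S.X ◁ μ[S.X] ≫ pS i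

/-- The morphism `s ↦ s e` of `A`-bimodules, for an element `e` that lifts to `e₀ : 1 ⟶ S ⊗ S` -/
lemma casimir_left (e : 𝟙_ (Bimod A A) ⟶ bimod i ⊗ bimod i) (e₀ : 𝟙_ C ⟶ S.X ⊗ S.X)
    (he : η[A.X] ≫ e.hom = e₀ ≫ pS i) :
    ((ρ_ (bimod i)).inv ≫ bimod i ◁ e ≫ (α_ _ _ _).inv ≫ mul i ▷ bimod i).hom =
      mulElement i e₀ := by
  have h₁ : π (bimod i) (reg A) ≫ (wL (bimod i) e).hom =
      S.X ◁ e.hom ≫ π (bimod i) (tensor (bimod i) (bimod i)) := π_wL (P := bimod i) e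
  have h₂ : S.X ◁ pS i ≫ π (bimod i) (tensor (bimod i) (bimod i)) ≫
      assocInv' (bimod i) (bimod i) (bimod i) =
      (α_ S.X S.X S.X).inv ≫ pS i ▷ S.X ≫ π (tensor (bimod i) (bimod i)) (bimod i) :=
    ππ_assocInv' (P := bimod i) (Q := bimod i) (R := bimod i)
  have h₃ : π (tensor (bimod i) (bimod i)) (bimod i) ≫ (wR (mul i) (bimod i)).hom =
      mul₀ i ▷ S.X ≫ pS i := π_wR (R := bimod i) (mul i)
  change ((ρ_ S.X).inv ≫ S.X ◁ η[A.X] ≫ π (bimod i) (reg A)) ≫ (wL (bimod i) e).hom ≫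
    assocInv' (bimod i) (bimod i) (bimod i) ≫ (wR (mul i) (bimod i)).hom = _
  have h₄ : S.X ◁ η[A.X] ≫ π (bimod i) (reg A) ≫ (wL (bimod i) e).hom =
      S.X ◁ e₀ ≫ S.X ◁ pS i ≫ π (bimod i) (tensor (bimod i) (bimod i)) := by
    rw [h₁, ← whiskerLeft_comp_assoc]
    refine (congrArg (fun z => S.X ◁ z ≫ π (bimod i) (tensor (bimod i) (bimod i))) he).trans ?_
    simp
  calc _ = (ρ_ S.X).inv ≫ (S.X ◁ η[A.X] ≫ π (bimod i) (reg A) ≫ (wL (bimod i) e).hom) ≫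
        assocInv' (bimod i) (bimod i) (bimod i) ≫ (wR (mul i) (bimod i)).hom := by
        simp only [Category.assoc]
    _ = (ρ_ S.X).inv ≫ S.X ◁ e₀ ≫ (S.X ◁ pS i ≫ π (bimod i) (tensor (bimod i) (bimod i)) ≫
        assocInv' (bimod i) (bimod i) (bimod i)) ≫ (wR (mul i) (bimod i)).hom := by
        rw [h₄]; simp only [Category.assoc]
    _ = _ := by
        rw [h₂, Category.assoc, Category.assoc, h₃, ← comp_whiskerRight_assoc, π_mul₀]
        rfl

/-- The morphism `s ↦ e s` of `A`-bimodules, for an element `e` that lifts to `e₀ : 1 ⟶ S ⊗ S` -/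
lemma casimir_right (e : 𝟙_ (Bimod A A) ⟶ bimod i ⊗ bimod i) (e₀ : 𝟙_ C ⟶ S.X ⊗ S.X)
    (he : η[A.X] ≫ e.hom = e₀ ≫ pS i) :
    ((λ_ (bimod i)).inv ≫ e ▷ bimod i ≫ (α_ _ _ _).hom ≫ bimod i ◁ mul i).hom =
      elementMul i e₀ := by
  have h₁ : π (reg A) (bimod i) ≫ (wR e (bimod i)).hom =
      e.hom ▷ S.X ≫ π (tensor (bimod i) (bimod i)) (bimod i) := π_wR (R := bimod i) e
  have h₂ : pS i ▷ S.X ≫ π (tensor (bimod i) (bimod i)) (bimod i) ≫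
      assocHom' (bimod i) (bimod i) (bimod i) =
      (α_ S.X S.X S.X).hom ≫ S.X ◁ pS i ≫ π (bimod i) (tensor (bimod i) (bimod i)) :=
    ππ_assocHom' (P := bimod i) (Q := bimod i) (R := bimod i)
  have h₃ : π (bimod i) (tensor (bimod i) (bimod i)) ≫ (wL (bimod i) (mul i)).hom =
      S.X ◁ mul₀ i ≫ pS i := π_wL (P := bimod i) (mul i)
  change ((λ_ S.X).inv ≫ η[A.X] ▷ S.X ≫ π (reg A) (bimod i)) ≫ (wR e (bimod i)).hom ≫
    assocHom' (bimod i) (bimod i) (bimod i) ≫ (wL (bimod i) (mul i)).hom = _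
  have h₄ : η[A.X] ▷ S.X ≫ π (reg A) (bimod i) ≫ (wR e (bimod i)).hom =
      e₀ ▷ S.X ≫ pS i ▷ S.X ≫ π (tensor (bimod i) (bimod i)) (bimod i) := by
    rw [h₁, ← comp_whiskerRight_assoc]
    refine (congrArg (fun z => z ▷ S.X ≫ π (tensor (bimod i) (bimod i)) (bimod i)) he).trans ?_
    simp
  calc _ = (λ_ S.X).inv ≫ (η[A.X] ▷ S.X ≫ π (reg A) (bimod i) ≫ (wR e (bimod i)).hom) ≫
        assocHom' (bimod i) (bimod i) (bimod i) ≫ (wL (bimod i) (mul i)).hom := by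
        simp only [Category.assoc]
    _ = (λ_ S.X).inv ≫ e₀ ▷ S.X ≫ (pS i ▷ S.X ≫ π (tensor (bimod i) (bimod i)) (bimod i) ≫
        assocHom' (bimod i) (bimod i) (bimod i)) ≫ (wL (bimod i) (mul i)).hom := by
        rw [h₄]; simp only [Category.assoc]
    _ = _ := by
        rw [h₂, Category.assoc, Category.assoc, h₃, ← whiskerLeft_comp_assoc, π_mul₀]
        rfl

lemma pS_wR_lUnitor (θ : bimod i ⟶ 𝟙_ (Bimod A A)) :
    pS i ≫ (wR θ (bimod i)).hom ≫ (lUnitor (bimod i)).hom.hom =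
      (θ.hom ≫ i.hom) ▷ S.X ≫ μ[S.X] := by
  have h : pS i ≫ (wR θ (bimod i)).hom = θ.hom ▷ S.X ≫ π (reg A) (bimod i) :=
    π_wR (R := bimod i) θ
  rw [reassoc_of% h, π_lUnitor]
  exact (comp_whiskerRight_assoc θ.hom i.hom S.X μ[S.X]).symm

lemma pS_wL_rUnitor (θ : bimod i ⟶ 𝟙_ (Bimod A A)) :
    pS i ≫ (wL (bimod i) θ).hom ≫ (rUnitor (bimod i)).hom.hom =
      S.X ◁ (θ.hom ≫ i.hom) ≫ μ[S.X] := by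
  have h : pS i ≫ (wL (bimod i) θ).hom = S.X ◁ θ.hom ≫ π (bimod i) (reg A) :=
    π_wL (P := bimod i) θ
  rw [reassoc_of% h, π_rUnitor]
  exact (whiskerLeft_comp_assoc S.X θ.hom i.hom μ[S.X]).symm

lemma mulElement_left (e : 𝟙_ C ⟶ S.X ⊗ S.X) : μ[A.X] ≫ i.hom ≫ mulElement i e =
    A.X ◁ (i.hom ≫ mulElement i e) ≫ (tensor (bimod i) (bimod i)).actLeft := by
  symm
  calc _ = 𝟙 _ ⊗≫ A.X ◁ i.hom ⊗≫ A.X ◁ S.X ◁ e ⊗≫ A.X ◁ μ[S.X] ▷ S.X ≫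
        (A.X ◁ pS i ≫ (tensor (bimod i) (bimod i)).actLeft) := by simp only [mulElement]; monoidal
    _ = 𝟙 _ ⊗≫ A.X ◁ i.hom ⊗≫ A.X ◁ S.X ◁ e ⊗≫ (A.X ◁ μ[S.X] ≫ i.hom ▷ S.X) ▷ S.X ≫
        μ[S.X] ▷ S.X ≫ pS i := by rw [pS_actL]; monoidal
    _ = 𝟙 _ ⊗≫ A.X ◁ i.hom ⊗≫ (A.X ⊗ S.X) ◁ e ⊗≫ i.hom ▷ (S.X ⊗ S.X) ▷ S.X ⊗≫
        ((α_ _ _ _).hom ≫ S.X ◁ μ[S.X] ≫ μ[S.X]) ▷ S.X ≫ pS i := by rw [whisker_exchange]; monoidal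
    _ = 𝟙 _ ⊗≫ A.X ◁ i.hom ⊗≫ ((A.X ⊗ S.X) ◁ e ≫ (i.hom ▷ S.X ≫ μ[S.X]) ▷ (S.X ⊗ S.X)) ⊗≫
        μ[S.X] ▷ S.X ≫ pS i := by rw [← MonObj.mul_assoc]; monoidal
    _ = 𝟙 _ ⊗≫ (A.X ◁ i.hom ≫ i.hom ▷ S.X ≫ μ[S.X]) ⊗≫ S.X ◁ e ⊗≫
        μ[S.X] ▷ S.X ≫ pS i := by rw [whisker_exchange]; monoidal
    _ = _ := by
        rw [whisker_exchange_assoc, ← mul_i]; simp only [mulElement]; monoidal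

lemma elementMul_right (e : 𝟙_ C ⟶ S.X ⊗ S.X) : μ[A.X] ≫ i.hom ≫ elementMul i e =
    (i.hom ≫ elementMul i e) ▷ A.X ≫ (tensor (bimod i) (bimod i)).actRight := by
  symm
  calc _ = 𝟙 _ ⊗≫ i.hom ▷ A.X ⊗≫ e ▷ S.X ▷ A.X ⊗≫ (S.X ◁ μ[S.X]) ▷ A.X ≫
        (pS i ▷ A.X ≫ (tensor (bimod i) (bimod i)).actRight) := by simp only [elementMul]; monoidal
    _ = 𝟙 _ ⊗≫ i.hom ▷ A.X ⊗≫ e ▷ S.X ▷ A.X ⊗≫ S.X ◁ (μ[S.X] ▷ A.X ≫ S.X ◁ i.hom) ≫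
        S.X ◁ μ[S.X] ≫ pS i := by rw [pS_actR]; monoidal
    _ = 𝟙 _ ⊗≫ i.hom ▷ A.X ⊗≫ e ▷ (S.X ⊗ A.X) ⊗≫ S.X ◁ (S.X ⊗ S.X) ◁ i.hom ⊗≫
        S.X ◁ (μ[S.X] ▷ S.X ≫ μ[S.X]) ≫ pS i := by rw [← whisker_exchange]; monoidal
    _ = 𝟙 _ ⊗≫ i.hom ▷ A.X ⊗≫ (e ▷ (S.X ⊗ A.X) ≫ (S.X ⊗ S.X) ◁ (S.X ◁ i.hom ≫ μ[S.X])) ⊗≫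
        S.X ◁ μ[S.X] ≫ pS i := by rw [MonObj.mul_assoc]; monoidal
    _ = 𝟙 _ ⊗≫ (i.hom ▷ A.X ≫ S.X ◁ i.hom ≫ μ[S.X]) ⊗≫ e ▷ S.X ⊗≫
        S.X ◁ μ[S.X] ≫ pS i := by rw [← whisker_exchange]; monoidal
    _ = _ := by rw [← mul_i]; simp only [elementMul]; monoidal

lemma one_mulElement (e : 𝟙_ C ⟶ S.X ⊗ S.X) : η[A.X] ≫ i.hom ≫ mulElement i e = e ≫ pS i := by
  calc _ = 𝟙 _ ⊗≫ (η[S.X] ▷ 𝟙_ C ≫ S.X ◁ e) ⊗≫ μ[S.X] ▷ S.X ≫ pS i := by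
        rw [← one_i i]; simp only [mulElement]; monoidal
    _ = 𝟙 _ ⊗≫ e ⊗≫ (η[S.X] ▷ S.X ≫ μ[S.X]) ▷ S.X ≫ pS i := by
        rw [← whisker_exchange]; monoidal
    _ = _ := by rw [MonObj.one_mul]; monoidal

lemma elementMul_counit {e : 𝟙_ C ⟶ S.X ⊗ S.X} {w : S.X ⟶ S.X} (he : e ≫ w ▷ S.X ≫ μ[S.X] = η[S.X])
    {f : (tensor (bimod i) (bimod i)).X ⟶ S.X} (hf : pS i ≫ f = w ▷ S.X ≫ μ[S.X]) :
    elementMul i e ≫ f = 𝟙 _ := by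
  calc _ = 𝟙 _ ⊗≫ e ▷ S.X ⊗≫ (S.X ◁ μ[S.X] ≫ w ▷ S.X) ≫ μ[S.X] := by
        simp only [elementMul, Category.assoc, hf]; monoidal
    _ = 𝟙 _ ⊗≫ e ▷ S.X ⊗≫ w ▷ S.X ▷ S.X ⊗≫ ((α_ _ _ _).hom ≫ S.X ◁ μ[S.X] ≫ μ[S.X]) := by
        rw [whisker_exchange]; monoidal
    _ = 𝟙 _ ⊗≫ (e ≫ w ▷ S.X ≫ μ[S.X]) ▷ S.X ≫ μ[S.X] := by rw [← MonObj.mul_assoc]; monoidal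
    _ = _ := by rw [he, MonObj.one_mul]; monoidal

lemma mulElement_counit {e : 𝟙_ C ⟶ S.X ⊗ S.X} {w : S.X ⟶ S.X} (he : e ≫ S.X ◁ w ≫ μ[S.X] = η[S.X])
    {f : (tensor (bimod i) (bimod i)).X ⟶ S.X} (hf : pS i ≫ f = S.X ◁ w ≫ μ[S.X]) :
    mulElement i e ≫ f = 𝟙 _ := by
  calc _ = 𝟙 _ ⊗≫ S.X ◁ e ⊗≫ (μ[S.X] ▷ S.X ≫ S.X ◁ w) ≫ μ[S.X] := by
        simp only [mulElement, Category.assoc, hf]; monoidal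
    _ = 𝟙 _ ⊗≫ S.X ◁ e ⊗≫ S.X ◁ S.X ◁ w ⊗≫ (μ[S.X] ▷ S.X ≫ μ[S.X]) := by
        rw [← whisker_exchange]; monoidal
    _ = 𝟙 _ ⊗≫ S.X ◁ (e ≫ S.X ◁ w ≫ μ[S.X]) ≫ μ[S.X] := by rw [MonObj.mul_assoc]; monoidal
    _ = _ := by rw [he, MonObj.mul_one]; monoidal

/-- If the projection `S ⊗ S ⟶ S ⊗_A S` splits in `C`, every element of `S ⊗_A S` lifts to `S ⊗ S`,
and Frobenius extensions are the extensions with a Frobenius system. -/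
lemma isFrobeniusExtension_iff (s : (tensor (bimod i) (bimod i)).X ⟶ S.X ⊗ S.X)
    (hs : s ≫ pS i = 𝟙 _) :
    IsFrobeniusExtension i ↔ ∃ θ e, IsFrobeniusSystem i (pS i) θ e := by
  constructor
  · rintro ⟨θ, e, h₁, h₂, h₃⟩
    have he : η[A.X] ≫ e.hom = (η[A.X] ≫ e.hom ≫ s) ≫ pS i := by
      simp only [Category.assoc]
      exact congrArg (fun z => η[A.X] ≫ z) ((congrArg (fun z => e.hom ≫ z) hs).trans
        (Category.comp_id _)).symm
    have h₂' : e.hom ≫ (wR θ (bimod i)).hom ≫ (lUnitor (bimod i)).hom.hom = i.hom :=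
      congrArg Bimod.Hom.hom h₂
    have h₃' : e.hom ≫ (wL (bimod i) θ).hom ≫ (rUnitor (bimod i)).hom.hom = i.hom :=
      congrArg Bimod.Hom.hom h₃
    -- the Casimir element of `S ⊗_A S` is the image of `1`, and `s` lifts it to `S ⊗ S`
    refine ⟨θ.hom, η[A.X] ≫ e.hom ≫ s, ?_, ?_, ?_, ?_, ?_⟩
    · exact (Category.assoc _ _ _).symm.trans θ.left_act_hom
    · exact (Category.assoc _ _ _).symm.trans θ.right_act_hom
    · have h := congrArg Bimod.Hom.hom h₁
      exact (casimir_left i e _ he).symm.trans (h.trans (casimir_right i e _ he))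
    · refine Eq.trans ?_ ((congrArg (fun z => η[A.X] ≫ z) h₂').trans (one_i i))
      refine Eq.trans ?_ ((congrArg (fun z => z ≫ (wR θ (bimod i)).hom ≫
        (lUnitor (bimod i)).hom.hom) he.symm).trans
        (Category.assoc _ _ _))
      refine Eq.trans ?_ (Category.assoc _ (pS i) _).symm
      rw [pS_wR_lUnitor]
    · refine Eq.trans ?_ ((congrArg (fun z => η[A.X] ≫ z) h₃').trans (one_i i))
      refine Eq.trans ?_ ((congrArg (fun z => z ≫ (wL (bimod i) θ).hom ≫
        (rUnitor (bimod i)).hom.hom) he.symm).trans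
        (Category.assoc _ _ _))
      refine Eq.trans ?_ (Category.assoc _ (pS i) _).symm
      rw [pS_wL_rUnitor]
  · rintro ⟨θ, e, h⟩
    have hc : mulElement i e = elementMul i e := h.casimir
    let θ' : bimod i ⟶ 𝟙_ (Bimod A A) :=
      { hom := θ
        left_act_hom := (Category.assoc _ _ _).trans h.left
        right_act_hom := (Category.assoc _ _ _).trans h.right }
    -- `a ↦ a e` is left linear, and `a ↦ e a` is right linear; they agree, as `e` is Casimir
    let e' : 𝟙_ (Bimod A A) ⟶ bimod i ⊗ bimod i :=
      { hom := i.hom ≫ mulElement i e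
        left_act_hom := mulElement_left i e
        right_act_hom := by rw [hc]; exact elementMul_right i e }
    have he : η[A.X] ≫ e'.hom = e ≫ pS i := one_mulElement i e
    refine ⟨θ', e', ?_, ?_, ?_⟩
    · exact Bimod.hom_ext _ _ ((casimir_left i e' e he).trans
        (hc.trans (casimir_right i e' e he).symm))
    · apply Bimod.hom_ext
      change (i.hom ≫ mulElement i e) ≫ (wR θ' (bimod i)).hom ≫ (lUnitor (bimod i)).hom.hom = i.hom
      rw [hc, Category.assoc]
      exact (congrArg (fun z => i.hom ≫ z)
        (elementMul_counit i h.unit_left (pS_wR_lUnitor i θ'))).trans (Category.comp_id _)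
    · apply Bimod.hom_ext
      change (i.hom ≫ mulElement i e) ≫ (wL (bimod i) θ').hom ≫ (rUnitor (bimod i)).hom.hom = i.hom
      rw [Category.assoc]
      exact (congrArg (fun z => i.hom ≫ z)
        (mulElement_counit i h.unit_right (pS_wL_rUnitor i θ'))).trans (Category.comp_id _)

end Extension
end Cowreath

namespace Cowreath

variable {C : Type u} [Category.{v} C] [MonoidalCategory C]

namespace ExtensionDual
open Extension

variable {A S : Mon C} {i : A ⟶ S} (D : ExtensionDual i)

/-- `Σ θ(yᵢ) xᵢ` -/
def element (θ : S.X ⟶ A.X) : 𝟙_ C ⟶ D.P.X := D.coev ≫ θ ▷ D.P.X ≫ D.actL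

/-- Every right `A`-linear functional `θ` on `S` is `⟨t, -⟩` with `t = Σ θ(yᵢ) xᵢ`. -/
lemma element_pair {θ : S.X ⟶ A.X} (h : S.X ◁ i.hom ≫ μ[S.X] ≫ θ = θ ▷ A.X ≫ μ[A.X]) :
    (λ_ S.X).inv ≫ D.element θ ▷ S.X ≫ D.pair = θ := by
  calc _ = 𝟙 _ ⊗≫ D.coev ▷ S.X ⊗≫ θ ▷ D.P.X ▷ S.X ≫ (D.actL ▷ S.X ≫ D.pair) := by
        simp only [element]; monoidal
    _ = 𝟙 _ ⊗≫ D.coev ▷ S.X ⊗≫ (θ ▷ (D.P.X ⊗ S.X) ≫ A.X ◁ D.pair) ≫ μ[A.X] := by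
        rw [pair_left]; monoidal
    _ = 𝟙 _ ⊗≫ D.coev ▷ S.X ⊗≫ S.X ◁ D.pair ≫ (θ ▷ A.X ≫ μ[A.X]) := by
        rw [← whisker_exchange]; monoidal
    _ = ((λ_ S.X).inv ≫ D.coev ▷ S.X ≫ (α_ _ _ _).hom ≫ S.X ◁ (D.P.act ≫ D.ev) ≫
          S.X ◁ i.hom ≫ μ[S.X]) ≫ θ := by
        rw [← h, pair]; monoidal
    _ = _ := by rw [D.basis_left, Category.id_comp]

lemma element_isCentral {θ : S.X ⟶ A.X} (hl : i.hom ▷ S.X ≫ μ[S.X] ≫ θ = A.X ◁ θ ≫ μ[A.X])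
    (hr : S.X ◁ i.hom ≫ μ[S.X] ≫ θ = θ ▷ A.X ≫ μ[A.X]) : D.IsCentral (D.element θ) := by
  have hp := D.element_pair hr
  set t := D.element θ
  refine D.ext_pair ?_
  calc _ = 𝟙 _ ⊗≫ (A.X ◁ t) ▷ S.X ≫ (D.actL ▷ S.X ≫ D.pair) := by monoidal
    _ = 𝟙 _ ⊗≫ A.X ◁ ((λ_ S.X).inv ≫ t ▷ S.X ≫ D.pair) ≫ μ[A.X] := by rw [pair_left]; monoidal
    _ = 𝟙 _ ⊗≫ i.hom ▷ S.X ≫ μ[S.X] ≫ ((λ_ S.X).inv ≫ t ▷ S.X ≫ D.pair) := by rw [hp, hl]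
    _ = 𝟙 _ ⊗≫ i.hom ▷ S.X ⊗≫ (𝟙_ C ◁ μ[S.X] ≫ t ▷ S.X) ≫ D.pair := by monoidal
    _ = 𝟙 _ ⊗≫ (𝟙_ C ◁ i.hom ≫ t ▷ S.X) ▷ S.X ⊗≫ ((α_ _ _ _).hom ≫ D.P.X ◁ μ[S.X] ≫ D.pair) := by
        rw [whisker_exchange]; monoidal
    _ = _ := by rw [whisker_exchange, ← act_pair]; monoidal

/-- `p ↦ ⟨p, e¹⟩ e²` -/
def contract (e : 𝟙_ C ⟶ S.X ⊗ S.X) : D.P.X ⟶ S.X :=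
  (ρ_ _).inv ≫ D.P.X ◁ e ≫ (α_ _ _ _).inv ≫ (D.pair ≫ i.hom) ▷ S.X ≫ μ[S.X]

lemma element_contract {θ : S.X ⟶ A.X} {e : 𝟙_ C ⟶ S.X ⊗ S.X}
    (h : S.X ◁ i.hom ≫ μ[S.X] ≫ θ = θ ▷ A.X ≫ μ[A.X])
    (he : e ≫ (θ ≫ i.hom) ▷ S.X ≫ μ[S.X] = η[S.X]) : D.element θ ≫ D.contract e = η[S.X] := by
  calc _ = 𝟙 _ ⊗≫ (D.element θ ▷ 𝟙_ C ≫ D.P.X ◁ e) ⊗≫ (D.pair ≫ i.hom) ▷ S.X ≫ μ[S.X] := by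
        simp only [contract]; monoidal
    _ = 𝟙 _ ⊗≫ e ≫ (((λ_ S.X).inv ≫ D.element θ ▷ S.X ≫ D.pair) ≫ i.hom) ▷ S.X ≫ μ[S.X] := by
        rw [← whisker_exchange]; monoidal
    _ = _ := by rw [D.element_pair h, he]; monoidal

lemma contract_left (e : 𝟙_ C ⟶ S.X ⊗ S.X) :
    D.actL ≫ D.contract e = A.X ◁ D.contract e ≫ i.hom ▷ S.X ≫ μ[S.X] := by
  calc _ = 𝟙 _ ⊗≫ (D.actL ▷ 𝟙_ C ≫ D.P.X ◁ e) ⊗≫ D.pair ▷ S.X ≫ i.hom ▷ S.X ≫ μ[S.X] := by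
        simp only [contract]; monoidal
    _ = 𝟙 _ ⊗≫ A.X ◁ D.P.X ◁ e ⊗≫ (D.actL ▷ S.X ≫ D.pair) ▷ S.X ⊗≫ i.hom ▷ S.X ≫ μ[S.X] := by
        rw [← whisker_exchange]; monoidal
    _ = 𝟙 _ ⊗≫ A.X ◁ D.P.X ◁ e ⊗≫ (A.X ◁ D.pair) ▷ S.X ⊗≫ (μ[A.X] ≫ i.hom) ▷ S.X ≫ μ[S.X] := by
        rw [pair_left]; monoidal
    _ = 𝟙 _ ⊗≫ A.X ◁ D.P.X ◁ e ⊗≫ (A.X ◁ D.pair ≫ i.hom ▷ A.X) ▷ S.X ≫ (S.X ◁ i.hom) ▷ S.X ≫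
          (μ[S.X] ▷ S.X ≫ μ[S.X]) := by
        rw [mul_i]; monoidal
    _ = 𝟙 _ ⊗≫ (A.X ◁ D.P.X ◁ e ⊗≫ i.hom ▷ ((D.P.X ⊗ S.X) ⊗ S.X)) ⊗≫
          S.X ◁ (D.pair ≫ i.hom) ▷ S.X ≫ S.X ◁ μ[S.X] ≫ μ[S.X] := by
        rw [whisker_exchange, MonObj.mul_assoc]; monoidal
    _ = 𝟙 _ ⊗≫ (i.hom ▷ _ ≫ S.X ◁ D.contract e) ≫ μ[S.X] := by
        rw [← cancel_epi (A.X ◁ (ρ_ D.P.X).hom)]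
        calc _ = 𝟙 _ ⊗≫ (A.X ◁ (D.P.X ◁ e) ≫ i.hom ▷ (D.P.X ⊗ (S.X ⊗ S.X))) ⊗≫
              S.X ◁ (D.pair ≫ i.hom) ▷ S.X ≫ S.X ◁ μ[S.X] ≫ μ[S.X] := by monoidal
          _ = _ := by rw [whisker_exchange]; simp only [contract]; monoidal
    _ = _ := by rw [← whisker_exchange]; monoidal

lemma contract_pair_right {θ : S.X ⟶ A.X} {e : 𝟙_ C ⟶ S.X ⊗ S.X}
    (h : i.hom ▷ S.X ≫ μ[S.X] ≫ θ = A.X ◁ θ ≫ μ[A.X])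
    (he : e ≫ S.X ◁ (θ ≫ i.hom) ≫ μ[S.X] = η[S.X]) : D.contract e ≫ θ = D.ev := by
  calc _ = 𝟙 _ ⊗≫ D.P.X ◁ e ⊗≫ D.pair ▷ S.X ≫ (i.hom ▷ S.X ≫ μ[S.X] ≫ θ) := by
        simp only [contract]; monoidal
    _ = 𝟙 _ ⊗≫ D.P.X ◁ e ⊗≫ (D.pair ▷ S.X ≫ A.X ◁ θ) ≫ μ[A.X] := by rw [h]; monoidal
    _ = 𝟙 _ ⊗≫ D.P.X ◁ e ⊗≫ (D.P.X ⊗ S.X) ◁ θ ⊗≫ ((α_ _ _ _).inv ≫ D.pair ▷ A.X ≫ μ[A.X]) := by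
        rw [← whisker_exchange]; monoidal
    _ = 𝟙 _ ⊗≫ D.P.X ◁ (e ≫ S.X ◁ (θ ≫ i.hom) ≫ μ[S.X]) ≫ D.pair := by
        rw [← pair_right]; monoidal
    _ = _ := by rw [he, pair_one]; monoidal

/-- `Σ yᵢ ⊗ Ψ(xᵢ)` -/
def basisElement (Ψ : D.P.X ⟶ S.X) : 𝟙_ C ⟶ S.X ⊗ S.X := D.coev ≫ S.X ◁ Ψ

/-- `s = Σ yᵢ ⟨xᵢ, s⟩`, for `s = f z` -/
lemma basis_expand {Z : C} (f : Z ⟶ S.X) :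
    f = (λ_ Z).inv ≫ D.coev ▷ Z ≫ (α_ _ _ _).hom ≫ S.X ◁ (D.P.X ◁ f ≫ D.pair) ≫
      S.X ◁ i.hom ≫ μ[S.X] := by
  calc _ = f ≫ 𝟙 _ := by simp
    _ = 𝟙 _ ⊗≫ (𝟙_ C ◁ f ≫ D.coev ▷ S.X) ⊗≫ S.X ◁ D.pair ≫ S.X ◁ i.hom ≫ μ[S.X] := by
      rw [← D.basis_left, pair]; monoidal
    _ = _ := by rw [whisker_exchange]; monoidal

section
variable [HasCoequalizers C] [∀ X : C, LeftCoflat X] [∀ Y : LeftModule A, IsRobust Y]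
open BimodTensor

/-- `P ⊗ (S ⊗_A S) ⟶ S`, `p ⊗ s ⊗ s' ↦ ⟨p, s⟩ s'` -/
lemma exists_pair_tensor : ∃ f : D.P.X ⊗ (tensor (bimod i) (bimod i)).X ⟶ S.X,
    D.P.X ◁ pS i ≫ f = (α_ _ _ _).inv ≫ (D.pair ≫ i.hom) ▷ S.X ≫ μ[S.X] := by
  refine ⟨descL (P := bimod i) (Q := bimod i)
    ((α_ _ _ _).inv ≫ (D.pair ≫ i.hom) ▷ S.X ≫ μ[S.X]) ?_,
    π_descL (P := bimod i) (Q := bimod i) _ _⟩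
  calc _ = 𝟙 _ ⊗≫ (D.P.X ◁ (S.X ◁ i.hom ≫ μ[S.X]) ≫ D.pair) ▷ S.X ⊗≫ i.hom ▷ S.X ≫ μ[S.X] := by
        monoidal
    _ = 𝟙 _ ⊗≫ D.pair ▷ A.X ▷ S.X ⊗≫ (μ[A.X] ≫ i.hom) ▷ S.X ≫ μ[S.X] := by
        rw [pair_right]; monoidal
    _ = 𝟙 _ ⊗≫ (D.pair ≫ i.hom) ▷ A.X ▷ S.X ⊗≫ (S.X ◁ i.hom) ▷ S.X ⊗≫ (μ[S.X] ▷ S.X ≫ μ[S.X]) := by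
        rw [mul_i]; monoidal
    _ = 𝟙 _ ⊗≫ ((D.pair ≫ i.hom) ▷ (A.X ⊗ S.X) ≫ S.X ◁ (i.hom ▷ S.X ≫ μ[S.X])) ≫ μ[S.X] := by
        rw [MonObj.mul_assoc]; monoidal
    _ = _ := by rw [← whisker_exchange]; monoidal

/-- `p ↦ ⟨p, e¹⟩ e²` is right `S`-linear if `e` is a Casimir element. The Casimir condition holds in
`S ⊗_A S` only, on which `p ⊗ s ⊗ s' ↦ ⟨p, s⟩ s'` is well defined. -/
lemma contract_right {e : 𝟙_ C ⟶ S.X ⊗ S.X}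
    (h : (ρ_ S.X).inv ≫ S.X ◁ e ≫ (α_ _ _ _).inv ≫ μ[S.X] ▷ S.X ≫ pS i =
      (λ_ S.X).inv ≫ e ▷ S.X ≫ (α_ _ _ _).hom ≫ S.X ◁ μ[S.X] ≫ pS i) :
    D.P.act ≫ D.contract e = D.contract e ▷ S.X ≫ μ[S.X] := by
  obtain ⟨f, hf⟩ := D.exists_pair_tensor
  calc _ = 𝟙 _ ⊗≫ (D.P.act ▷ 𝟙_ C ≫ D.P.X ◁ e) ⊗≫ D.pair ▷ S.X ≫ i.hom ▷ S.X ≫ μ[S.X] := by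
        simp only [contract]; monoidal
    _ = 𝟙 _ ⊗≫ D.P.X ◁ S.X ◁ e ⊗≫ (D.P.act ▷ S.X ≫ D.pair) ▷ S.X ⊗≫ i.hom ▷ S.X ≫ μ[S.X] := by
        rw [← whisker_exchange]; monoidal
    _ = 𝟙 _ ⊗≫ D.P.X ◁ S.X ◁ e ⊗≫ D.P.X ◁ (μ[S.X] ▷ S.X) ≫
          ((α_ _ _ _).inv ≫ (D.pair ≫ i.hom) ▷ S.X ≫ μ[S.X]) := by
        rw [act_pair]; monoidal
    _ = D.P.X ◁ ((ρ_ S.X).inv ≫ S.X ◁ e ≫ (α_ _ _ _).inv ≫ μ[S.X] ▷ S.X ≫ pS i) ≫ f := by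
        rw [← hf]; monoidal
    _ = 𝟙 _ ⊗≫ D.P.X ◁ (e ▷ S.X) ⊗≫ D.P.X ◁ (S.X ◁ μ[S.X]) ≫ (D.P.X ◁ pS i ≫ f) := by
        rw [h]; monoidal
    _ = 𝟙 _ ⊗≫ D.P.X ◁ (e ▷ S.X) ⊗≫ ((D.P.X ⊗ S.X) ◁ μ[S.X] ≫ (D.pair ≫ i.hom) ▷ S.X) ≫ μ[S.X] := by
        rw [hf]; monoidal
    _ = 𝟙 _ ⊗≫ D.P.X ◁ (e ▷ S.X) ⊗≫ (D.pair ≫ i.hom) ▷ S.X ▷ S.X ⊗≫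
          ((α_ _ _ _).hom ≫ S.X ◁ μ[S.X] ≫ μ[S.X]) := by
        rw [whisker_exchange]; monoidal
    _ = _ := by rw [← MonObj.mul_assoc]; simp only [contract]; monoidal

lemma isFrobeniusPair_of_isFrobeniusSystem {θ : S.X ⟶ A.X} {e : 𝟙_ C ⟶ S.X ⊗ S.X}
    (h : IsFrobeniusSystem i (pS i) θ e) : D.IsFrobeniusPair (D.element θ) (D.contract e) where
  central := D.element_isCentral h.left h.right
  bilinear := ⟨D.contract_left e, D.contract_right h.casimir⟩
  apply_element := D.element_contract h.right h.unit_left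
  pair_apply := by
    have : D.P.ofElement (D.element θ) ≫ D.ev = θ := by
      conv_rhs => rw [← D.element_pair h.right]
      simp [RightModule.ofElement, pair]
    rw [this, D.contract_pair_right h.left h.unit_right]

/-- `Σ yᵢ ⊗ Ψ(xᵢ)` is a Casimir element: `Σ s yᵢ ⊗ xᵢ = Σ yᵢ ⊗ xᵢ s` in `S ⊗_A P`, for a dual basis.
-/
lemma basisElement_casimir {Ψ : D.P.X ⟶ S.X} (h : D.IsBilinear Ψ) :
    (ρ_ S.X).inv ≫ S.X ◁ D.basisElement Ψ ≫ (α_ _ _ _).inv ≫ μ[S.X] ▷ S.X ≫ pS i =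
      (λ_ S.X).inv ≫ D.basisElement Ψ ▷ S.X ≫ (α_ _ _ _).hom ≫ S.X ◁ μ[S.X] ≫ pS i := by
  calc _ = 𝟙 _ ⊗≫ S.X ◁ D.coev ⊗≫ (μ[S.X] ▷ D.P.X ≫ S.X ◁ Ψ) ≫ pS i := by
        rw [← whisker_exchange]; simp only [basisElement]; monoidal
    _ = 𝟙 _ ⊗≫ S.X ◁ D.coev ⊗≫ D.coev ▷ (S.X ⊗ S.X) ▷ D.P.X ⊗≫
          S.X ◁ (D.P.X ◁ μ[S.X] ≫ D.pair) ▷ D.P.X ⊗≫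
          ((S.X ◁ i.hom ≫ μ[S.X]) ▷ D.P.X ≫ S.X ◁ Ψ) ≫ pS i := by
        -- expand the products `s yᵢ` in the dual basis
        conv_lhs => rw [D.basis_expand μ[S.X]]
        monoidal
    _ = 𝟙 _ ⊗≫ S.X ◁ D.coev ⊗≫ D.coev ▷ (S.X ⊗ S.X) ▷ D.P.X ⊗≫
          S.X ◁ ((α_ _ _ _).hom ≫ D.P.X ◁ μ[S.X] ≫ D.pair) ▷ D.P.X ⊗≫
          S.X ◁ A.X ◁ Ψ ⊗≫ ((S.X ◁ i.hom ≫ μ[S.X]) ▷ S.X ≫ pS i) := by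
        rw [← whisker_exchange]; monoidal
    _ = 𝟙 _ ⊗≫ S.X ◁ D.coev ⊗≫ D.coev ▷ (S.X ⊗ S.X) ▷ D.P.X ⊗≫
          S.X ◁ (D.P.act ▷ S.X ≫ D.pair) ▷ D.P.X ⊗≫
          S.X ◁ (A.X ◁ Ψ ≫ i.hom ▷ S.X ≫ μ[S.X]) ≫ pS i := by
        rw [pS_cond, ← act_pair]; monoidal
    _ = 𝟙 _ ⊗≫ (𝟙_ C ◁ (S.X ◁ D.coev) ≫ D.coev ▷ (S.X ⊗ (S.X ⊗ D.P.X))) ⊗≫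
          S.X ◁ (D.P.act ▷ S.X ≫ D.pair) ▷ D.P.X ⊗≫ S.X ◁ (D.actL ≫ Ψ) ≫ pS i := by
        rw [h.left]; monoidal
    _ = 𝟙 _ ⊗≫ D.coev ▷ S.X ⊗≫ S.X ◁ ((D.P.X ⊗ S.X) ◁ D.coev ≫ D.P.act ▷ (S.X ⊗ D.P.X)) ⊗≫
          S.X ◁ D.pair ▷ D.P.X ⊗≫ S.X ◁ (D.actL ≫ Ψ) ≫ pS i := by
        rw [whisker_exchange]; monoidal
    _ = 𝟙 _ ⊗≫ D.coev ▷ S.X ⊗≫ S.X ◁ D.P.act ≫ S.X ◁ ((ρ_ D.P.X).inv ≫ D.P.X ◁ D.coev ≫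
          (α_ _ _ _).inv ≫ (D.P.act ≫ D.ev) ▷ D.P.X ≫ D.actL) ≫ S.X ◁ Ψ ≫ pS i := by
        rw [whisker_exchange, pair]; monoidal
    _ = 𝟙 _ ⊗≫ D.coev ▷ S.X ⊗≫ S.X ◁ (D.P.act ≫ Ψ) ≫ pS i := by rw [D.basis_right]; monoidal
    _ = _ := by rw [h.right]; simp only [basisElement]; monoidal

lemma isFrobeniusSystem_of_isFrobeniusPair {t : 𝟙_ C ⟶ D.P.X} {Ψ : D.P.X ⟶ S.X}
    (h : D.IsFrobeniusPair t Ψ) :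
    IsFrobeniusSystem i (pS i) (D.P.ofElement t ≫ D.ev) (D.basisElement Ψ) where
  left := by
    have := (D.isCentral_iff t).1 h.central
    rw [reassoc_of% this, D.actL_ev]; simp
  right := by
    rw [← Category.assoc μ[S.X], RightModule.mul_ofElement]
    calc _ = (S.X ◁ i.hom ≫ D.P.ofElement t ▷ S.X) ≫ D.P.act ≫ D.ev := by simp
      _ = _ := by rw [whisker_exchange, Category.assoc, D.act_ev]; simp
  casimir := D.basisElement_casimir h.bilinear
  unit_left := by
    calc _ = D.coev ≫ (S.X ◁ Ψ ≫ (D.P.ofElement t ≫ D.ev) ▷ S.X) ≫ i.hom ▷ S.X ≫ μ[S.X] := by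
          simp [basisElement]
      _ = D.coev ≫ (D.P.ofElement t ≫ D.ev) ▷ D.P.X ≫ (A.X ◁ Ψ ≫ i.hom ▷ S.X ≫ μ[S.X]) := by
          rw [whisker_exchange]; simp
      _ = 𝟙 _ ⊗≫ D.coev ⊗≫ (t ▷ S.X ≫ D.pair) ▷ D.P.X ≫ D.actL ≫ Ψ := by
          rw [← h.bilinear.left, pair]; simp only [RightModule.ofElement]; monoidal
      _ = 𝟙 _ ⊗≫ (𝟙_ C ◁ D.coev ≫ t ▷ (S.X ⊗ D.P.X)) ⊗≫ D.pair ▷ D.P.X ≫ D.actL ≫ Ψ := by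
          monoidal
      _ = 𝟙 _ ⊗≫ t ≫ ((ρ_ D.P.X).inv ≫ D.P.X ◁ D.coev ≫
            (α_ _ _ _).inv ≫ (D.P.act ≫ D.ev) ▷ D.P.X ≫ D.actL) ≫ Ψ := by
          rw [whisker_exchange, pair]; monoidal
      _ = _ := by rw [D.basis_right, Category.id_comp, h.apply_element]; monoidal
  unit_right := by
    calc _ = D.coev ≫ S.X ◁ (Ψ ≫ D.P.ofElement t ≫ D.ev) ≫ S.X ◁ i.hom ≫ μ[S.X] := by
          simp [basisElement]
      _ = D.coev ≫ S.X ◁ ((ρ_ _).inv ≫ D.P.X ◁ η[S.X] ≫ D.pair) ≫ S.X ◁ i.hom ≫ μ[S.X] := by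
          rw [h.pair_apply, pair_one]; simp
      _ = _ := by
          conv_rhs => rw [D.basis_expand η[S.X]]
          monoidal

/-- Frobenius extensions `A ⟶ S` whose module `S` has a dual basis: `S` and its dual `P` are
isomorphic, by maps that are linear over `A` on the left and over `S` on the right. -/
theorem isFrobeniusExtension_iff (s : (tensor (bimod i) (bimod i)).X ⟶ S.X ⊗ S.X)
    (hs : s ≫ pS i = 𝟙 _) : IsFrobeniusExtension i ↔ ∃ t Ψ, D.IsFrobeniusPair t Ψ := by
  rw [Extension.isFrobeniusExtension_iff i s hs]
  exact ⟨fun ⟨θ, e, h⟩ => ⟨_, _, D.isFrobeniusPair_of_isFrobeniusSystem h⟩,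
    fun ⟨t, Ψ, h⟩ => ⟨_, _, D.isFrobeniusSystem_of_isFrobeniusPair h⟩⟩

end
end ExtensionDual
end Cowreath

/-! ### The left dual of the extension `A ⟶ Y A` -/

namespace Cowreath

variable {C : Type u} [Category.{v} C] [MonoidalCategory C] {A : Mon C}

namespace Duality
variable (X : RightTransfer A) (Y : C) [ExactPairing Y X.X]

lemma runit_d₁ : (A.X ⊗ X.X) ◁ runit A Y ≫ d₁ X Y =
    (α_ _ _ _).hom ≫ A.X ◁ ε_ Y X.X ≫ (ρ_ _).hom := by
  calc _ = 𝟙 _ ⊗≫ A.X ◁ ((X.X ⊗ Y) ◁ η[A.X] ≫ ε_ Y X.X ▷ A.X) ⊗≫ μ[A.X] := by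
        simp only [d₁, runit]; monoidal
    _ = 𝟙 _ ⊗≫ A.X ◁ ε_ Y X.X ⊗≫ (A.X ◁ η[A.X] ≫ μ[A.X]) := by
        rw [whisker_exchange]; monoidal
    _ = _ := by rw [MonObj.mul_one]; monoidal

/-- The dual basis `Σ yᵢ ⊗ xᵢ : 1 ⟶ (Y A) ⊗ (A X)` -/
def basis : 𝟙_ C ⟶ (Y ⊗ A.X) ⊗ (A.X ⊗ X.X) :=
  η_ Y X.X ≫ runit A Y ▷ X.X ≫ (Y ⊗ A.X) ◁ lunit A X.X

/-- The expansion of `Y A` in the dual basis -/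
lemma basis_left : (λ_ (Y ⊗ A.X)).inv ≫ basis X Y ▷ (Y ⊗ A.X) ≫ (α_ _ _ _).hom ≫
    (Y ⊗ A.X) ◁ d₁ X Y ≫ (bimod X Y).actRight = 𝟙 _ := by
  calc _ = 𝟙 _ ⊗≫ η_ Y X.X ▷ (Y ⊗ A.X) ⊗≫ (runit A Y ▷ X.X) ▷ (Y ⊗ A.X) ⊗≫
        (Y ⊗ A.X) ◁ (lunit A X.X ▷ (Y ⊗ A.X) ≫ d₁ X Y) ⊗≫ Y ◁ μ[A.X] := by
        simp only [basis]; monoidal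
    _ = 𝟙 _ ⊗≫ η_ Y X.X ▷ (Y ⊗ A.X) ⊗≫ (runit A Y ▷ ((X.X ⊗ Y) ⊗ A.X) ≫
        (Y ⊗ A.X) ◁ (ε_ Y X.X ▷ A.X)) ⊗≫ Y ◁ μ[A.X] := by
        rw [lunit_d₁]; monoidal
    _ = 𝟙 _ ⊗≫ (η_ Y X.X ▷ Y ≫ (α_ _ _ _).hom ≫ Y ◁ ε_ Y X.X) ▷ A.X ⊗≫ rext A (runit A Y) := by
        rw [← whisker_exchange]; simp only [rext]; monoidal
    _ = _ := by rw [ExactPairing.evaluation_coevaluation, rext_runit]; monoidal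

/-- The expansion of `A X` in the dual basis -/
lemma basis_right : (ρ_ (A.X ⊗ X.X)).inv ≫ (A.X ⊗ X.X) ◁ basis X Y ≫ (α_ _ _ _).inv ≫
    d₁ X Y ▷ (A.X ⊗ X.X) ≫ (Coring.obj X).actLeft = 𝟙 _ := by
  calc _ = 𝟙 _ ⊗≫ (A.X ⊗ X.X) ◁ η_ Y X.X ⊗≫ ((A.X ⊗ X.X) ◁ runit A Y) ▷ X.X ⊗≫
        (((A.X ⊗ X.X) ⊗ (Y ⊗ A.X)) ◁ lunit A X.X ≫ d₁ X Y ▷ (A.X ⊗ X.X)) ⊗≫ μ[A.X] ▷ X.X := by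
        simp only [basis]; monoidal
    _ = 𝟙 _ ⊗≫ (A.X ⊗ X.X) ◁ η_ Y X.X ⊗≫ ((A.X ⊗ X.X) ◁ runit A Y ≫ d₁ X Y) ▷ X.X ⊗≫
        lext A (lunit A X.X) := by
        rw [whisker_exchange]; simp only [lext]; monoidal
    _ = 𝟙 _ ⊗≫ A.X ◁ (X.X ◁ η_ Y X.X ≫ (α_ _ _ _).inv ≫ ε_ Y X.X ▷ X.X) ⊗≫ 𝟙 _ := by
        rw [runit_d₁, lext_lunit]; monoidal
    _ = _ := by rw [ExactPairing.coevaluation_evaluation]; monoidal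

variable [ComonObj X]

/-- The action `N Y A ⟶ N X Y A ⟶ N A ⟶ N` of `Y A` on an entwined module `N`. -/
def entwinedAct (N : EntwinedModule X) : N.X ⊗ (Y ⊗ A.X) ⟶ N.X := (toModule (Y := Y) N).act

lemma entwinedAct_eq (N : EntwinedModule X) : entwinedAct X Y N =
    𝟙 _ ⊗≫ N.coact ▷ (Y ⊗ A.X) ⊗≫ N.X ◁ ε_ Y X.X ▷ A.X ⊗≫ N.act := by
  change (α_ N.X Y A.X).inv ≫ (N.coact ▷ Y ≫ (α_ N.X X.X Y).hom ≫ N.X ◁ ε_ Y X.X ≫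
    (ρ_ N.X).hom) ▷ A.X ≫ N.act = _
  monoidal

lemma entwinedAct_wOne (N : EntwinedModule X) :
    N.X ◁ wOne X Y ≫ entwinedAct X Y N = (ρ_ N.X).hom := (toModule (Y := Y) N).act_one

/-- Restricting the action of `Y A` to `A` gives back the action of `A`. -/
lemma incl_entwinedAct (N : EntwinedModule X) :
    N.X ◁ (incl X Y).hom ≫ entwinedAct X Y N = N.act := by
  change N.X ◁ ((λ_ A.X).inv ≫ wOne X Y ▷ A.X ≫ (α_ Y A.X A.X).hom ≫ Y ◁ μ[A.X]) ≫
    entwinedAct X Y N = N.act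
  calc _ = 𝟙 (N.X ⊗ A.X) ⊗≫ N.X ◁ wOne X Y ▷ A.X ⊗≫
        (N.X ◁ (Y ◁ μ[A.X]) ≫ N.coact ▷ (Y ⊗ A.X)) ⊗≫
        N.X ◁ ε_ Y X.X ▷ A.X ⊗≫ N.act := by
        rw [entwinedAct_eq]; monoidal
    _ = 𝟙 (N.X ⊗ A.X) ⊗≫ N.X ◁ wOne X Y ▷ A.X ⊗≫ N.coact ▷ (Y ⊗ (A.X ⊗ A.X)) ⊗≫
        N.X ◁ ((X.X ⊗ Y) ◁ μ[A.X] ≫ ε_ Y X.X ▷ A.X) ⊗≫ N.act := by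
        rw [whisker_exchange]; monoidal
    _ = 𝟙 (N.X ⊗ A.X) ⊗≫ N.X ◁ wOne X Y ▷ A.X ⊗≫ N.coact ▷ (Y ⊗ (A.X ⊗ A.X)) ⊗≫
        N.X ◁ ε_ Y X.X ▷ A.X ▷ A.X ⊗≫ (N.X ◁ μ[A.X] ≫ N.act) := by
        rw [whisker_exchange]; monoidal
    _ = 𝟙 (N.X ⊗ A.X) ⊗≫ (N.X ◁ wOne X Y ≫ entwinedAct X Y N) ▷ A.X ⊗≫ N.act := by
        rw [N.act_mul, entwinedAct_eq]; monoidal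
    _ = _ := by rw [entwinedAct_wOne]; monoidal

/-- The action of `Y A` on `A X` -/
def coringAct : (A.X ⊗ X.X) ⊗ (Y ⊗ A.X) ⟶ A.X ⊗ X.X := entwinedAct X Y (Coring.entwined X)

lemma coringAct_eq : coringAct X Y = 𝟙 _ ⊗≫ lext A (cδ X) ▷ (Y ⊗ A.X) ⊗≫
    (A.X ⊗ X.X) ◁ ε_ Y X.X ▷ A.X ⊗≫ lext A X.ψ := by
  change (α_ (A.X ⊗ X.X) Y A.X).inv ≫ ((A.X ◁ cδ X ≫ (α_ A.X A.X (X.X ⊗ X.X)).inv ≫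
    μ[A.X] ▷ (X.X ⊗ X.X) ≫ (α_ A.X X.X X.X).inv) ▷ Y ≫ (α_ (A.X ⊗ X.X) X.X Y).hom ≫
      (A.X ⊗ X.X) ◁ ε_ Y X.X ≫ (ρ_ (A.X ⊗ X.X)).hom) ▷ A.X ≫ (Coring.obj X).actRight = _
  rw [Coring.actRight_eq]
  simp only [lext]; monoidal

lemma coringAct_left : (Coring.obj X).actLeft ▷ (Y ⊗ A.X) ≫ coringAct X Y =
    (α_ _ _ _).hom ≫ A.X ◁ coringAct X Y ≫ (Coring.obj X).actLeft := by
  calc _ = 𝟙 _ ⊗≫ ((α_ A.X A.X X.X).inv ≫ μ[A.X] ▷ X.X ≫ lext A (cδ X)) ▷ (Y ⊗ A.X) ⊗≫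
        (A.X ⊗ X.X) ◁ ε_ Y X.X ▷ A.X ⊗≫ lext A X.ψ := by
        rw [coringAct_eq]; monoidal
    _ = 𝟙 _ ⊗≫ (A.X ◁ lext A (cδ X)) ▷ (Y ⊗ A.X) ⊗≫ (μ[A.X] ▷ (X.X ⊗ ((X.X ⊗ Y) ⊗ A.X)) ≫
        A.X ◁ (X.X ◁ ε_ Y X.X ▷ A.X)) ⊗≫ lext A X.ψ := by
        rw [mul_lext]; monoidal
    _ = 𝟙 _ ⊗≫ (A.X ◁ lext A (cδ X)) ▷ (Y ⊗ A.X) ⊗≫ (A.X ⊗ A.X) ◁ (X.X ◁ ε_ Y X.X ▷ A.X) ⊗≫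
        ((α_ A.X A.X _).inv ≫ μ[A.X] ▷ (X.X ⊗ A.X) ≫ lext A X.ψ) := by
        rw [← whisker_exchange]; monoidal
    _ = _ := by rw [mul_lext, coringAct_eq]; monoidal

/-- The counit `A X ⟶ A` of the coring -/
def coringCounit : A.X ⊗ X.X ⟶ A.X := A.X ◁ cε X ≫ μ[A.X]

lemma coringCounit_left :
    (Coring.obj X).actLeft ≫ coringCounit X = A.X ◁ coringCounit X ≫ μ[A.X] := by
  calc _ = 𝟙 _ ⊗≫ (μ[A.X] ▷ X.X ≫ A.X ◁ cε X) ≫ μ[A.X] := by simp only [coringCounit]; monoidal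
    _ = 𝟙 _ ⊗≫ A.X ◁ A.X ◁ cε X ⊗≫ (μ[A.X] ▷ A.X ≫ μ[A.X]) := by
        rw [← whisker_exchange]; monoidal
    _ = _ := by rw [MonObj.mul_assoc]; simp only [coringCounit]; monoidal

lemma coringCounit_right :
    (Coring.obj X).actRight ≫ coringCounit X = coringCounit X ▷ A.X ≫ μ[A.X] := by
  calc _ = 𝟙 _ ⊗≫ A.X ◁ X.ψ ⊗≫ (μ[A.X] ▷ X.X ≫ A.X ◁ cε X) ≫ μ[A.X] := by
        simp only [coringCounit]; monoidal
    _ = 𝟙 _ ⊗≫ A.X ◁ X.ψ ⊗≫ A.X ◁ A.X ◁ cε X ⊗≫ (μ[A.X] ▷ A.X ≫ μ[A.X]) := by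
        rw [← whisker_exchange]; monoidal
    _ = 𝟙 _ ⊗≫ A.X ◁ (X.ψ ≫ A.X ◁ cε X ≫ μ[A.X]) ⊗≫ μ[A.X] := by
        rw [MonObj.mul_assoc]; monoidal
    _ = 𝟙 _ ⊗≫ A.X ◁ cε X ▷ A.X ⊗≫ ((α_ _ _ _).hom ≫ A.X ◁ μ[A.X] ≫ μ[A.X]) := by
        rw [ψ_cε]; monoidal
    _ = _ := by rw [← MonObj.mul_assoc]; simp only [coringCounit]; monoidal

/-- The pairing of `A X` and `Y A` is `a x ⊗ y a' ↦ a d(x, y) a'`. -/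
lemma coringAct_counit : coringAct X Y ≫ coringCounit X = d₁ X Y := by
  calc _ = 𝟙 _ ⊗≫ lext A (cδ X) ▷ (Y ⊗ A.X) ⊗≫ (A.X ⊗ X.X) ◁ ε_ Y X.X ▷ A.X ⊗≫
        ((Coring.obj X).actRight ≫ coringCounit X) := by
        rw [coringAct_eq, Coring.actRight_eq]; monoidal
    _ = 𝟙 _ ⊗≫ lext A (cδ X) ▷ (Y ⊗ A.X) ⊗≫ ((A.X ⊗ X.X) ◁ (ε_ Y X.X ▷ A.X) ≫
        coringCounit X ▷ (𝟙_ C ⊗ A.X)) ⊗≫ μ[A.X] := by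
        rw [coringCounit_right]; monoidal
    _ = 𝟙 _ ⊗≫ (lext A (cδ X) ≫ lext A (rten (cε X ≫ (ρ_ A.X).inv) X.X)) ▷ (Y ⊗ A.X) ⊗≫
        A.X ◁ ε_ Y X.X ▷ A.X ⊗≫ μ[A.X] := by
        rw [whisker_exchange]; simp only [coringCounit, lext, rten]; monoidal
    _ = 𝟙 _ ⊗≫ lext A (lunit A (𝟙_ C ⊗ X.X)) ▷ (Y ⊗ A.X) ⊗≫
        A.X ◁ ε_ Y X.X ▷ A.X ⊗≫ μ[A.X] := by
        rw [← lext_comp, cδ_cε_left, lext_precomp]; monoidal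
    _ = _ := by rw [lext_lunit]; simp only [d₁]; monoidal

/-- `A X` is the left dual of the extension `A ⟶ Y A`. -/
def extensionDual : ExtensionDual (incl X Y) where
  P := toModule (Coring.entwined X)
  actL := (Coring.obj X).actLeft
  actL_act := coringAct_left X Y
  ev := coringCounit X
  actL_ev := coringCounit_left X
  act_ev := by
    change (A.X ⊗ X.X) ◁ (incl X Y).hom ≫ entwinedAct X Y (Coring.entwined X) ≫ coringCounit X = _
    exact (Category.assoc _ _ _).symm.trans
      ((congrArg (· ≫ coringCounit X) (incl_entwinedAct X Y (Coring.entwined X))).trans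
        (coringCounit_right X))
  coev := basis X Y
  basis_left := by
    change (λ_ (Y ⊗ A.X)).inv ≫ basis X Y ▷ (Y ⊗ A.X) ≫ (α_ _ _ _).hom ≫
      (Y ⊗ A.X) ◁ (coringAct X Y ≫ coringCounit X) ≫ (Y ⊗ A.X) ◁ (incl X Y).hom ≫ wreathMul X Y = _
    rw [coringAct_counit, mul_incl]
    exact basis_left X Y
  basis_right := by
    change (ρ_ (A.X ⊗ X.X)).inv ≫ (A.X ⊗ X.X) ◁ basis X Y ≫ (α_ _ _ _).inv ≫
      (coringAct X Y ≫ coringCounit X) ▷ (A.X ⊗ X.X) ≫ (Coring.obj X).actLeft = _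
    rw [coringAct_counit]
    exact basis_right X Y

end Duality

end Cowreath

/-! ### Right `Y A`-modules and entwined modules -/

namespace Cowreath

variable {C : Type u} [Category.{v} C] [MonoidalCategory C] {A : Mon C}

/-- A right linear morphism whose underlying morphism is invertible is an isomorphism. -/
noncomputable def RightModule.isoMk {M N : RightModule A} (f : M ⟶ N) [IsIso f.hom] : M ≅ N where
  hom := f
  inv := ⟨inv f.hom, by
    rw [← cancel_mono f.hom, Category.assoc, Category.assoc, f.act_hom,
      ← comp_whiskerRight_assoc]; simp⟩
  hom_inv_id := RightModule.Hom.ext (IsIso.hom_inv_id f.hom)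
  inv_hom_id := RightModule.Hom.ext (IsIso.inv_hom_id f.hom)

lemma RightModule.isIso_hom {M N : RightModule A} (e : M ≅ N) : IsIso e.hom.hom :=
  ⟨e.inv.hom, congrArg RightModule.Hom.hom e.hom_inv_id, congrArg RightModule.Hom.hom e.inv_hom_id⟩

/-- An entwined morphism whose underlying morphism is invertible is an isomorphism. -/
noncomputable def EntwinedModule.isoMk {X : RightTransfer A} [ComonObj X]
    {M N : EntwinedModule X} (f : M ⟶ N)
    [IsIso f.hom] : M ≅ N where
  hom := f
  inv :=
    { hom := inv f.hom
      act_hom := by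
        rw [← cancel_mono f.hom, Category.assoc, Category.assoc, f.act_hom,
          ← comp_whiskerRight_assoc]; simp
      coact_hom := by
        rw [← cancel_epi f.hom, reassoc_of% f.coact_hom, ← comp_whiskerRight]; simp }
  hom_inv_id := EntwinedModule.Hom.ext (IsIso.hom_inv_id f.hom)
  inv_hom_id := EntwinedModule.Hom.ext (IsIso.inv_hom_id f.hom)

lemma EntwinedModule.isIso_hom {X : RightTransfer A} [ComonObj X] {M N : EntwinedModule X}
    (e : M ≅ N) : IsIso e.hom.hom :=
  ⟨e.inv.hom, congrArg (fun f => f.hom) e.hom_inv_id, congrArg (fun f => f.hom) e.inv_hom_id⟩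

namespace Duality
variable (X : RightTransfer A) (Y : C) [ExactPairing Y X.X]

lemma hat_precomp {Z Z' W : C} (f : Z' ⟶ Z) (g : Z ⟶ Y ⊗ W) :
    hat X.X (f ≫ g) = X.X ◁ f ≫ hat X.X g := by
  simp [hat]

/-- The transpose of the left action of `A` on `Y A`. -/
lemma hat_actLeft {Z : C} (g : Z ⟶ Y ⊗ A.X) : hat X.X (A.X ◁ g ≫ (bimod X Y).actLeft) =
    (α_ _ _ _).inv ≫ X.ψ ▷ Z ≫ (α_ _ _ _).hom ≫ A.X ◁ hat X.X g ≫ μ[A.X] := by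
  calc _ = 𝟙 _ ⊗≫ X.X ◁ A.X ◁ g ⊗≫
        (X.X ◁ dualφ X Y ≫ (α_ X.X Y A.X).inv ≫ ε_ Y X.X ▷ A.X) ▷ A.X ⊗≫ μ[A.X] := by
        calc _ = hat X.X ((A.X ◁ g ≫ (α_ _ _ _).inv) ≫ rext A (dualφ X Y)) := by
              simp only [rext]; congr 1; monoidal
          _ = _ := by rw [hat_rext]; monoidal
    _ = 𝟙 _ ⊗≫ ((X.X ⊗ A.X) ◁ g ≫ X.ψ ▷ (Y ⊗ A.X)) ⊗≫ A.X ◁ ε_ Y X.X ▷ A.X ⊗≫ μ[A.X] := by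
        rw [hat_dualφ]; monoidal
    _ = _ := by rw [whisker_exchange]; simp only [hat]; monoidal

lemma hat_actRight {Z : C} (g : Z ⟶ Y ⊗ A.X) : hat X.X (g ▷ A.X ≫ (bimod X Y).actRight) =
    (α_ _ _ _).inv ≫ hat X.X g ▷ A.X ≫ μ[A.X] := by
  calc _ = 𝟙 _ ⊗≫ X.X ◁ g ▷ A.X ⊗≫ ((X.X ⊗ Y) ◁ μ[A.X] ≫ ε_ Y X.X ▷ A.X) ⊗≫ 𝟙 _ := by
        simp only [hat]; monoidal
    _ = _ := by rw [whisker_exchange]; simp only [hat]; monoidal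

/-- Left `A`-linear maps out of `A X` are determined by their restriction to `X`. -/
lemma lunit_ext {W : C} {aW : A.X ⊗ W ⟶ W} {f g : A.X ⊗ X.X ⟶ W}
    (hf : (Coring.obj X).actLeft ≫ f = A.X ◁ f ≫ aW)
    (hg : (Coring.obj X).actLeft ≫ g = A.X ◁ g ≫ aW)
    (h : lunit A X.X ≫ f = lunit A X.X ≫ g) : f = g := by
  have key (f : A.X ⊗ X.X ⟶ W) (hf : (Coring.obj X).actLeft ≫ f = A.X ◁ f ≫ aW) :
      f = A.X ◁ (lunit A X.X ≫ f) ≫ aW := by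
    calc _ = lext A (lunit A X.X) ≫ f := by rw [lext_lunit]; simp
      _ = A.X ◁ lunit A X.X ≫ ((Coring.obj X).actLeft ≫ f) := by simp only [lext]; monoidal
      _ = _ := by rw [hf]; monoidal
  rw [key f hf, h, ← key g hg]

/-- The left `A`-linear map `A X ⟶ Y A` given by `B : X X ⟶ A` -/
def ofForm (B : X.X ⊗ X.X ⟶ A.X) : A.X ⊗ X.X ⟶ Y ⊗ A.X :=
  A.X ◁ unhat Y B ≫ (bimod X Y).actLeft

lemma hat_ofForm (B : X.X ⊗ X.X ⟶ A.X) : hat X.X (ofForm X Y B) =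
    (α_ _ _ _).inv ≫ X.ψ ▷ X.X ≫ (α_ _ _ _).hom ≫ A.X ◁ B ≫ μ[A.X] := by
  rw [ofForm, hat_actLeft, hat_unhat]

lemma ofForm_left (B : X.X ⊗ X.X ⟶ A.X) : (Coring.obj X).actLeft ≫ ofForm X Y B =
    A.X ◁ ofForm X Y B ≫ (bimod X Y).actLeft := by
  calc _ = 𝟙 _ ⊗≫ (μ[A.X] ▷ X.X ≫ A.X ◁ unhat Y B) ≫ (bimod X Y).actLeft := by
        simp only [ofForm]; monoidal
    _ = 𝟙 _ ⊗≫ A.X ◁ A.X ◁ unhat Y B ⊗≫ (μ[A.X] ▷ (bimod X Y).X ≫ (bimod X Y).actLeft) := by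
        rw [← whisker_exchange]; monoidal
    _ = _ := by rw [(bimod X Y).left_assoc]; simp only [ofForm]; monoidal

lemma lunit_ofForm (B : X.X ⊗ X.X ⟶ A.X) : lunit A X.X ≫ ofForm X Y B = unhat Y B := by
  calc _ = 𝟙 _ ⊗≫ (η[A.X] ▷ X.X ≫ A.X ◁ unhat Y B) ≫ (bimod X Y).actLeft := by
        simp only [ofForm, lunit]; monoidal
    _ = 𝟙 _ ⊗≫ unhat Y B ⊗≫ (η[A.X] ▷ (bimod X Y).X ≫ (bimod X Y).actLeft) := by
        rw [← whisker_exchange]; monoidal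
    _ = _ := by rw [(bimod X Y).one_actLeft]; monoidal

lemma eq_ofForm {f : A.X ⊗ X.X ⟶ Y ⊗ A.X}
    (hf : (Coring.obj X).actLeft ≫ f = A.X ◁ f ≫ (bimod X Y).actLeft) :
    f = ofForm X Y (hat X.X (lunit A X.X ≫ f)) :=
  lunit_ext X hf (ofForm_left X Y _) (by rw [lunit_ofForm, unhat_hat])

/-- The map of a form `B` is right `A`-linear if and only if `B` is compatible with `ψ`. -/
lemma ofForm_right_iff (B : X.X ⊗ X.X ⟶ A.X) :
    (Coring.obj X).actRight ≫ ofForm X Y B = ofForm X Y B ▷ A.X ≫ (bimod X Y).actRight ↔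
      ψ₂ X ≫ A.X ◁ B ≫ μ[A.X] = B ▷ A.X ≫ μ[A.X] := by
  have h₁ : lunit A X.X ▷ A.X ≫ (Coring.obj X).actRight ≫ ofForm X Y B = X.ψ ≫ ofForm X Y B := by
    rw [← Category.assoc]; congr 1
    calc _ = rten (lunit A X.X) A.X ≫ lext A X.ψ := by
          rw [Coring.actRight_eq]; simp only [rten]; monoidal
      _ = _ := by rw [rten_lunit, lunit_lext]
  have h₂ : lunit A X.X ▷ A.X ≫ ofForm X Y B ▷ A.X ≫ (bimod X Y).actRight =
      unhat Y B ▷ A.X ≫ (bimod X Y).actRight := by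
    rw [← comp_whiskerRight_assoc, lunit_ofForm]
  have h₃ : hat X.X (X.ψ ≫ ofForm X Y B) = (α_ _ _ _).inv ≫ ψ₂ X ≫ A.X ◁ B ≫ μ[A.X] := by
    rw [hat_precomp, hat_ofForm]; simp [ψ₂]
  have h₄ : hat X.X (unhat Y B ▷ A.X ≫ (bimod X Y).actRight) =
      (α_ _ _ _).inv ≫ B ▷ A.X ≫ μ[A.X] := by
    rw [hat_actRight, hat_unhat]
  constructor
  · intro h
    have h' := congrArg (fun z => hat X.X (lunit A X.X ▷ A.X ≫ z)) h
    dsimp only at h'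
    rw [h₁, h₂, h₃, h₄, cancel_epi] at h'
    exact h'
  · intro h
    have h' : X.ψ ≫ ofForm X Y B = unhat Y B ▷ A.X ≫ (bimod X Y).actRight :=
      hat_injective (X := X.X) (by rw [h₃, h₄, h])
    calc _ = 𝟙 _ ⊗≫ A.X ◁ X.ψ ⊗≫ ((Coring.obj X).actLeft ≫ ofForm X Y B) := by monoidal
      _ = 𝟙 _ ⊗≫ A.X ◁ (X.ψ ≫ ofForm X Y B) ≫ (bimod X Y).actLeft := by
        rw [ofForm_left]; monoidal
      _ = 𝟙 _ ⊗≫ A.X ◁ unhat Y B ▷ A.X ⊗≫ ((α_ A.X (bimod X Y).X A.X).hom ≫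
          A.X ◁ (bimod X Y).actRight ≫ (bimod X Y).actLeft) := by
        rw [h']; monoidal
      _ = _ := by rw [← (bimod X Y).middle_assoc]; simp only [ofForm]; monoidal

variable [ComonObj X]

/-- The action of `Y` on an entwined module -/
lemma entwinedAct_runit (N : EntwinedModule X) : N.X ◁ runit A Y ≫ entwinedAct X Y N =
    N.coact ▷ Y ≫ (α_ N.X X.X Y).hom ≫ N.X ◁ ε_ Y X.X ≫ (ρ_ N.X).hom := by
  calc _ = 𝟙 (N.X ⊗ Y) ⊗≫ (N.X ◁ (Y ◁ η[A.X]) ≫ N.coact ▷ (Y ⊗ A.X)) ⊗≫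
        N.X ◁ ε_ Y X.X ▷ A.X ⊗≫ N.act := by
        rw [entwinedAct_eq]; simp only [runit]; monoidal
    _ = 𝟙 (N.X ⊗ Y) ⊗≫ N.coact ▷ Y ⊗≫ N.X ◁ ((X.X ⊗ Y) ◁ η[A.X] ≫ ε_ Y X.X ▷ A.X) ⊗≫ N.act := by
        rw [whisker_exchange]; monoidal
    _ = 𝟙 (N.X ⊗ Y) ⊗≫ N.coact ▷ Y ⊗≫ N.X ◁ ε_ Y X.X ⊗≫ (N.X ◁ η[A.X] ≫ N.act) := by
        rw [whisker_exchange]; monoidal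
    _ = _ := by rw [N.act_one]; monoidal

lemma toEntwined_coact (M : RightModule (mon X Y)) : (toEntwined M).coact =
    (ρ_ M.X).inv ≫ M.X ◁ η_ Y X.X ≫ (α_ M.X Y X.X).inv ≫ actY M ▷ X.X := rfl

/-- For an entwined module `N` and a right `Y A`-module `M`, a morphism `N ⟶ M` is `Y A`-linear if
and only if it is a morphism of entwined modules. -/
lemma linear_iff_entwined (N : EntwinedModule X) (M : RightModule (mon X Y)) (f : N.X ⟶ M.X) :
    entwinedAct X Y N ≫ f = f ▷ (Y ⊗ A.X) ≫ M.act ↔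
      N.act ≫ f = f ▷ A.X ≫ (actA M).act ∧ f ≫ (toEntwined M).coact = N.coact ≫ f ▷ X.X := by
  constructor
  · intro h
    constructor
    · rw [← incl_entwinedAct X Y N, Category.assoc, h, whisker_exchange_assoc]
    · have h' : f ▷ Y ≫ actY M = (N.coact ▷ Y ≫ (α_ N.X X.X Y).hom ≫ N.X ◁ ε_ Y X.X ≫
          (ρ_ N.X).hom) ≫ f := by
        rw [← entwinedAct_runit, Category.assoc, h, actY, ← whisker_exchange_assoc]
      rw [toEntwined_coact]
      calc _ = 𝟙 N.X ⊗≫ (f ▷ 𝟙_ C ≫ M.X ◁ η_ Y X.X) ⊗≫ actY M ▷ X.X := by monoidal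
        _ = 𝟙 N.X ⊗≫ N.X ◁ η_ Y X.X ⊗≫ (f ▷ Y ≫ actY M) ▷ X.X := by
          rw [← whisker_exchange]; monoidal
        _ = 𝟙 N.X ⊗≫ (N.X ◁ η_ Y X.X ≫ N.coact ▷ (Y ⊗ X.X)) ⊗≫ N.X ◁ ε_ Y X.X ▷ X.X ⊗≫
            f ▷ X.X := by
          rw [h']; monoidal
        _ = 𝟙 N.X ⊗≫ N.coact ⊗≫ N.X ◁ (X.X ◁ η_ Y X.X ≫ (α_ _ _ _).inv ≫ ε_ Y X.X ▷ X.X) ⊗≫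
            f ▷ X.X := by
          rw [whisker_exchange]; monoidal
        _ = _ := by rw [ExactPairing.coevaluation_evaluation]; monoidal
  · rintro ⟨h₁, h₂⟩
    rw [toEntwined_coact] at h₂
    calc _ = 𝟙 (N.X ⊗ (Y ⊗ A.X)) ⊗≫ N.coact ▷ (Y ⊗ A.X) ⊗≫ N.X ◁ ε_ Y X.X ▷ A.X ⊗≫
          (N.act ≫ f) := by rw [entwinedAct_eq]; monoidal
      _ = 𝟙 (N.X ⊗ (Y ⊗ A.X)) ⊗≫ N.coact ▷ (Y ⊗ A.X) ⊗≫ (N.X ◁ ε_ Y X.X ≫ f ▷ 𝟙_ C) ▷ A.X ⊗≫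
          (actA M).act := by rw [h₁]; monoidal
      _ = 𝟙 (N.X ⊗ (Y ⊗ A.X)) ⊗≫ (N.coact ≫ f ▷ X.X) ▷ (Y ⊗ A.X) ⊗≫ (M.X ◁ ε_ Y X.X) ▷ A.X ⊗≫
          (actA M).act := by rw [whisker_exchange]; monoidal
      _ = 𝟙 (N.X ⊗ (Y ⊗ A.X)) ⊗≫ f ▷ (Y ⊗ A.X) ⊗≫ M.X ◁ η_ Y X.X ▷ (Y ⊗ A.X) ⊗≫
          (actY M ▷ (X.X ⊗ Y) ≫ M.X ◁ ε_ Y X.X) ▷ A.X ⊗≫ (actA M).act := by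
        rw [← h₂]; monoidal
      _ = 𝟙 (N.X ⊗ (Y ⊗ A.X)) ⊗≫ f ▷ (Y ⊗ A.X) ⊗≫
          M.X ◁ (η_ Y X.X ▷ Y ≫ (α_ _ _ _).hom ≫ Y ◁ ε_ Y X.X) ▷ A.X ⊗≫
          actY M ▷ A.X ≫ (actA M).act := by
        rw [← whisker_exchange]; monoidal
      _ = f ▷ (Y ⊗ A.X) ≫ (α_ M.X Y A.X).inv ≫ actY M ▷ A.X ≫ (actA M).act := by
        rw [ExactPairing.evaluation_coevaluation]; monoidal
      _ = _ := congrArg (f ▷ (Y ⊗ A.X) ≫ ·) (act_eq M)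

end Duality
end Cowreath

/-! ### Casimir morphisms -/

namespace Cowreath

variable {C : Type u} [Category.{v} C] [MonoidalCategory C] {A : Mon C}

namespace Duality
variable (X : RightTransfer A) (Y : C) [ExactPairing Y X.X]

/-- The form of a morphism `X X ⟶ 1` of right transfer morphisms -/
def form {X : RightTransfer A} (B : X ⊗ X ⟶ 𝟙_ (RightTransfer A)) : X.X ⊗ X.X ⟶ A.X :=
  (B.hom : X.X ⊗ X.X ⟶ A.X ⊗ 𝟙_ C) ≫ (ρ_ A.X).hom

lemma hom_eq_form {X : RightTransfer A} (B : X ⊗ X ⟶ 𝟙_ (RightTransfer A)) :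
    (B.hom : X.X ⊗ X.X ⟶ A.X ⊗ 𝟙_ C) = form B ≫ (ρ_ A.X).inv := by
  have h (f : X.X ⊗ X.X ⟶ A.X ⊗ 𝟙_ C) : f = (f ≫ (ρ_ A.X).hom) ≫ (ρ_ A.X).inv := by simp
  exact h B.hom

lemma casimirMap_eq (B : X ⊗ X ⟶ 𝟙_ (RightTransfer A)) : casimirMap Y B = ofForm X Y (form B) :=
  hat_injective (X := X.X) (by
    rw [hat_ofForm]
    exact hat_unhat ((α_ X.X A.X X.X).inv ≫ X.ψ ▷ X.X ≫ (α_ A.X X.X X.X).hom ≫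
      A.X ◁ form B ≫ μ[A.X]))

lemma form_comm {X : RightTransfer A} (B : X ⊗ X ⟶ 𝟙_ (RightTransfer A)) :
    ψ₂ X ≫ A.X ◁ form B ≫ μ[A.X] = form B ▷ A.X ≫ μ[A.X] := by
  have h : ψ₂ X ≫ lext A (form B ≫ (ρ_ A.X).inv) =
      rten (form B ≫ (ρ_ A.X).inv) A.X ≫ lext A ((λ_ A.X).hom ≫ (ρ_ A.X).inv) := by
    rw [← hom_eq_form]; exact B.comm'
  calc _ = (ψ₂ X ≫ lext A (form B ≫ (ρ_ A.X).inv)) ≫ (ρ_ A.X).hom := by simp only [lext]; monoidal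
    _ = _ := by rw [h]; simp only [lext, rten]; monoidal

/-- The morphism `X X ⟶ 1` of right transfer morphisms of a form compatible with `ψ` -/
def homOfForm {X : RightTransfer A} (B : X.X ⊗ X.X ⟶ A.X)
    (h : ψ₂ X ≫ A.X ◁ B ≫ μ[A.X] = B ▷ A.X ≫ μ[A.X]) : X ⊗ X ⟶ 𝟙_ (RightTransfer A) :=
  RightTransfer.Hom.mk' (X := X ⊗ X) (Y := 𝟙_ (RightTransfer A)) (B ≫ (ρ_ A.X).inv) (by
    change ψ₂ X ≫ lext A (B ≫ (ρ_ A.X).inv) =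
      rten (B ≫ (ρ_ A.X).inv) A.X ≫ lext A ((λ_ A.X).hom ≫ (ρ_ A.X).inv)
    calc _ = (ψ₂ X ≫ A.X ◁ B ≫ μ[A.X]) ≫ (ρ_ A.X).inv := by simp only [lext]; monoidal
      _ = _ := by rw [h]; simp only [lext, rten]; monoidal)

lemma form_homOfForm {X : RightTransfer A} (B : X.X ⊗ X.X ⟶ A.X)
    (h : ψ₂ X ≫ A.X ◁ B ≫ μ[A.X] = B ▷ A.X ≫ μ[A.X]) : form (homOfForm B h) = B := by
  change (B ≫ (ρ_ A.X).inv) ≫ (ρ_ A.X).hom = B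
  simp

variable [ComonObj X]

/-- The action of `Y` on the regular module `Y A`. -/
lemma runit_mul : (Y ⊗ A.X) ◁ runit A Y ≫ wreathMul X Y =
    𝟙 _ ⊗≫ Y ◁ dualφ X Y ⊗≫ rext A (wMul X Y) := by
  calc _ = 𝟙 _ ⊗≫ Y ◁ ((A.X ⊗ Y) ◁ η[A.X] ≫ dualφ X Y ▷ A.X) ⊗≫
        (Y ⊗ Y) ◁ μ[A.X] ⊗≫ rext A (wMul X Y) := by
        rw [mul_eq'']; simp only [runit]; monoidal
    _ = 𝟙 _ ⊗≫ Y ◁ dualφ X Y ⊗≫ (Y ⊗ Y) ◁ (A.X ◁ η[A.X] ≫ μ[A.X]) ⊗≫ rext A (wMul X Y) := by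
        rw [whisker_exchange]; monoidal
    _ = _ := by rw [MonObj.mul_one]; monoidal

/-- The coaction of the regular module `Y A`. -/
def regCoact : Y ⊗ A.X ⟶ (Y ⊗ A.X) ⊗ X.X :=
  (toEntwined (RightModule.regular (mon X Y))).coact

lemma regCoact_eq : regCoact X Y = 𝟙 _ ⊗≫ Y ◁ b₁ X Y ⊗≫ rext A (wMul X Y) ▷ X.X ⊗≫ 𝟙 _ := by
  change (ρ_ (Y ⊗ A.X)).inv ≫ (Y ⊗ A.X) ◁ η_ Y X.X ≫ (α_ (Y ⊗ A.X) Y X.X).inv ≫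
    ((Y ⊗ A.X) ◁ runit A Y ≫ wreathMul X Y) ▷ X.X = _
  rw [runit_mul, b₁_eq]; monoidal

/-- The transpose of the coaction of `Y A` is the action `x ⊗ s ↦ x s` of `Y A` on `X ⊆ A X`. -/
lemma hat_regCoact : hat X.X (regCoact X Y ≫ (α_ _ _ _).hom) =
    lunit A X.X ▷ (Y ⊗ A.X) ≫ coringAct X Y := by
  have h : lunit A X.X ▷ (Y ⊗ A.X) ≫ coringAct X Y = 𝟙 _ ⊗≫ cδ X ▷ (Y ⊗ A.X) ⊗≫
      (A.X ⊗ X.X) ◁ ε_ Y X.X ▷ A.X ⊗≫ lext A X.ψ := by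
    calc _ = 𝟙 _ ⊗≫ (lunit A X.X ≫ lext A (cδ X)) ▷ (Y ⊗ A.X) ⊗≫
          (A.X ⊗ X.X) ◁ ε_ Y X.X ▷ A.X ⊗≫ lext A X.ψ := by rw [coringAct_eq]; monoidal
      _ = _ := by rw [lunit_lext]
  rw [h]
  calc _ = 𝟙 _ ⊗≫ X.X ◁ Y ◁ b₁ X Y ⊗≫
        (X.X ◁ wMul X Y ≫ (α_ X.X Y A.X).inv ≫ ε_ Y X.X ▷ A.X) ▷ (A.X ⊗ X.X) ⊗≫ μ[A.X] ▷ X.X := by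
        calc _ = 𝟙 _ ⊗≫ X.X ◁ Y ◁ b₁ X Y ⊗≫ X.X ◁ (wMul X Y ▷ A.X ▷ X.X) ⊗≫
              ((X.X ⊗ Y) ◁ (μ[A.X] ▷ X.X) ≫ ε_ Y X.X ▷ (A.X ⊗ X.X)) ⊗≫ 𝟙 _ := by
              rw [regCoact_eq]; simp only [hat, rext]; monoidal
          _ = _ := by rw [whisker_exchange]; monoidal
    _ = 𝟙 _ ⊗≫ (X.X ◁ (Y ◁ b₁ X Y) ≫ cδ X ▷ (Y ⊗ (Y ⊗ (A.X ⊗ X.X)))) ⊗≫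
        A.X ◁ ev₂ X.X Y ▷ (A.X ⊗ X.X) ⊗≫ μ[A.X] ▷ X.X := by
        rw [hat_wMul]; monoidal
    _ = 𝟙 _ ⊗≫ cδ X ▷ (Y ⊗ A.X) ⊗≫ (A.X ⊗ X.X) ◁ ((X.X ⊗ Y) ◁ b₁ X Y ≫
        ε_ Y X.X ▷ (Y ⊗ (A.X ⊗ X.X))) ⊗≫ A.X ◁ ε_ Y X.X ▷ (A.X ⊗ X.X) ⊗≫ μ[A.X] ▷ X.X := by
        rw [whisker_exchange]; simp only [ev₂]; monoidal
    _ = 𝟙 _ ⊗≫ cδ X ▷ (Y ⊗ A.X) ⊗≫ (A.X ⊗ X.X) ◁ ε_ Y X.X ▷ A.X ⊗≫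
        A.X ◁ (hat X.X (b₁ X Y)) ⊗≫ μ[A.X] ▷ X.X := by
        rw [whisker_exchange]; simp only [hat]; monoidal
    _ = _ := by
        have : b₁ X Y = unhat Y X.ψ := by simp only [b₁, unhat]
        rw [this, hat_unhat]; simp only [lext]; monoidal

lemma wreathMul_assoc : wreathMul X Y ▷ (Y ⊗ A.X) ≫ wreathMul X Y =
    (α_ _ _ _).hom ≫ (Y ⊗ A.X) ◁ wreathMul X Y ≫ wreathMul X Y :=
  (mon X Y).mon.mul_assoc

lemma actLeft_mul : (bimod X Y).actLeft ▷ (Y ⊗ A.X) ≫ wreathMul X Y =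
    (α_ _ _ _).hom ≫ A.X ◁ wreathMul X Y ≫ (bimod X Y).actLeft := by
  rw [← incl_mul]
  calc _ = ((incl X Y).hom ▷ (Y ⊗ A.X)) ▷ (Y ⊗ A.X) ≫ (wreathMul X Y ▷ (Y ⊗ A.X) ≫
        wreathMul X Y) := by monoidal
    _ = 𝟙 _ ⊗≫ ((incl X Y).hom ▷ ((Y ⊗ A.X) ⊗ (Y ⊗ A.X)) ≫ (Y ⊗ A.X) ◁ wreathMul X Y) ≫
        wreathMul X Y := by
      rw [wreathMul_assoc]; monoidal
    _ = _ := by rw [← whisker_exchange]; monoidal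

lemma regCoact_left : (bimod X Y).actLeft ≫ regCoact X Y =
    A.X ◁ regCoact X Y ≫ (α_ _ _ _).inv ≫ (bimod X Y).actLeft ▷ X.X := by
  have h : regCoact X Y = (ρ_ (Y ⊗ A.X)).inv ≫ (Y ⊗ A.X) ◁ η_ Y X.X ≫ (α_ (Y ⊗ A.X) Y X.X).inv ≫
      ((Y ⊗ A.X) ◁ runit A Y ≫ wreathMul X Y) ▷ X.X := rfl
  rw [h]
  calc _ = 𝟙 _ ⊗≫ ((bimod X Y).actLeft ▷ 𝟙_ C ≫ (Y ⊗ A.X) ◁ η_ Y X.X) ⊗≫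
        ((Y ⊗ A.X) ◁ runit A Y ≫ wreathMul X Y) ▷ X.X := by monoidal
    _ = 𝟙 _ ⊗≫ (A.X ⊗ (Y ⊗ A.X)) ◁ η_ Y X.X ⊗≫
        ((bimod X Y).actLeft ▷ Y ≫ (Y ⊗ A.X) ◁ runit A Y) ▷ X.X ⊗≫ wreathMul X Y ▷ X.X := by
      rw [← whisker_exchange]; monoidal
    _ = 𝟙 _ ⊗≫ (A.X ⊗ (Y ⊗ A.X)) ◁ η_ Y X.X ⊗≫ ((A.X ⊗ (Y ⊗ A.X)) ◁ runit A Y) ▷ X.X ⊗≫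
        ((bimod X Y).actLeft ▷ (Y ⊗ A.X) ≫ wreathMul X Y) ▷ X.X := by
      rw [← whisker_exchange]; monoidal
    _ = _ := by rw [actLeft_mul]; monoidal

lemma coact_left : (Coring.obj X).actLeft ≫ lext A (cδ X) ≫ (α_ A.X X.X X.X).inv =
    A.X ◁ (lext A (cδ X) ≫ (α_ A.X X.X X.X).inv) ≫ (α_ _ _ _).inv ≫
      (Coring.obj X).actLeft ▷ X.X := by
  calc _ = ((α_ A.X A.X X.X).inv ≫ μ[A.X] ▷ X.X ≫ lext A (cδ X)) ≫ (α_ A.X X.X X.X).inv := by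
        monoidal
    _ = _ := by rw [mul_lext]; monoidal

/-- The map `A X ⟶ Y A` of a form `B` is colinear if and only if `B` is a Casimir form. -/
lemma ofForm_colinear_iff (B : X.X ⊗ X.X ⟶ A.X) :
    ofForm X Y B ≫ regCoact X Y = (lext A (cδ X) ≫ (α_ A.X X.X X.X).inv) ≫ ofForm X Y B ▷ X.X ↔
      𝟙 (X.X ⊗ X.X) ⊗≫ cδ X ▷ X.X ⊗≫ (A.X ⊗ X.X) ◁ B ⊗≫ lext A X.ψ =
        𝟙 (X.X ⊗ X.X) ⊗≫ X.X ◁ cδ X ⊗≫ X.ψ ▷ (X.X ⊗ X.X) ⊗≫ (A.X ◁ B ≫ μ[A.X]) ▷ X.X := by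
  have h₁ : hat X.X ((lunit A X.X ≫ ofForm X Y B ≫ regCoact X Y) ≫ (α_ _ _ _).hom) =
      𝟙 (X.X ⊗ X.X) ⊗≫ cδ X ▷ X.X ⊗≫ (A.X ⊗ X.X) ◁ B ⊗≫ lext A X.ψ := by
    have h : (lunit A X.X ≫ ofForm X Y B ≫ regCoact X Y) ≫ (α_ _ _ _).hom =
        unhat Y B ≫ regCoact X Y ≫ (α_ _ _ _).hom := by
      rw [← lunit_ofForm]; simp only [Category.assoc]
    rw [h, hat_precomp, hat_regCoact]
    calc _ = 𝟙 _ ⊗≫ (X.X ◁ unhat Y B ≫ (lunit A X.X ≫ lext A (cδ X)) ▷ (Y ⊗ A.X)) ⊗≫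
          (A.X ⊗ X.X) ◁ ε_ Y X.X ▷ A.X ⊗≫ lext A X.ψ := by
          rw [coringAct_eq]; monoidal
      _ = 𝟙 _ ⊗≫ cδ X ▷ X.X ⊗≫ (A.X ⊗ X.X) ◁ hat X.X (unhat Y B) ⊗≫ lext A X.ψ := by
          rw [lunit_lext, whisker_exchange]; simp only [hat]; monoidal
      _ = _ := by rw [hat_unhat]
  have h₂ : hat X.X ((lunit A X.X ≫ (lext A (cδ X) ≫ (α_ A.X X.X X.X).inv) ≫ ofForm X Y B ▷ X.X) ≫
      (α_ _ _ _).hom) =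
        𝟙 (X.X ⊗ X.X) ⊗≫ X.X ◁ cδ X ⊗≫ X.ψ ▷ (X.X ⊗ X.X) ⊗≫ (A.X ◁ B ≫ μ[A.X]) ▷ X.X := by
    calc _ = 𝟙 _ ⊗≫ X.X ◁ (lunit A X.X ≫ lext A (cδ X)) ⊗≫ hat X.X (ofForm X Y B) ▷ X.X := by
          simp only [hat]; monoidal
      _ = _ := by rw [lunit_lext, hat_ofForm]; monoidal
  rw [← h₁, ← h₂]
  refine ⟨fun h => by rw [h], fun h => ?_⟩
  refine lunit_ext X (aW := (α_ _ _ _).inv ≫ (bimod X Y).actLeft ▷ X.X) ?_ ?_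
    ((cancel_mono (α_ _ _ _).hom).1 (hat_injective h))
  · calc _ = ((Coring.obj X).actLeft ≫ ofForm X Y B) ≫ regCoact X Y := by simp only [Category.assoc]
      _ = A.X ◁ ofForm X Y B ≫ ((bimod X Y).actLeft ≫ regCoact X Y) := by
        rw [ofForm_left, Category.assoc]
      _ = _ := by rw [regCoact_left]; simp
  · calc _ = ((Coring.obj X).actLeft ≫ lext A (cδ X) ≫ (α_ A.X X.X X.X).inv) ≫
          ofForm X Y B ▷ X.X := by simp only [Category.assoc]
      _ = 𝟙 _ ⊗≫ A.X ◁ (lext A (cδ X) ≫ (α_ A.X X.X X.X).inv) ⊗≫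
          ((Coring.obj X).actLeft ≫ ofForm X Y B) ▷ X.X := by
        rw [coact_left]; monoidal
      _ = _ := by rw [ofForm_left]; monoidal

lemma isCasimir_iff {X : RightTransfer A} [ComonObj X] (B : X ⊗ X ⟶ 𝟙_ (RightTransfer A)) :
    IsCasimir B ↔ 𝟙 (X.X ⊗ X.X) ⊗≫ cδ X ▷ X.X ⊗≫ (A.X ⊗ X.X) ◁ form B ⊗≫ lext A X.ψ =
        𝟙 (X.X ⊗ X.X) ⊗≫ X.X ◁ cδ X ⊗≫ X.ψ ▷ (X.X ⊗ X.X) ⊗≫ (A.X ◁ form B ≫ μ[A.X]) ▷ X.X := by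
  have h₁ : (Δ[X] ▷ X ≫ (α_ X X X).hom ≫ X ◁ B ≫ (ρ_ X).hom).hom =
      𝟙 (X.X ⊗ X.X) ⊗≫ cδ X ▷ X.X ⊗≫ (A.X ⊗ X.X) ◁ form B ⊗≫ lext A X.ψ := by
    have h : rten (cδ X) X.X ≫ lext A (((α_ X.X X.X X.X).hom ≫ lunit A _) ≫
          lext A (X.lten (form B ≫ (ρ_ A.X).inv) ≫ lext A ((ρ_ X.X).hom ≫ lunit A _))) =
        𝟙 (X.X ⊗ X.X) ⊗≫ cδ X ▷ X.X ⊗≫ (A.X ⊗ X.X) ◁ form B ⊗≫ lext A X.ψ := by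
      rw [RightTransfer.comp_pure, Category.assoc, lunit_lext]
      simp only [lext, rten, RightTransfer.lten]; monoidal
    rw [← h, ← hom_eq_form]; rfl
  have h₂ : (X ◁ Δ[X] ≫ (α_ X X X).inv ≫ B ▷ X ≫ (λ_ X).hom).hom =
      𝟙 (X.X ⊗ X.X) ⊗≫ X.X ◁ cδ X ⊗≫ X.ψ ▷ (X.X ⊗ X.X) ⊗≫ (A.X ◁ form B ≫ μ[A.X]) ▷ X.X := by
    have h : X.lten (cδ X) ≫ lext A (((α_ X.X X.X X.X).inv ≫ lunit A _) ≫
          lext A (rten (form B ≫ (ρ_ A.X).inv) X.X ≫ lext A ((λ_ X.X).hom ≫ lunit A _))) =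
        𝟙 (X.X ⊗ X.X) ⊗≫ X.X ◁ cδ X ⊗≫ X.ψ ▷ (X.X ⊗ X.X) ⊗≫ (A.X ◁ form B ≫ μ[A.X]) ▷ X.X := by
      rw [RightTransfer.comp_pure, Category.assoc, lunit_lext]
      simp only [lext, rten, RightTransfer.lten]; monoidal
    rw [← h, ← hom_eq_form]; rfl
  rw [← h₁, ← h₂, IsCasimir]
  exact ⟨fun h => congrArg _ h, fun h => RightTransfer.hom_ext _ _ h⟩

lemma isBilinear_iff_linear (Ψ : A.X ⊗ X.X ⟶ Y ⊗ A.X) : (extensionDual X Y).IsBilinear Ψ ↔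
    (Coring.obj X).actLeft ≫ Ψ = A.X ◁ Ψ ≫ (bimod X Y).actLeft ∧
      entwinedAct X Y (Coring.entwined X) ≫ Ψ = Ψ ▷ (Y ⊗ A.X) ≫ wreathMul X Y := by
  rw [← incl_mul]
  exact ⟨fun h => ⟨h.left, h.right⟩, fun h => ⟨h.1, h.2⟩⟩

lemma isBilinear_iff_entwined (Ψ : A.X ⊗ X.X ⟶ Y ⊗ A.X) : (extensionDual X Y).IsBilinear Ψ ↔
    (Coring.obj X).actLeft ≫ Ψ = A.X ◁ Ψ ≫ (bimod X Y).actLeft ∧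
      (Coring.obj X).actRight ≫ Ψ = Ψ ▷ A.X ≫ (bimod X Y).actRight ∧
        Ψ ≫ regCoact X Y = (lext A (cδ X) ≫ (α_ A.X X.X X.X).inv) ≫ Ψ ▷ X.X := by
  rw [isBilinear_iff_linear]
  refine and_congr_right fun _ => (linear_iff_entwined X Y (Coring.entwined X)
    (RightModule.regular (mon X Y)) Ψ).trans ?_
  have h₁ : (bimod X Y).actRight = (Y ⊗ A.X) ◁ (incl X Y).hom ≫ wreathMul X Y :=
    (mul_incl X Y).symm
  have h₂ : lext A (cδ X) ≫ (α_ A.X X.X X.X).inv = (Coring.entwined X).coact := by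
    simp only [lext, Category.assoc]; rfl
  rw [h₁, h₂]
  exact Iff.rfl

lemma isBilinear_casimirMap_iff (B : X ⊗ X ⟶ 𝟙_ (RightTransfer A)) :
    (extensionDual X Y).IsBilinear (casimirMap Y B) ↔ IsCasimir B := by
  rw [casimirMap_eq, isBilinear_iff_entwined, isCasimir_iff, ofForm_colinear_iff]
  exact ⟨fun h => h.2.2, fun h => ⟨ofForm_left X Y _, (ofForm_right_iff X Y _).2 (form_comm B), h⟩⟩

lemma exists_eq_casimirMap {Ψ : A.X ⊗ X.X ⟶ Y ⊗ A.X} (h : (extensionDual X Y).IsBilinear Ψ) :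
    ∃ B : X ⊗ X ⟶ 𝟙_ (RightTransfer A), casimirMap Y B = Ψ := by
  obtain ⟨h₁, h₂, -⟩ := (isBilinear_iff_entwined X Y Ψ).1 h
  have e := eq_ofForm X Y h₁
  refine ⟨homOfForm (hat X.X (lunit A X.X ≫ Ψ)) ((ofForm_right_iff X Y _).1 (by rw [← e, h₂])), ?_⟩
  rw [casimirMap_eq, form_homOfForm, ← e]

end Duality
end Cowreath

/-! ### Frobenius coalgebras and isomorphisms of `A X` with `Y A` -/

namespace Cowreath

variable {C : Type u} [Category.{v} C] [MonoidalCategory C] {A : Mon C}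

namespace Duality
variable (X : RightTransfer A) (Y : C) [ExactPairing Y X.X] [ComonObj X]

lemma extensionDual_isBilinear_iff_isoAsModules :
    (∃ Ψ, (extensionDual X Y).IsBilinear Ψ ∧ IsIso Ψ) ↔ IsoAsModules X Y := by
  constructor
  · rintro ⟨Ψ, h, hΨ⟩
    obtain ⟨h₁, h₂⟩ := (isBilinear_iff_linear X Y Ψ).1 h
    let f : toModule (Y := Y) (Coring.entwined X) ⟶ RightModule.regular (mon X Y) := ⟨Ψ, h₂⟩
    have : IsIso f.hom := hΨ
    exact ⟨RightModule.isoMk f, h₁⟩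
  · rintro ⟨e, h⟩
    exact ⟨e.hom.hom, (isBilinear_iff_linear X Y e.hom.hom).2 ⟨h, e.hom.act_hom⟩,
      RightModule.isIso_hom e⟩

lemma isoAsModules_iff_isoAsEntwinedModules : IsoAsModules X Y ↔ IsoAsEntwinedModules X Y := by
  constructor
  · rintro ⟨e, h⟩
    obtain ⟨h₁, h₂⟩ := (linear_iff_entwined X Y (Coring.entwined X)
      (RightModule.regular (mon X Y)) e.hom.hom).1 e.hom.act_hom
    let f : Coring.entwined X ⟶ toEntwined (RightModule.regular (mon X Y)) :=
      { hom := e.hom.hom, act_hom := h₁, coact_hom := h₂ }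
    have : IsIso f.hom := RightModule.isIso_hom e
    exact ⟨EntwinedModule.isoMk f, h⟩
  · rintro ⟨e, h⟩
    let f : toModule (Y := Y) (Coring.entwined X) ⟶ RightModule.regular (mon X Y) :=
      ⟨e.hom.hom, (linear_iff_entwined X Y (Coring.entwined X)
        (RightModule.regular (mon X Y)) e.hom.hom).2 ⟨e.hom.act_hom, e.hom.coact_hom⟩⟩
    have : IsIso f.hom := EntwinedModule.isIso_hom e
    exact ⟨RightModule.isoMk f, h⟩

lemma extensionDual_isBilinear_iff_casimirMap :
    (∃ Ψ, (extensionDual X Y).IsBilinear Ψ ∧ IsIso Ψ) ↔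
      ∃ B : X ⊗ X ⟶ 𝟙_ (RightTransfer A), IsCasimir B ∧ IsIso (casimirMap Y B) := by
  constructor
  · rintro ⟨Ψ, h, hΨ⟩
    obtain ⟨B, rfl⟩ := exists_eq_casimirMap X Y h
    exact ⟨B, (isBilinear_casimirMap_iff X Y B).1 h, hΨ⟩
  · rintro ⟨B, h, hB⟩
    exact ⟨_, (isBilinear_casimirMap_iff X Y B).2 h, hB⟩

/-- The element of `A X` underlying a morphism `1 ⟶ X` of right transfer morphisms -/
def element {X : RightTransfer A} (t : 𝟙_ (RightTransfer A) ⟶ X) : 𝟙_ C ⟶ A.X ⊗ X.X := t.hom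

/-- The map of `t` is `s ↦ t s`. -/
lemma frobeniusMap_eq (t : 𝟙_ (RightTransfer A) ⟶ X) :
    frobeniusMap Y t = (extensionDual X Y).P.ofElement (element t) := by
  change _ = (λ_ (Y ⊗ A.X)).inv ≫ element t ▷ (Y ⊗ A.X) ≫ coringAct X Y
  rw [frobeniusMap]
  change (λ_ (Y ⊗ A.X)).inv ≫ element t ▷ (Y ⊗ A.X) ≫ _ = _
  congr 2
  calc _ = 𝟙 _ ⊗≫ A.X ◁ (cδ X ▷ (Y ⊗ A.X)) ⊗≫ A.X ◁ (A.X ◁ (X.X ◁ (ε_ Y X.X ▷ A.X))) ⊗≫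
        A.X ◁ lext A X.ψ ⊗≫ μ[A.X] ▷ X.X := by
        simp only [lext]; monoidal
    _ = 𝟙 _ ⊗≫ A.X ◁ (cδ X ▷ (Y ⊗ A.X)) ⊗≫ (A.X ⊗ A.X) ◁ (X.X ◁ (ε_ Y X.X ▷ A.X)) ⊗≫
        (A.X ◁ lext A X.ψ ≫ (α_ A.X A.X X.X).inv ≫ μ[A.X] ▷ X.X) := by
        monoidal
    _ = 𝟙 _ ⊗≫ A.X ◁ (cδ X ▷ (Y ⊗ A.X)) ⊗≫ ((A.X ⊗ A.X) ◁ (X.X ◁ (ε_ Y X.X ▷ A.X)) ≫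
        μ[A.X] ▷ (X.X ⊗ (𝟙_ C ⊗ A.X))) ⊗≫ lext A X.ψ := by
        rw [← mul_lext]; monoidal
    _ = _ := by
        rw [whisker_exchange, coringAct_eq]; simp only [lext]; monoidal

lemma isCentral_iff_comm (t : 𝟙_ C ⟶ A.X ⊗ X.X) : (extensionDual X Y).IsCentral t ↔
    ((λ_ A.X).hom ≫ (ρ_ A.X).inv) ≫ lext A t = rten t A.X ≫ lext A X.ψ := by
  have h : (extensionDual X Y).IsCentral t ↔ (ρ_ A.X).inv ≫ A.X ◁ t ≫ (Coring.obj X).actLeft =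
      (λ_ A.X).inv ≫ t ▷ A.X ≫ (A.X ⊗ X.X) ◁ (incl X Y).hom ≫ coringAct X Y := Iff.rfl
  have h' : (A.X ⊗ X.X) ◁ (incl X Y).hom ≫ coringAct X Y =
    (α_ A.X X.X A.X).hom ≫ lext A X.ψ := incl_entwinedAct X Y (Coring.entwined X)
  rw [h, h', ← cancel_epi (λ_ A.X).hom, Iso.hom_inv_id_assoc]
  simp only [lext, rten, Category.assoc]

/-- `t` as a morphism of right transfer morphisms -/
def homOfElement {X : RightTransfer A} (t : 𝟙_ C ⟶ A.X ⊗ X.X)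
    (h : ((λ_ A.X).hom ≫ (ρ_ A.X).inv) ≫ lext A t = rten t A.X ≫ lext A X.ψ) :
    𝟙_ (RightTransfer A) ⟶ X :=
  RightTransfer.Hom.mk' (X := 𝟙_ (RightTransfer A)) t h

lemma isCentral_hom (t : 𝟙_ (RightTransfer A) ⟶ X) : (extensionDual X Y).IsCentral (element t) :=
  (isCentral_iff_comm X Y (element t)).2 t.comm'

lemma extensionDual_ofElement_iff_frobeniusMap :
    (∃ t, (extensionDual X Y).IsCentral t ∧ IsIso ((extensionDual X Y).P.ofElement t)) ↔
      ∃ t : 𝟙_ (RightTransfer A) ⟶ X, IsIso (frobeniusMap Y t) := by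
  constructor
  · rintro ⟨t, h, ht⟩
    refine ⟨homOfElement t ((isCentral_iff_comm X Y t).1 h), ?_⟩
    rw [frobeniusMap_eq]
    exact ht
  · rintro ⟨t, ht⟩
    rw [frobeniusMap_eq] at ht
    exact ⟨t.hom, isCentral_hom X Y t, ht⟩

/-- The condition `B ∘ (X t) = ε` says that the map of `B` sends `t` to `1`. -/
lemma counit_right_iff (t : 𝟙_ (RightTransfer A) ⟶ X) (B : X ⊗ X ⟶ 𝟙_ (RightTransfer A)) :
    (ρ_ X).inv ≫ X ◁ t ≫ B = ε[X] ↔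
      element t ≫ ofForm X Y (form B) = wOne X Y := by
  have h₁ : (X.X ◁ element t ≫ hat X.X (ofForm X Y (form B))) =
      hat X.X (element t ≫ ofForm X Y (form B)) := (hat_precomp X Y _ _).symm
  have h₂ : ((ρ_ X).inv ≫ X ◁ t ≫ B).hom = (ρ_ X.X).inv ≫
      hat X.X (element t ≫ ofForm X Y (form B)) ≫ (ρ_ A.X).inv := by
    have h : ((ρ_ X.X).inv ≫ lunit A _) ≫ lext A (X.lten (element t) ≫
        lext A (form B ≫ (ρ_ A.X).inv)) = (ρ_ X.X).inv ≫
          hat X.X (element t ≫ ofForm X Y (form B)) ≫ (ρ_ A.X).inv := by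
      rw [← h₁, hat_ofForm, Category.assoc, lunit_lext]
      simp only [lext, RightTransfer.lten]; monoidal
    rw [← h, ← hom_eq_form]; rfl
  have h₃ : hat X.X (wOne X Y) = (ρ_ X.X).hom ≫ cε X := by
    rw [← cancel_mono (λ_ A.X).inv, ← whisker_hat, hat_wOne, Category.assoc]
  have h₄ : (ε[X]).hom = cε X ≫ (ρ_ A.X).inv := (cε' X).symm
  constructor
  · intro h
    have h' := h₂.symm.trans ((congrArg RightTransfer.Hom.hom h).trans h₄)
    refine hat_injective (X := X.X) ?_
    rw [h₃, ← Iso.inv_comp_eq, ← cancel_mono (ρ_ A.X).inv, Category.assoc]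
    exact h'
  · intro h
    refine RightTransfer.hom_ext _ _ (h₂.trans (Eq.trans ?_ h₄.symm))
    rw [h, h₃, Category.assoc, Iso.inv_hom_id_assoc]

/-- The condition `B ∘ (t X) = ε` says that `⟨t, Ψ x⟩ = ε x` for the map `Ψ` of `B`. -/
lemma counit_left_iff (t : 𝟙_ (RightTransfer A) ⟶ X) (B : X ⊗ X ⟶ 𝟙_ (RightTransfer A)) :
    (λ_ X).inv ≫ t ▷ X ≫ B = ε[X] ↔
      ofForm X Y (form B) ≫ frobeniusMap Y t ≫ coringCounit X =
        coringCounit X := by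
  have hf : frobeniusMap Y t = (extensionDual X Y).P.ofElement (element t) := frobeniusMap_eq X Y t
  have hc : (bimod X Y).actLeft ≫ frobeniusMap Y t =
      A.X ◁ frobeniusMap Y t ≫ (Coring.obj X).actLeft := by
    rw [← incl_mul, hf]
    exact (Category.assoc _ _ _).trans
      (((extensionDual X Y).isCentral_iff (element t)).1 (isCentral_hom X Y t))
  generalize frobeniusMap Y t = f at hf hc ⊢
  have hf' : f ≫ coringCounit X =
      (λ_ (Y ⊗ A.X)).inv ≫ element t ▷ (Y ⊗ A.X) ≫ d₁ X Y := by
    have e : f = (λ_ (Y ⊗ A.X)).inv ≫ element t ▷ (Y ⊗ A.X) ≫ coringAct X Y := hf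
    rw [e, ← coringAct_counit]
    simp only [Category.assoc]
  have h₁ : lunit A X.X ≫ ofForm X Y (form B) ≫ f ≫ coringCounit X =
      (λ_ X.X).inv ≫ rten (element t) X.X ≫ A.X ◁ form B ≫ μ[A.X] := by
    rw [hf', ← Category.assoc, lunit_ofForm]
    generalize element t = t'
    calc _ = 𝟙 _ ⊗≫ (𝟙_ C ◁ unhat Y (form B) ≫ t' ▷ (Y ⊗ A.X)) ≫ d₁ X Y := by monoidal
      _ = 𝟙 _ ⊗≫ t' ▷ X.X ⊗≫ A.X ◁ hat X.X (unhat Y (form B)) ⊗≫ μ[A.X] := by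
        rw [whisker_exchange]; simp only [d₁, hat]; monoidal
      _ = _ := by rw [hat_unhat]; simp only [rten]; monoidal
  have h₂ : ((λ_ X).inv ≫ t ▷ X ≫ B).hom = ((λ_ X.X).inv ≫
      rten (element t) X.X ≫ A.X ◁ form B ≫ μ[A.X]) ≫ (ρ_ A.X).inv := by
    have h : ((λ_ X.X).inv ≫ lunit A _) ≫ lext A (rten (element t) X.X ≫
        lext A (form B ≫ (ρ_ A.X).inv)) = ((λ_ X.X).inv ≫
      rten (element t) X.X ≫ A.X ◁ form B ≫ μ[A.X]) ≫ (ρ_ A.X).inv := by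
      rw [Category.assoc, lunit_lext]
      simp only [lext]; monoidal
    rw [← h, ← hom_eq_form]; rfl
  have h₃ : lunit A X.X ≫ coringCounit X = cε X := by
    rw [coringCounit, reassoc_of% (lunit_natural A (cε X))]
    calc _ = 𝟙 _ ⊗≫ cε X ⊗≫ (η[A.X] ▷ A.X ≫ μ[A.X]) := by simp only [lunit]; monoidal
      _ = _ := by rw [MonObj.one_mul]; monoidal
  have h₄ : (ε[X]).hom = cε X ≫ (ρ_ A.X).inv := (cε' X).symm
  constructor
  · intro h
    refine lunit_ext X (aW := μ[A.X]) ?_ (coringCounit_left X) ?_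
    · calc _ = ((Coring.obj X).actLeft ≫ ofForm X Y (form B)) ≫ f ≫ coringCounit X := by
            simp only [Category.assoc]
        _ = A.X ◁ ofForm X Y (form B) ≫ ((bimod X Y).actLeft ≫ f) ≫ coringCounit X := by
          rw [ofForm_left]; simp only [Category.assoc]
        _ = A.X ◁ ofForm X Y (form B) ≫ A.X ◁ f ≫ ((Coring.obj X).actLeft ≫ coringCounit X) := by
          rw [hc]; simp only [Category.assoc]
        _ = _ := by
          rw [coringCounit_left]; simp only [MonoidalCategory.whiskerLeft_comp, Category.assoc]
    · rw [h₁, h₃, ← cancel_mono (ρ_ A.X).inv]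
      exact h₂.symm.trans ((congrArg RightTransfer.Hom.hom h).trans h₄)
  · intro h
    refine RightTransfer.hom_ext _ _ (h₂.trans (Eq.trans ?_ h₄.symm))
    exact congrArg (· ≫ (ρ_ A.X).inv) (h₁.symm.trans ((congrArg (lunit A X.X ≫ ·) h).trans h₃))

/-- Frobenius structures `(t, B)` on the coalgebra `X` are Frobenius pairs `(t, Ψ)`, where `Ψ` is
the map of `B`. -/
lemma isFrobeniusCoalgebra_iff : IsFrobeniusCoalgebra X ↔
    ∃ t Ψ, (extensionDual X Y).IsFrobeniusPair t Ψ := by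
  constructor
  · rintro ⟨t, B, hB, hl, hr⟩
    refine ⟨t.hom, casimirMap Y B, isCentral_hom X Y t,
      (isBilinear_casimirMap_iff X Y B).2 hB, ?_, ?_⟩
    · rw [casimirMap_eq]; exact (counit_right_iff X Y t B).1 hr
    · rw [casimirMap_eq]
      have h := (counit_left_iff X Y t B).1 hl
      rw [frobeniusMap_eq] at h
      exact h
  · rintro ⟨t, Ψ, h⟩
    obtain ⟨B, rfl⟩ := exists_eq_casimirMap X Y h.bilinear
    refine ⟨homOfElement t ((isCentral_iff_comm X Y t).1 h.central), B,
      (isBilinear_casimirMap_iff X Y B).1 h.bilinear,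
      (counit_left_iff X Y _ B).2 ?_, (counit_right_iff X Y _ B).2 ?_⟩
    · rw [← casimirMap_eq, frobeniusMap_eq]; exact h.pair_apply
    · rw [← casimirMap_eq]; exact h.apply_element

end Duality
end Cowreath

/-! ### Frobenius extensions `A ⟶ Y A` -/

namespace Cowreath

variable {C : Type u} [Category.{v} C] [MonoidalCategory C] {A : Mon C}

namespace Duality
variable (X : RightTransfer A) (Y : C) [ExactPairing Y X.X]

/-- `(Y A) ⊗ S ⟶ Y ⊗ S`, `y a ⊗ s ↦ y ⊗ a s`, for `S = Y A`. It identifies `S ⊗_A S` with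
`Y ⊗ S`. -/
def split : (Y ⊗ A.X) ⊗ (Y ⊗ A.X) ⟶ Y ⊗ (Y ⊗ A.X) :=
  (α_ _ _ _).hom ≫ Y ◁ (bimod X Y).actLeft

/-- `Y ⊗ S ⟶ S ⊗ S`, `y ⊗ s ↦ y 1 ⊗ s`, for `S = Y A` -/
def unsplit (A : Mon C) (Y : C) : Y ⊗ (Y ⊗ A.X) ⟶ (Y ⊗ A.X) ⊗ (Y ⊗ A.X) :=
  runit A Y ▷ (Y ⊗ A.X)

lemma runit_actRight : runit A Y ▷ A.X ≫ (bimod X Y).actRight = 𝟙 _ := by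
  calc _ = 𝟙 _ ⊗≫ Y ◁ (η[A.X] ▷ A.X ≫ μ[A.X]) := by simp only [runit]; monoidal
    _ = _ := by rw [MonObj.one_mul]; monoidal

lemma runit_actLeft : A.X ◁ runit A Y ≫ (bimod X Y).actLeft = dualφ X Y := by
  calc _ = 𝟙 _ ⊗≫ ((A.X ⊗ Y) ◁ η[A.X] ≫ dualφ X Y ▷ A.X) ⊗≫ Y ◁ μ[A.X] := by
        simp only [runit]; monoidal
    _ = 𝟙 _ ⊗≫ dualφ X Y ⊗≫ Y ◁ (A.X ◁ η[A.X] ≫ μ[A.X]) := by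
        rw [whisker_exchange]; monoidal
    _ = _ := by rw [MonObj.mul_one]; monoidal

/-- `unsplit ∘ split` moves the factor `A` of the first tensorand to the second one. -/
lemma split_unsplit : split X Y ≫ unsplit A Y =
    (runit A Y ▷ A.X) ▷ (Y ⊗ A.X) ≫ (α_ _ _ _).hom ≫ (Y ⊗ A.X) ◁ (bimod X Y).actLeft := by
  calc _ = (α_ _ _ _).hom ≫ (Y ◁ (bimod X Y).actLeft ≫ runit A Y ▷ (Y ⊗ A.X)) := by
        simp only [split, unsplit, Category.assoc]
    _ = _ := by rw [whisker_exchange]; monoidal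

/-- Balanced maps out of `S ⊗ S` factor through `split`. -/
lemma split_unsplit_comp {Z : C} {q : (Y ⊗ A.X) ⊗ (Y ⊗ A.X) ⟶ Z}
    (h : (bimod X Y).actRight ▷ (Y ⊗ A.X) ≫ q =
      ((α_ _ _ _).hom ≫ (Y ⊗ A.X) ◁ (bimod X Y).actLeft) ≫ q) :
    split X Y ≫ unsplit A Y ≫ q = q := by
  calc _ = (split X Y ≫ unsplit A Y) ≫ q := by rw [Category.assoc]
    _ = (runit A Y ▷ A.X) ▷ (Y ⊗ A.X) ≫ 
          (((α_ _ _ _).hom ≫ (Y ⊗ A.X) ◁ (bimod X Y).actLeft) ≫ q) := by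
        rw [split_unsplit]; simp only [Category.assoc]
    _ = (runit A Y ▷ A.X ≫ (bimod X Y).actRight) ▷ (Y ⊗ A.X) ≫ q := by rw [← h]; monoidal
    _ = q := by rw [runit_actRight]; monoidal

lemma split_balanced : (bimod X Y).actRight ▷ (Y ⊗ A.X) ≫ split X Y =
    ((α_ _ _ _).hom ≫ (Y ⊗ A.X) ◁ (bimod X Y).actLeft) ≫ split X Y := by
  calc _ = 𝟙 _ ⊗≫ Y ◁ (μ[A.X] ▷ (bimod X Y).X ≫ (bimod X Y).actLeft) := by
        simp only [split]; monoidal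
    _ = _ := by rw [(bimod X Y).left_assoc]; simp only [split]; monoidal

lemma unsplit_split : unsplit A Y ≫ split X Y = 𝟙 _ := by
  calc _ = 𝟙 _ ⊗≫ Y ◁ (η[A.X] ▷ (bimod X Y).X ≫ (bimod X Y).actLeft) := by
        simp only [unsplit, split, runit]; monoidal
    _ = _ := by rw [(bimod X Y).one_actLeft]; monoidal

lemma counit_left_balanced {θ : Y ⊗ A.X ⟶ A.X}
    (h : (bimod X Y).actRight ≫ θ = θ ▷ A.X ≫ μ[A.X]) :
    (bimod X Y).actRight ▷ (Y ⊗ A.X) ≫ θ ▷ (Y ⊗ A.X) ≫ (bimod X Y).actLeft =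
      ((α_ _ _ _).hom ≫ (Y ⊗ A.X) ◁ (bimod X Y).actLeft) ≫
        θ ▷ (Y ⊗ A.X) ≫ (bimod X Y).actLeft := by
  calc _ = ((bimod X Y).actRight ≫ θ) ▷ (Y ⊗ A.X) ≫ (bimod X Y).actLeft := by monoidal
    _ = θ ▷ A.X ▷ (Y ⊗ A.X) ≫ (μ[A.X] ▷ (bimod X Y).X ≫ (bimod X Y).actLeft) := by
        rw [h]; monoidal
    _ = 𝟙 _ ⊗≫ (θ ▷ (A.X ⊗ (Y ⊗ A.X)) ≫ A.X ◁ (bimod X Y).actLeft) ≫ (bimod X Y).actLeft := by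
        rw [(bimod X Y).left_assoc]; monoidal
    _ = _ := by rw [← whisker_exchange]; monoidal

lemma counit_right_balanced {θ : Y ⊗ A.X ⟶ A.X}
    (h : (bimod X Y).actLeft ≫ θ = A.X ◁ θ ≫ μ[A.X]) :
    (bimod X Y).actRight ▷ (Y ⊗ A.X) ≫ (Y ⊗ A.X) ◁ θ ≫ (bimod X Y).actRight =
      ((α_ _ _ _).hom ≫ (Y ⊗ A.X) ◁ (bimod X Y).actLeft) ≫
        (Y ⊗ A.X) ◁ θ ≫ (bimod X Y).actRight := by
  symm
  calc _ = (α_ _ _ _).hom ≫ (Y ⊗ A.X) ◁ ((bimod X Y).actLeft ≫ θ) ≫ (bimod X Y).actRight := by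
        monoidal
    _ = 𝟙 _ ⊗≫ ((Y ⊗ A.X) ⊗ A.X) ◁ θ ⊗≫ ((bimod X Y).X ◁ μ[A.X] ≫ (bimod X Y).actRight) := by
        rw [h]; monoidal
    _ = 𝟙 _ ⊗≫ (((Y ⊗ A.X) ⊗ A.X) ◁ θ ≫ (bimod X Y).actRight ▷ A.X) ≫ (bimod X Y).actRight := by
        rw [(bimod X Y).right_assoc]; monoidal
    _ = _ := by rw [whisker_exchange]; monoidal

variable [ComonObj X]

lemma mul_actRight : (Y ⊗ A.X) ◁ (bimod X Y).actRight ≫ wreathMul X Y =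
    (α_ _ _ _).inv ≫ wreathMul X Y ▷ A.X ≫ (bimod X Y).actRight := by
  have h : (bimod X Y).actRight = (Y ⊗ A.X) ◁ (incl X Y).hom ≫ wreathMul X Y :=
    (mul_incl X Y).symm
  rw [h]
  calc _ = 𝟙 _ ⊗≫ ((Y ⊗ A.X) ⊗ (Y ⊗ A.X)) ◁ (incl X Y).hom ⊗≫
        ((α_ _ _ _).hom ≫ (Y ⊗ A.X) ◁ wreathMul X Y ≫ wreathMul X Y) := by monoidal
    _ = 𝟙 _ ⊗≫ (((Y ⊗ A.X) ⊗ (Y ⊗ A.X)) ◁ (incl X Y).hom ≫ wreathMul X Y ▷ (Y ⊗ A.X)) ≫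
        wreathMul X Y := by rw [← wreathMul_assoc]; monoidal
    _ = _ := by rw [whisker_exchange]; monoidal

/-- The left action of `S = Y A` on `Y ⊗ S`, the image of its action on `S ⊗_A S` -/
def splitActL : (Y ⊗ A.X) ⊗ (Y ⊗ (Y ⊗ A.X)) ⟶ Y ⊗ (Y ⊗ A.X) :=
  (Y ⊗ A.X) ◁ unsplit A Y ≫ (α_ _ _ _).inv ≫ wreathMul X Y ▷ (Y ⊗ A.X) ≫ split X Y

/-- The right action of `S = Y A` on `Y ⊗ S` -/
def splitActR : (Y ⊗ (Y ⊗ A.X)) ⊗ (Y ⊗ A.X) ⟶ Y ⊗ (Y ⊗ A.X) :=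
  (α_ _ _ _).hom ≫ Y ◁ wreathMul X Y

lemma split_actL : (Y ⊗ A.X) ◁ split X Y ≫ splitActL X Y =
    (α_ _ _ _).inv ≫ wreathMul X Y ▷ (Y ⊗ A.X) ≫ split X Y := by
  have h : (Y ⊗ A.X) ◁ ((bimod X Y).actRight ▷ (Y ⊗ A.X)) ≫ (α_ _ _ _).inv ≫
      wreathMul X Y ▷ (Y ⊗ A.X) ≫ split X Y =
      (Y ⊗ A.X) ◁ ((α_ _ _ _).hom ≫ (Y ⊗ A.X) ◁ (bimod X Y).actLeft) ≫ (α_ _ _ _).inv ≫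
        wreathMul X Y ▷ (Y ⊗ A.X) ≫ split X Y := by
    calc _ = 𝟙 _ ⊗≫ ((Y ⊗ A.X) ◁ (bimod X Y).actRight ≫ wreathMul X Y) ▷ (Y ⊗ A.X) ≫
          split X Y := by monoidal
      _ = 𝟙 _ ⊗≫ wreathMul X Y ▷ A.X ▷ (Y ⊗ A.X) ≫
          ((bimod X Y).actRight ▷ (Y ⊗ A.X) ≫ split X Y) := by
        rw [mul_actRight]; monoidal
      _ = 𝟙 _ ⊗≫ (wreathMul X Y ▷ (A.X ⊗ (Y ⊗ A.X)) ≫ (Y ⊗ A.X) ◁ (bimod X Y).actLeft) ≫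
          split X Y := by
        rw [split_balanced]; monoidal
      _ = _ := by rw [← whisker_exchange]; monoidal
  calc _ = (Y ⊗ A.X) ◁ (split X Y ≫ unsplit A Y) ≫ (α_ _ _ _).inv ≫
        wreathMul X Y ▷ (Y ⊗ A.X) ≫ split X Y := by
        simp only [splitActL]; monoidal
    _ = (Y ⊗ A.X) ◁ ((runit A Y ▷ A.X) ▷ (Y ⊗ A.X)) ≫ ((Y ⊗ A.X) ◁ ((α_ _ _ _).hom ≫
        (Y ⊗ A.X) ◁ (bimod X Y).actLeft) ≫ (α_ _ _ _).inv ≫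
          wreathMul X Y ▷ (Y ⊗ A.X) ≫ split X Y) := by
        rw [split_unsplit]; monoidal
    _ = (Y ⊗ A.X) ◁ (runit A Y ▷ A.X ≫ (bimod X Y).actRight) ▷ (Y ⊗ A.X) ≫ (α_ _ _ _).inv ≫
          wreathMul X Y ▷ (Y ⊗ A.X) ≫ split X Y := by
        rw [← h]; monoidal
    _ = _ := by rw [runit_actRight]; monoidal

lemma split_actR : split X Y ▷ (Y ⊗ A.X) ≫ splitActR X Y =
    (α_ _ _ _).hom ≫ (Y ⊗ A.X) ◁ wreathMul X Y ≫ split X Y := by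
  calc _ = 𝟙 _ ⊗≫ Y ◁ ((bimod X Y).actLeft ▷ (Y ⊗ A.X) ≫ wreathMul X Y) := by
        simp only [split, splitActR]; monoidal
    _ = _ := by rw [actLeft_mul]; simp only [split]; monoidal

lemma splitActL_actR : splitActL X Y ▷ (Y ⊗ A.X) ≫ splitActR X Y =
    (α_ _ _ _).hom ≫ (Y ⊗ A.X) ◁ splitActR X Y ≫ splitActL X Y := by
  calc _ = ((Y ⊗ A.X) ◁ unsplit A Y ≫ (α_ _ _ _).inv ≫ wreathMul X Y ▷ (Y ⊗ A.X)) ▷ (Y ⊗ A.X) ≫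
        (split X Y ▷ (Y ⊗ A.X) ≫ splitActR X Y) := by
        conv_lhs => rw [splitActL]
        monoidal
    _ = 𝟙 _ ⊗≫ ((Y ⊗ A.X) ◁ unsplit A Y) ▷ (Y ⊗ A.X) ⊗≫
        (wreathMul X Y ▷ ((Y ⊗ A.X) ⊗ (Y ⊗ A.X)) ≫ (Y ⊗ A.X) ◁ wreathMul X Y) ≫ split X Y := by
        rw [split_actR]; monoidal
    _ = 𝟙 _ ⊗≫ (Y ⊗ A.X) ◁ (runit A Y ▷ ((Y ⊗ A.X) ⊗ (Y ⊗ A.X)) ≫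
        (Y ⊗ A.X) ◁ wreathMul X Y) ⊗≫ wreathMul X Y ▷ (Y ⊗ A.X) ≫ split X Y := by
        rw [← whisker_exchange]; simp only [unsplit]; monoidal
    _ = _ := by
        rw [← whisker_exchange]; simp only [splitActL, splitActR, unsplit]; monoidal

lemma splitActL_assoc : wreathMul X Y ▷ (Y ⊗ (Y ⊗ A.X)) ≫ splitActL X Y =
    (α_ _ _ _).hom ≫ (Y ⊗ A.X) ◁ splitActL X Y ≫ splitActL X Y := by
  symm
  calc _ = (α_ _ _ _).hom ≫ (Y ⊗ A.X) ◁ ((Y ⊗ A.X) ◁ unsplit A Y ≫ (α_ _ _ _).inv ≫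
        wreathMul X Y ▷ (Y ⊗ A.X)) ≫ ((Y ⊗ A.X) ◁ split X Y ≫ splitActL X Y) := by
        conv_lhs => enter [2, 1, 2]; rw [splitActL]
        monoidal
    _ = 𝟙 _ ⊗≫ ((Y ⊗ A.X) ⊗ (Y ⊗ A.X)) ◁ unsplit A Y ⊗≫
        ((α_ _ _ _).hom ≫ (Y ⊗ A.X) ◁ wreathMul X Y ≫ wreathMul X Y) ▷ (Y ⊗ A.X) ≫ split X Y := by
        rw [split_actL]; monoidal
    _ = 𝟙 _ ⊗≫ (((Y ⊗ A.X) ⊗ (Y ⊗ A.X)) ◁ unsplit A Y ≫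
        wreathMul X Y ▷ ((Y ⊗ A.X) ⊗ (Y ⊗ A.X))) ⊗≫ wreathMul X Y ▷ (Y ⊗ A.X) ≫ split X Y := by
        rw [← wreathMul_assoc]; monoidal
    _ = _ := by rw [whisker_exchange]; simp only [splitActL]; monoidal

/-- `s ↦ s w`, for an element `w` of `Y ⊗ S`, with `S = Y A` -/
def mulLeft (w : 𝟙_ C ⟶ Y ⊗ (Y ⊗ A.X)) : Y ⊗ A.X ⟶ Y ⊗ (Y ⊗ A.X) :=
  (ρ_ _).inv ≫ (Y ⊗ A.X) ◁ w ≫ splitActL X Y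

/-- `s ↦ w s`, for an element `w` of `Y ⊗ S`, with `S = Y A` -/
def mulRight (w : 𝟙_ C ⟶ Y ⊗ (Y ⊗ A.X)) : Y ⊗ A.X ⟶ Y ⊗ (Y ⊗ A.X) :=
  (λ_ _).inv ≫ w ▷ (Y ⊗ A.X) ≫ splitActR X Y

lemma mul_mulLeft (w : 𝟙_ C ⟶ Y ⊗ (Y ⊗ A.X)) :
    wreathMul X Y ≫ mulLeft X Y w = (Y ⊗ A.X) ◁ mulLeft X Y w ≫ splitActL X Y := by
  calc _ = 𝟙 _ ⊗≫ (wreathMul X Y ▷ 𝟙_ C ≫ (Y ⊗ A.X) ◁ w) ≫ splitActL X Y := by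
        simp only [mulLeft]; monoidal
    _ = 𝟙 _ ⊗≫ ((Y ⊗ A.X) ⊗ (Y ⊗ A.X)) ◁ w ≫
        (wreathMul X Y ▷ (Y ⊗ (Y ⊗ A.X)) ≫ splitActL X Y) := by
        rw [← whisker_exchange]; monoidal
    _ = _ := by rw [splitActL_assoc]; simp only [mulLeft]; monoidal

lemma mul_mulRight (w : 𝟙_ C ⟶ Y ⊗ (Y ⊗ A.X)) :
    wreathMul X Y ≫ mulRight X Y w = mulRight X Y w ▷ (Y ⊗ A.X) ≫ splitActR X Y := by
  calc _ = 𝟙 _ ⊗≫ (𝟙_ C ◁ wreathMul X Y ≫ w ▷ (Y ⊗ A.X)) ≫ splitActR X Y := by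
        simp only [mulRight]; monoidal
    _ = 𝟙 _ ⊗≫ w ▷ ((Y ⊗ A.X) ⊗ (Y ⊗ A.X)) ⊗≫
        Y ◁ ((α_ _ _ _).hom ≫ (Y ⊗ A.X) ◁ wreathMul X Y ≫ wreathMul X Y) := by
        rw [whisker_exchange]; simp only [splitActR]; monoidal
    _ = _ := by rw [← wreathMul_assoc]; simp only [mulRight, splitActR]; monoidal

lemma mulRight_actL (w : 𝟙_ C ⟶ Y ⊗ (Y ⊗ A.X)) :
    (Y ⊗ A.X) ◁ mulRight X Y w ≫ splitActL X Y = mulLeft X Y w ▷ (Y ⊗ A.X) ≫ splitActR X Y := by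
  calc _ = 𝟙 _ ⊗≫ (Y ⊗ A.X) ◁ w ▷ (Y ⊗ A.X) ⊗≫
        ((α_ _ _ _).hom ≫ (Y ⊗ A.X) ◁ splitActR X Y ≫ splitActL X Y) := by
        simp only [mulRight]; monoidal
    _ = _ := by rw [← splitActL_actR]; simp only [mulLeft]; monoidal

/-- An element of `S ⊗_A S ≅ Y ⊗ S` is a Casimir element as soon as it commutes with `A` and with
`Y`, which generate `S = Y A`. -/
lemma mulLeft_eq_mulRight_iff (w : 𝟙_ C ⟶ Y ⊗ (Y ⊗ A.X)) :
    mulLeft X Y w = mulRight X Y w ↔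
      (incl X Y).hom ≫ mulLeft X Y w = (incl X Y).hom ≫ mulRight X Y w ∧
        runit A Y ≫ mulLeft X Y w = runit A Y ≫ mulRight X Y w := by
  refine ⟨fun h => by rw [h]; exact ⟨rfl, rfl⟩, fun ⟨hA, hY⟩ => ?_⟩
  have key (f : Y ⊗ A.X ⟶ Y ⊗ (Y ⊗ A.X)) : f =
      runit A Y ▷ A.X ≫ (Y ⊗ A.X) ◁ (incl X Y).hom ≫ wreathMul X Y ≫ f := by
    have h := runit_mul_incl X Y
    rw [Category.assoc] at h
    rw [reassoc_of% h]
  calc _ = runit A Y ▷ A.X ≫ (Y ⊗ A.X) ◁ ((incl X Y).hom ≫ mulLeft X Y w) ≫ splitActL X Y := by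
        rw [MonoidalCategory.whiskerLeft_comp_assoc, ← mul_mulLeft]; exact key _
    _ = runit A Y ▷ A.X ≫ (Y ⊗ A.X) ◁ (incl X Y).hom ≫
        mulLeft X Y w ▷ (Y ⊗ A.X) ≫ splitActR X Y := by
        rw [hA, MonoidalCategory.whiskerLeft_comp_assoc, mulRight_actL]
    _ = (runit A Y ≫ mulLeft X Y w) ▷ A.X ≫ (Y ⊗ (Y ⊗ A.X)) ◁ (incl X Y).hom ≫ splitActR X Y := by
        rw [whisker_exchange_assoc, comp_whiskerRight_assoc]
    _ = runit A Y ▷ A.X ≫ (Y ⊗ A.X) ◁ (incl X Y).hom ≫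
        mulRight X Y w ▷ (Y ⊗ A.X) ≫ splitActR X Y := by
        rw [hY, whisker_exchange_assoc, comp_whiskerRight_assoc]
    _ = _ := by rw [← mul_mulRight]; exact (key _).symm

/-- Frobenius systems of the extension `A ⟶ S = Y A`, with the Casimir element given by an element
`w` of `Y ⊗ S ≅ S ⊗_A S`. -/
structure IsWreathSystem (θ : Y ⊗ A.X ⟶ A.X) (w : 𝟙_ C ⟶ Y ⊗ (Y ⊗ A.X)) : Prop where
  left : (bimod X Y).actLeft ≫ θ = A.X ◁ θ ≫ μ[A.X]
  right : (bimod X Y).actRight ≫ θ = θ ▷ A.X ≫ μ[A.X]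
  casimir : mulLeft X Y w = mulRight X Y w
  unit_left : w ≫ unsplit A Y ≫ θ ▷ (Y ⊗ A.X) ≫ (bimod X Y).actLeft = wOne X Y
  unit_right : w ≫ unsplit A Y ≫ (Y ⊗ A.X) ◁ θ ≫ (bimod X Y).actRight = wOne X Y

lemma mulLeft_split (e : 𝟙_ C ⟶ (Y ⊗ A.X) ⊗ (Y ⊗ A.X)) : mulLeft X Y (e ≫ split X Y) =
    (ρ_ _).inv ≫ (Y ⊗ A.X) ◁ e ≫ (α_ _ _ _).inv ≫ wreathMul X Y ▷ (Y ⊗ A.X) ≫ split X Y := by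
  rw [mulLeft, MonoidalCategory.whiskerLeft_comp_assoc, split_actL]

lemma mulRight_split (e : 𝟙_ C ⟶ (Y ⊗ A.X) ⊗ (Y ⊗ A.X)) : mulRight X Y (e ≫ split X Y) =
    (λ_ _).inv ≫ e ▷ (Y ⊗ A.X) ≫ (α_ _ _ _).hom ≫ (Y ⊗ A.X) ◁ wreathMul X Y ≫ split X Y := by
  rw [mulRight, comp_whiskerRight_assoc, split_actR]

lemma isFrobeniusSystem_split_iff (θ : Y ⊗ A.X ⟶ A.X) (e : 𝟙_ C ⟶ (Y ⊗ A.X) ⊗ (Y ⊗ A.X)) :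
    Extension.IsFrobeniusSystem (incl X Y) (split X Y) θ e ↔
      IsWreathSystem X Y θ (e ≫ split X Y) := by
  have hL : (bimod X Y).actLeft = (incl X Y).hom ▷ (Y ⊗ A.X) ≫ wreathMul X Y := (incl_mul X Y).symm
  have hR : (bimod X Y).actRight = (Y ⊗ A.X) ◁ (incl X Y).hom ≫ wreathMul X Y :=
    (mul_incl X Y).symm
  have h₁ : (θ ≫ (incl X Y).hom) ▷ (Y ⊗ A.X) ≫ wreathMul X Y =
      θ ▷ (Y ⊗ A.X) ≫ (bimod X Y).actLeft := by
    rw [comp_whiskerRight_assoc, incl_mul]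
  have h₂ : (Y ⊗ A.X) ◁ (θ ≫ (incl X Y).hom) ≫ wreathMul X Y =
      (Y ⊗ A.X) ◁ θ ≫ (bimod X Y).actRight := by
    rw [MonoidalCategory.whiskerLeft_comp_assoc, mul_incl]
  constructor
  · intro h
    have hl : (bimod X Y).actLeft ≫ θ = A.X ◁ θ ≫ μ[A.X] := by
      rw [hL]; exact (Category.assoc _ _ _).trans h.left
    have hr : (bimod X Y).actRight ≫ θ = θ ▷ A.X ≫ μ[A.X] := by
      rw [hR]; exact (Category.assoc _ _ _).trans h.right
    refine ⟨hl, hr, ?_, ?_, ?_⟩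
    · rw [mulLeft_split, mulRight_split]; exact h.casimir
    · rw [Category.assoc, split_unsplit_comp X Y (counit_left_balanced X Y hr), ← h₁]
      exact h.unit_left
    · rw [Category.assoc, split_unsplit_comp X Y (counit_right_balanced X Y hl), ← h₂]
      exact h.unit_right
  · intro h
    refine ⟨?_, ?_, ?_, ?_, ?_⟩
    · have := h.left
      rw [hL] at this; exact (Category.assoc _ _ _).symm.trans this
    · have := h.right
      rw [hR] at this; exact (Category.assoc _ _ _).symm.trans this
    · have := h.casimir
      rw [mulLeft_split, mulRight_split] at this; exact this
    · have := h.unit_left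
      rw [Category.assoc, split_unsplit_comp X Y (counit_left_balanced X Y h.right), ← h₁] at this
      exact this
    · have := h.unit_right
      rw [Category.assoc, split_unsplit_comp X Y (counit_right_balanced X Y h.left), ← h₂] at this
      exact this

section
variable [HasCoequalizers C] [∀ X : C, LeftCoflat X] [∀ Y : LeftModule A, IsRobust Y]
open BimodTensor Extension

/-- `S ⊗_A S ⟶ Y ⊗ S`, for `S = Y A` -/
noncomputable def splitDesc : (tensor (Extension.bimod (incl X Y)) (Extension.bimod (incl X Y))).X ⟶
    Y ⊗ (Y ⊗ A.X) :=
  desc (P := Extension.bimod (incl X Y)) (Q := Extension.bimod (incl X Y)) (split X Y) (by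
    change ((Y ⊗ A.X) ◁ (incl X Y).hom ≫ wreathMul X Y) ▷ (Y ⊗ A.X) ≫ split X Y =
      ((α_ _ _ _).hom ≫ (Y ⊗ A.X) ◁ ((incl X Y).hom ▷ (Y ⊗ A.X) ≫ wreathMul X Y)) ≫ split X Y
    rw [mul_incl, incl_mul]
    exact split_balanced X Y)

/-- The projection `S ⊗ S ⟶ S ⊗_A S`, with the underlying object of `S` written as `Y A`, for `S = Y
A` -/
noncomputable def proj : (Y ⊗ A.X) ⊗ (Y ⊗ A.X) ⟶
    (tensor (Extension.bimod (incl X Y)) (Extension.bimod (incl X Y))).X := pS (incl X Y)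

lemma proj_splitDesc : proj X Y ≫ splitDesc X Y = split X Y :=
  π_desc (P := Extension.bimod (incl X Y)) (Q := Extension.bimod (incl X Y)) (split X Y) _

lemma split_unsplit_proj : split X Y ≫ unsplit A Y ≫ proj X Y = proj X Y :=
  split_unsplit_comp X Y (by
    have h : ((Y ⊗ A.X) ◁ (incl X Y).hom ≫ wreathMul X Y) ▷ (Y ⊗ A.X) ≫ proj X Y =
      (α_ _ _ _).hom ≫ (Y ⊗ A.X) ◁ ((incl X Y).hom ▷ (Y ⊗ A.X) ≫ wreathMul X Y) ≫ proj X Y :=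
      pS_cond (incl X Y)
    rw [mul_incl, incl_mul] at h
    exact h.trans (Category.assoc _ _ _).symm)

/-- The projection `S ⊗ S ⟶ S ⊗_A S` splits in `C`, for `S = Y A`. -/
lemma section_proj : (splitDesc X Y ≫ unsplit A Y) ≫ proj X Y = 𝟙 _ := by
  have : Epi (proj X Y) := inferInstanceAs
    (Epi (π (Extension.bimod (incl X Y)) (Extension.bimod (incl X Y))))
  rw [← cancel_epi (proj X Y), Category.assoc, reassoc_of% (proj_splitDesc X Y), split_unsplit_proj,
    Category.comp_id]

lemma isFrobeniusSystem_pS_iff (θ : Y ⊗ A.X ⟶ A.X) (e : 𝟙_ C ⟶ (Y ⊗ A.X) ⊗ (Y ⊗ A.X)) :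
    Extension.IsFrobeniusSystem (incl X Y) (pS (incl X Y)) θ e ↔
      IsWreathSystem X Y θ (e ≫ split X Y) := by
  rw [← isFrobeniusSystem_split_iff]
  have hc : (ρ_ (Y ⊗ A.X)).inv ≫ (Y ⊗ A.X) ◁ e ≫ (α_ _ _ _).inv ≫
        wreathMul X Y ▷ (Y ⊗ A.X) ≫ proj X Y = (λ_ _).inv ≫ e ▷ (Y ⊗ A.X) ≫ (α_ _ _ _).hom ≫
          (Y ⊗ A.X) ◁ wreathMul X Y ≫ proj X Y ↔
      (ρ_ (Y ⊗ A.X)).inv ≫ (Y ⊗ A.X) ◁ e ≫ (α_ _ _ _).inv ≫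
        wreathMul X Y ▷ (Y ⊗ A.X) ≫ split X Y = (λ_ _).inv ≫ e ▷ (Y ⊗ A.X) ≫ (α_ _ _ _).hom ≫
          (Y ⊗ A.X) ◁ wreathMul X Y ≫ split X Y := by
    constructor
    · intro h
      have := congrArg (· ≫ splitDesc X Y) h
      simpa only [Category.assoc, proj_splitDesc] using this
    · intro h
      have := congrArg (· ≫ unsplit A Y ≫ proj X Y) h
      simpa only [Category.assoc, split_unsplit_proj] using this
  exact ⟨fun h => ⟨h.left, h.right, hc.1 h.casimir, h.unit_left, h.unit_right⟩,
    fun h => ⟨h.left, h.right, hc.2 h.casimir, h.unit_left, h.unit_right⟩⟩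

lemma isFrobeniusExtension_iff_wreathSystem :
    IsFrobeniusExtension (incl X Y) ↔ ∃ θ w, IsWreathSystem X Y θ w := by
  rw [Extension.isFrobeniusExtension_iff (incl X Y) (splitDesc X Y ≫ unsplit A Y)
    (section_proj X Y)]
  constructor
  · rintro ⟨θ, e, h⟩
    exact ⟨θ, _, (isFrobeniusSystem_pS_iff X Y θ e).1 h⟩
  · rintro ⟨θ, w, h⟩
    refine ⟨θ, w ≫ unsplit A Y, (isFrobeniusSystem_pS_iff X Y θ _).2 ?_⟩
    rwa [Category.assoc, unsplit_split, Category.comp_id]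

lemma isFrobeniusExtension_iff :
    IsFrobeniusExtension (incl X Y) ↔ ∃ t Ψ, (extensionDual X Y).IsFrobeniusPair t Ψ :=
  (extensionDual X Y).isFrobeniusExtension_iff (splitDesc X Y ≫ unsplit A Y) (section_proj X Y)

end

end Duality
end Cowreath

/-! ### Frobenius algebras of left transfer morphisms -/

namespace Cowreath

variable {C : Type u} [Category.{v} C] [MonoidalCategory C] {A : Mon C}

namespace Duality
variable (X : RightTransfer A) (Y : C) [ExactPairing Y X.X]

lemma actLeft_eq : (bimod X Y).actLeft = (α_ A.X Y A.X).inv ≫ rext A (dualφ X Y) := rfl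

/-- The right `A`-linear map `Y A ⟶ A` extending `θ : Y ⟶ A` -/
def extendForm (θ : Y ⟶ A.X) : Y ⊗ A.X ⟶ A.X := θ ▷ A.X ≫ μ[A.X]

variable {Y} in
lemma runit_extendForm (θ : Y ⟶ A.X) : runit A Y ≫ extendForm Y θ = θ := by
  calc _ = (runit A Y ≫ θ ▷ A.X) ≫ μ[A.X] := by simp only [extendForm, Category.assoc]
    _ = θ ⊗≫ (A.X ◁ η[A.X] ≫ μ[A.X]) := by rw [runit_natural]; simp only [runit]; monoidal
    _ = _ := by rw [MonObj.mul_one]; monoidal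

lemma extendForm_right (θ : Y ⟶ A.X) :
    (bimod X Y).actRight ≫ extendForm Y θ = extendForm Y θ ▷ A.X ≫ μ[A.X] := by
  calc _ = 𝟙 _ ⊗≫ (Y ◁ μ[A.X] ≫ θ ▷ A.X) ⊗≫ μ[A.X] := by simp only [extendForm]; monoidal
    _ = 𝟙 _ ⊗≫ θ ▷ (A.X ⊗ A.X) ⊗≫ ((α_ _ _ _).hom ≫ A.X ◁ μ[A.X] ≫ μ[A.X]) := by
        rw [whisker_exchange]; monoidal
    _ = _ := by rw [← MonObj.mul_assoc]; simp only [extendForm]; monoidal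

lemma extendForm_runit {θ : Y ⊗ A.X ⟶ A.X}
    (h : (bimod X Y).actRight ≫ θ = θ ▷ A.X ≫ μ[A.X]) : extendForm Y (runit A Y ≫ θ) = θ := by
  calc _ = runit A Y ▷ A.X ≫ (θ ▷ A.X ≫ μ[A.X]) := by simp only [extendForm]; monoidal
    _ = (runit A Y ▷ A.X ≫ (bimod X Y).actRight) ≫ θ := by rw [← h]; simp only [Category.assoc]
    _ = _ := by rw [runit_actRight]; exact Category.id_comp _

lemma extendForm_left_iff (θ : Y ⟶ A.X) :
    (bimod X Y).actLeft ≫ extendForm Y θ = A.X ◁ extendForm Y θ ≫ μ[A.X] ↔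
      dualφ X Y ≫ θ ▷ A.X ≫ μ[A.X] = A.X ◁ θ ≫ μ[A.X] := by
  constructor
  · intro h
    calc _ = A.X ◁ runit A Y ≫ ((bimod X Y).actLeft ≫ extendForm Y θ) := by
          rw [← runit_actLeft]; simp only [extendForm, Category.assoc]
      _ = A.X ◁ (runit A Y ≫ extendForm Y θ) ≫ μ[A.X] := by rw [h]; monoidal
      _ = _ := by rw [runit_extendForm]
  · intro h
    calc _ = 𝟙 _ ⊗≫ dualφ X Y ▷ A.X ⊗≫ (Y ◁ μ[A.X] ≫ θ ▷ A.X) ⊗≫ μ[A.X] := by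
          simp only [extendForm]; monoidal
      _ = 𝟙 _ ⊗≫ dualφ X Y ▷ A.X ⊗≫ θ ▷ (A.X ⊗ A.X) ⊗≫
          ((α_ _ _ _).hom ≫ A.X ◁ μ[A.X] ≫ μ[A.X]) := by
          rw [whisker_exchange]; monoidal
      _ = 𝟙 _ ⊗≫ (dualφ X Y ≫ θ ▷ A.X ≫ μ[A.X]) ▷ A.X ⊗≫ μ[A.X] := by
          rw [← MonObj.mul_assoc]; monoidal
      _ = 𝟙 _ ⊗≫ A.X ◁ θ ▷ A.X ⊗≫ (μ[A.X] ▷ A.X ≫ μ[A.X]) := by rw [h]; monoidal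
      _ = _ := by rw [MonObj.mul_assoc]; simp only [extendForm]; monoidal

lemma whiskerRight_split (f : Y ⊗ Y ⟶ Y ⊗ A.X) : f ▷ (Y ⊗ A.X) ≫ split X Y =
    (α_ _ _ _).inv ≫ rext A (dtenr X Y f) ≫ (α_ _ _ _).hom := by
  simp only [split, rext, dtenr]; monoidal

lemma unsplit_extendForm_left (e : 𝟙_ C ⟶ (Y ⊗ Y) ⊗ A.X) (θ : Y ⟶ A.X) :
    (e ≫ (α_ _ _ _).hom) ≫ unsplit A Y ≫ extendForm Y θ ▷ (Y ⊗ A.X) ≫ (bimod X Y).actLeft =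
      e ≫ rext A (dtenr X Y (θ ≫ (λ_ A.X).inv)) ≫ (λ_ Y).hom ▷ A.X := by
  calc _ = e ⊗≫ (runit A Y ≫ extendForm Y θ) ▷ (Y ⊗ A.X) ≫ (bimod X Y).actLeft := by
        simp only [unsplit]; monoidal
    _ = _ := by
        rw [runit_extendForm, actLeft_eq]; simp only [rext, dtenr]; monoidal

lemma unsplit_extendForm_right (e : 𝟙_ C ⟶ (Y ⊗ Y) ⊗ A.X) (θ : Y ⟶ A.X) :
    (e ≫ (α_ _ _ _).hom) ≫ unsplit A Y ≫ (Y ⊗ A.X) ◁ extendForm Y θ ≫ (bimod X Y).actRight =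
      e ≫ rext A (wten Y (θ ≫ (λ_ A.X).inv)) ≫ (ρ_ Y).hom ▷ A.X := by
  calc _ = e ⊗≫ (runit A Y ▷ (Y ⊗ A.X) ≫ (Y ⊗ A.X) ◁ extendForm Y θ) ≫ (bimod X Y).actRight := by
        simp only [unsplit]; monoidal
    _ = e ⊗≫ Y ◁ extendForm Y θ ≫ (runit A Y ▷ A.X ≫ (bimod X Y).actRight) := by
        rw [← whisker_exchange]; monoidal
    _ = _ := by
        rw [runit_actRight]; simp only [extendForm, rext, wten]; monoidal

variable [ComonObj X]

lemma runit_splitActL : runit A Y ▷ (Y ⊗ (Y ⊗ A.X)) ≫ splitActL X Y =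
    (α_ _ _ _).inv ≫ wMul X Y ▷ (Y ⊗ A.X) ≫ split X Y := by
  calc _ = (α_ _ _ _).inv ≫ ((runit A Y ▷ Y ≫ (Y ⊗ A.X) ◁ runit A Y) ≫ wreathMul X Y) ▷ (Y ⊗ A.X) ≫
        split X Y := by simp only [splitActL, unsplit]; monoidal
    _ = _ := by rw [runit_mul_runit]

lemma runit_mulLeft (e : 𝟙_ C ⟶ (Y ⊗ Y) ⊗ A.X) :
    runit A Y ≫ mulLeft X Y (e ≫ (α_ _ _ _).hom) =
      ((ρ_ Y).inv ≫ wten Y e ≫ rext A ((α_ _ _ _).inv ≫ dtenr X Y (wMul X Y))) ≫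
        (α_ _ _ _).hom := by
  calc _ = 𝟙 _ ⊗≫ (runit A Y ▷ 𝟙_ C ≫ (Y ⊗ A.X) ◁ (e ≫ (α_ _ _ _).hom)) ≫ splitActL X Y := by
        simp only [mulLeft]; monoidal
    _ = 𝟙 _ ⊗≫ Y ◁ (e ≫ (α_ _ _ _).hom) ≫ (runit A Y ▷ (Y ⊗ (Y ⊗ A.X)) ≫ splitActL X Y) := by
        rw [← whisker_exchange]; monoidal
    _ = _ := by
        rw [runit_splitActL, whiskerRight_split, rext_precomp]; simp only [wten]; monoidal

lemma runit_mulRight (e : 𝟙_ C ⟶ (Y ⊗ Y) ⊗ A.X) :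
    runit A Y ≫ mulRight X Y (e ≫ (α_ _ _ _).hom) =
      ((λ_ Y).inv ≫ dtenr X Y e ≫ rext A ((α_ _ _ _).hom ≫ wten Y (wMul X Y))) ≫
        (α_ _ _ _).hom := by
  calc _ = 𝟙 _ ⊗≫ (𝟙_ C ◁ runit A Y ≫ (e ≫ (α_ _ _ _).hom) ▷ (Y ⊗ A.X)) ⊗≫
        Y ◁ wreathMul X Y := by
        simp only [mulRight, splitActR]; monoidal
    _ = 𝟙 _ ⊗≫ (e ≫ (α_ _ _ _).hom) ▷ Y ⊗≫ Y ◁ ((Y ⊗ A.X) ◁ runit A Y ≫ wreathMul X Y) := by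
        rw [whisker_exchange]; monoidal
    _ = _ := by
        rw [runit_mul, rext_precomp]; simp only [dtenr, wten, rext]; monoidal

lemma incl_mulLeft (e : 𝟙_ C ⟶ (Y ⊗ Y) ⊗ A.X) :
    (incl X Y).hom ≫ mulLeft X Y (e ≫ (α_ _ _ _).hom) =
      (ρ_ A.X).inv ≫ (wten A.X e ≫ rext A (dualφ₂ X Y)) ≫ (α_ _ _ _).hom := by
  calc _ = 𝟙 _ ⊗≫ ((incl X Y).hom ▷ 𝟙_ C ≫ (Y ⊗ A.X) ◁ (e ≫ (α_ _ _ _).hom)) ≫ splitActL X Y := by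
        simp only [mulLeft]; monoidal
    _ = 𝟙 _ ⊗≫ A.X ◁ (e ≫ (α_ _ _ _).hom) ⊗≫ (((incl X Y).hom ▷ Y ≫ (Y ⊗ A.X) ◁ runit A Y) ≫
        wreathMul X Y) ▷ (Y ⊗ A.X) ≫ split X Y := by
        rw [← whisker_exchange]; simp only [splitActL, unsplit]; monoidal
    _ = _ := by
        rw [incl_mul_runit]; simp only [wten, dualφ₂, rext, split]; monoidal

lemma incl_mulRight (e : 𝟙_ C ⟶ (Y ⊗ Y) ⊗ A.X) :
    (incl X Y).hom ≫ mulRight X Y (e ≫ (α_ _ _ _).hom) =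
      (λ_ A.X).inv ≫ rext A e ≫ (α_ _ _ _).hom := by
  calc _ = 𝟙 _ ⊗≫ (𝟙_ C ◁ (incl X Y).hom ≫ (e ≫ (α_ _ _ _).hom) ▷ (Y ⊗ A.X)) ⊗≫
        Y ◁ wreathMul X Y := by
        simp only [mulRight, splitActR]; monoidal
    _ = 𝟙 _ ⊗≫ (e ≫ (α_ _ _ _).hom) ▷ A.X ⊗≫ Y ◁ ((Y ⊗ A.X) ◁ (incl X Y).hom ≫ wreathMul X Y) := by
        rw [whisker_exchange]; monoidal
    _ = _ := by rw [mul_incl]; simp only [rext]; monoidal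

/-- `IsWreathSystem` in terms of the morphisms underlying a Frobenius structure on `(Y, φ)`. -/
lemma isWreathSystem_extendForm_iff (θ : Y ⟶ A.X) (e : 𝟙_ C ⟶ (Y ⊗ Y) ⊗ A.X) :
    IsWreathSystem X Y (extendForm Y θ) (e ≫ (α_ _ _ _).hom) ↔
      dualφ X Y ≫ rext A (θ ≫ (λ_ A.X).inv) =
        wten A.X (θ ≫ (λ_ A.X).inv) ≫ rext A ((ρ_ A.X).hom ≫ (λ_ A.X).inv) ∧
      ((ρ_ A.X).hom ≫ (λ_ A.X).inv) ≫ rext A e = wten A.X e ≫ rext A (dualφ₂ X Y) ∧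
      (ρ_ Y).inv ≫ wten Y e ≫ rext A ((α_ _ _ _).inv ≫ dtenr X Y (wMul X Y)) =
        (λ_ Y).inv ≫ dtenr X Y e ≫ rext A ((α_ _ _ _).hom ≫ wten Y (wMul X Y)) ∧
      e ≫ rext A (dtenr X Y (θ ≫ (λ_ A.X).inv)) ≫ (λ_ Y).hom ▷ A.X = wOne X Y ∧
      e ≫ rext A (wten Y (θ ≫ (λ_ A.X).inv)) ≫ (ρ_ Y).hom ▷ A.X = wOne X Y := by
  have hθ : dualφ X Y ≫ rext A (θ ≫ (λ_ A.X).inv) =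
        wten A.X (θ ≫ (λ_ A.X).inv) ≫ rext A ((ρ_ A.X).hom ≫ (λ_ A.X).inv) ↔
      (bimod X Y).actLeft ≫ extendForm Y θ = A.X ◁ extendForm Y θ ≫ μ[A.X] := by
    rw [extendForm_left_iff, ← cancel_mono (λ_ A.X).inv]
    have h₁ : dualφ X Y ≫ rext A (θ ≫ (λ_ A.X).inv) =
        (dualφ X Y ≫ θ ▷ A.X ≫ μ[A.X]) ≫ (λ_ A.X).inv := by simp only [rext]; monoidal
    have h₂ : wten A.X (θ ≫ (λ_ A.X).inv) ≫ rext A ((ρ_ A.X).hom ≫ (λ_ A.X).inv) =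
        (A.X ◁ θ ≫ μ[A.X]) ≫ (λ_ A.X).inv := by simp only [rext, wten]; monoidal
    rw [h₁, h₂]
  have he : ((ρ_ A.X).hom ≫ (λ_ A.X).inv) ≫ rext A e = wten A.X e ≫ rext A (dualφ₂ X Y) ↔
      (incl X Y).hom ≫ mulLeft X Y (e ≫ (α_ _ _ _).hom) =
        (incl X Y).hom ≫ mulRight X Y (e ≫ (α_ _ _ _).hom) := by
    rw [incl_mulLeft, incl_mulRight, ← cancel_mono (α_ _ _ _).hom, ← cancel_epi (ρ_ A.X).inv]
    simp only [Category.assoc, Iso.inv_hom_id_assoc]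
    exact eq_comm
  have hc : (ρ_ Y).inv ≫ wten Y e ≫ rext A ((α_ _ _ _).inv ≫ dtenr X Y (wMul X Y)) =
        (λ_ Y).inv ≫ dtenr X Y e ≫ rext A ((α_ _ _ _).hom ≫ wten Y (wMul X Y)) ↔
      runit A Y ≫ mulLeft X Y (e ≫ (α_ _ _ _).hom) =
        runit A Y ≫ mulRight X Y (e ≫ (α_ _ _ _).hom) := by
    rw [runit_mulLeft, runit_mulRight, cancel_mono]
  rw [hθ, he, hc, ← unsplit_extendForm_left X Y, ← unsplit_extendForm_right X Y]
  constructor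
  · intro h
    obtain ⟨h₁, h₂⟩ := (mulLeft_eq_mulRight_iff X Y _).1 h.casimir
    exact ⟨h.left, h₁, h₂, h.unit_left, h.unit_right⟩
  · rintro ⟨h₁, h₂, h₃, h₄, h₅⟩
    exact ⟨h₁, extendForm_right X Y θ, (mulLeft_eq_mulRight_iff X Y _).2 ⟨h₂, h₃⟩, h₄, h₅⟩

/-- The conditions on a Frobenius structure on `(Y, φ)`, in terms of the underlying morphisms in `C`
-/
lemma isFrobeniusAlgebra_conditions_iff
    (θ : dualTransfer X Y ⟶ 𝟙_ (LeftTransfer A))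
    (e : 𝟙_ (LeftTransfer A) ⟶ dualTransfer X Y ⊗ dualTransfer X Y)
    (θ₀ : Y ⟶ 𝟙_ C ⊗ A.X) (hθ₀ : θ.hom = θ₀) (e₀ : 𝟙_ C ⟶ (Y ⊗ Y) ⊗ A.X) (he₀ : e.hom = e₀) :
    (letI := dualTransferMonObj X Y;
      (ρ_ (dualTransfer X Y)).inv ≫ dualTransfer X Y ◁ e ≫ (α_ _ _ _).inv ≫
          μ[dualTransfer X Y] ▷ dualTransfer X Y =
        (λ_ (dualTransfer X Y)).inv ≫ e ▷ dualTransfer X Y ≫ (α_ _ _ _).hom ≫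
          dualTransfer X Y ◁ μ[dualTransfer X Y] ∧
      e ≫ θ ▷ dualTransfer X Y ≫ (λ_ (dualTransfer X Y)).hom = η[dualTransfer X Y] ∧
      e ≫ dualTransfer X Y ◁ θ ≫ (ρ_ (dualTransfer X Y)).hom = η[dualTransfer X Y]) ↔
    (ρ_ Y).inv ≫ wten Y e₀ ≫ rext A ((α_ _ _ _).inv ≫ dtenr X Y (wMul X Y)) =
        (λ_ Y).inv ≫ dtenr X Y e₀ ≫ rext A ((α_ _ _ _).hom ≫ wten Y (wMul X Y)) ∧
      e₀ ≫ rext A (dtenr X Y θ₀) ≫ (λ_ Y).hom ▷ A.X = wOne X Y ∧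
      e₀ ≫ rext A (wten Y θ₀) ≫ (ρ_ Y).hom ▷ A.X = wOne X Y := by
  refine and_congr ?_ (and_congr ?_ ?_)
  · have h₁ : ((ρ_ Y).inv ≫ runit A (Y ⊗ 𝟙_ C)) ≫ rext A (wten Y e₀ ≫
        rext A (((α_ Y Y Y).inv ≫ runit A _) ≫ rext A (dtenr X Y (wMul X Y)))) =
        (ρ_ Y).inv ≫ wten Y e₀ ≫ rext A ((α_ _ _ _).inv ≫ dtenr X Y (wMul X Y)) := by
      simp only [Category.assoc, runit_rext]
    have h₂ : ((λ_ Y).inv ≫ runit A (𝟙_ C ⊗ Y)) ≫ rext A (dtenr X Y e₀ ≫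
        rext A (((α_ Y Y Y).hom ≫ runit A _) ≫ rext A (wten Y (wMul X Y)))) =
        (λ_ Y).inv ≫ dtenr X Y e₀ ≫ rext A ((α_ _ _ _).hom ≫ wten Y (wMul X Y)) := by
      simp only [Category.assoc, runit_rext]
    rw [← h₁, ← h₂]
    subst he₀
    exact LeftTransfer.Hom.ext_iff
  · have h : e₀ ≫ rext A (dtenr X Y θ₀ ≫ rext A ((λ_ Y).hom ≫ runit A Y)) =
        e₀ ≫ rext A (dtenr X Y θ₀) ≫ (λ_ Y).hom ▷ A.X := by
      rw [LeftTransfer.comp_pure, rext_postcomp]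
    rw [← h]
    subst hθ₀ he₀
    exact LeftTransfer.Hom.ext_iff
  · have h : e₀ ≫ rext A (wten Y θ₀ ≫ rext A ((ρ_ Y).hom ≫ runit A Y)) =
        e₀ ≫ rext A (wten Y θ₀) ≫ (ρ_ Y).hom ▷ A.X := by
      rw [LeftTransfer.comp_pure, rext_postcomp]
    rw [← h]
    subst hθ₀ he₀
    exact LeftTransfer.Hom.ext_iff

/-- Frobenius structures on `(Y, φ)` are the same as Frobenius systems of `A ⟶ Y A`, since bilinear
maps `Y A ⟶ A` are given by their restriction to `Y`, and `Y A` is generated by `Y` and `A`. -/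
lemma isFrobeniusAlgebra_dualTransfer_iff_wreathSystem :
    (letI := dualTransferMonObj X Y;
      IsFrobeniusAlgebra (dualTransfer X Y)) ↔ ∃ θ w, IsWreathSystem X Y θ w := by
  constructor
  · rintro ⟨θ, e, h⟩
    obtain ⟨θ₀, hθ₀⟩ : ∃ f : Y ⟶ 𝟙_ C ⊗ A.X, θ.hom = f := ⟨_, rfl⟩
    obtain ⟨e₀, he₀⟩ : ∃ f : 𝟙_ C ⟶ (Y ⊗ Y) ⊗ A.X, e.hom = f := ⟨_, rfl⟩
    obtain ⟨h₁, h₂, h₃⟩ := (isFrobeniusAlgebra_conditions_iff X Y θ e θ₀ hθ₀ e₀ he₀).1 h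
    have c₁ : dualφ X Y ≫ rext A θ₀ = wten A.X θ₀ ≫ rext A ((ρ_ A.X).hom ≫ (λ_ A.X).inv) := by
      subst hθ₀; exact θ.comm'
    have c₂ : ((ρ_ A.X).hom ≫ (λ_ A.X).inv) ≫ rext A e₀ = wten A.X e₀ ≫ rext A (dualφ₂ X Y) := by
      subst he₀; exact e.comm'
    refine ⟨extendForm Y (θ₀ ≫ (λ_ A.X).hom), e₀ ≫ (α_ _ _ _).hom,
      (isWreathSystem_extendForm_iff X Y _ _).2 ?_⟩
    have hθ : (θ₀ ≫ (λ_ A.X).hom) ≫ (λ_ A.X).inv = θ₀ := by simp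
    rw [hθ]
    exact ⟨c₁, c₂, h₁, h₂, h₃⟩
  · rintro ⟨θ, w, h⟩
    have hw : w = (w ≫ (α_ _ _ _).inv) ≫ (α_ _ _ _).hom := by simp
    rw [← extendForm_runit X Y h.right, hw] at h
    obtain ⟨h₁, h₂, h₃, h₄, h₅⟩ := (isWreathSystem_extendForm_iff X Y _ _).1 h
    exact ⟨LeftTransfer.Hom.mk' _ h₁, LeftTransfer.Hom.mk' _ h₂,
      (isFrobeniusAlgebra_conditions_iff X Y _ _ _ rfl _ rfl).2 ⟨h₃, h₄, h₅⟩⟩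

end Duality
end Cowreath

/-! ### Frobenius `A`-rings -/

namespace Cowreath

lemma IsFrobeniusAlgebra.of_iso {D : Type u} [Category.{v} D] [MonoidalCategory D] {S T : D}
    [MonObj S] [MonObj T] (f : S ≅ T) (hμ : μ[S] ≫ f.hom = f.hom ▷ S ≫ T ◁ f.hom ≫ μ[T])
    (hη : η[S] ≫ f.hom = η[T]) (h : IsFrobeniusAlgebra S) : IsFrobeniusAlgebra T := by
  obtain ⟨θ, e, hc, hl, hr⟩ := h
  refine ⟨f.inv ≫ θ, e ≫ f.hom ▷ S ≫ T ◁ f.hom, ?_, ?_, ?_⟩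
  · rw [← cancel_epi f.hom]
    calc _ = 𝟙 _ ⊗≫ (f.hom ▷ 𝟙_ D ≫ T ◁ e) ⊗≫ T ◁ f.hom ▷ S ⊗≫
          ((T ⊗ T) ◁ f.hom ≫ μ[T] ▷ T) := by monoidal
      _ = 𝟙 _ ⊗≫ S ◁ e ⊗≫ f.hom ▷ (S ⊗ S) ⊗≫ T ◁ f.hom ▷ S ⊗≫ (μ[T] ▷ S ≫ T ◁ f.hom) := by
          rw [← whisker_exchange f.hom e, whisker_exchange μ[T] f.hom]; monoidal
      _ = 𝟙 _ ⊗≫ S ◁ e ⊗≫ (f.hom ▷ S ≫ T ◁ f.hom ≫ μ[T]) ▷ S ≫ T ◁ f.hom := by monoidal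
      _ = ((ρ_ S).inv ≫ S ◁ e ≫ (α_ S S S).inv ≫ μ[S] ▷ S) ≫ f.hom ▷ S ≫ T ◁ f.hom := by
          rw [← hμ]; monoidal
      _ = 𝟙 _ ⊗≫ e ▷ S ⊗≫ S ◁ μ[S] ≫ f.hom ▷ S ≫ T ◁ f.hom := by rw [hc]; monoidal
      _ = 𝟙 _ ⊗≫ e ▷ S ⊗≫ f.hom ▷ (S ⊗ S) ≫ T ◁ (μ[S] ≫ f.hom) := by
          rw [whisker_exchange_assoc]; monoidal
      _ = 𝟙 _ ⊗≫ (e ≫ f.hom ▷ S ≫ T ◁ f.hom) ▷ S ⊗≫ T ◁ T ◁ f.hom ≫ T ◁ μ[T] := by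
          rw [hμ]; monoidal
      _ = 𝟙 _ ⊗≫ ((e ≫ f.hom ▷ S ≫ T ◁ f.hom) ▷ S ≫ (T ⊗ T) ◁ f.hom) ⊗≫ T ◁ μ[T] := by
          monoidal
      _ = 𝟙 _ ⊗≫ (𝟙_ D ◁ f.hom ≫ (e ≫ f.hom ▷ S ≫ T ◁ f.hom) ▷ T) ⊗≫ T ◁ μ[T] := by
          rw [whisker_exchange]
      _ = _ := by monoidal
  · calc _ = e ≫ f.hom ▷ S ≫ (T ◁ f.hom ≫ (f.inv ≫ θ) ▷ T) ≫ (λ_ T).hom := by monoidal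
      _ = e ≫ (f.hom ≫ f.inv ≫ θ) ▷ S ≫ 𝟙_ D ◁ f.hom ≫ (λ_ T).hom := by
          rw [whisker_exchange]; monoidal
      _ = (e ≫ θ ▷ S ≫ (λ_ S).hom) ≫ f.hom := by
          rw [Iso.hom_inv_id_assoc]; monoidal
      _ = _ := by rw [hl, hη]
  · calc _ = e ≫ f.hom ▷ S ≫ T ◁ (f.hom ≫ f.inv ≫ θ) ≫ (ρ_ T).hom := by monoidal
      _ = e ≫ (f.hom ▷ S ≫ T ◁ θ) ≫ (ρ_ T).hom := by
          rw [Iso.hom_inv_id_assoc]; monoidal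
      _ = (e ≫ S ◁ θ ≫ (ρ_ S).hom) ≫ f.hom := by
          rw [← whisker_exchange]; monoidal
      _ = _ := by rw [hr, hη]

lemma isFrobeniusAlgebra_iff_of_iso {D : Type u} [Category.{v} D] [MonoidalCategory D] {S T : D}
    [MonObj S] [MonObj T] (f : S ≅ T) (hμ : μ[S] ≫ f.hom = f.hom ▷ S ≫ T ◁ f.hom ≫ μ[T])
    (hη : η[S] ≫ f.hom = η[T]) : IsFrobeniusAlgebra S ↔ IsFrobeniusAlgebra T := by
  refine ⟨IsFrobeniusAlgebra.of_iso f hμ hη, IsFrobeniusAlgebra.of_iso f.symm ?_ ?_⟩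
  · change μ[T] ≫ f.inv = f.inv ▷ T ≫ S ◁ f.inv ≫ μ[S]
    rw [Iso.comp_inv_eq, Category.assoc, Category.assoc, hμ, ← whisker_exchange_assoc,
      ← comp_whiskerRight_assoc]
    simp
  · exact (Iso.comp_inv_eq f).2 hη.symm

section
variable {D : Type u} [Category.{v} D] [MonoidalCategory D] (X Y : D) [ExactPairing Y X]
  [ComonObj X]

/-- The action `X Y ⟶ X X Y ⟶ X` on a coalgebra `X` of its dual algebra `Y` -/
def dualAct : X ⊗ Y ⟶ X := Δ[X] ▷ Y ≫ (α_ _ _ _).hom ≫ X ◁ ε_ Y X ≫ (ρ_ X).hom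

lemma dualAct_ev : (α_ X Y Y).inv ≫ dualAct X Y ▷ Y ≫ ε_ Y X = Δ[X] ▷ (Y ⊗ Y) ≫ ev₂ X Y := by
  simp only [dualAct, ev₂]; monoidal

variable {X Y}

/-- The dual multiplication is the one for which `⟨x, y y'⟩ = ⟨x y, y'⟩`. -/
lemma eq_dualMul {m : Y ⊗ Y ⟶ Y}
    (h : (α_ X Y Y).hom ≫ X ◁ m ≫ ε_ Y X = dualAct X Y ▷ Y ≫ ε_ Y X) : m = dualMul X Y :=
  dual_ext (X := X) (by rw [dualMul_ev, ← dualAct_ev, ← h, Iso.inv_hom_id_assoc])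

lemma eq_dualOne {u : 𝟙_ D ⟶ Y} (h : X ◁ u ≫ ε_ Y X = (ρ_ X).hom ≫ ε[X]) : u = dualOne X Y :=
  dual_ext (X := X) (by rw [dualOne_ev, h])

end

variable {C : Type u} [Category.{v} C] [MonoidalCategory C] {A : Mon C}

namespace Duality
variable (X : RightTransfer A) (Y : C) [ExactPairing Y X.X] [ComonObj X]

lemma incl_coringAct : (A.X ⊗ X.X) ◁ (incl X Y).hom ≫ coringAct X Y = (Coring.obj X).actRight :=
  incl_entwinedAct X Y (Coring.entwined X)

lemma incl_d₁ : (A.X ⊗ X.X) ◁ (incl X Y).hom ≫ d₁ X Y =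
    (Coring.obj X).actRight ≫ coringCounit X := by
  rw [← coringAct_counit, ← incl_coringAct X Y, Category.assoc]

lemma mul_d₁ : (A.X ⊗ X.X) ◁ wreathMul X Y ≫ d₁ X Y =
    (α_ _ _ _).inv ≫ coringAct X Y ▷ (Y ⊗ A.X) ≫ d₁ X Y := by
  have h : (A.X ⊗ X.X) ◁ wreathMul X Y ≫ coringAct X Y =
      (α_ _ _ _).inv ≫ coringAct X Y ▷ (Y ⊗ A.X) ≫ coringAct X Y :=
    (toModule (Y := Y) (Coring.entwined X)).act_mul
  rw [← coringAct_counit, reassoc_of% h]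

variable [HasCoequalizers C] [∀ X : C, LeftCoflat X] [∀ Y : LeftModule A, IsRobust Y]
open BimodTensor

/-- The identity of `Y A`, from the `A`-bimodule `Y A` to the bimodule of the extension
`A ⟶ Y A` -/
noncomputable def bimodIso : bimod X Y ≅ Extension.bimod (incl X Y) :=
  Bimod.isoOfIso (P := bimod X Y) (Q := Extension.bimod (incl X Y)) (Iso.refl (Y ⊗ A.X))
    (by
      change (bimod X Y).actLeft ≫ 𝟙 _ =
        A.X ◁ 𝟙 (Y ⊗ A.X) ≫ (incl X Y).hom ▷ (Y ⊗ A.X) ≫ wreathMul X Y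
      rw [incl_mul]; simp)
    (by
      change (bimod X Y).actRight ≫ 𝟙 _ =
        𝟙 (Y ⊗ A.X) ▷ A.X ≫ (Y ⊗ A.X) ◁ (incl X Y).hom ≫ wreathMul X Y
      rw [mul_incl]; simp)

lemma counit_hom : letI := Coring.comonObj X
    (ε[Coring.obj X]).hom = coringCounit X := by
  change lext A (cε₀ X) ≫ (ρ_ A.X).hom = coringCounit X
  simp only [coringCounit, cε, lext]; monoidal

/-- The action of the dual `Y A` on the coring `A X` is the action `coringAct`. -/
lemma π_dualAct : letI := Coring.comonObj X
    π (Coring.obj X) (bimod X Y) ≫ (dualAct (Coring.obj X) (bimod X Y)).hom = coringAct X Y := by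
  let _ := Coring.comonObj X
  have h₁ : π (Coring.obj X) (bimod X Y) ≫ (wR (Δ[Coring.obj X]) (bimod X Y)).hom =
      ((lext A (cδ X) ≫ Coring.ins X.X X.X) ▷ (Y ⊗ A.X)) ≫
        π (Coring.obj X) (Coring.obj X) ▷ (Y ⊗ A.X) ≫
          π (tensor (Coring.obj X) (Coring.obj X)) (bimod X Y) := by
    refine (π_wR (P := Coring.obj X) (R := bimod X Y) (Δ[Coring.obj X])).trans ?_
    change (lext A (cδ X) ≫ Coring.ins X.X X.X ≫ π (Coring.obj X) (Coring.obj X)) ▷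
      (Y ⊗ A.X) ≫ _ = _
    simp only [comp_whiskerRight, Category.assoc]
    rfl
  have h₂ := ππ_assoc (P := Coring.obj X) (Q := Coring.obj X) (R := bimod X Y)
  have h₃ : ((A.X ⊗ X.X) ◁ π (Coring.obj X) (bimod X Y) ≫
      π (Coring.obj X) (tensor (Coring.obj X) (bimod X Y))) ≫ (wL (Coring.obj X) (ev X Y)).hom =
      (A.X ⊗ X.X) ◁ d₁ X Y ≫ π (Coring.obj X) (reg A) := by
    rw [Category.assoc]
    refine (congrArg ((A.X ⊗ X.X) ◁ π (Coring.obj X) (bimod X Y) ≫ ·)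
      (π_wL (P := Coring.obj X) (ev X Y))).trans ?_
    rw [← Category.assoc]
    exact congrArg (· ≫ π (Coring.obj X) (reg A))
      ((MonoidalCategory.whiskerLeft_comp _ _ _).symm.trans
      (congrArg ((A.X ⊗ X.X) ◁ ·) (π_ev X Y)))
  have h₅ : (lext A (cδ X) ≫ Coring.ins X.X X.X) ▷ (Y ⊗ A.X) ≫ (α_ _ _ _).hom ≫
      (A.X ⊗ X.X) ◁ d₁ X Y ≫ (Coring.obj X).actRight = coringAct X Y := by
    calc _ = 𝟙 _ ⊗≫ lext A (cδ X) ▷ (Y ⊗ A.X) ⊗≫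
          (A.X ⊗ X.X) ◁ (lunit A X.X ▷ (Y ⊗ A.X) ≫ d₁ X Y) ≫ (Coring.obj X).actRight := by
          rw [Coring.ins_eq]; monoidal
      _ = _ := by rw [lunit_d₁, coringAct_eq, Coring.actRight_eq]; monoidal
  exact glue_zig h₁ ((Category.assoc _ _ _).trans h₂) h₃ (π_rUnitor (Coring.obj X)) h₅

/-- The multiplication of the bimodule of the extension, on `Y A` -/
noncomputable def extMul : bimod X Y ⊗ bimod X Y ⟶ bimod X Y :=
  letI := Extension.monObj (incl X Y)
  (bimodIso X Y).hom ▷ bimod X Y ≫ Extension.bimod (incl X Y) ◁ (bimodIso X Y).hom ≫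
    μ[Extension.bimod (incl X Y)] ≫ (bimodIso X Y).inv

lemma π_extMul : π (bimod X Y) (bimod X Y) ≫ (extMul X Y).hom = wreathMul X Y := by
  have h₁ : π (bimod X Y) (bimod X Y) ≫ (wR (bimodIso X Y).hom (bimod X Y)).hom =
      𝟙 _ ≫ π (Extension.bimod (incl X Y)) (bimod X Y) := by
    refine (π_wR (R := bimod X Y) (bimodIso X Y).hom).trans ?_
    exact congrArg (· ≫ π (Extension.bimod (incl X Y)) (bimod X Y))
      (id_whiskerRight (Y ⊗ A.X) (Y ⊗ A.X))
  have h₂ : π (Extension.bimod (incl X Y)) (bimod X Y) ≫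
      (wL (Extension.bimod (incl X Y)) (bimodIso X Y).hom).hom =
      𝟙 _ ≫ π (Extension.bimod (incl X Y)) (Extension.bimod (incl X Y)) := by
    refine (π_wL (P := Extension.bimod (incl X Y)) (bimodIso X Y).hom).trans ?_
    exact congrArg (· ≫ π (Extension.bimod (incl X Y)) (Extension.bimod (incl X Y)))
      (MonoidalCategory.whiskerLeft_id (Y ⊗ A.X) (Y ⊗ A.X))
  have h₃ : π (Extension.bimod (incl X Y)) (Extension.bimod (incl X Y)) ≫
      Extension.mul₀ (incl X Y) = wreathMul X Y ≫ 𝟙 _ :=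
    (Extension.π_mul₀ (incl X Y)).trans (Category.comp_id _).symm
  have h₄ : 𝟙 (Y ⊗ A.X) ≫ 𝟙 (Y ⊗ A.X) = 𝟙 _ := Category.comp_id _
  exact glue_zig h₁ h₂ h₃ h₄ (x := wreathMul X Y) (by
    rw [Category.comp_id]
    exact (Category.id_comp _).trans (Category.id_comp _))

/-- The dual algebra structure on `Y A` is determined by its pairing with the coring `A X`, and the
multiplication of the extension is compatible with this pairing, as `A X` is an `S`-module for
`S = Y A`. -/
lemma dualMul_eq : letI := Coring.comonObj X
    extMul X Y = dualMul (Coring.obj X) (bimod X Y) := by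
  let _ := Coring.comonObj X
  refine eq_dualMul (hom_ext₃ ?_)
  have h₁ : (A.X ⊗ X.X) ◁ π (bimod X Y) (bimod X Y) ≫
      π (Coring.obj X) (tensor (bimod X Y) (bimod X Y)) ≫ (wL (Coring.obj X) (extMul X Y)).hom =
        (A.X ⊗ X.X) ◁ wreathMul X Y ≫ π (Coring.obj X) (bimod X Y) := by
    refine (congrArg ((A.X ⊗ X.X) ◁ π (bimod X Y) (bimod X Y) ≫ ·)
      (π_wL (P := Coring.obj X) (extMul X Y))).trans ?_
    rw [← Category.assoc]
    exact congrArg (· ≫ π (Coring.obj X) (bimod X Y))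
      ((MonoidalCategory.whiskerLeft_comp _ _ _).symm.trans
      (congrArg ((A.X ⊗ X.X) ◁ ·) (π_extMul X Y)))
  have h₂ : π (Coring.obj X) (bimod X Y) ▷ (Y ⊗ A.X) ≫
      π (tensor (Coring.obj X) (bimod X Y)) (bimod X Y) ≫
        (wR (dualAct (Coring.obj X) (bimod X Y)) (bimod X Y)).hom =
      coringAct X Y ▷ (Y ⊗ A.X) ≫ π (Coring.obj X) (bimod X Y) := by
    refine (congrArg (π (Coring.obj X) (bimod X Y) ▷ (Y ⊗ A.X) ≫ ·)
      (π_wR (R := bimod X Y) (dualAct (Coring.obj X) (bimod X Y)))).trans ?_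
    rw [← Category.assoc]
    exact congrArg (· ≫ π (Coring.obj X) (bimod X Y)) ((comp_whiskerRight _ _ _).symm.trans
      (congrArg (· ▷ (Y ⊗ A.X)) (π_dualAct X Y)))
  have h₃ := ππ_assoc (P := Coring.obj X) (Q := bimod X Y) (R := bimod X Y)
  have hl : (π (Coring.obj X) (bimod X Y) ▷ (Y ⊗ A.X) ≫
      π (tensor (Coring.obj X) (bimod X Y)) (bimod X Y)) ≫
        (assoc (Coring.obj X) (bimod X Y) (bimod X Y)).hom.hom ≫
          (wL (Coring.obj X) (extMul X Y)).hom ≫ (ev X Y).hom =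
      coringAct X Y ▷ (Y ⊗ A.X) ≫ d₁ X Y := by
    refine (Category.assoc _ _ _).symm.trans ((congrArg (· ≫ _)
      ((Category.assoc _ _ _).trans h₃)).trans ?_)
    rw [Category.assoc]
    refine (congrArg ((α_ _ _ _).hom ≫ ·) ((Category.assoc _ _ _).symm.trans
      (congrArg (· ≫ (ev X Y).hom) ((Category.assoc _ _ _).trans h₁)))).trans ?_
    rw [Category.assoc, π_ev, mul_d₁, Iso.hom_inv_id_assoc]
  have hr : (π (Coring.obj X) (bimod X Y) ▷ (Y ⊗ A.X) ≫
      π (tensor (Coring.obj X) (bimod X Y)) (bimod X Y)) ≫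
        (wR (dualAct (Coring.obj X) (bimod X Y)) (bimod X Y)).hom ≫ (ev X Y).hom =
      coringAct X Y ▷ (Y ⊗ A.X) ≫ d₁ X Y := by
    refine (Category.assoc _ _ _).symm.trans ((congrArg (· ≫ (ev X Y).hom)
      ((Category.assoc _ _ _).trans h₂)).trans ?_)
    rw [Category.assoc, π_ev]
  exact (Category.assoc _ _ _).symm.trans ((hl.trans hr.symm).trans (Category.assoc _ _ _))

lemma dualOne_eq : letI := Coring.comonObj X
    Extension.one (incl X Y) ≫ (bimodIso X Y).inv = dualOne (Coring.obj X) (bimod X Y) := by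
  let _ := Coring.comonObj X
  refine eq_dualOne (hom_ext' (Q := reg A) ?_)
  have h₁ : π (Coring.obj X) (reg A) ≫
      (wL (Coring.obj X) (Extension.one (incl X Y) ≫ (bimodIso X Y).inv)).hom =
        (A.X ⊗ X.X) ◁ (incl X Y).hom ≫ π (Coring.obj X) (bimod X Y) := by
    refine (π_wL (P := Coring.obj X) (Q := reg A) _).trans ?_
    exact congrArg (fun z => (A.X ⊗ X.X) ◁ z ≫ π (Coring.obj X) (bimod X Y))
      (Category.comp_id (incl X Y).hom)
  have hl : π (Coring.obj X) (reg A) ≫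
      (wL (Coring.obj X) (Extension.one (incl X Y) ≫ (bimodIso X Y).inv)).hom ≫ (ev X Y).hom =
        (Coring.obj X).actRight ≫ coringCounit X := by
    refine (Category.assoc _ _ _).symm.trans ((congrArg (· ≫ (ev X Y).hom) h₁).trans ?_)
    rw [Category.assoc, π_ev, incl_d₁]
  have hr : π (Coring.obj X) (reg A) ≫ (rUnitor (Coring.obj X)).hom.hom ≫ (ε[Coring.obj X]).hom =
        (Coring.obj X).actRight ≫ coringCounit X := by
    refine (Category.assoc _ _ _).symm.trans
      ((congrArg (· ≫ (ε[Coring.obj X]).hom) (π_rUnitor (Coring.obj X))).trans ?_)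
    exact congrArg ((Coring.obj X).actRight ≫ ·) (counit_hom X)
  exact hl.trans hr.symm

/-- The two algebra structures on the `A`-bimodule `Y A`, as the dual of the coring `A X` and as an
extension of `A`, agree. -/
lemma isFrobeniusAlgebra_bimod_iff :
    (letI := Duality.monObj X Y; IsFrobeniusAlgebra (bimod X Y)) ↔
      IsFrobeniusExtension (incl X Y) := by
  let _ := Coring.comonObj X
  let _ := Duality.monObj X Y
  let _ := Extension.monObj (incl X Y)
  refine isFrobeniusAlgebra_iff_of_iso (bimodIso X Y) ?_ ?_
  · have h : μ[bimod X Y] = extMul X Y := (dualMul_eq X Y).symm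
    rw [h]
    simp only [extMul, Category.assoc, Iso.inv_hom_id, Category.comp_id]
  · have h : η[bimod X Y] = Extension.one (incl X Y) ≫ (bimodIso X Y).inv := (dualOne_eq X Y).symm
    rw [h, Category.assoc, Iso.inv_hom_id, Category.comp_id]
    rfl

end Duality
end Cowreath

/-! ### The cofree entwined modules -/

namespace Cowreath

variable {C : Type u} [Category.{v} C] [MonoidalCategory C] {A : Mon C}

lemma RightModule.hom_ext {M N : RightModule A} {f g : M ⟶ N} (h : f.hom = g.hom) : f = g :=
  RightModule.Hom.ext h

lemma EntwinedModule.hom_ext {X : RightTransfer A} [ComonObj X] {M N : EntwinedModule X}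
    {f g : M ⟶ N}
    (h : f.hom = g.hom) : f = g :=
  EntwinedModule.Hom.ext h

namespace RightModule
variable (M : RightModule A) {Z W V : C}

/-- `M Z ⟶ M W`, `m ⊗ z ↦ m f(z)`, for a right `A`-module `M` and `f : Z ⟶ A W`. This makes `M ⊗ -`
a functor on the Kleisli category of `A ⊗ -`, in which morphisms of right transfer morphisms are
composed. -/
def mext (f : Z ⟶ A.X ⊗ W) : M.X ⊗ Z ⟶ M.X ⊗ W := M.X ◁ f ≫ (α_ _ _ _).inv ≫ M.act ▷ W

lemma mext_precomp (f : Z ⟶ W) (g : W ⟶ A.X ⊗ V) : M.mext (f ≫ g) = M.X ◁ f ≫ M.mext g := by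
  simp [mext]

lemma mext_postcomp (f : Z ⟶ A.X ⊗ W) (g : W ⟶ V) :
    M.mext (f ≫ A.X ◁ g) = M.mext f ≫ M.X ◁ g := by
  calc _ = M.X ◁ f ⊗≫ ((M.X ⊗ A.X) ◁ g ≫ M.act ▷ V) := by simp only [mext]; monoidal
    _ = _ := by rw [whisker_exchange]; simp only [mext]; monoidal

lemma mext_lunit : M.mext (lunit A Z) = 𝟙 _ := by
  calc _ = 𝟙 _ ⊗≫ (M.X ◁ η[A.X] ≫ M.act) ▷ Z := by simp only [mext, lunit]; monoidal
    _ = _ := by rw [M.act_one]; monoidal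

lemma mext_comp (f : Z ⟶ A.X ⊗ W) (g : W ⟶ A.X ⊗ V) :
    M.mext (f ≫ lext A g) = M.mext f ≫ M.mext g := by
  calc _ = M.X ◁ f ⊗≫ M.X ◁ A.X ◁ g ⊗≫ (M.X ◁ μ[A.X] ≫ M.act) ▷ V := by
        simp only [mext, lext]; monoidal
    _ = M.X ◁ f ⊗≫ ((M.X ⊗ A.X) ◁ g ≫ M.act ▷ (A.X ⊗ V)) ⊗≫ M.act ▷ V := by
        rw [M.act_mul]; monoidal
    _ = _ := by rw [whisker_exchange]; simp only [mext]; monoidal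

lemma mext_rten (f : Z ⟶ A.X ⊗ W) (V : C) :
    M.mext (rten f V) = (α_ _ _ _).inv ≫ M.mext f ▷ V ≫ (α_ _ _ _).hom := by
  simp only [mext, rten]; monoidal

variable {M} in
lemma hom_mext {N : RightModule A} (h : M ⟶ N) (f : Z ⟶ A.X ⊗ W) :
    M.mext f ≫ h.hom ▷ W = h.hom ▷ Z ≫ N.mext f := by
  calc _ = 𝟙 _ ⊗≫ M.X ◁ f ⊗≫ (M.act ≫ h.hom) ▷ W := by simp only [mext]; monoidal
    _ = 𝟙 _ ⊗≫ (M.X ◁ f ≫ h.hom ▷ (A.X ⊗ W)) ⊗≫ N.act ▷ W := by rw [h.act_hom]; monoidal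
    _ = _ := by rw [whisker_exchange]; simp only [mext]; monoidal

end RightModule

section
variable (X : RightTransfer A) [ComonObj X]

/-- `(n f(z))₀ ⊗ (n f(z))₁ = n₀ ψ(n₁ ⊗ f(z))` -/
lemma EntwinedModule.mext_coact {X : RightTransfer A} [ComonObj X] (N : EntwinedModule X) {Z W : C}
    (f : Z ⟶ A.X ⊗ W) : N.mext f ≫ N.coact ▷ W =
      N.coact ▷ Z ≫ (α_ _ _ _).hom ≫ N.mext (X.lten f) ≫ (α_ _ _ _).inv := by
  calc _ = 𝟙 _ ⊗≫ N.X ◁ f ⊗≫ (N.act ≫ N.coact) ▷ W := by simp only [RightModule.mext]; monoidal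
    _ = 𝟙 _ ⊗≫ (N.X ◁ f ≫ N.coact ▷ (A.X ⊗ W)) ⊗≫ N.X ◁ X.ψ ▷ W ⊗≫ N.act ▷ (X.X ⊗ W) ⊗≫ 𝟙 _ := by
        rw [N.act_coact]; monoidal
    _ = _ := by
        rw [whisker_exchange]; simp only [RightModule.mext, RightTransfer.lten]; monoidal

lemma EntwinedModule.coact_coact {X : RightTransfer A} [ComonObj X] (N : EntwinedModule X) :
    N.coact ≫ N.coact ▷ X.X = N.coact ≫ N.mext (cδ X) ≫ (α_ _ _ _).inv := by
  have h := N.coassoc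
  rw [← cancel_mono (α_ _ _ _).hom]
  simp only [RightModule.mext, Category.assoc, Iso.inv_hom_id, Category.comp_id]
  exact h

/-- The cofree entwined module `M X` on a right `A`-module `M`. For `M = A` it is, by definition,
the entwined module `A X`. -/
def cofree (M : RightModule A) : EntwinedModule X where
  X := M.X ⊗ X.X
  act := (α_ M.X X.X A.X).hom ≫ M.X ◁ X.ψ ≫ (α_ M.X A.X X.X).inv ≫ M.act ▷ X.X
  act_one := by
    have h : (ρ_ X.X).inv ≫ X.X ◁ η[A.X] ≫ X.ψ = lunit A X.X := X.one_ψ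
    calc _ = (α_ M.X X.X (𝟙_ C)).hom ≫ M.X ◁ (X.X ◁ η[A.X]) ≫ M.mext X.ψ := by
          simp only [RightModule.mext]; monoidal
      _ = (α_ M.X X.X (𝟙_ C)).hom ≫ M.X ◁ (ρ_ X.X).hom ≫
          M.mext ((ρ_ X.X).inv ≫ X.X ◁ η[A.X] ≫ X.ψ) := by
          rw [RightModule.mext_precomp, RightModule.mext_precomp]; monoidal
      _ = (α_ M.X X.X (𝟙_ C)).hom ≫ M.X ◁ (ρ_ X.X).hom ≫ M.mext (lunit A X.X) := by rw [h]
      _ = _ := by rw [RightModule.mext_lunit]; monoidal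
  act_mul := by
    have h : X.X ◁ μ[A.X] ≫ X.ψ = (α_ X.X A.X A.X).inv ≫ rten X.ψ A.X ≫ lext A X.ψ := by
      simp [X.mul_ψ, rten, lext]
    calc _ = (α_ _ _ _).hom ≫ M.mext (X.X ◁ μ[A.X] ≫ X.ψ) := by
          simp only [RightModule.mext]; monoidal
      _ = (α_ _ _ _).hom ≫ M.X ◁ (α_ X.X A.X A.X).inv ≫ M.mext (rten X.ψ A.X) ≫ M.mext X.ψ := by
          rw [h, RightModule.mext_precomp, RightModule.mext_comp]
      _ = _ := by rw [RightModule.mext_rten]; simp only [RightModule.mext]; monoidal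
  coact := M.X ◁ cδ X ≫ (α_ M.X A.X (X.X ⊗ X.X)).inv ≫ M.act ▷ (X.X ⊗ X.X) ≫
    (α_ M.X X.X X.X).inv
  act_coact := by
    calc _ = (α_ _ _ _).hom ≫ (M.mext X.ψ ≫ M.mext (cδ X)) ≫ (α_ _ _ _).inv := by
          simp only [RightModule.mext, Category.assoc]
      _ = (α_ _ _ _).hom ≫ (M.mext (rten (cδ X) A.X) ≫ M.mext (ψ₂ X)) ≫ (α_ _ _ _).inv := by
          rw [← RightModule.mext_comp, ψ_cδ, RightModule.mext_comp]
      _ = M.mext (cδ X) ▷ A.X ≫ (α_ _ _ _).hom ≫ M.mext (ψ₂ X) ≫ (α_ _ _ _).inv := by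
          rw [RightModule.mext_rten]; simp
      _ = _ := by simp only [RightModule.mext, ψ₂]; monoidal
  coassoc := by
    calc _ = (M.mext (cδ X) ≫ M.mext (rten (cδ X) X.X)) ≫ M.X ◁ (α_ X.X X.X X.X).hom ≫
          (α_ _ _ _).inv := by
          rw [RightModule.mext_rten]; simp only [RightModule.mext]; monoidal
      _ = M.mext (cδ X ≫ lext A (rten (cδ X) X.X) ≫ A.X ◁ (α_ X.X X.X X.X).hom) ≫
          (α_ _ _ _).inv := by
          rw [← RightModule.mext_comp, ← Category.assoc, ← RightModule.mext_postcomp,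
            Category.assoc]
      _ = M.mext (cδ X) ≫ M.mext (X.lten (cδ X)) ≫ (α_ _ _ _).inv := by
          rw [← cδ_assoc, RightModule.mext_comp, Category.assoc]
      _ = _ := by simp only [RightModule.mext, RightTransfer.lten]; monoidal
  counit := by
    calc _ = (M.mext (cδ X) ≫ M.mext (X.lten (cε X ≫ (ρ_ A.X).inv))) ≫ M.X ◁ (ρ_ X.X).hom := by
          simp only [RightModule.mext, RightTransfer.lten]; monoidal
      _ = _ := by
          rw [← RightModule.mext_comp, cδ_cε_right, RightModule.mext_precomp,
            RightModule.mext_lunit]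
          monoidal

lemma cofree_act (M : RightModule A) : (cofree X M).act = (α_ _ _ _).hom ≫ M.mext X.ψ := rfl

lemma cofree_coact (M : RightModule A) : (cofree X M).coact = M.mext (cδ X) ≫ (α_ _ _ _).inv := by
  simp only [RightModule.mext, Category.assoc]; rfl

/-- The functor sending a right `A`-module to the cofree entwined module `M X` -/
def cofreeFunctor : RightModule A ⥤ EntwinedModule X where
  obj M := cofree X M
  map {M N} f :=
    { hom := f.hom ▷ X.X
      act_hom := by
        change ((α_ _ _ _).hom ≫ M.mext X.ψ) ≫ f.hom ▷ X.X =
          f.hom ▷ X.X ▷ A.X ≫ (α_ _ _ _).hom ≫ N.mext X.ψ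
        rw [Category.assoc, RightModule.hom_mext]; simp
      coact_hom := by
        rw [cofree_coact, cofree_coact]
        change f.hom ▷ X.X ≫ N.mext (cδ X) ≫ (α_ _ _ _).inv =
          (M.mext (cδ X) ≫ (α_ _ _ _).inv) ≫ f.hom ▷ X.X ▷ X.X
        rw [← reassoc_of% (RightModule.hom_mext f (cδ X)), Category.assoc]; simp }
  map_id M := EntwinedModule.hom_ext (id_whiskerRight M.X X.X)
  map_comp f g := EntwinedModule.hom_ext (comp_whiskerRight f.hom g.hom X.X)

/-- The cofree functor is right adjoint to the forgetful functor. -/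
def forgetAdjCofree : EntwinedModule.forget X ⊣ cofreeFunctor X where
  unit :=
    { app N :=
        { hom := N.coact
          act_hom := N.act_coact
          coact_hom := by
            change N.coact ≫ (cofree X N.toRightModule).coact = _
            rw [cofree_coact]; exact N.coact_coact.symm }
      naturality M N f := EntwinedModule.hom_ext f.coact_hom }
  counit :=
    { app M :=
        { hom := M.X ◁ cε X ≫ M.act
          act_hom := by
            change ((α_ _ _ _).hom ≫ M.mext X.ψ) ≫ M.X ◁ cε X ≫ M.act =
              (M.X ◁ cε X ≫ M.act) ▷ A.X ≫ M.act
            calc _ = (α_ _ _ _).hom ≫ M.X ◁ X.ψ ⊗≫ (M.act ▷ X.X ≫ M.X ◁ cε X) ≫ M.act := by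
                  simp only [RightModule.mext]; monoidal
              _ = (α_ _ _ _).hom ≫ M.X ◁ X.ψ ≫ M.X ◁ A.X ◁ cε X ≫
                  ((α_ _ _ _).inv ≫ M.act ▷ A.X ≫ M.act) := by
                  rw [← whisker_exchange]; monoidal
              _ = (α_ _ _ _).hom ≫ M.X ◁ (X.ψ ≫ A.X ◁ cε X ≫ μ[A.X]) ≫ M.act := by
                  rw [← M.act_mul]; simp only [MonoidalCategory.whiskerLeft_comp, Category.assoc]
              _ = (α_ _ _ _).hom ≫ M.X ◁ (cε X ▷ A.X) ≫ (M.X ◁ μ[A.X] ≫ M.act) := by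
                  rw [ψ_cε]; simp only [MonoidalCategory.whiskerLeft_comp, Category.assoc]
              _ = _ := by rw [M.act_mul]; monoidal }
      naturality M N f := RightModule.hom_ext (by
        change f.hom ▷ X.X ≫ N.X ◁ cε X ≫ N.act = (M.X ◁ cε X ≫ M.act) ≫ f.hom
        rw [Category.assoc, f.act_hom, ← whisker_exchange_assoc]) }
  left_triangle_components N := RightModule.hom_ext N.counit
  right_triangle_components M := EntwinedModule.hom_ext (by
    change (cofree X M).coact ≫ (M.X ◁ cε X ≫ M.act) ▷ X.X = 𝟙 _
    rw [cofree_coact]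
    calc _ = (M.mext (cδ X) ≫ M.mext (rten (cε X ≫ (ρ_ A.X).inv) X.X)) ≫ M.X ◁ (λ_ X.X).hom := by
          simp only [RightModule.mext, rten]; monoidal
      _ = M.mext ((λ_ X.X).inv ≫ lunit A (𝟙_ C ⊗ X.X)) ≫ M.X ◁ (λ_ X.X).hom := by
          rw [← RightModule.mext_comp, cδ_cε_left]
      _ = 𝟙 (M.X ⊗ X.X) := by
          rw [RightModule.mext_precomp, RightModule.mext_lunit]; monoidal)

end
end Cowreath

/-! ### The forgetful functor of a Frobenius coalgebra -/

namespace Cowreath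

variable {C : Type u} [Category.{v} C] [MonoidalCategory C] {A : Mon C}

lemma RightModule.mext_pure (M : RightModule A) {Z W : C} (f : Z ⟶ W) :
    M.mext (f ≫ lunit A W) = M.X ◁ f := by
  rw [mext_precomp, mext_lunit, Category.comp_id]

lemma RightModule.mext_lext (M : RightModule A) {Z W : C} (f : Z ⟶ A.X ⊗ W) :
    M.mext (lext A f) = (α_ _ _ _).inv ≫ M.act ▷ Z ≫ M.mext f := by
  calc _ = 𝟙 _ ⊗≫ M.X ◁ A.X ◁ f ⊗≫ (M.X ◁ μ[A.X] ≫ M.act) ▷ W := by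
        simp only [mext, lext]; monoidal
    _ = 𝟙 _ ⊗≫ ((M.X ⊗ A.X) ◁ f ≫ M.act ▷ (A.X ⊗ W)) ⊗≫ M.act ▷ W := by
        rw [M.act_mul]; monoidal
    _ = _ := by rw [whisker_exchange]; simp only [mext]; monoidal

section
variable {X : RightTransfer A}

/-- The form `X X ⟶ A 1` underlying a morphism `X X ⟶ 1` of right transfer morphisms -/
def formHom (B : X ⊗ X ⟶ 𝟙_ (RightTransfer A)) : X.X ⊗ X.X ⟶ A.X ⊗ 𝟙_ C := B.hom

lemma formHom_comm (B : X ⊗ X ⟶ 𝟙_ (RightTransfer A)) :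
    ψ₂ X ≫ lext A (formHom B) = rten (formHom B) A.X ≫ lext A ((λ_ A.X).hom ≫ (ρ_ A.X).inv) :=
  B.comm'

lemma element_comm (t : 𝟙_ (RightTransfer A) ⟶ X) :
    ((λ_ A.X).hom ≫ (ρ_ A.X).inv) ≫ lext A (Duality.element t) =
      rten (Duality.element t) A.X ≫ lext A X.ψ :=
  t.comm'

variable [ComonObj X]

lemma cofree_mext (M : RightModule A) {Z W : C} (f : Z ⟶ A.X ⊗ W) :
    (cofree X M).mext f = (α_ M.X X.X Z).hom ≫ M.mext (X.lten f) ≫ (α_ M.X X.X W).inv := by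
  change (M.X ⊗ X.X) ◁ f ≫ (α_ (M.X ⊗ X.X) A.X W).inv ≫ (cofree X M).act ▷ W = _
  rw [cofree_act]
  simp only [RightModule.mext, RightTransfer.lten]; monoidal

lemma counit_right_hom {t : 𝟙_ (RightTransfer A) ⟶ X} {B : X ⊗ X ⟶ 𝟙_ (RightTransfer A)}
    (h : (ρ_ X).inv ≫ X ◁ t ≫ B = ε[X]) : (ρ_ X.X).inv ≫ X.lten (Duality.element t) ≫
      lext A (formHom B) = cε X ≫ (ρ_ A.X).inv := by
  have e : ((ρ_ X.X).inv ≫ lunit A _) ≫ lext A (X.lten (Duality.element t) ≫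
      lext A (formHom B)) = cε X ≫ (ρ_ A.X).inv :=
    (congrArg RightTransfer.Hom.hom h).trans (cε' X).symm
  rw [← e, Category.assoc, lunit_lext]

/-- The Casimir condition, evaluated at a right `A`-module -/
lemma mext_casimir {B : X ⊗ X ⟶ 𝟙_ (RightTransfer A)} (h : IsCasimir B) (M : RightModule A) :
    M.mext (rten (cδ X) X.X) ≫ M.X ◁ (α_ _ _ _).hom ≫ M.mext (X.lten (formHom B)) ≫
        M.X ◁ (ρ_ X.X).hom =
      M.mext (X.lten (cδ X)) ≫ M.X ◁ (α_ _ _ _).inv ≫ M.mext (rten (formHom B) X.X) ≫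
        M.X ◁ (λ_ X.X).hom := by
  have e : rten (cδ X) X.X ≫ lext A (((α_ X.X X.X X.X).hom ≫ lunit A _) ≫
          lext A (X.lten (formHom B) ≫ lext A ((ρ_ X.X).hom ≫ lunit A _))) =
        X.lten (cδ X) ≫ lext A (((α_ X.X X.X X.X).inv ≫ lunit A _) ≫
          lext A (rten (formHom B) X.X ≫ lext A ((λ_ X.X).hom ≫ lunit A _))) :=
    congrArg RightTransfer.Hom.hom h
  have e' := congrArg M.mext e
  simpa only [RightModule.mext_comp, RightModule.mext_pure] using e'

/-- In a Frobenius coalgebra, `t₁ B(t₂, x) = x`. -/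
lemma casimir_element {D : Type*} [Category* D] [MonoidalCategory D] {X : D} [ComonObj X]
    {t : 𝟙_ D ⟶ X} {B : X ⊗ X ⟶ 𝟙_ D}
    (h : Δ[X] ▷ X ≫ (α_ X X X).hom ≫ X ◁ B ≫ (ρ_ X).hom =
      X ◁ Δ[X] ≫ (α_ X X X).inv ≫ B ▷ X ≫ (λ_ X).hom) (ht : (λ_ X).inv ≫ t ▷ X ≫ B = ε[X]) :
    (λ_ X).inv ≫ t ▷ X ≫ Δ[X] ▷ X ≫ (α_ X X X).hom ≫ X ◁ B ≫ (ρ_ X).hom = 𝟙 X := by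
  calc _ = (λ_ X).inv ≫ (t ▷ X ≫ X ◁ Δ[X]) ≫ (α_ X X X).inv ≫ B ▷ X ≫ (λ_ X).hom := by
        rw [h, Category.assoc]
    _ = Δ[X] ≫ ((λ_ X).inv ≫ t ▷ X ≫ B) ▷ X ≫ (λ_ X).hom := by
        rw [← whisker_exchange]; monoidal
    _ = _ := by rw [ht, ComonObj.counit_comul_assoc]; simp

/-- The identity `t₁ B(t₂, x) = x`, evaluated at a right `A`-module -/
lemma mext_casimir_element {t : 𝟙_ (RightTransfer A) ⟶ X} {B : X ⊗ X ⟶ 𝟙_ (RightTransfer A)}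
    (h : IsCasimir B) (ht : (λ_ X).inv ≫ t ▷ X ≫ B = ε[X]) (M : RightModule A) :
    M.X ◁ (λ_ X.X).inv ≫ M.mext (rten (Duality.element t) X.X) ≫ M.mext (rten (cδ X) X.X) ≫
      M.X ◁ (α_ _ _ _).hom ≫ M.mext (X.lten (formHom B)) ≫ M.X ◁ (ρ_ X.X).hom = 𝟙 _ := by
  have e : ((λ_ X.X).inv ≫ lunit A _) ≫ lext A (rten (Duality.element t) X.X ≫
        lext A (rten (cδ X) X.X ≫ lext A (((α_ X.X X.X X.X).hom ≫ lunit A _) ≫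
          lext A (X.lten (formHom B) ≫ lext A ((ρ_ X.X).hom ≫ lunit A _))))) = lunit A X.X :=
    congrArg RightTransfer.Hom.hom (casimir_element h ht)
  have e' := congrArg M.mext e
  simpa only [RightModule.mext_comp, RightModule.mext_pure, RightModule.mext_lunit] using e'

/-- The morphism `M ⟶ M X`, `m ↦ m t` -/
def unitMap (t : 𝟙_ (RightTransfer A) ⟶ X) (M : RightModule A) :
    M ⟶ (cofree X M).toRightModule where
  hom := (ρ_ M.X).inv ≫ M.mext (Duality.element t)
  act_hom := by
    change M.act ≫ (ρ_ M.X).inv ≫ M.mext (Duality.element t) =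
      ((ρ_ M.X).inv ≫ M.mext (Duality.element t)) ▷ A.X ≫ (cofree X M).act
    rw [cofree_act]
    calc _ = 𝟙 _ ⊗≫ M.X ◁ ((λ_ A.X).hom ≫ (ρ_ A.X).inv) ≫ ((α_ _ _ _).inv ≫ M.act ▷ (𝟙_ C) ≫
          M.mext (Duality.element t)) := by monoidal
      _ = 𝟙 _ ⊗≫ M.mext (((λ_ A.X).hom ≫ (ρ_ A.X).inv) ≫ lext A (Duality.element t)) := by
          rw [← RightModule.mext_lext, ← RightModule.mext_precomp]
      _ = 𝟙 _ ⊗≫ (M.mext (rten (Duality.element t) A.X) ≫ M.mext X.ψ) := by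
          rw [element_comm, RightModule.mext_comp]
      _ = _ := by rw [RightModule.mext_rten]; monoidal

/-- The morphism `N X ⟶ N`, `n ⊗ x ↦ n₀ B(n₁, x)` -/
def counitMap {B : X ⊗ X ⟶ 𝟙_ (RightTransfer A)} (h : IsCasimir B) (N : EntwinedModule X) :
    cofree X N.toRightModule ⟶ N where
  hom := N.coact ▷ X.X ≫ (α_ _ _ _).hom ≫ N.mext (formHom B) ≫ (ρ_ N.X).hom
  act_hom := by
    change ((α_ N.X X.X A.X).hom ≫ N.mext X.ψ) ≫ N.coact ▷ X.X ≫ (α_ _ _ _).hom ≫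
      N.mext (formHom B) ≫ (ρ_ N.X).hom = (N.coact ▷ X.X ≫ (α_ _ _ _).hom ≫
      N.mext (formHom B) ≫ (ρ_ N.X).hom) ▷ A.X ≫ N.act
    have hψ : (α_ X.X X.X A.X).hom ≫ X.lten X.ψ = ψ₂ X := rfl
    calc _ = (α_ _ _ _).hom ≫ (N.mext X.ψ ≫ N.coact ▷ X.X) ≫ (α_ _ _ _).hom ≫
          N.mext (formHom B) ≫ (ρ_ N.X).hom := by simp only [Category.assoc]
      _ = (N.coact ▷ X.X) ▷ A.X ⊗≫ N.X ◁ (α_ X.X X.X A.X).hom ≫ N.mext (X.lten X.ψ) ≫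
          N.mext (formHom B) ≫ (ρ_ N.X).hom := by
          rw [EntwinedModule.mext_coact]; monoidal
      _ = (N.coact ▷ X.X) ▷ A.X ⊗≫ N.mext (ψ₂ X ≫ lext A (formHom B)) ≫ (ρ_ N.X).hom := by
          rw [← hψ, RightModule.mext_comp, RightModule.mext_precomp, Category.assoc, Category.assoc]
      _ = (N.coact ▷ X.X) ▷ A.X ⊗≫ N.mext (rten (formHom B) A.X) ≫
          N.mext ((λ_ A.X).hom ≫ (ρ_ A.X).inv) ≫ (ρ_ N.X).hom := by
          rw [formHom_comm, RightModule.mext_comp, Category.assoc]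
      _ = _ := by
          rw [RightModule.mext_rten]; simp only [RightModule.mext]; monoidal
  coact_hom := by
    change (N.coact ▷ X.X ≫ (α_ _ _ _).hom ≫ N.mext (formHom B) ≫ (ρ_ N.X).hom) ≫ N.coact =
      (cofree X N.toRightModule).coact ≫ (N.coact ▷ X.X ≫ (α_ _ _ _).hom ≫
      N.mext (formHom B) ≫ (ρ_ N.X).hom) ▷ X.X
    rw [cofree_coact]
    calc _ = N.coact ▷ X.X ⊗≫ (N.mext (formHom B) ≫ N.coact ▷ 𝟙_ C) ⊗≫ 𝟙 _ := by monoidal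
      _ = (N.coact ≫ N.coact ▷ X.X) ▷ X.X ⊗≫ N.mext (X.lten (formHom B)) ⊗≫ 𝟙 _ := by
          rw [EntwinedModule.mext_coact]; monoidal
      _ = N.coact ▷ X.X ⊗≫ N.mext (rten (cδ X) X.X) ≫ N.X ◁ (α_ _ _ _).hom ≫
          N.mext (X.lten (formHom B)) ≫ N.X ◁ (ρ_ X.X).hom := by
          rw [EntwinedModule.coact_coact, RightModule.mext_rten]; monoidal
      _ = N.coact ▷ X.X ⊗≫ N.mext (X.lten (cδ X)) ⊗≫ N.mext (rten (formHom B) X.X) ≫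
          N.X ◁ (λ_ X.X).hom := by
          rw [mext_casimir h]; monoidal
      _ = (N.coact ▷ X.X ≫ (α_ _ _ _).hom ≫ N.mext (X.lten (cδ X)) ≫ (α_ _ _ _).inv) ⊗≫
          N.mext (formHom B) ▷ X.X ⊗≫ 𝟙 _ := by
          rw [RightModule.mext_rten]; monoidal
      _ = _ := by rw [← EntwinedModule.mext_coact]; monoidal

/-- For a Frobenius coalgebra `X`, the cofree functor is also left adjoint to the forgetful functor:
the unit is `m ↦ m t` and the counit is `n ⊗ x ↦ n₀ B(n₁, x)`. -/
def cofreeAdjForget {t : 𝟙_ (RightTransfer A) ⟶ X} {B : X ⊗ X ⟶ 𝟙_ (RightTransfer A)}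
    (h : IsCasimir B) (hl : (λ_ X).inv ≫ t ▷ X ≫ B = ε[X]) (hr : (ρ_ X).inv ≫ X ◁ t ≫ B = ε[X]) :
    cofreeFunctor X ⊣ EntwinedModule.forget X where
  unit :=
    { app M := unitMap t M
      naturality M N f := RightModule.hom_ext (by
        change f.hom ≫ (ρ_ N.X).inv ≫ N.mext (Duality.element t) =
          ((ρ_ M.X).inv ≫ M.mext (Duality.element t)) ≫ f.hom ▷ X.X
        rw [Category.assoc, RightModule.hom_mext]; monoidal) }
  counit :=
    { app N := counitMap h N
      naturality M N f := EntwinedModule.hom_ext (by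
        change f.hom ▷ X.X ≫ N.coact ▷ X.X ≫ (α_ _ _ _).hom ≫ N.mext (formHom B) ≫ (ρ_ N.X).hom =
          (M.coact ▷ X.X ≫ (α_ _ _ _).hom ≫ M.mext (formHom B) ≫ (ρ_ M.X).hom) ≫ f.hom
        have hf : f.hom ≫ N.coact = M.coact ≫ f.hom ▷ X.X := f.coact_hom
        have hb := RightModule.hom_mext f.toHom (formHom B)
        calc _ = (f.hom ≫ N.coact) ▷ X.X ⊗≫ N.mext (formHom B) ≫ (ρ_ N.X).hom := by monoidal
          _ = M.coact ▷ X.X ⊗≫ (f.hom ▷ (X.X ⊗ X.X) ≫ N.mext (formHom B)) ≫ (ρ_ N.X).hom := by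
              rw [hf]; monoidal
          _ = _ := by rw [← hb]; monoidal) }
  left_triangle_components M := EntwinedModule.hom_ext (by
    change ((ρ_ M.X).inv ≫ M.mext (Duality.element t)) ▷ X.X ≫ (cofree X M).coact ▷ X.X ≫
      (α_ _ _ _).hom ≫ (cofree X M).mext (formHom B) ≫ (ρ_ (M.X ⊗ X.X)).hom = 𝟙 (M.X ⊗ X.X)
    rw [cofree_coact, cofree_mext, ← mext_casimir_element h hl M, RightModule.mext_rten,
      RightModule.mext_rten]
    monoidal)
  right_triangle_components N := RightModule.hom_ext (by
    change ((ρ_ N.X).inv ≫ N.mext (Duality.element t)) ≫ N.coact ▷ X.X ≫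
      (α_ _ _ _).hom ≫ N.mext (formHom B) ≫ (ρ_ N.X).hom = 𝟙 N.X
    calc _ = (ρ_ N.X).inv ≫ (N.mext (Duality.element t) ≫ N.coact ▷ X.X) ≫
          (α_ _ _ _).hom ≫ N.mext (formHom B) ≫ (ρ_ N.X).hom := by simp only [Category.assoc]
      _ = N.coact ≫ N.X ◁ (ρ_ X.X).inv ≫ N.mext (X.lten (Duality.element t)) ≫
          N.mext (formHom B) ≫ (ρ_ N.X).hom := by
          rw [EntwinedModule.mext_coact]; monoidal
      _ = N.coact ≫ N.mext ((ρ_ X.X).inv ≫ X.lten (Duality.element t) ≫ lext A (formHom B)) ≫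
          (ρ_ N.X).hom := by
          rw [RightModule.mext_precomp, RightModule.mext_comp]; simp only [Category.assoc]
      _ = N.coact ≫ N.X ◁ cε X ≫ N.act := by
          rw [counit_right_hom hr]; simp only [RightModule.mext]; monoidal
      _ = _ := N.counit)

lemma isFrobeniusFunctor_of_isFrobeniusCoalgebra (h : IsFrobeniusCoalgebra X) :
    IsFrobeniusFunctor (EntwinedModule.forget X) := by
  obtain ⟨t, B, hB, hl, hr⟩ := h
  exact ⟨cofreeFunctor X, ⟨forgetAdjCofree X⟩, ⟨cofreeAdjForget hB hl hr⟩⟩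

end
end Cowreath

/-! ### Frobenius coalgebras from Frobenius functors -/

namespace Cowreath

variable {C : Type u} [Category.{v} C] [MonoidalCategory C] {A : Mon C}

/-- The right linear map `S ⟶ N`, `s ↦ t s`, as a morphism of modules -/
def RightModule.ofElementHom {S : Mon C} (N : RightModule S) (t : 𝟙_ C ⟶ N.X) :
    RightModule.regular S ⟶ N where
  hom := N.ofElement t
  act_hom := N.mul_ofElement t

/-- A central element `t` that is sent to `1` by a right linear map, and such that only the identity
among the right linear endomorphisms of `P` fixes `t`, is part of a Frobenius pair. -/
lemma ExtensionDual.isFrobeniusPair_of_universal {S : Mon C} {i : A ⟶ S} (D : ExtensionDual i)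
    {t : 𝟙_ C ⟶ D.P.X} {Ψ : D.P.X ⟶ S.X} (ht : D.IsCentral t)
    (hΨ : D.P.act ≫ Ψ = Ψ ▷ S.X ≫ μ[S.X]) (htΨ : t ≫ Ψ = η[S.X])
    (huniv : ∀ k : D.P.X ⟶ D.P.X, D.P.act ≫ k = k ▷ S.X ≫ D.P.act → t ≫ k = t → k = 𝟙 _) :
    D.IsFrobeniusPair t Ψ :=
  isFrobeniusPair_of_inverse ht
    (by
      rw [RightModule.ofElement, Category.assoc, Category.assoc, hΨ,
        ← comp_whiskerRight_assoc, htΨ, MonObj.one_mul]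
      simp)
    (huniv _ (by rw [reassoc_of% hΨ, RightModule.mul_ofElement, comp_whiskerRight, Category.assoc])
      (by rw [reassoc_of% htΨ, RightModule.one_ofElement]))

namespace Duality
variable (X : RightTransfer A) (Y : C) [ExactPairing Y X.X] [ComonObj X]

/-- The coaction of an entwined module, recovered from the action of `Y A` -/
lemma coact_eq (N : EntwinedModule X) : N.coact = (ρ_ N.X).inv ≫ N.X ◁ η_ Y X.X ≫
    (α_ N.X Y X.X).inv ≫ (N.X ◁ runit A Y ≫ entwinedAct X Y N) ▷ X.X := by
  rw [entwinedAct_runit]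
  symm
  calc _ = 𝟙 _ ⊗≫ (N.X ◁ η_ Y X.X ≫ N.coact ▷ (Y ⊗ X.X)) ⊗≫ N.X ◁ ε_ Y X.X ▷ X.X ⊗≫ 𝟙 _ := by
        monoidal
    _ = N.coact ⊗≫ N.X ◁ (X.X ◁ η_ Y X.X ≫ (α_ X.X Y X.X).inv ≫ ε_ Y X.X ▷ X.X) ⊗≫ 𝟙 _ := by
        rw [whisker_exchange]; monoidal
    _ = _ := by rw [ExactPairing.coevaluation_evaluation]; monoidal

/-- A `Y A`-linear map of entwined modules, as a morphism of entwined modules -/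
def homOfLinear {N M : EntwinedModule X} (f : N.X ⟶ M.X)
    (hf : entwinedAct X Y N ≫ f = f ▷ (Y ⊗ A.X) ≫ entwinedAct X Y M) : N ⟶ M where
  hom := f
  act_hom := by
    rw [← incl_entwinedAct X Y N, Category.assoc, hf, whisker_exchange_assoc, incl_entwinedAct]
  coact_hom := by
    rw [coact_eq X Y M, coact_eq X Y N]
    calc _ = (ρ_ N.X).inv ≫ (f ▷ 𝟙_ C ≫ M.X ◁ η_ Y X.X) ≫
          (α_ M.X Y X.X).inv ≫ (M.X ◁ runit A Y ≫ entwinedAct X Y M) ▷ X.X := by monoidal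
      _ = (ρ_ N.X).inv ≫ N.X ◁ η_ Y X.X ≫ (α_ N.X Y X.X).inv ≫
          ((f ▷ Y ≫ M.X ◁ runit A Y) ≫ entwinedAct X Y M) ▷ X.X := by
          rw [← whisker_exchange]; monoidal
      _ = (ρ_ N.X).inv ≫ N.X ◁ η_ Y X.X ≫ (α_ N.X Y X.X).inv ≫
          (N.X ◁ runit A Y ≫ (f ▷ (Y ⊗ A.X) ≫ entwinedAct X Y M)) ▷ X.X := by
          rw [← whisker_exchange, Category.assoc]
      _ = _ := by rw [← hf]; simp only [comp_whiskerRight, Category.assoc]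

/-- The inclusion `A ⟶ Y A` as a morphism of right `A`-modules -/
def inclHom : RightModule.regular A ⟶
    (EntwinedModule.forget X).obj (toEntwined (RightModule.regular (mon X Y))) where
  hom := (incl X Y).hom
  act_hom := by
    change μ[A.X] ≫ (incl X Y).hom = (incl X Y).hom ▷ A.X ≫
      (Y ⊗ A.X) ◁ (incl X Y).hom ≫ wreathMul X Y
    exact Extension.mul_i (incl X Y)

/-- If the cofree functor is left adjoint to the forgetful functor, the unit of the adjunction at
the right module `A` is `a ↦ t a` for an element `t` of `A X`. It is central, by naturality of the
unit for the left multiplications `A ⟶ A`, and it is universal: entwined maps out of `A X` are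
determined by the image of `t`, which can be any element. -/
lemma exists_isFrobeniusPair_of_adjunction (hgen : IsLeftTensorGenerator (𝟙_ C))
    (adj : cofreeFunctor X ⊣ EntwinedModule.forget X) :
    ∃ t Ψ, (extensionDual X Y).IsFrobeniusPair t Ψ := by
  -- the entwined map `A X ⟶ Y A` that sends `t` to `1`
  let Φ : cofree X (RightModule.regular A) ⟶ toEntwined (RightModule.regular (mon X Y)) :=
    (adj.homEquiv _ _).symm (inclHom X Y)
  obtain ⟨u, hu⟩ : ∃ u : A.X ⟶ A.X ⊗ X.X, (adj.unit.app (RightModule.regular A)).hom = u := ⟨_, rfl⟩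
  obtain ⟨Ψ, hΨ⟩ : ∃ Ψ : A.X ⊗ X.X ⟶ Y ⊗ A.X, Φ.hom = Ψ := ⟨_, rfl⟩
  have huΨ : u ≫ Ψ = (incl X Y).hom := by
    have h : adj.homEquiv _ _ Φ = inclHom X Y := (adj.homEquiv _ _).apply_symm_apply _
    have h' := (adj.homEquiv_unit (f := Φ)).symm.trans h
    rw [← hu, ← hΨ]
    exact congrArg RightModule.Hom.hom h'
  have hinj (k : cofree X (RightModule.regular A) ⟶ cofree X (RightModule.regular A))
      (k₀ : A.X ⊗ X.X ⟶ A.X ⊗ X.X) (hk₀ : k.hom = k₀) (hk : u ≫ k₀ = u) : k₀ = 𝟙 (A.X ⊗ X.X) := by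
    have h : adj.homEquiv (RightModule.regular A) _ k =
        adj.homEquiv (RightModule.regular A) _ (𝟙 (cofree X (RightModule.regular A))) := by
      refine (adj.homEquiv_unit (f := k)).trans (Eq.trans ?_ (adj.homEquiv_id _).symm)
      refine RightModule.hom_ext ?_
      subst hu hk₀
      exact hk
    rw [← hk₀]
    exact congrArg (fun f => f.hom) ((adj.homEquiv _ _).injective h)
  obtain ⟨t, ht⟩ : ∃ t : 𝟙_ C ⟶ A.X ⊗ X.X, η[A.X] ≫ u = t := ⟨_, rfl⟩
  have hur : u = (λ_ A.X).inv ≫ t ▷ A.X ≫ (Coring.obj X).actRight := by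
    rw [← ht, ← hu]
    exact (Coring.entwined X).toRightModule.eq_ofElement
      (adj.unit.app (RightModule.regular A)).act_hom
  have hul : u = (ρ_ A.X).inv ≫ A.X ◁ t ≫ (Coring.obj X).actLeft := by
    rw [← cancel_epi (ρ_ A.X).hom, Iso.hom_inv_id_assoc]
    refine hgen _ _ fun a => ?_
    -- naturality of the unit at the left multiplication `l` by `a`
    obtain ⟨l, hl⟩ : ∃ l : A.X ⟶ A.X, (RightModule.regular A).ofElement a = l := ⟨_, rfl⟩
    have h : l ≫ u = u ≫ l ▷ X.X := by
      rw [← hu, ← hl]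
      exact congrArg RightModule.Hom.hom
        (adj.unit.naturality ((RightModule.regular A).ofElementHom a))
    have e : η[A.X] ≫ l = a := hl ▸ (RightModule.regular A).one_ofElement a
    have h' : a ≫ u = t ≫ ((λ_ A.X).inv ≫ a ▷ A.X ≫ μ[A.X]) ▷ X.X := by
      have hl' : l = (λ_ A.X).inv ≫ a ▷ A.X ≫ μ[A.X] := hl.symm
      rw [← hl', ← ht, ← e, Category.assoc, Category.assoc, h]
    have hleft : (Coring.obj X).actLeft = (α_ A.X A.X X.X).inv ≫ μ[A.X] ▷ X.X := rfl
    calc _ = (ρ_ (𝟙_ C)).hom ≫ a ≫ u := by simp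
      _ = 𝟙 _ ⊗≫ (𝟙_ C ◁ t ≫ a ▷ (A.X ⊗ X.X)) ⊗≫ μ[A.X] ▷ X.X := by rw [h']; monoidal
      _ = _ := by rw [whisker_exchange, hleft]; monoidal
  -- entwined endomorphisms of `A X` that fix `t` fix the unit, and are the identity
  have huniv (k : Coring.entwined X ⟶ Coring.entwined X) (k₀ : A.X ⊗ X.X ⟶ A.X ⊗ X.X)
      (hk₀ : k.hom = k₀) (hk : t ≫ k₀ = t) : k₀ = 𝟙 (A.X ⊗ X.X) := by
    refine hinj k k₀ hk₀ ?_
    have hK : (Coring.obj X).actRight ≫ k₀ = k₀ ▷ A.X ≫ (Coring.obj X).actRight := by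
      rw [← hk₀]; exact k.act_hom
    rw [hur, Category.assoc, Category.assoc, hK, ← comp_whiskerRight_assoc, hk]
  have hincl : (A.X ⊗ X.X) ◁ (incl X Y).hom ≫ coringAct X Y = (Coring.obj X).actRight :=
    incl_entwinedAct X Y (Coring.entwined X)
  have hlin : coringAct X Y ≫ Ψ = Ψ ▷ (Y ⊗ A.X) ≫ wreathMul X Y := by
    rw [← hΨ]
    exact (linear_iff_entwined X Y (Coring.entwined X) (RightModule.regular (mon X Y)) Φ.hom).2
      ⟨Φ.act_hom, Φ.coact_hom⟩
  have htΨ : t ≫ Ψ = wOne X Y := by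
    rw [← ht, Category.assoc, huΨ]; exact Extension.one_i (incl X Y)
  refine ⟨t, Ψ, (extensionDual X Y).isFrobeniusPair_of_universal ?_ hlin htΨ fun k hk htk => ?_⟩
  · change (ρ_ A.X).inv ≫ A.X ◁ t ≫ (Coring.obj X).actLeft = (λ_ A.X).inv ≫ t ▷ A.X ≫
      (A.X ⊗ X.X) ◁ (incl X Y).hom ≫ coringAct X Y
    rw [hincl, ← hur, ← hul]
  · exact huniv (homOfLinear X Y (N := Coring.entwined X) (M := Coring.entwined X) k hk) k rfl htk

/-- A right adjoint of the forgetful functor is isomorphic to the cofree functor, so the cofree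
functor is a left adjoint if some right adjoint is. -/
lemma exists_isFrobeniusPair_of_isFrobeniusFunctor (hgen : IsLeftTensorGenerator (𝟙_ C))
    (h : IsFrobeniusFunctor (EntwinedModule.forget X)) :
    ∃ t Ψ, (extensionDual X Y).IsFrobeniusPair t Ψ := by
  obtain ⟨G, ⟨adj₁⟩, ⟨adj₂⟩⟩ := h
  exact exists_isFrobeniusPair_of_adjunction X Y hgen
    (adj₂.ofNatIsoLeft (adj₁.rightAdjointUniq (forgetAdjCofree X)))

end Duality

end Cowreath

theorem mainTheorem2 {C : Type u} [Category.{v} C] [MonoidalCategory C] [HasCoequalizers C]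
    [∀ Z : C, LeftCoflat Z] (A : Mon C) [∀ M : LeftModule A, IsRobust M]
    (X : RightTransfer A) [ComonObj X] (Y : C) [ExactPairing Y X.X] :
    List.TFAE
      [IsFrobeniusCoalgebra X,
       letI := Duality.monObj X Y
       IsFrobeniusAlgebra (Duality.bimod X Y),
       letI := dualTransferMonObj X Y
       IsFrobeniusAlgebra (dualTransfer X Y),
       IsFrobeniusExtension (Duality.incl X Y),
       IsoAsModules X Y,
       IsoAsEntwinedModules X Y,
       ∃ t : 𝟙_ (RightTransfer A) ⟶ X, IsIso (frobeniusMap Y t),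
       ∃ B : X ⊗ X ⟶ 𝟙_ (RightTransfer A), IsCasimir B ∧ IsIso (casimirMap Y B)] ∧
    (IsLeftTensorGenerator (𝟙_ C) →
      (IsFrobeniusCoalgebra X ↔ IsFrobeniusFunctor (EntwinedModule.forget X))) := by
  have h₁ := Duality.isFrobeniusCoalgebra_iff X Y
  refine ⟨?_, fun hgen => ⟨isFrobeniusFunctor_of_isFrobeniusCoalgebra, fun h =>
    h₁.2 (Duality.exists_isFrobeniusPair_of_isFrobeniusFunctor X Y hgen h)⟩⟩
  have h₄ := Duality.isFrobeniusExtension_iff X Y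
  have h₅ := ((Duality.extensionDual X Y).exists_isFrobeniusPair_iff_isIso).trans
    (Duality.extensionDual_isBilinear_iff_isoAsModules X Y)
  tfae_have 1 ↔ 4 := h₁.trans h₄.symm
  tfae_have 2 ↔ 4 := Duality.isFrobeniusAlgebra_bimod_iff X Y
  tfae_have 3 ↔ 4 := (Duality.isFrobeniusAlgebra_dualTransfer_iff_wreathSystem X Y).trans
    (Duality.isFrobeniusExtension_iff_wreathSystem X Y).symm
  tfae_have 4 ↔ 5 := h₄.trans h₅
  tfae_have 5 ↔ 6 := Duality.isoAsModules_iff_isoAsEntwinedModules X Y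
  tfae_have 1 ↔ 7 := h₁.trans
    (((Duality.extensionDual X Y).exists_isFrobeniusPair_iff_isIso_ofElement).trans
      (Duality.extensionDual_ofElement_iff_frobeniusMap X Y))
  tfae_have 1 ↔ 8 := h₁.trans
    (((Duality.extensionDual X Y).exists_isFrobeniusPair_iff_isIso).trans
      (Duality.extensionDual_isBilinear_iff_casimirMap X Y))
  tfae_finish
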